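/- For every $n\in\mathbb N$ let $\mathcal I_n$ be a set with $|\mathcal I_n|=n$ and $\mathbf d$ a metric on $\mathcal I_n$ with values in $[0,\infty]$ such that $\mathbf d(i,j)\ge 1$ for $i\ne j$; let $X_i$, $i\in\mathcal I_n$, be random vectors in $\mathbb R^d$ on a probability space (which may depend on $n$), and let $H=H_n:\mathbb R^d\times\mathbb R^d\to\mathbb R$ be a symmetric measurable function. Write $\tilde X_j$ for a copy of $X_j$ that is independent of the other variables in the same expression. Assume that for all $n$ and all $i\ne k$ in $\mathcal I_n$: $\mathbb E H(X_i,\tilde X_k)^2<\infty$, and $\mathbb E H(X_k,x)=0$ for almost every $x$ with respect to the law of $X_i$ (degeneracy). Let $$S_n=\sum_{i\neq k}H(X_i,X_k),\qquad s_n^2=\operatorname{Var}(S_n),\qquad W_n=s_n^{-1}(S_n-\mathbb E S_n).$$ For $\sigma$-algebras $\mathcal F_1,\mathcal F_2$ let $\beta(\mathcal F_1,\mathcal F_2)=\sup\frac12\sum_{A\in\mathcal A}\sum_{B\in\mathcal B}|P(A\cap B)-P(A)P(B)|$, the supremum being over finite partitions $\mathcal A\subset\mathcal F_1$, $\mathcal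 B\subset\mathcal F_2$ of the probability space. For real $m>0$ let $\beta(m)$ be the supremum of $\beta(\sigma(X_i:i\in I_1),\sigma(X_i:i\in I_2))$ over all $n$ and all $I_1,I_2\subset\mathcal I_n$ with $|I_1|\le 2$ and $\mathbf d(I_1,I_2)=\inf_{i\in I_1,j\in I_2}\mathbf d(i,j)\ge m$. Let $\mathcal N_i^m=\{j\in\mathcal I_n:\mathbf d(i,j)\le m\}$ and $\eta_m=\eta_m(n)=\max_{i\in\mathcal I_n}|\mathcal N_i^m|$. For $p\ge1$ put $$\mathbf H_p=\sup_{i\ne j}\max\{\|H(X_i,X_j)\|_p,\|H(X_i,\tilde X_j)\|_p\},\qquad \Gamma^{i,j}(x,y)=\mathbb E[H(X_i,x)H(X_j,y)],$$ $$\mathbf\Gamma_{m,p}=\sup\{\|\Gamma^{i,j}(X_{k_1},\tilde X_{k_2})\|_p:\ i,j,k_1,k_2\in\mathcal I_n,\ j\in\mathcal N_i^m,\ \mathbf d(k_1,k_2)>m\}.$$ **Theorem.** Suppose that $s_n=\Theta(n)$ and that $\beta(m)=O(\rho^m)$ as $m\to\infty$ for some $0<\rho<1$. Let $C>0$, and suppose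 that there are $K,c<\infty$ such that, for all sufficiently large $n$, $\eta_r(n)\le c\,r^K$ for all real $r\ge C\log n$. If for some $\varepsilon,\delta>0$, with $m=C\log n$ and $\mu=\frac{C\delta}{4+\delta}\log\rho$, $$\frac1n\mathbf H_4^4+\mathbf\Gamma_{m,2}^2+n^{2+\mu}\,\mathbf H_{4+\delta}^4=o(n^{-\varepsilon}),$$ then $W_n$ converges in distribution to $N(0,1)$ as $n\to\infty$. -/

import Mathlib

open MeasureTheory ProbabilityTheory Filter Asymptotics
open scoped ENNReal Topology

namespace CrossSection

noncomputable section

/-- A finite family of sets that partitions `Ω` into members of the σ-algebra `F`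
(empty members are harmless). -/
structure IsFinPartition {Ω : Type*} (F : MeasurableSpace Ω) {k : ℕ} (A : Fin k → Set Ω) :
    Prop where
  measurable : ∀ i, MeasurableSet[F] (A i)
  disjoint : Pairwise fun i j => Disjoint (A i) (A j)
  cover : ⋃ i, A i = Set.univ

/-- The β-mixing (absolute regularity) coefficient of two σ-algebras:
`sup (1/2) ∑ᵢ ∑ⱼ |P(Aᵢ ∩ Bⱼ) - P(Aᵢ) P(Bⱼ)|` over finite partitions `A ⊆ F₁`, `B ⊆ F₂`. -/
def betaCoeff {Ω : Type*} [MeasurableSpace Ω] (P : Measure Ω) (F₁ F₂ : MeasurableSpace Ω) :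
    ℝ≥0∞ :=
  ⨆ (k : ℕ) (l : ℕ) (A : Fin k → Set Ω) (B : Fin l → Set Ω)
    (_ : IsFinPartition F₁ A) (_ : IsFinPartition F₂ B),
    ENNReal.ofReal
      ((1 / 2) * ∑ i, ∑ j, |P.real (A i ∩ B j) - P.real (A i) * P.real (B j)|)

/-- The σ-algebra `σ(X i : i ∈ J)` generated by the observations in a group `J`. -/
abbrev sigmaOf {Ω I E : Type*} [MeasurableSpace E] (X : I → Ω → E) (J : Finset I) :
    MeasurableSpace Ω :=
  ⨆ i ∈ J, MeasurableSpace.comap (X i) inferInstance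

/-- The distance between two groups of nodes, `inf` of the pairwise distances (`∞` if one of
them is empty). -/
def groupDist {I : Type*} [EDist I] (J₁ J₂ : Finset I) : ℝ≥0∞ :=
  ⨅ i ∈ J₁, ⨅ j ∈ J₂, edist i j

/-- The mixing coefficient `β(n₁, n₂, r)` of one sample: the supremum of the β-mixing
coefficients of `σ(J₁)` and `σ(J₂)` over groups with `|J₁| ≤ n₁`, `|J₂| ≤ n₂` and
`d(J₁, J₂) ≥ r`.  The sizes `n₁`, `n₂` may be `∞`. -/
def sampleBeta {Ω I E : Type*} [MeasurableSpace Ω] [MeasurableSpace E] [EDist I]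
    (P : Measure Ω) (X : I → Ω → E) (n₁ n₂ : ℕ∞) (r : ℝ) : ℝ≥0∞ :=
  ⨆ (J₁ : Finset I) (J₂ : Finset I) (_ : (J₁.card : ℕ∞) ≤ n₁) (_ : (J₂.card : ℕ∞) ≤ n₂)
    (_ : ENNReal.ofReal r ≤ groupDist J₁ J₂),
    betaCoeff P (sigmaOf X J₁) (sigmaOf X J₂)

/-- The `r`-neighbourhood `{j : d(i, j) ≤ r}` of a node `i` (it contains `i` if `r ≥ 0`). -/
def nbhd {I : Type*} [EDist I] (r : ℝ) (i : I) : Set I :=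
  {j | edist i j ≤ ENNReal.ofReal r}

/-- The maximal size `η_r` of an `r`-neighbourhood in a finite index space. -/
def maxNbhd (I : Type*) [Fintype I] [EDist I] (r : ℝ) : ℕ :=
  Finset.univ.sup fun i : I => (nbhd r i).ncard

/-- `𝐇_p`: the supremum over `i ≠ j` of `‖H(Xᵢ, Xⱼ)‖_p` and `‖H(Xᵢ, X̃ⱼ)‖_p`, where `X̃ⱼ` is a
copy of `Xⱼ` independent of `Xᵢ`, so that `(Xᵢ, X̃ⱼ)` has the product of the marginal laws. -/
def kernelNorm {Ω I E : Type*} [MeasurableSpace Ω] [MeasurableSpace E]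
    (P : Measure Ω) (X : I → Ω → E) (H : E → E → ℝ) (p : ℝ≥0∞) : ℝ≥0∞ :=
  ⨆ (i : I) (j : I) (_ : i ≠ j),
    max (eLpNorm (fun ω => H (X i ω) (X j ω)) p P)
      (eLpNorm (fun z : E × E => H z.1 z.2) p ((P.map (X i)).prod (P.map (X j))))

/-- `Γ^{i,j}(x, y) = E[H(Xᵢ, x) H(Xⱼ, y)]`, with the true joint law of `(Xᵢ, Xⱼ)`. -/
def Gam {Ω I E : Type*} [MeasurableSpace Ω]
    (P : Measure Ω) (X : I → Ω → E) (H : E → E → ℝ) (i j : I) (x y : E) : ℝ :=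
  ∫ ω, H (X i ω) x * H (X j ω) y ∂P

/-- `𝚪_{r,p}`: the supremum of `‖Γ^{i,j}(X_{k₁}, X̃_{k₂})‖_p` over `j` in the `r`-neighbourhood
of `i` and `d(k₁, k₂) > r`, where `X̃_{k₂}` is a copy of `X_{k₂}` independent of `X_{k₁}`. -/
def gammaNorm {Ω I E : Type*} [MeasurableSpace Ω] [MeasurableSpace E] [EDist I]
    (P : Measure Ω) (X : I → Ω → E) (H : E → E → ℝ) (r : ℝ) (p : ℝ≥0∞) : ℝ≥0∞ :=
  ⨆ (i : I) (j : I) (k₁ : I) (k₂ : I) (_ : j ∈ nbhd r i)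
    (_ : ENNReal.ofReal r < edist k₁ k₂),
    eLpNorm (fun z : E × E => Gam P X H i j z.1 z.2) p
      ((P.map (X k₁)).prod (P.map (X k₂)))

open scoped Classical in
/-- The U-statistic `S = ∑_{i ≠ k} H(Xᵢ, X_k)`, a sum over ordered pairs. -/
def uStat {Ω I E : Type*} [Fintype I] (X : I → Ω → E) (H : E → E → ℝ) (ω : Ω) : ℝ :=
  ∑ i, ∑ k, if i ≠ k then H (X i ω) (X k ω) else 0

/-- The standard deviation `s = √Var(S)` of the U-statistic. -/
def uStd {Ω I E : Type*} [MeasurableSpace Ω] [Fintype I]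
    (P : Measure Ω) (X : I → Ω → E) (H : E → E → ℝ) : ℝ :=
  √(variance (uStat X H) P)

/-- The normalised U-statistic `W = (S - E S) / s`. -/
def uNorm {Ω I E : Type*} [MeasurableSpace Ω] [Fintype I]
    (P : Measure Ω) (X : I → Ω → E) (H : E → E → ℝ) (ω : Ω) : ℝ :=
  (uStat X H ω - ∫ ω', uStat X H ω' ∂P) / uStd P X H

end

end CrossSection

set_option linter.unusedSectionVars false

/-! The proof is Stein's method for characteristic functions. The U-statistic is first replaced by a
sum of rows `Y_i = ∑_k h_{ik}(X_i, X_k)`, where the kernels `h` are symmetric, bounded, degenerate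
at every point, and zero for indices at distance at most `3R`. Here `R = C' log n`, with `C'` so
large that the mixing coefficient at distance `R` beats every polynomial factor that occurs.

Let `L_i` be the sum of the `Y_j` with `d(i,j) ≤ R`. By symmetry and the vanishing of `h` near the
diagonal, `∑_j Y_j - 2 L_i` involves only observations far from `i`
(`IsKernel.sum_rowSum_sub_farSum`), and degeneracy makes `Y_i` almost uncorrelated with every
bounded function of those (`IsKernel.abs_integral_rowSum_mul_le`). Put `Z_i = Y_i / s`, `Δ_i = 2 L_i
/ s` and `W = ∑ Z_i`. Expanding `exp(it(W - Δ_i))` around `exp(itW)` shows that the characteristic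
function `φ` of `W` satisfies `φ' ≈ -tφ`, provided that `∑ Z_i Δ_i` is close to 1 and that `∑ Z_i
Δ_i²` and `∑ E|Z_i Δ_i³|` are small (`norm_integral_mul_exp_sub_le`, `norm_integral_exp_sub_le`,
`IsGood.norm_charFun_sub_le`).

These conditions are moment bounds of orders four and six. A product of row sums is a sum over
tuples `k` of partner indices. If some slot of `k` is far from everything else, degeneracy makes the
term negligible. Otherwise (`clustered_or_matched`) either `k` has so few clusters that such tuples
can be counted, or its slots form close pairs that are far from each other. Pairs inside one group
of factors cancel in the covariance. Pairs across two far groups are integrated out, and summing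
over their positions produces `closeSum`, whose L² norm has to be small.

This is where `𝚪` enters. In the squared L² norm of a sum of contractions over close pairs `(k,k')`,
the order of integration is interchanged (`integral_gram_mul_gram`), which leaves contractions over
the anchor `u`, that is `Γ^{u,u}(X_k, X̃_{k'})`. For `d(k,k') > m` these are bounded by `𝚪_{m,2}`;
the remaining `(k,k')` are few and the fourth moments suffice.

General kernels are cut off at level `√n` and centred twice
(`IsDegenerate.integral_sq_uStat_sub_le`). An auxiliary cutoff at `n³` mediates between `H` and the
working kernel.

The third term of the moment condition only serves to fix the mixing rate. If `2 + μ > 0`, it would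
make the fourth moments of the kernel decay like a power of `n`, which contradicts `s_n = Θ(n)`
(`IsDegenerate.rate_le_of_le_uStd`). Hence `2 + μ ≤ 0`, so `C log ρ ≤ -2` and the mixing coefficient
at distance `m` is `O(n⁻²)`. This is exactly what controls pairs whose distance lies between `m` and
`R`. -/

namespace CrossSection

/-! ### β-mixing and decoupling of bounded functions -/

section Mixing

variable {Ω : Type*} {F₁ F₂ : MeasurableSpace Ω} [MeasurableSpace Ω] {P : Measure Ω}

/-- Sums of the signed discrepancies of cells of two finite partitions are controlled by the
mixing coefficient. -/
lemma sum_abs_le_betaCoeff {β : ℝ} (hβ0 : 0 ≤ β)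
    (hβ : betaCoeff P F₁ F₂ ≤ ENNReal.ofReal β) {k l : ℕ} (p : Ω → Fin k) (q : Ω → Fin l)
    (hp : Measurable[F₁] p) (hq : Measurable[F₂] q) :
    ∑ i, ∑ j, |P.real (p ⁻¹' {i} ∩ q ⁻¹' {j}) - P.real (p ⁻¹' {i}) * P.real (q ⁻¹' {j})|
      ≤ 2 * β := by
  have hA : IsFinPartition F₁ (fun i => p ⁻¹' {i}) :=
    ⟨fun i => hp (measurableSet_singleton i),
      fun i j hij => Set.disjoint_left.2 fun ω h1 h2 => hij (h1.symm.trans h2),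
      Set.eq_univ_of_forall fun ω => Set.mem_iUnion.2 ⟨p ω, rfl⟩⟩
  have hB : IsFinPartition F₂ (fun i => q ⁻¹' {i}) :=
    ⟨fun i => hq (measurableSet_singleton i),
      fun i j hij => Set.disjoint_left.2 fun ω h1 h2 => hij (h1.symm.trans h2),
      Set.eq_univ_of_forall fun ω => Set.mem_iUnion.2 ⟨q ω, rfl⟩⟩
  have h : ENNReal.ofReal ((1 / 2) * ∑ i, ∑ j, |P.real (p ⁻¹' {i} ∩ q ⁻¹' {j}) -
      P.real (p ⁻¹' {i}) * P.real (q ⁻¹' {j})|) ≤ ENNReal.ofReal β := by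
    refine le_trans ?_ hβ
    unfold betaCoeff
    refine le_iSup_of_le k (le_iSup_of_le l (le_iSup_of_le (fun i => p ⁻¹' {i})
      (le_iSup_of_le (fun i => q ⁻¹' {i}) (le_iSup_of_le hA (le_iSup_of_le hB le_rfl)))))
  rw [ENNReal.ofReal_le_ofReal_iff hβ0] at h
  linarith

variable [IsProbabilityMeasure P] {E₁ E₂ : Type*} [MeasurableSpace E₁] [MeasurableSpace E₂]

/-- Sets of pairs that are determined by finitely many measurable classes of each coordinate. -/
def finCells (E₁ E₂ : Type*) [MeasurableSpace E₁] [MeasurableSpace E₂] : Set (Set (E₁ × E₂)) :=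
  {Z | ∃ (k l : ℕ) (p : E₁ → Fin k) (q : E₂ → Fin l) (S : Set (Fin k × Fin l)),
    Measurable p ∧ Measurable q ∧ Z = {z | (p z.1, q z.2) ∈ S}}

/-- The common refinement of the two classifications, with `Fin k × Fin k'` coded as `Fin (k * k')`,
decides membership in both sets. -/
lemma finCells_combine {Z₁ Z₂ : Set (E₁ × E₂)} (h₁ : Z₁ ∈ finCells E₁ E₂)
    (h₂ : Z₂ ∈ finCells E₁ E₂) (c : Prop → Prop → Prop) :
    {z | c (z ∈ Z₁) (z ∈ Z₂)} ∈ finCells E₁ E₂ := by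
  obtain ⟨k, l, p, q, S, hp, hq, rfl⟩ := h₁
  obtain ⟨k', l', p', q', S', hp', hq', rfl⟩ := h₂
  refine ⟨k * k', l * l', fun x => finProdFinEquiv (p x, p' x),
    fun y => finProdFinEquiv (q y, q' y),
    {w | c (((finProdFinEquiv.symm w.1).1, (finProdFinEquiv.symm w.2).1) ∈ S)
      (((finProdFinEquiv.symm w.1).2, (finProdFinEquiv.symm w.2).2) ∈ S')}, ?_, ?_, ?_⟩
  · exact (measurable_of_finite _).comp (hp.prodMk hp')
  · exact (measurable_of_finite _).comp (hq.prodMk hq')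
  · ext z; simp only [Set.mem_ofPred_eq, Equiv.symm_apply_apply]

lemma isSetRing_finCells : IsSetRing (finCells E₁ E₂) where
  empty_mem := ⟨1, 1, fun _ => 0, fun _ => 0, ∅, measurable_const, measurable_const, by ext; simp⟩
  union_mem _ _ h₁ h₂ := finCells_combine h₁ h₂ Or
  sdiff_mem _ _ h₁ h₂ := finCells_combine h₁ h₂ fun a b => a ∧ ¬ b

lemma measurableSet_finCells {Z : Set (E₁ × E₂)} (h : Z ∈ finCells E₁ E₂) : MeasurableSet Z := by
  obtain ⟨k, l, p, q, S, hp, hq, rfl⟩ := h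
  exact (hp.comp measurable_fst).prodMk (hq.comp measurable_snd) (S.toFinite.measurableSet)

open Classical in
lemma rect_mem_finCells {A : Set E₁} {B : Set E₂} (hA : MeasurableSet A) (hB : MeasurableSet B) :
    A ×ˢ B ∈ finCells E₁ E₂ := by
  refine ⟨2, 2, fun x => if x ∈ A then 1 else 0, fun x => if x ∈ B then 1 else 0, {(1, 1)},
    Measurable.ite hA measurable_const measurable_const,
    Measurable.ite hB measurable_const measurable_const, ?_⟩
  ext z
  by_cases h1 : z.1 ∈ A <;> by_cases h2 : z.2 ∈ B <;> simp [h1, h2]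

lemma generateFrom_finCells :
    (inferInstance : MeasurableSpace (E₁ × E₂)) = MeasurableSpace.generateFrom (finCells E₁ E₂) := by
  apply le_antisymm
  · rw [← generateFrom_prod]
    refine MeasurableSpace.generateFrom_mono ?_
    rintro _ ⟨A, hA, B, hB, rfl⟩
    exact rect_mem_finCells hA hB
  · exact MeasurableSpace.generateFrom_le fun Z hZ => measurableSet_finCells hZ

/-- Such a set is a disjoint union of cells of two finite partitions, so its discrepancy is at most
the sum over all cells. The factor 2 undoes the `1/2` in `betaCoeff`. -/
lemma abs_map_sub_prod_le_of_finCells {β : ℝ} (hβ0 : 0 ≤ β)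
    (hβ : betaCoeff P F₁ F₂ ≤ ENNReal.ofReal β) {U : Ω → E₁} {V : Ω → E₂}
    (hU : Measurable[F₁] U) (hV : Measurable[F₂] V) (hU' : Measurable U) (hV' : Measurable V)
    {Z : Set (E₁ × E₂)} (hZ : Z ∈ finCells E₁ E₂) :
    |(P.map fun ω => (U ω, V ω)).real Z - ((P.map U).prod (P.map V)).real Z| ≤ 2 * β := by
  classical
  have hprob := Measure.isProbabilityMeasure_map (μ := P) hU'.aemeasurable
  have hprob' := Measure.isProbabilityMeasure_map (μ := P) hV'.aemeasurable
  obtain ⟨k, l, p, q, S, hp, hq, rfl⟩ := hZ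
  have key : ∀ (μ : Measure (E₁ × E₂)) [IsFiniteMeasure μ],
      μ.real {z | (p z.1, q z.2) ∈ S} =
        ∑ s : Fin k × Fin l, if s ∈ S then μ.real ((p ⁻¹' {s.1}) ×ˢ (q ⁻¹' {s.2})) else 0 := by
    intro μ _
    have : {z : E₁ × E₂ | (p z.1, q z.2) ∈ S}
        = ⋃ s ∈ (Finset.univ.filter fun s => s ∈ S), (p ⁻¹' {s.1}) ×ˢ (q ⁻¹' {s.2}) := by
      ext z; simp only [Set.mem_ofPred_eq, Set.mem_iUnion, Finset.mem_filter, Finset.mem_univ,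
        true_and, Set.mem_prod, Set.mem_preimage, Set.mem_singleton_iff, exists_prop]
      constructor
      · intro h; exact ⟨_, h, rfl, rfl⟩
      · rintro ⟨s, h, h1, h2⟩; rw [h1, h2]; exact h
    rw [this, measureReal_biUnion_finset, Finset.sum_filter]
    · intro s _ t _ hst
      refine Set.disjoint_left.2 fun z h1 h2 => hst ?_
      exact Prod.ext (h1.1.symm.trans h2.1) (h1.2.symm.trans h2.2)
    · intro s _
      exact (hp (measurableSet_singleton _)).prod (hq (measurableSet_singleton _))
  have hJ := Measure.isProbabilityMeasure_map (μ := P) (hU'.prodMk hV').aemeasurable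
  rw [key, key, ← Finset.sum_sub_distrib]
  refine (Finset.abs_sum_le_sum_abs _ _).trans ?_
  have h2 := sum_abs_le_betaCoeff hβ0 hβ (fun ω => p (U ω)) (fun ω => q (V ω)) (hp.comp hU)
    (hq.comp hV)
  refine le_trans ?_ h2
  rw [← Finset.univ_product_univ, Finset.sum_product]
  refine Finset.sum_le_sum fun i _ => Finset.sum_le_sum fun j _ => ?_
  split_ifs
  · rw [measureReal_def, Measure.map_apply (hU'.prodMk hV')
      ((hp (measurableSet_singleton _)).prod (hq (measurableSet_singleton _))), measureReal_prod_prod,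
      measureReal_def (P.map U), measureReal_def (P.map V), Measure.map_apply hU'
      (hp (measurableSet_singleton _)), Measure.map_apply hV' (hq (measurableSet_singleton _))]
    exact le_rfl
  · simp

/-- The sets in `finCells` form a ring that generates the product σ-algebra, so every measurable set
is approximated in measure by one of them. -/
lemma abs_map_sub_prod_le {β : ℝ} (hβ0 : 0 ≤ β)
    (hβ : betaCoeff P F₁ F₂ ≤ ENNReal.ofReal β) {U : Ω → E₁} {V : Ω → E₂}
    (hU : Measurable[F₁] U) (hV : Measurable[F₂] V) (hU' : Measurable U) (hV' : Measurable V)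
    {Z : Set (E₁ × E₂)} (hZ : MeasurableSet Z) :
    |(P.map fun ω => (U ω, V ω)).real Z - ((P.map U).prod (P.map V)).real Z| ≤ 2 * β := by
  have hprob := Measure.isProbabilityMeasure_map (μ := P) hU'.aemeasurable
  have hprob' := Measure.isProbabilityMeasure_map (μ := P) hV'.aemeasurable
  have hJ := Measure.isProbabilityMeasure_map (μ := P) (hU'.prodMk hV').aemeasurable
  set μ := P.map fun ω => (U ω, V ω) with hμ
  set ν := (P.map U).prod (P.map V) with hν
  refine le_of_forall_pos_le_add fun ε hε => ?_
  -- Approximating with respect to `μ + ν` gives one `T` that is good for both laws.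
  obtain ⟨T, hT, hlt⟩ := exists_measure_symmDiff_lt_of_generateFrom_isSetRing (μ := μ + ν)
    isSetRing_finCells ⟨{Set.univ}, Set.countable_singleton _, by
      simpa using rect_mem_finCells (E₁ := E₁) (E₂ := E₂) MeasurableSet.univ MeasurableSet.univ,
      by simp⟩ generateFrom_finCells hZ (ε := ENNReal.ofReal (ε / 2)) (by simpa using hε)
  have hTm := measurableSet_finCells hT
  have h1 := abs_map_sub_prod_le_of_finCells hβ0 hβ hU hV hU' hV' hT
  have key : ∀ (κ : Measure (E₁ × E₂)) [IsProbabilityMeasure κ], κ ≤ μ + ν →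
      |κ.real Z - κ.real T| ≤ ε / 2 := by
    intro κ _ hκ
    have h3 : κ.real (symmDiff T Z) ≤ ε / 2 := by
      rw [measureReal_def]
      refine ENNReal.toReal_le_of_le_ofReal (by positivity) ?_
      exact (hκ _).trans hlt.le
    have ha : κ.real Z ≤ κ.real T + κ.real (symmDiff T Z) := by
      refine (measureReal_mono ?_).trans (measureReal_union_le _ _)
      intro z hz; by_cases h : z ∈ T
      · exact Or.inl h
      · exact Or.inr (Or.inr ⟨hz, h⟩)
    have hb : κ.real T ≤ κ.real Z + κ.real (symmDiff T Z) := by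
      refine (measureReal_mono ?_).trans (measureReal_union_le _ _)
      intro z hz; by_cases h : z ∈ Z
      · exact Or.inl h
      · exact Or.inr (Or.inl ⟨hz, h⟩)
    rw [abs_le]; constructor <;> linarith
  have hm := key μ (Measure.le_add_right le_rfl)
  have hn := key ν (Measure.le_add_left le_rfl)
  rw [abs_le] at *
  constructor <;> linarith [hm.1, hm.2, hn.1, hn.2, h1.1, h1.2]

/-- If two probability measures differ by at most `c` on all measurable sets, integrals of
functions bounded by `B` differ by at most `2 B c`. -/
lemma abs_integral_sub_le_of_measure {α : Type*} [MeasurableSpace α] {μ ν : Measure α}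
    [IsProbabilityMeasure μ] [IsProbabilityMeasure ν] {c : ℝ}
    (h : ∀ Z, MeasurableSet Z → |μ.real Z - ν.real Z| ≤ c) {F : α → ℝ} (hF : Measurable F)
    {B : ℝ} (hB : ∀ x, |F x| ≤ B) : |∫ x, F x ∂μ - ∫ x, F x ∂ν| ≤ 2 * B * c := by
  obtain ⟨x0⟩ : Nonempty α := nonempty_of_isProbabilityMeasure μ
  have hB0 : 0 ≤ B := (abs_nonneg _).trans (hB x0)
  have hint : ∀ (κ : Measure α) [IsProbabilityMeasure κ], Integrable F κ := fun κ _ =>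
    Integrable.of_bound hF.aestronglyMeasurable B (ae_of_all _ hB)
  -- Layer-cake formula for `F + B`, which takes values in `[0, 2B]`. The difference of the two
  -- integrals becomes an integral of set discrepancies over an interval of length `2B`.
  have hlayer : ∀ (κ : Measure α) [IsProbabilityMeasure κ],
      ∫ x, F x ∂κ = (∫ t in (0)..(2 * B), κ.real {x | t ≤ F x + B}) - B := by
    intro κ _
    have hi : Integrable (fun x => F x + B) κ := (hint κ).add (integrable_const B)
    have := hi.integral_eq_integral_Ioc_meas_le (M := 2 * B)
      (ae_of_all _ fun x => by simp only [Pi.zero_apply]; linarith [(abs_le.1 (hB x)).1])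
      (ae_of_all _ fun x => by linarith [(abs_le.1 (hB x)).2])
    rw [integral_add (hint κ) (integrable_const B)] at this
    simp only [integral_const, probReal_univ, one_smul] at this
    rw [intervalIntegral.integral_of_le (by positivity), ← this]; ring
  have hii : ∀ (κ : Measure α) [IsProbabilityMeasure κ],
      IntervalIntegrable (fun t => κ.real {x | t ≤ F x + B}) volume 0 (2 * B) := by
    intro κ _
    refine AntitoneOn.intervalIntegrable ?_
    intro s _ t _ hst
    exact measureReal_mono fun x hx => hst.trans hx
  rw [hlayer μ, hlayer ν, sub_sub_sub_cancel_right,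
    ← intervalIntegral.integral_sub (hii μ) (hii ν)]
  have := intervalIntegral.norm_integral_le_of_norm_le_const (a := 0) (b := 2 * B) (C := c)
    (f := fun t => μ.real {x | t ≤ F x + B} - ν.real {x | t ≤ F x + B}) (fun t _ => by
      rw [Real.norm_eq_abs]
      exact h _ (measurableSet_le measurable_const (hF.add_const B)))
  rw [Real.norm_eq_abs, sub_zero, abs_of_nonneg (by positivity : 0 ≤ 2 * B)] at this
  linarith

/-- Decoupling under β-mixing, for bounded functions. -/
lemma abs_integral_sub_integral_integral_le {β : ℝ} (hβ0 : 0 ≤ β)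
    (hβ : betaCoeff P F₁ F₂ ≤ ENNReal.ofReal β) {U : Ω → E₁} {V : Ω → E₂}
    (hU : Measurable[F₁] U) (hV : Measurable[F₂] V) (hU' : Measurable U) (hV' : Measurable V)
    {F : E₁ → E₂ → ℝ} (hF : Measurable (Function.uncurry F)) {B : ℝ} (hB : ∀ x y, |F x y| ≤ B) :
    |∫ ω, F (U ω) (V ω) ∂P - ∫ ω, ∫ ω', F (U ω') (V ω) ∂P ∂P| ≤ 4 * B * β := by
  have hprob := Measure.isProbabilityMeasure_map (μ := P) hU'.aemeasurable
  have hprob' := Measure.isProbabilityMeasure_map (μ := P) hV'.aemeasurable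
  have hJ := Measure.isProbabilityMeasure_map (μ := P) (hU'.prodMk hV').aemeasurable
  have h := abs_integral_sub_le_of_measure
    (fun Z hZ => abs_map_sub_prod_le hβ0 hβ hU hV hU' hV' hZ) hF (B := B) fun z => hB z.1 z.2
  rw [integral_map (hU'.prodMk hV').aemeasurable hF.aestronglyMeasurable,
    integral_prod_symm _ (Integrable.of_bound hF.aestronglyMeasurable B
      (ae_of_all _ fun z => hB z.1 z.2))] at h
  have e1 : ∀ y, ∫ x, Function.uncurry F (x, y) ∂(P.map U) = ∫ ω', F (U ω') y ∂P := fun y =>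
    integral_map hU'.aemeasurable (hF.comp measurable_prodMk_right).aestronglyMeasurable
  have e2 : ∫ y, ∫ x, Function.uncurry F (x, y) ∂(P.map U) ∂(P.map V) =
      ∫ ω, ∫ x, Function.uncurry F (x, V ω) ∂(P.map U) ∂P :=
    integral_map hV'.aemeasurable
      (hF.stronglyMeasurable.integral_prod_left' (μ := P.map U)).aestronglyMeasurable
  rw [e2] at h
  simp only [e1] at h
  calc _ ≤ _ := h
    _ = _ := by ring

end Mixing

/-! ### Replacing observations by independent copies; bounded degenerate kernels -/

section Core

variable {Ω I E : Type*} [MeasurableSpace Ω] [MeasurableSpace E] [Fintype I] [EMetricSpace I]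

/-- Groups of at most two observations are `β`-independent of the observations at a distance
larger than `R`. -/
structure IsMixing (P : Measure Ω) (X : I → Ω → E) (R : ℝ≥0∞) (β : ℝ) : Prop where
  measurable : ∀ i, Measurable (X i)
  nonneg : 0 ≤ β
  mix : ∀ K J : Finset I, K.card ≤ 2 → (∀ i ∈ K, ∀ j ∈ J, R < edist i j) →
    betaCoeff P (sigmaOf X K) (sigmaOf X J) ≤ ENNReal.ofReal β

lemma measurable_sigmaOf (X : I → Ω → E) {J : Finset I} {j : I} (hj : j ∈ J) :
    Measurable[sigmaOf X J] (X j) := by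
  rw [measurable_iff_comap_le]
  exact le_iSup₂_of_le j hj le_rfl

lemma integrable_of_abs_le {α : Type*} [MeasurableSpace α] {μ : Measure α} [IsFiniteMeasure μ]
    {f : α → ℝ} (hf : Measurable f) {B : ℝ} (hB : ∀ x, |f x| ≤ B) : Integrable f μ :=
  Integrable.of_bound hf.aestronglyMeasurable B (ae_of_all _ hB)

lemma abs_integral_le_of_abs_le {α : Type*} [MeasurableSpace α] {μ : Measure α}
    [IsProbabilityMeasure μ] {f : α → ℝ} {B : ℝ} (hB : ∀ x, |f x| ≤ B) : |∫ x, f x ∂μ| ≤ B := by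
  have := norm_integral_le_of_norm_le_const (μ := μ) (f := f) (ae_of_all _ hB)
  simpa using this

variable {P : Measure Ω} [IsProbabilityMeasure P] {X : I → Ω → E} {R : ℝ≥0∞} {β : ℝ}

open Classical in
/-- A group of at most two observations may be replaced by an independent copy in the
expectation of a bounded function of it and of far observations. -/
lemma IsMixing.swap (hM : IsMixing P X R β) (K : Finset I) (hK : K.card ≤ 2)
    {Φ : (I → E) → ℝ} (hΦ : Measurable Φ) {B : ℝ} (hB : ∀ ξ, |Φ ξ| ≤ B)
    (hdep : ∀ ξ ζ : I → E, (∀ i ∈ K, ξ i = ζ i) →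
      (∀ j, (∀ i ∈ K, R < edist i j) → ξ j = ζ j) → Φ ξ = Φ ζ) :
    |∫ ω, Φ (fun i => X i ω) ∂P -
      ∫ ω, ∫ ω', Φ (K.piecewise (fun i => X i ω') fun i => X i ω) ∂P ∂P| ≤ 4 * B * β := by
  obtain ⟨ω₀⟩ : Nonempty Ω := nonempty_of_isProbabilityMeasure P
  set J : Finset I := Finset.univ.filter fun j => ∀ i ∈ K, R < edist i j with hJ
  -- Outside its group each configuration is frozen at the sample point `ω₀`. It remains a full
  -- configuration but is measurable with respect to the σ-algebra of the group; `hdep` ensures that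
  -- the frozen coordinates have no influence.
  set U : Ω → I → E := fun ω i => if i ∈ K then X i ω else X i ω₀ with hU
  set V : Ω → I → E := fun ω i => if i ∈ J then X i ω else X i ω₀ with hV
  have hUm : Measurable[sigmaOf X K] U := by
    refine @measurable_pi_lambda _ _ _ (_) _ _ fun i => ?_
    by_cases h : i ∈ K
    · simp only [hU, h, if_true]; exact measurable_sigmaOf X h
    · simp only [hU, h, if_false]; exact @measurable_const _ _ _ (_) _
  have hVm : Measurable[sigmaOf X J] V := by
    refine @measurable_pi_lambda _ _ _ (_) _ _ fun i => ?_
    by_cases h : i ∈ J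
    · simp only [hV, h, if_true]; exact measurable_sigmaOf X h
    · simp only [hV, h, if_false]; exact @measurable_const _ _ _ (_) _
  have hle : ∀ L : Finset I, sigmaOf X L ≤ (inferInstance : MeasurableSpace Ω) := fun L =>
    iSup₂_le fun i _ => (hM.measurable i).comap_le
  have hF : Measurable (Function.uncurry fun ξ ζ : I → E => Φ (K.piecewise ξ ζ)) := by
    refine hΦ.comp (measurable_pi_lambda _ fun i => ?_)
    by_cases h : i ∈ K
    · simp only [Finset.piecewise, h, if_true]
      exact (measurable_pi_apply i).comp measurable_fst
    · simp only [Finset.piecewise, h, if_false]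
      exact (measurable_pi_apply i).comp measurable_snd
  have h := abs_integral_sub_integral_integral_le hM.nonneg
    (hM.mix K J hK fun i hi j hj => (Finset.mem_filter.1 hj).2 i hi) hUm hVm
    (hUm.mono (hle K) le_rfl) (hVm.mono (hle J) le_rfl) hF (B := B) fun ξ ζ => hB _
  have e : ∀ ω ω', Φ (K.piecewise (U ω') (V ω)) =
      Φ (K.piecewise (fun i => X i ω') fun i => X i ω) := by
    intro ω ω'
    apply hdep
    · intro i hi; simp [hU, hi]
    · intro j hj
      have hj' : j ∈ J := by simpa [hJ] using hj
      by_cases hjK : j ∈ K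
      · simp [hU, hjK]
      · simp [hV, hjK, hj']
  simp only [e] at h
  have e2 : ∀ ω : Ω, (K.piecewise (fun i => X i ω) fun i => X i ω) = fun i => X i ω := fun ω => by
    ext i; simp [Finset.piecewise]
  simpa only [e2] using h

open Classical in
/-- A bounded function whose integral over one observation, far from the others, vanishes, is
almost centred. -/
lemma IsMixing.abs_integral_le_of_centred (hM : IsMixing P X R β) (k : I)
    {Φ : (I → E) → ℝ} (hΦ : Measurable Φ) {B : ℝ} (hB : ∀ ξ, |Φ ξ| ≤ B)
    (hdep : ∀ ξ ζ : I → E, ξ k = ζ k → (∀ j, R < edist k j → ξ j = ζ j) → Φ ξ = Φ ζ)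
    (h0 : ∀ ξ : I → E, ∫ ω, Φ (Function.update ξ k (X k ω)) ∂P = 0) :
    |∫ ω, Φ (fun i => X i ω) ∂P| ≤ 4 * B * β := by
  have h := hM.swap {k} (by simp) hΦ hB fun ξ ζ h1 h2 => hdep ξ ζ (h1 k (by simp)) fun j hj =>
    h2 j (by simpa using hj)
  simpa [Finset.piecewise_singleton, h0] using h

/-- Bounded symmetric kernels, degenerate in each argument, and vanishing for close indices. -/
structure IsKernel (P : Measure Ω) (X : I → Ω → E) (R : ℝ≥0∞) (h : I → I → E → E → ℝ) (b : ℝ) :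
    Prop where
  measurable : ∀ i k, Measurable fun z : E × E => h i k z.1 z.2
  bound : ∀ i k x y, |h i k x y| ≤ b
  symm : ∀ i k x y, h i k x y = h k i y x
  zero : ∀ i k, edist i k ≤ 3 * R → ∀ x y, h i k x y = 0
  degenerate : ∀ i k x, ∫ ω, h i k x (X k ω) ∂P = 0

/-- The row sum `∑ₖ hᵢₖ(ξᵢ, ξₖ)`. -/
def rowSum (h : I → I → E → E → ℝ) (i : I) (ξ : I → E) : ℝ := ∑ k, h i k (ξ i) (ξ k)

/-- The product of the kernels along the index pairs `(uₐ, kₐ)`. -/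
def kerProd (h : I → I → E → E → ℝ) {r : ℕ} (u k : Fin r → I) (ξ : I → E) : ℝ :=
  ∏ a, h (u a) (k a) (ξ (u a)) (ξ (k a))

lemma prod_rowSum (h : I → I → E → E → ℝ) {r : ℕ} (u : Fin r → I) (ξ : I → E) :
    ∏ a, rowSum h (u a) ξ = ∑ k : Fin r → I, kerProd h u k ξ := by
  classical
  simp only [rowSum, kerProd]
  rw [Finset.prod_univ_sum, Fintype.piFinset_univ]

/-- The slot `a` of `k` is far from all the anchors `u` and from all the other slots of `k`. -/
def Isolated (R : ℝ≥0∞) {r : ℕ} (u k : Fin r → I) (a : Fin r) : Prop :=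
  (∀ c, R < edist (k a) (u c)) ∧ ∀ c, c ≠ a → R < edist (k a) (k c)

variable {h : I → I → E → E → ℝ} {b : ℝ}

lemma IsKernel.bound_nonneg (hK : IsKernel P X R h b) (i k : I) (x y : E) : 0 ≤ b :=
  (abs_nonneg _).trans (hK.bound i k x y)

lemma IsKernel.measurable_eval (hK : IsKernel P X R h b) (i k : I) :
    Measurable fun ξ : I → E => h i k (ξ i) (ξ k) :=
  (hK.measurable i k).comp (g := fun z : E × E => h i k z.1 z.2)
    (f := fun ξ : I → E => (ξ i, ξ k)) ((measurable_pi_apply i).prodMk (measurable_pi_apply k))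

lemma IsKernel.measurable_rowSum (hK : IsKernel P X R h b) (i : I) : Measurable (rowSum h i) :=
  Finset.measurable_sum _ fun k _ => hK.measurable_eval i k

lemma IsKernel.measurable_kerProd (hK : IsKernel P X R h b) {r : ℕ} (u k : Fin r → I) :
    Measurable (kerProd h u k) :=
  Finset.measurable_prod _ fun a _ => hK.measurable_eval (u a) (k a)

lemma IsKernel.abs_kerProd_le (hK : IsKernel P X R h b) {r : ℕ} (u k : Fin r → I) (ξ : I → E) :
    |kerProd h u k ξ| ≤ b ^ r := by
  rw [kerProd, Finset.abs_prod]
  calc _ ≤ ∏ _a : Fin r, b := Finset.prod_le_prod (fun _ _ => abs_nonneg _) fun a _ => hK.bound _ _ _ _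
    _ = b ^ r := by simp

lemma kerProd_congr {r : ℕ} (u k : Fin r → I) {ξ ζ : I → E} (h1 : ∀ a, ξ (u a) = ζ (u a))
    (h2 : ∀ a, ξ (k a) = ζ (k a)) : kerProd h u k ξ = kerProd h u k ζ := by
  simp only [kerProd, h1, h2]

/-- Products of kernels with an isolated slot are almost centred. -/
lemma IsKernel.abs_integral_kerProd_le_of_isolated (hK : IsKernel P X R h b)
    (hM : IsMixing P X R β) {r : ℕ} (u k : Fin r → I) {a : Fin r} (ha : Isolated R u k a) :
    |∫ ω, kerProd h u k (fun i => X i ω) ∂P| ≤ 4 * b ^ r * β := by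
  classical
  refine hM.abs_integral_le_of_centred (k a) (hK.measurable_kerProd u k) (hK.abs_kerProd_le u k)
    ?_ ?_
  · intro ξ ζ h1 h2
    refine kerProd_congr u k (fun c => h2 _ (ha.1 c)) fun c => ?_
    by_cases hc : c = a
    · rw [hc, h1]
    · exact h2 _ (ha.2 c hc)
  · intro ξ
    have hu : ∀ c, u c ≠ k a := fun c hc => by
      have := ha.1 c; rw [hc, edist_self] at this; exact absurd this (not_lt.2 zero_le)
    have hk : ∀ c, c ≠ a → k c ≠ k a := fun c hca hc => by
      have := ha.2 c hca; rw [hc, edist_self] at this; exact absurd this (not_lt.2 zero_le)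
    -- The observation at an isolated slot enters only the factor number `a`, and there as the
    -- second argument, so degeneracy removes the whole product.
    have e : ∀ x, kerProd h u k (Function.update ξ (k a) x) =
        h (u a) (k a) (ξ (u a)) x *
          ∏ c ∈ Finset.univ.erase a, h (u c) (k c) (ξ (u c)) (ξ (k c)) := by
      intro x
      rw [kerProd, ← Finset.mul_prod_erase _ _ (Finset.mem_univ a)]
      congr 1
      · simp [Function.update_of_ne (hu a)]
      · refine Finset.prod_congr rfl fun c hc => ?_
        rw [Function.update_of_ne (hu c), Function.update_of_ne (hk c (Finset.ne_of_mem_erase hc))]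
    simp only [e]
    rw [integral_mul_const, hK.degenerate, zero_mul]

end Core

/-! ### Index tuples without isolated slots -/

section Combinatorics

variable {I : Type*} [EMetricSpace I]

/-- The slots of `k` are matched in close pairs by the involution `π`, and the pairs are far from
each other and from the anchors `u`. -/
def Matched (R : ℝ≥0∞) {r : ℕ} (u k : Fin r → I) (π : Fin r → Fin r) : Prop :=
  ∀ a, π (π a) = a ∧ π a ≠ a ∧ edist (k a) (k (π a)) ≤ R ∧ (∀ c, R < edist (k a) (u c)) ∧
    ∀ c, c ≠ a → c ≠ π a → R < edist (k a) (k c)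

/-- Every slot of `k` is close to an anchor or to one of at most `q` slots. -/
def Clustered (R : ℝ≥0∞) {r : ℕ} (u k : Fin r → I) (q : ℕ) : Prop :=
  ∃ T : Finset (Fin r), T.card ≤ q ∧
    ∀ a, (∃ c, edist (k a) (u c) ≤ 3 * R) ∨ ∃ c ∈ T, edist (k a) (k c) ≤ 3 * R

/-- Take `T` maximal among the sets of slots that are more than `3R` away from the anchors and from
each other. Maximality gives the covering. Every slot of `T` is far from the anchors, hence has a
partner slot within `R`; the partners are distinct and lie outside `T`, so `2|T| ≤ r`. In the case
of equality `T` and its partners exhaust all slots, and the triangle inequality separates the pairs.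
-/
lemma clustered_or_matched {R : ℝ≥0∞} {r : ℕ} (u k : Fin r → I) (hno : ∀ a, ¬ Isolated R u k a) :
    ∃ T : Finset (Fin r), 2 * T.card ≤ r ∧
      (∀ a, (∃ c, edist (k a) (u c) ≤ 3 * R) ∨ ∃ c ∈ T, edist (k a) (k c) ≤ 3 * R) ∧
      (2 * T.card = r → ∃ π, Matched R u k π) := by
  classical
  have h3 : (3 : ℝ≥0∞) * R = R + R + R := by ring
  have hR3 : R ≤ 3 * R := by rw [h3, add_assoc]; exact le_self_add
  set S : Finset (Finset (Fin r)) := Finset.univ.filter fun T =>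
    ∀ c ∈ T, (∀ e, 3 * R < edist (k c) (u e)) ∧ ∀ c' ∈ T, c' ≠ c → 3 * R < edist (k c) (k c')
    with hS
  obtain ⟨T, hTS, hmax⟩ := Finset.exists_max_image S Finset.card ⟨∅, by simp [hS]⟩
  have hT := (Finset.mem_filter.1 hTS).2
  have hcov : ∀ a, (∃ c, edist (k a) (u c) ≤ 3 * R) ∨ ∃ c ∈ T, edist (k a) (k c) ≤ 3 * R := by
    intro a
    by_contra! hcon
    have haT : a ∉ T := fun haT => by
      have := hcon.2 a haT; rw [edist_self] at this; exact absurd this (not_lt.2 zero_le)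
    have : insert a T ∈ S := by
      refine Finset.mem_filter.2 ⟨Finset.mem_univ _, fun c hc => ?_⟩
      rcases Finset.mem_insert.1 hc with rfl | hc
      · refine ⟨hcon.1, fun c' hc' hne => ?_⟩
        rcases Finset.mem_insert.1 hc' with rfl | hc'
        · exact absurd rfl hne
        · exact hcon.2 c' hc'
      · refine ⟨(hT c hc).1, fun c' hc' hne => ?_⟩
        rcases Finset.mem_insert.1 hc' with h' | h'
        · rw [h', edist_comm]; exact hcon.2 c hc
        · exact (hT c hc).2 c' h' hne
    have := hmax _ this
    rw [Finset.card_insert_of_notMem haT] at this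
    omega
  -- A slot of `T` is far from all anchors, so its not being isolated can only be due to another
  -- slot.
  have hpart : ∀ c, ∃ f, c ∈ T → f ≠ c ∧ edist (k c) (k f) ≤ R := by
    intro c
    by_cases hc : c ∈ T
    · have := hno c
      unfold Isolated at this
      push Not at this
      obtain ⟨f, hf, hf'⟩ := this fun e => hR3.trans_lt ((hT c hc).1 e)
      exact ⟨f, fun _ => ⟨hf, hf'⟩⟩
    · exact ⟨c, fun h => absurd h hc⟩
  choose f hf using hpart
  have hfT : ∀ c ∈ T, f c ∉ T := fun c hc hfc =>
    absurd ((hf c hc).2.trans hR3) (not_le.2 ((hT c hc).2 _ hfc (hf c hc).1))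
  have hinj : Set.InjOn f T := by
    intro c hc c' hc' hcc
    by_contra hne
    refine absurd ?_ (not_le.2 ((hT c hc).2 c' hc' (Ne.symm hne)))
    calc edist (k c) (k c') ≤ edist (k c) (k (f c)) + edist (k (f c)) (k c') := edist_triangle _ _ _
      _ ≤ R + R := add_le_add (hf c hc).2 (by rw [hcc, edist_comm]; exact (hf c' hc').2)
      _ ≤ 3 * R := by rw [h3]; exact le_self_add
  have hdisj : Disjoint T (T.image f) := by
    rw [Finset.disjoint_left]
    intro c hc hc'
    obtain ⟨c', hc'', rfl⟩ := Finset.mem_image.1 hc'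
    exact hfT _ hc'' hc
  have hcard : (T ∪ T.image f).card = 2 * T.card := by
    rw [Finset.card_union_of_disjoint hdisj, Finset.card_image_of_injOn hinj]; ring
  refine ⟨T, ?_, hcov, fun heq => ?_⟩
  · rw [← hcard]; exact (Finset.card_le_univ _).trans (by simp)
  have huniv : T ∪ T.image f = Finset.univ := by
    rw [← Finset.card_eq_iff_eq_univ, hcard, heq]; simp
  -- The slot `c` is the representative in `T` of the pair that contains `a`.
  have hg : ∀ a, ∃ c, (a ∈ T → c = a) ∧ c ∈ T ∧ (a = c ∨ a = f c) := by
    intro a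
    have : a ∈ T ∪ T.image f := by rw [huniv]; exact Finset.mem_univ _
    rcases Finset.mem_union.1 this with h | h
    · exact ⟨a, fun _ => rfl, h, Or.inl rfl⟩
    · obtain ⟨c, hc, hca⟩ := Finset.mem_image.1 h
      exact ⟨c, fun h' => absurd h' (hca ▸ hfT c hc), hc, Or.inr hca.symm⟩
  choose ρ hρ1 hρT hρ using hg
  have hρf : ∀ c ∈ T, ρ (f c) = c := by
    intro c hc
    rcases hρ (f c) with h | h
    · exact absurd (hρT (f c)) (h ▸ hfT c hc)
    · exact (hinj hc (hρT _) h).symm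
  have hρd : ∀ a, edist (k a) (k (ρ a)) ≤ R := by
    intro a
    rcases hρ a with h | h
    · rw [← h, edist_self]; exact zero_le
    · conv_lhs => rw [h, hρf _ (hρT a), edist_comm]
      exact (hf _ (hρT a)).2
  refine ⟨fun a => if a ∈ T then f a else ρ a, fun a => ⟨?_, ?_, ?_, ?_, ?_⟩⟩
  · by_cases ha : a ∈ T
    · simp [ha, hfT a ha, hρf a ha]
    · simp only [ha, if_false, hρT a, if_true]
      rcases hρ a with h | h
      · exact absurd (hρT a) (h ▸ ha)
      · exact h.symm
  · by_cases ha : a ∈ T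
    · simpa [ha] using (hf a ha).1
    · simp only [ha, if_false]; exact fun h => ha (h ▸ hρT a)
  · by_cases ha : a ∈ T
    · simpa [ha] using (hf a ha).2
    · simpa [ha] using hρd a
  · intro c
    by_contra! hcon
    refine absurd ?_ (not_le.2 ((hT _ (hρT a)).1 c))
    calc edist (k (ρ a)) (u c) ≤ edist (k (ρ a)) (k a) + edist (k a) (u c) := edist_triangle _ _ _
      _ ≤ R + R := add_le_add (by rw [edist_comm]; exact hρd a) hcon
      _ ≤ 3 * R := by rw [h3]; exact le_self_add
  · intro c hca hcπ
    beta_reduce at hcπ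
    by_contra! hcon
    -- Slots of different pairs have different representatives. These are more than `3R` apart, and
    -- each slot is within `R` of its own.
    have hne : ρ c ≠ ρ a := by
      intro he
      by_cases ha : a ∈ T
      · rw [if_pos ha] at hcπ
        rw [hρ1 a ha] at he
        rcases hρ c with h | h
        · exact hca (h.trans he)
        · exact hcπ (he ▸ h)
      · rw [if_neg ha] at hcπ
        rcases hρ a with h | h
        · exact ha (h ▸ hρT a)
        · rcases hρ c with h' | h'
          · exact hcπ (h'.trans he)
          · exact hca (h'.trans ((congrArg f he).trans h.symm))
    refine absurd ?_ (not_le.2 ((hT _ (hρT a)).2 _ (hρT c) hne))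
    calc edist (k (ρ a)) (k (ρ c))
        ≤ edist (k (ρ a)) (k a) + edist (k a) (k c) + edist (k c) (k (ρ c)) :=
          edist_triangle4 _ _ _ _
      _ ≤ R + R + R := add_le_add (add_le_add (by rw [edist_comm]; exact hρd a) hcon) (hρd c)
      _ = 3 * R := h3.symm

open Classical in
-- Choose the set `T` (at most `2 ^ r` ways) and the values of `k` on it (at most `|I| ^ q` ways).
-- Every slot then lies in one of at most `2r` neighbourhoods: those of the anchors and those of the
-- chosen values.
lemma card_le_of_clustered [Fintype I] {R : ℝ≥0∞} {D : ℕ}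
    (hD : ∀ i : I, (Finset.univ.filter fun j => edist i j ≤ 3 * R).card ≤ D) {r q : ℕ}
    (u : Fin r → I) (hI : 1 ≤ Fintype.card I) (S : Finset (Fin r → I))
    (hS : ∀ k ∈ S, Clustered R u k q) :
    S.card ≤ 2 ^ r * (Fintype.card I ^ q * (2 * r * D) ^ r) := by
  set N : I → Finset I := fun i => Finset.univ.filter fun j => edist i j ≤ 3 * R with hN
  have hsub : S ⊆ (Finset.univ.filter fun T : Finset (Fin r) => T.card ≤ q).biUnion fun T =>
      (Finset.univ : Finset (T → I)).biUnion fun ρ => Fintype.piFinset fun _ : Fin r =>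
        (Finset.univ.biUnion fun c => N (u c)) ∪ Finset.univ.biUnion fun c => N (ρ c) := by
    intro k hk
    obtain ⟨T, hT, hcov⟩ := hS k hk
    refine Finset.mem_biUnion.2 ⟨T, by simpa using hT, Finset.mem_biUnion.2
      ⟨fun c => k c, Finset.mem_univ _, Fintype.mem_piFinset.2 fun a => ?_⟩⟩
    rcases hcov a with ⟨c, hc⟩ | ⟨c, hcT, hc⟩
    · exact Finset.mem_union_left _ (Finset.mem_biUnion.2 ⟨c, Finset.mem_univ _,
        Finset.mem_filter.2 ⟨Finset.mem_univ _, by rwa [edist_comm]⟩⟩)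
    · exact Finset.mem_union_right _ (Finset.mem_biUnion.2 ⟨⟨c, hcT⟩, Finset.mem_univ _,
        Finset.mem_filter.2 ⟨Finset.mem_univ _, by rwa [edist_comm]⟩⟩)
  refine (Finset.card_le_card hsub).trans ((Finset.card_biUnion_le_card_mul _ _
    (Fintype.card I ^ q * (2 * r * D) ^ r) fun T hT => ?_).trans (Nat.mul_le_mul_right _ ?_))
  · refine (Finset.card_biUnion_le_card_mul _ _ ((2 * r * D) ^ r) fun ρ _ => ?_).trans
      (Nat.mul_le_mul_right _ ?_)
    · rw [Fintype.card_piFinset]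
      refine (Finset.prod_le_pow_card _ _ (2 * r * D) fun a _ => ?_).trans (by simp)
      refine (Finset.card_union_le _ _).trans ?_
      have h1 : (Finset.univ.biUnion fun c => N (u c)).card ≤ r * D :=
        (Finset.card_biUnion_le_card_mul _ _ D fun c _ => hD _).trans (by simp)
      have h2 : (Finset.univ.biUnion fun c => N (ρ c)).card ≤ r * D :=
        (Finset.card_biUnion_le_card_mul _ _ D fun c _ => hD _).trans
          (Nat.mul_le_mul_right _ (by simpa using Finset.card_le_univ T))
      calc _ ≤ r * D + r * D := add_le_add h1 h2
        _ = 2 * r * D := by ring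
    · rw [Finset.card_univ, Fintype.card_fun, Fintype.card_coe]
      exact Nat.pow_le_pow_right hI (Finset.mem_filter.1 hT).2
  · exact (Finset.card_le_univ _).trans (by simp)

end Combinatorics

/-! ### Moments of row sums; the near and far parts of the total sum -/

section Moments

variable {Ω I E : Type*} [MeasurableSpace Ω] [MeasurableSpace E] [Fintype I] [EMetricSpace I]
variable {P : Measure Ω} [IsProbabilityMeasure P] {X : I → Ω → E} {R : ℝ≥0∞} {β : ℝ}
  {h : I → I → E → E → ℝ} {b : ℝ}

/-- Every index has at most `D` indices at a distance of at most `10 R`. -/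
def NbhdBound (I : Type*) [Fintype I] [EMetricSpace I] (R : ℝ≥0∞) (D : ℕ) : Prop :=
  ∀ i : I, ∀ S : Finset I, (∀ j ∈ S, edist i j ≤ 10 * R) → S.card ≤ D

lemma IsMixing.measurable_sample (hM : IsMixing P X R β) :
    Measurable fun ω => fun i => X i ω :=
  measurable_pi_lambda _ hM.measurable

lemma IsMixing.integrable_comp (hM : IsMixing P X R β) {Φ : (I → E) → ℝ} (hΦ : Measurable Φ)
    {B : ℝ} (hB : ∀ ξ, |Φ ξ| ≤ B) : Integrable (fun ω => Φ fun i => X i ω) P :=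
  integrable_of_abs_le (hΦ.comp hM.measurable_sample) fun _ => hB _

lemma ennreal_mul_le_mul {a b : ℕ} (R : ℝ≥0∞) (hab : a ≤ b) : (a : ℝ≥0∞) * R ≤ b * R := by
  gcongr

lemma le_three_mul (R : ℝ≥0∞) : R ≤ 3 * R := by
  simpa using ennreal_mul_le_mul R (a := 1) (b := 3) (by norm_num)

/-- Expectation of a product of row sums: only the index tuples without an isolated slot
contribute. -/
lemma IsKernel.abs_integral_prod_rowSum_le (hK : IsKernel P X R h b) (hM : IsMixing P X R β)
    {D : ℕ} (hD : NbhdBound I R D) (hn : 1 ≤ Fintype.card I) (hb : 0 ≤ b) {r q : ℕ}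
    (hrq : r ≤ 2 * q + 1)
    (u : Fin r → I) {m : ℝ} (hm : ∀ k : Fin r → I, ∫ ω, |kerProd h u k fun i => X i ω| ∂P ≤ m) :
    |∫ ω, ∏ a, rowSum h (u a) (fun i => X i ω) ∂P| ≤
      2 ^ r * (Fintype.card I ^ q * (2 * r * D) ^ r) * m
        + (Fintype.card I : ℝ) ^ r * (4 * b ^ r * β) := by
  classical
  have hint : ∀ k : Fin r → I, Integrable (fun ω => kerProd h u k fun i => X i ω) P := fun k =>
    hM.integrable_comp (hK.measurable_kerProd u k) (hK.abs_kerProd_le u k)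
  simp only [prod_rowSum]
  rw [integral_finsetSum _ fun k _ => hint k]
  have hm0 : 0 ≤ m := by
    obtain ⟨i⟩ : Nonempty I := Fintype.card_pos_iff.1 hn
    exact (integral_nonneg fun _ => abs_nonneg _).trans (hm fun _ => i)
  have hβ := hM.nonneg
  set S : Finset (Fin r → I) := Finset.univ.filter fun k => ∀ a, ¬ Isolated R u k a with hS
  have hcard : S.card ≤ 2 ^ r * (Fintype.card I ^ q * (2 * r * D) ^ r) := by
    refine card_le_of_clustered (R := R) (fun i => hD i _ fun j hj => ?_) u hn S fun k hk => ?_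
    · exact (Finset.mem_filter.1 hj).2.trans (by
        simpa using ennreal_mul_le_mul R (a := 3) (b := 10) (by norm_num))
    · obtain ⟨T, hT, hT', -⟩ := clustered_or_matched u k (Finset.mem_filter.1 hk).2
      -- From `2|T| ≤ r ≤ 2q + 1`: two slots share one free index.
      exact ⟨T, by omega, hT'⟩
  calc |∑ k : Fin r → I, ∫ ω, kerProd h u k (fun i => X i ω) ∂P|
      ≤ ∑ k : Fin r → I, |∫ ω, kerProd h u k (fun i => X i ω) ∂P| :=
        Finset.abs_sum_le_sum_abs _ _
    _ ≤ ∑ k : Fin r → I, ((if k ∈ S then m else 0) + 4 * b ^ r * β) := by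
        refine Finset.sum_le_sum fun k _ => ?_
        by_cases hk : k ∈ S
        · rw [if_pos hk]
          have h1 : |∫ ω, kerProd h u k (fun i => X i ω) ∂P| ≤ m :=
            (abs_integral_le_integral_abs).trans (hm k)
          have : 0 ≤ 4 * b ^ r * β := by positivity
          linarith
        · rw [if_neg hk, zero_add]
          simp only [hS, Finset.mem_filter, Finset.mem_univ, true_and, not_forall, not_not] at hk
          obtain ⟨a, ha⟩ := hk
          exact hK.abs_integral_kerProd_le_of_isolated hM u k ha
    _ = S.card * m + (Fintype.card I : ℝ) ^ r * (4 * b ^ r * β) := by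
        rw [Finset.sum_add_distrib, Finset.sum_ite_mem, Finset.univ_inter, Finset.sum_const,
          Finset.sum_const, Finset.card_univ, Fintype.card_fun, Fintype.card_fin]
        simp
    _ ≤ _ := by
        have : (S.card : ℝ) ≤ 2 ^ r * (Fintype.card I ^ q * (2 * r * D) ^ r) := by
          exact_mod_cast hcard
        gcongr

lemma abs_mul4_le (x y z w : ℝ) : |x * y * z * w| ≤ (x ^ 4 + y ^ 4 + z ^ 4 + w ^ 4) / 4 := by
  rw [abs_le]
  constructor <;> nlinarith [sq_nonneg (x ^ 2 - y ^ 2), sq_nonneg (z ^ 2 - w ^ 2),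
    sq_nonneg (x * y - z * w), sq_nonneg (x * y + z * w)]

lemma IsKernel.integrable_pow (hK : IsKernel P X R h b) (hM : IsMixing P X R β) (i k : I) (p : ℕ) :
    Integrable (fun ω => h i k (X i ω) (X k ω) ^ p) P := by
  refine hM.integrable_comp (Φ := fun ξ => h i k (ξ i) (ξ k) ^ p)
    ((hK.measurable_eval i k).pow_const p) (B := b ^ p) fun ξ => ?_
  rw [abs_pow]
  exact pow_le_pow_left₀ (abs_nonneg _) (hK.bound _ _ _ _) p

lemma IsKernel.integral_abs_kerProd_two_le (hK : IsKernel P X R h b) (hM : IsMixing P X R β) {v : ℝ}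
    (hv : ∀ i k, ∫ ω, h i k (X i ω) (X k ω) ^ 2 ∂P ≤ v) (u k : Fin 2 → I) :
    ∫ ω, |kerProd h u k fun i => X i ω| ∂P ≤ v := by
  calc ∫ ω, |kerProd h u k fun i => X i ω| ∂P
      ≤ ∫ ω, (h (u 0) (k 0) (X (u 0) ω) (X (k 0) ω) ^ 2 +
          h (u 1) (k 1) (X (u 1) ω) (X (k 1) ω) ^ 2) / 2 ∂P := by
        refine integral_mono (hM.integrable_comp (hK.measurable_kerProd u k)
          (hK.abs_kerProd_le u k)).abs (((hK.integrable_pow hM _ _ 2).add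
            (hK.integrable_pow hM _ _ 2)).div_const 2) fun ω => ?_
        simp only [kerProd, Fin.prod_univ_two]
        rw [abs_le]
        constructor <;> nlinarith [sq_nonneg (h (u 0) (k 0) (X (u 0) ω) (X (k 0) ω) -
          h (u 1) (k 1) (X (u 1) ω) (X (k 1) ω)), sq_nonneg (h (u 0) (k 0) (X (u 0) ω) (X (k 0) ω) +
          h (u 1) (k 1) (X (u 1) ω) (X (k 1) ω))]
    _ ≤ v := by
        rw [integral_div, integral_add (hK.integrable_pow hM _ _ 2) (hK.integrable_pow hM _ _ 2)]
        linarith [hv (u 0) (k 0), hv (u 1) (k 1)]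

lemma IsKernel.integral_abs_mul4_le (hK : IsKernel P X R h b) (hM : IsMixing P X R β) {a4 : ℝ}
    (ha : ∀ i k, ∫ ω, h i k (X i ω) (X k ω) ^ 4 ∂P ≤ a4) (u k : Fin 4 → I) :
    ∫ ω, |kerProd h u k fun i => X i ω| ∂P ≤ a4 := by
  have hi := fun a => hK.integrable_pow hM (u a) (k a) 4
  calc ∫ ω, |kerProd h u k fun i => X i ω| ∂P
      ≤ ∫ ω, (∑ a, h (u a) (k a) (X (u a) ω) (X (k a) ω) ^ 4) / 4 ∂P := by
        refine integral_mono (hM.integrable_comp (hK.measurable_kerProd u k)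
          (hK.abs_kerProd_le u k)).abs ((integrable_finsetSum _ fun a _ => hi a).div_const 4)
          fun ω => ?_
        simp only [kerProd, Fin.prod_univ_four, Fin.sum_univ_four]
        exact abs_mul4_le _ _ _ _
    _ ≤ a4 := by
        rw [integral_div, integral_finsetSum _ fun a _ => hi a]
        have : ∑ a, ∫ ω, h (u a) (k a) (X (u a) ω) (X (k a) ω) ^ 4 ∂P ≤ ∑ _a : Fin 4, a4 :=
          Finset.sum_le_sum fun a _ => ha _ _
        simp at this
        linarith

/-- Only fourth moments are available, so two of the six factors are bounded by `b`. This is the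
price for which the cutoff level must stay as low as `√n`. -/
lemma IsKernel.integral_abs_kerProd_six_le (hK : IsKernel P X R h b) (hM : IsMixing P X R β)
    (hb : 0 ≤ b) {a4 : ℝ} (ha : ∀ i k, ∫ ω, h i k (X i ω) (X k ω) ^ 4 ∂P ≤ a4) (u k : Fin 6 → I) :
    ∫ ω, |kerProd h u k fun i => X i ω| ∂P ≤ b ^ 2 * a4 := by
  set u' : Fin 4 → I := fun a => u (Fin.castLE (by norm_num) a) with hu'
  set k' : Fin 4 → I := fun a => k (Fin.castLE (by norm_num) a) with hk'
  have e : ∀ ξ : I → E, kerProd h u k ξ = kerProd h u' k' ξ *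
        (h (u 4) (k 4) (ξ (u 4)) (ξ (k 4)) * h (u 5) (k 5) (ξ (u 5)) (ξ (k 5))) := by
    intro ξ
    simp only [kerProd, Fin.prod_univ_six, Fin.prod_univ_four, mul_assoc]
    rfl
  calc ∫ ω, |kerProd h u k fun i => X i ω| ∂P
      ≤ ∫ ω, b ^ 2 * |kerProd h u' k' fun i => X i ω| ∂P := by
        refine integral_mono (hM.integrable_comp (hK.measurable_kerProd u k)
          (hK.abs_kerProd_le u k)).abs ((hM.integrable_comp (hK.measurable_kerProd _ _)
          (hK.abs_kerProd_le _ _)).abs.const_mul _) fun ω => ?_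
        simp only [e]
        rw [abs_mul, mul_comm, sq, abs_mul]
        gcongr
        · exact hK.bound _ _ _ _
        · exact hK.bound _ _ _ _
    _ ≤ b ^ 2 * a4 := by
        rw [integral_const_mul]
        exact mul_le_mul_of_nonneg_left (hK.integral_abs_mul4_le hM ha u' k') (by positivity)

/-- The sum of the kernels over the pairs of indices that are far from `i`. -/
noncomputable def farSum (h : I → I → E → E → ℝ) (R : ℝ≥0∞) (i : I) (ξ : I → E) : ℝ :=
  open Classical in
  ∑ j with R < edist i j, ∑ l with R < edist i l, h j l (ξ j) (ξ l)

lemma farSum_congr {i : I} {ξ ζ : I → E} (hξ : ∀ j, R < edist i j → ξ j = ζ j) :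
    farSum h R i ξ = farSum h R i ζ := by
  classical
  refine Finset.sum_congr rfl fun j hj => Finset.sum_congr rfl fun l hl => ?_
  rw [hξ j (Finset.mem_filter.1 hj).2, hξ l (Finset.mem_filter.1 hl).2]

open Classical in
-- The terms missing from the far sum are those with an index within `R` of `i`. Two such indices
-- are within `2R ≤ 3R` of each other, where the kernel vanishes, so exactly one of the two indices
-- is close to `i`; by symmetry both choices contribute the same, whence the factor 2.
lemma IsKernel.sum_rowSum_sub_farSum (hK : IsKernel P X R h b) (i : I) (ξ : I → E) :
    ∑ j, rowSum h j ξ - farSum h R i ξ = 2 * ∑ j with edist i j ≤ R, rowSum h j ξ := by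
  set f : I → I → ℝ := fun j l => h j l (ξ j) (ξ l) with hf
  have hsymm : ∀ j l, f j l = f l j := fun j l => hK.symm _ _ _ _
  have hz : ∀ j l, edist i j ≤ R → edist i l ≤ R → f j l = 0 := fun j l hj hl => by
    refine hK.zero _ _ ?_ _ _
    calc edist j l ≤ edist j i + edist i l := edist_triangle _ _ _
      _ ≤ R + R := add_le_add (by rwa [edist_comm]) hl
      _ ≤ 3 * R := by
        have : (3 : ℝ≥0∞) * R = R + R + R := by ring
        rw [this]; exact le_self_add
  have hsplit : ∀ g : I → ℝ, ∑ j, g j = ∑ j with edist i j ≤ R, g j + ∑ j with R < edist i j, g j := by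
    intro g
    rw [← Finset.sum_filter_add_sum_filter_not Finset.univ (fun j => edist i j ≤ R)]
    simp only [not_le]
  have e1 : ∑ j, rowSum h j ξ = ∑ j with edist i j ≤ R, ∑ l, f j l +
      ∑ j with R < edist i j, ∑ l, f j l := hsplit _
  have e2 : ∑ j with R < edist i j, ∑ l, f j l =
      ∑ j with R < edist i j, ∑ l with edist i l ≤ R, f j l + farSum h R i ξ := by
    rw [farSum, ← Finset.sum_add_distrib]
    exact Finset.sum_congr rfl fun j _ => hsplit _
  have e3 : ∑ j with R < edist i j, ∑ l with edist i l ≤ R, f j l =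
      ∑ j with edist i j ≤ R, ∑ l, f j l := by
    rw [Finset.sum_comm]
    refine Finset.sum_congr rfl fun l hl => ?_
    rw [hsplit, Finset.sum_eq_zero (s := Finset.univ.filter fun j => edist i j ≤ R)
      (fun j hj => hz _ _ (Finset.mem_filter.1 hl).2 (Finset.mem_filter.1 hj).2), zero_add]
    exact Finset.sum_congr rfl fun j _ => hsymm _ _
  have e4 : ∑ j with edist i j ≤ R, rowSum h j ξ = ∑ j with edist i j ≤ R, ∑ l, f j l := rfl
  rw [e4, e1, e2, e3]; ring

lemma IsKernel.measurable_farSum (hK : IsKernel P X R h b) (i : I) : Measurable (farSum h R i) :=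
  Finset.measurable_sum _ fun _ _ => Finset.measurable_sum _ fun _ _ => hK.measurable_eval _ _

lemma IsKernel.abs_rowSum_le (hK : IsKernel P X R h b) (i : I) (ξ : I → E) :
    |rowSum h i ξ| ≤ Fintype.card I * b := by
  refine (Finset.abs_sum_le_sum_abs _ _).trans ((Finset.sum_le_sum fun k _ =>
    hK.bound i k _ _).trans ?_)
  simp

lemma IsKernel.abs_farSum_le (hK : IsKernel P X R h b) (hb : 0 ≤ b) (i : I) (ξ : I → E) :
    |farSum h R i ξ| ≤ Fintype.card I ^ 2 * b := by
  classical
  have h1 : ∀ (S : Finset I) , (S.card : ℝ) ≤ Fintype.card I := fun S => by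
    exact_mod_cast Finset.card_le_univ S
  refine (Finset.abs_sum_le_sum_abs _ _).trans ((Finset.sum_le_sum fun j _ =>
    (Finset.abs_sum_le_sum_abs _ _).trans ((Finset.sum_le_sum fun l _ =>
      hK.bound j l _ _))).trans ?_)
  simp only [Finset.sum_const, nsmul_eq_mul]
  rw [sq, mul_assoc]
  gcongr
  · exact_mod_cast h1 _
  · exact_mod_cast h1 _

/-- A row sum is almost uncorrelated with bounded functions of the far observations. -/
lemma IsKernel.abs_integral_rowSum_mul_le (hK : IsKernel P X R h b) (hM : IsMixing P X R β)
    (i : I) {Ψ : (I → E) → ℝ} (hΨ : Measurable Ψ) {B : ℝ} (hB : ∀ ξ, |Ψ ξ| ≤ B)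
    (hdep : ∀ ξ ζ : I → E, (∀ j, R < edist i j → ξ j = ζ j) → Ψ ξ = Ψ ζ) :
    |∫ ω, rowSum h i (fun j => X j ω) * Ψ (fun j => X j ω) ∂P| ≤
      Fintype.card I * (4 * (b * B) * β) := by
  classical
  have hbd : ∀ k (ξ : I → E), |h i k (ξ i) (ξ k) * Ψ ξ| ≤ b * B := fun k ξ => by
    rw [abs_mul]
    exact mul_le_mul (hK.bound _ _ _ _) (hB ξ) (abs_nonneg _) (hK.bound_nonneg i k (ξ i) (ξ k))
  have hint : ∀ k, Integrable (fun ω => h i k (X i ω) (X k ω) * Ψ (fun j => X j ω)) P := fun k =>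
    hM.integrable_comp (Φ := fun ξ => h i k (ξ i) (ξ k) * Ψ ξ) ((hK.measurable_eval i k).mul hΨ)
      (hbd k)
  simp only [rowSum, Finset.sum_mul]
  rw [integral_finsetSum _ fun k _ => hint k]
  refine (Finset.abs_sum_le_sum_abs _ _).trans ?_
  have : ∀ k ∈ (Finset.univ : Finset I),
      |∫ ω, h i k (X i ω) (X k ω) * Ψ (fun j => X j ω) ∂P| ≤ 4 * (b * B) * β := by
    intro k _
    by_cases hk : edist i k ≤ 3 * R
    · have hβ := hM.nonneg
      obtain ⟨ω₀⟩ : Nonempty Ω := nonempty_of_isProbabilityMeasure P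
      have hbB : 0 ≤ b * B := (abs_nonneg _).trans (hbd k fun j => X j ω₀)
      simp only [hK.zero i k hk, zero_mul, integral_zero, abs_zero]
      positivity
    -- Here `X_i` is far from `X_k` and from everything that `Ψ` depends on. It is integrated out,
    -- and symmetry turns degeneracy in the second argument into degeneracy in the first.
    · have hk' : R < edist i k := (le_three_mul R).trans_lt (not_le.1 hk)
      have hne : k ≠ i := fun e => by
        rw [e, edist_self] at hk'; exact absurd hk' (not_lt.2 zero_le)
      refine hM.abs_integral_le_of_centred i (Φ := fun ξ => h i k (ξ i) (ξ k) * Ψ ξ)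
        ((hK.measurable_eval i k).mul hΨ) (hbd k) ?_ ?_
      · intro ξ ζ h1 h2
        simp only [h1, h2 k hk', hdep ξ ζ h2]
      · intro ξ
        have e1 : ∀ x, Ψ (Function.update ξ i x) = Ψ ξ := fun x => hdep _ _ fun j hj => by
          refine Function.update_of_ne (fun e => ?_) _ _
          rw [e, edist_self] at hj; exact absurd hj (not_lt.2 zero_le)
        simp only [e1, Function.update_self, Function.update_of_ne hne]
        rw [integral_mul_const]
        simp only [hK.symm i k _ (ξ k)]
        rw [hK.degenerate, zero_mul]
  refine (Finset.sum_le_sum this).trans ?_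
  simp

end Moments

/-! ### Negligible mixing errors, second moments, decoupling of groups -/

section Decoupling

variable {Ω I E : Type*} [MeasurableSpace Ω] [MeasurableSpace E] [Fintype I] [EMetricSpace I]
variable {P : Measure Ω} [IsProbabilityMeasure P] {X : I → Ω → E} {R : ℝ≥0∞} {β : ℝ}
  {h : I → I → E → E → ℝ} {b : ℝ}

/-- The mixing coefficient is negligible in comparison with powers of the sample size and of the
bound of the kernels. -/
def Negligible (n : ℕ) (b β : ℝ) : Prop := (n : ℝ) ^ 8 * (4 * b ^ 12 * β) ≤ 1

lemma Negligible.le_one {n : ℕ} {b β : ℝ} (hτ : Negligible n b β) (hn : 1 ≤ n) (hb : 1 ≤ b)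
    (hβ : 0 ≤ β) {p q : ℕ} (hq : q ≤ 8) (hp : p ≤ 12) : (n : ℝ) ^ q * (4 * b ^ p * β) ≤ 1 := by
  refine le_trans ?_ hτ
  have hn' : (1 : ℝ) ≤ n := by exact_mod_cast hn
  gcongr

lemma NbhdBound.one_le {D : ℕ} (hD : NbhdBound I R D) (hn : 1 ≤ Fintype.card I) : 1 ≤ D := by
  obtain ⟨i⟩ : Nonempty I := Fintype.card_pos_iff.1 hn
  simpa using hD i {i} (by simp)

lemma IsKernel.integrable_rowSum_mul (hK : IsKernel P X R h b) (hM : IsMixing P X R β) (i j : I) :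
    Integrable (fun ω => rowSum h i (fun l => X l ω) * rowSum h j (fun l => X l ω)) P := by
  refine hM.integrable_comp (Φ := fun ξ => rowSum h i ξ * rowSum h j ξ)
    ((hK.measurable_rowSum i).mul (hK.measurable_rowSum j))
    (B := (Fintype.card I * b) * (Fintype.card I * b)) fun ξ => ?_
  rw [abs_mul]
  exact mul_le_mul (hK.abs_rowSum_le i ξ) (hK.abs_rowSum_le j ξ) (abs_nonneg _)
    ((abs_nonneg _).trans (hK.abs_rowSum_le i ξ))

open Classical in
/-- The second moment of the full sum, up to a negligible term, only involves products of row sums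
of close indices. -/
lemma IsKernel.abs_integral_sq_sub_le (hK : IsKernel P X R h b) (hM : IsMixing P X R β)
    (hn : 1 ≤ Fintype.card I) (hb : 1 ≤ b) (hτ : Negligible (Fintype.card I) b β) :
    |∫ ω, (∑ i, rowSum h i fun l => X l ω) ^ 2 ∂P -
      ∑ i, ∫ ω, rowSum h i (fun l => X l ω) *
        (2 * ∑ j with edist i j ≤ R, rowSum h j fun l => X l ω) ∂P| ≤ 1 := by
  have hb0 : 0 ≤ b := zero_le_one.trans hb
  have hif : ∀ i, Integrable (fun ω => rowSum h i (fun l => X l ω) *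
      farSum h R i (fun l => X l ω)) P := by
    intro i
    refine hM.integrable_comp (Φ := fun ξ => rowSum h i ξ * farSum h R i ξ)
      ((hK.measurable_rowSum i).mul (hK.measurable_farSum i))
      (B := (Fintype.card I * b) * (Fintype.card I ^ 2 * b)) fun ξ => ?_
    rw [abs_mul]
    exact mul_le_mul (hK.abs_rowSum_le i ξ) (hK.abs_farSum_le hb0 i ξ) (abs_nonneg _)
      ((abs_nonneg _).trans (hK.abs_rowSum_le i ξ))
  have hin : ∀ i, Integrable (fun ω => rowSum h i (fun l => X l ω) *
        (2 * ∑ j with edist i j ≤ R, rowSum h j fun l => X l ω)) P := by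
    intro i
    have : Integrable (fun ω => ∑ j with edist i j ≤ R,
        2 * (rowSum h i (fun l => X l ω) * rowSum h j fun l => X l ω)) P :=
      integrable_finsetSum _ fun j _ => (hK.integrable_rowSum_mul hM i j).const_mul 2
    refine this.congr (ae_of_all _ fun ω => ?_)
    simp only [Finset.mul_sum]
    exact Finset.sum_congr rfl fun j _ => by ring
  -- One factor of the square is split for each `i` into its near part `2 L_i` and its far part; the
  -- latter is decoupled from the row `i`.
  have e : ∀ ω, (∑ i, rowSum h i fun l => X l ω) ^ 2 =
      ∑ i, (rowSum h i (fun l => X l ω) * (2 * ∑ j with edist i j ≤ R, rowSum h j fun l => X l ω) +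
        rowSum h i (fun l => X l ω) * farSum h R i (fun l => X l ω)) := by
    intro ω
    rw [sq, Finset.sum_mul]
    refine Finset.sum_congr rfl fun i _ => ?_
    rw [← hK.sum_rowSum_sub_farSum]; ring
  have eI := (integral_finsetSum Finset.univ fun i _ => (hin i).add (hif i)).trans
    (Finset.sum_congr rfl fun i _ => integral_add (hin i) (hif i))
  simp only [Pi.add_apply] at eI
  simp only [e]
  rw [eI, Finset.sum_add_distrib, add_sub_cancel_left]
  refine (Finset.abs_sum_le_sum_abs _ _).trans ?_
  have : ∀ i ∈ (Finset.univ : Finset I), |∫ ω, rowSum h i (fun l => X l ω) *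
      farSum h R i (fun l => X l ω) ∂P| ≤ Fintype.card I * (4 * (b * (Fintype.card I ^ 2 * b)) * β) :=
    fun i _ => hK.abs_integral_rowSum_mul_le hM i (hK.measurable_farSum i) (hK.abs_farSum_le hb0 i)
      fun ξ ζ => farSum_congr
  refine (Finset.sum_le_sum this).trans ?_
  have := hτ.le_one hn hb hM.nonneg (p := 2) (q := 4) (by norm_num) (by norm_num)
  simp only [Finset.sum_const, Finset.card_univ, nsmul_eq_mul]
  calc _ = (Fintype.card I : ℝ) ^ 4 * (4 * b ^ 2 * β) := by ring
    _ ≤ 1 := this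

/-- Second moment of the full sum of a kernel with small second moments. -/
lemma IsKernel.integral_sq_sum_rowSum_le (hK : IsKernel P X R h b) (hM : IsMixing P X R β)
    {D : ℕ} (hD : NbhdBound I R D) (hn : 1 ≤ Fintype.card I) (hb : 1 ≤ b)
    (hτ : Negligible (Fintype.card I) b β) {v : ℝ}
    (hv : ∀ i k, ∫ ω, h i k (X i ω) (X k ω) ^ 2 ∂P ≤ v) :
    ∫ ω, (∑ i, rowSum h i fun l => X l ω) ^ 2 ∂P ≤
      128 * Fintype.card I ^ 2 * D ^ 3 * v + 3 * Fintype.card I * D := by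
  classical
  have h1 := (abs_le.1 (hK.abs_integral_sq_sub_le hM hn hb hτ)).2
  have hD1 := hD.one_le hn
  set n := Fintype.card I with hnn
  have hn' : (1 : ℝ) ≤ n := by exact_mod_cast hn
  have hD' : (1 : ℝ) ≤ D := by exact_mod_cast hD1
  have hv0 : 0 ≤ v := by
    obtain ⟨i⟩ : Nonempty I := Fintype.card_pos_iff.1 hn
    exact (integral_nonneg fun _ => sq_nonneg _).trans (hv i i)
  have hYY : ∀ i j, ∫ ω, rowSum h i (fun l => X l ω) * rowSum h j (fun l => X l ω) ∂P ≤
      64 * n * D ^ 2 * v + 1 := by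
    intro i j
    have h2 := hK.abs_integral_prod_rowSum_le hM hD hn (zero_le_one.trans hb) (r := 2) (q := 1)
      (by norm_num) ![i, j] fun k => hK.integral_abs_kerProd_two_le hM hv ![i, j] k
    simp only [Fin.prod_univ_two, Matrix.cons_val_zero, Matrix.cons_val_one] at h2
    have h3 := hτ.le_one hn hb hM.nonneg (p := 2) (q := 2) (by norm_num) (by norm_num)
    refine (le_abs_self _).trans (h2.trans ?_)
    have : (2 : ℝ) ^ 2 * (n ^ 1 * (2 * (2 : ℕ) * D) ^ 2) * v = 64 * n * D ^ 2 * v := by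
      push_cast; ring
    linarith
  have h4 : ∀ i, ∫ ω, rowSum h i (fun l => X l ω) *
        (2 * ∑ j with edist i j ≤ R, rowSum h j fun l => X l ω) ∂P ≤
        D * (2 * (64 * n * D ^ 2 * v + 1)) := by
    intro i
    have e : ∀ ω, rowSum h i (fun l => X l ω) *
        (2 * ∑ j with edist i j ≤ R, rowSum h j fun l => X l ω) =
        ∑ j with edist i j ≤ R, 2 * (rowSum h i (fun l => X l ω) * rowSum h j fun l => X l ω) :=
      fun ω => by
        simp only [Finset.mul_sum]
        exact Finset.sum_congr rfl fun j _ => by ring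
    simp only [e]
    rw [integral_finsetSum _ fun j _ => (hK.integrable_rowSum_mul hM i j).const_mul 2]
    simp only [integral_const_mul]
    refine (Finset.sum_le_card_nsmul _ _ (2 * (64 * n * D ^ 2 * v + 1)) fun j _ => ?_).trans ?_
    · linarith [hYY i j]
    · rw [nsmul_eq_mul]
      have : (Finset.univ.filter fun j => edist i j ≤ R).card ≤ D := hD i _ fun j hj =>
        (Finset.mem_filter.1 hj).2.trans (by simpa using ennreal_mul_le_mul R (a := 1) (b := 10) (by norm_num))
      have : ((Finset.univ.filter fun j => edist i j ≤ R).card : ℝ) ≤ D := by exact_mod_cast this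
      gcongr
  have h5 := Finset.sum_le_sum fun i (_ : i ∈ (Finset.univ : Finset I)) => h4 i
  simp only [Finset.sum_const, Finset.card_univ, nsmul_eq_mul] at h5
  rw [← hnn] at h5
  have h6 : (1 : ℝ) ≤ n * D := by nlinarith
  nlinarith

/-- Decoupling of a function of a group of at most two observations. -/
lemma IsMixing.abs_integral_mul_sub_le (hM : IsMixing P X R β) (K : Finset I) (hK : K.card ≤ 2)
    {f g : (I → E) → ℝ} (hf : Measurable f) (hg : Measurable g) {Bf Bg : ℝ}
    (hBf : ∀ ξ, |f ξ| ≤ Bf) (hBg : ∀ ξ, |g ξ| ≤ Bg)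
    (hdf : ∀ ξ ζ : I → E, (∀ i ∈ K, ξ i = ζ i) → f ξ = f ζ)
    (hdg : ∀ ξ ζ : I → E, (∀ j, (∀ i ∈ K, R < edist i j) → ξ j = ζ j) → g ξ = g ζ) :
    |∫ ω, f (fun i => X i ω) * g (fun i => X i ω) ∂P -
      (∫ ω, f (fun i => X i ω) ∂P) * ∫ ω, g (fun i => X i ω) ∂P| ≤ 4 * (Bf * Bg) * β := by
  classical
  have hs := hM.swap K hK (Φ := fun ξ => f ξ * g ξ) (hf.mul hg) (B := Bf * Bg) (fun ξ => by
    rw [abs_mul]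
    exact mul_le_mul (hBf ξ) (hBg ξ) (abs_nonneg _) ((abs_nonneg _).trans (hBf ξ)))
    fun ξ ζ h1 h2 => by rw [hdf ξ ζ h1, hdg ξ ζ h2]
  have e : ∀ ω ω', f (K.piecewise (fun i => X i ω') fun i => X i ω) *
      g (K.piecewise (fun i => X i ω') fun i => X i ω) =
      f (fun i => X i ω') * g (fun i => X i ω) := by
    intro ω ω'
    congr 1
    · exact hdf _ _ fun i hi => by simp [hi]
    · refine hdg _ _ fun j hj => ?_
      have hjK : j ∉ K := fun hjK => by
        have := hj j hjK; rw [edist_self] at this; exact absurd this (not_lt.2 zero_le)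
      simp [hjK]
  simp only [e] at hs
  simp only [integral_mul_const, integral_const_mul] at hs
  exact hs

lemma measurable_piecewise₂ (K : Finset I) [DecidablePred (· ∈ K)] :
    Measurable fun z : (I → E) × (I → E) => K.piecewise z.1 z.2 := by
  refine measurable_pi_lambda _ fun i => ?_
  by_cases hi : i ∈ K
  · simp only [Finset.piecewise, hi, if_true]; exact (measurable_pi_apply i).comp measurable_fst
  · simp only [Finset.piecewise, hi, if_false]; exact (measurable_pi_apply i).comp measurable_snd

/-- Decoupling of a function of two groups of at most two observations, which are far from each
other. -/
lemma IsMixing.abs_integral_mul_sub_le₂ (hM : IsMixing P X R β) (K L : Finset I) (hK : K.card ≤ 2)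
    (hL : L.card ≤ 2) (hKL : ∀ i ∈ K, ∀ j ∈ L, R < edist i j)
    {f g : (I → E) → ℝ} (hf : Measurable f) (hg : Measurable g) {Bf Bg : ℝ}
    (hBf : ∀ ξ, |f ξ| ≤ Bf) (hBg : ∀ ξ, |g ξ| ≤ Bg)
    (hdf : ∀ ξ ζ : I → E, (∀ i ∈ K, ξ i = ζ i) → (∀ i ∈ L, ξ i = ζ i) → f ξ = f ζ)
    (hdg : ∀ ξ ζ : I → E, (∀ j, (∀ i ∈ K, R < edist i j) → (∀ i ∈ L, R < edist i j) → ξ j = ζ j) →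
      g ξ = g ζ) :
    |∫ ω, f (fun i => X i ω) * g (fun i => X i ω) ∂P -
      (∫ ω, f (fun i => X i ω) ∂P) * ∫ ω, g (fun i => X i ω) ∂P| ≤ 12 * (Bf * Bg) * β := by
  classical
  obtain ⟨ω₀⟩ : Nonempty Ω := nonempty_of_isProbabilityMeasure P
  have hβ := hM.nonneg
  have hBf0 : 0 ≤ Bf := (abs_nonneg _).trans (hBf fun i => X i ω₀)
  have hBg0 : 0 ≤ Bg := (abs_nonneg _).trans (hBg fun i => X i ω₀)
  -- Mixing frees at most two observations at a time. The group `K` is averaged out first, and `F`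
  -- depends on the group `L` alone.
  set F : (I → E) → ℝ := fun ξ => ∫ ω', f (K.piecewise (fun i => X i ω') ξ) ∂P with hF
  have hFm : Measurable F := by
    have : Measurable fun z : (I → E) × Ω => f (K.piecewise (fun i => X i z.2) z.1) :=
      hf.comp ((measurable_piecewise₂ K).comp
        ((hM.measurable_sample.comp measurable_snd).prodMk measurable_fst))
    exact (this.stronglyMeasurable.integral_prod_right' (ν := P)).measurable
  have hFB : ∀ ξ, |F ξ| ≤ Bf := fun ξ => abs_integral_le_of_abs_le fun ω' => hBf _
  have hFd : ∀ ξ ζ : I → E, (∀ i ∈ L, ξ i = ζ i) → F ξ = F ζ := by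
    intro ξ ζ h1
    refine integral_congr_ae (ae_of_all _ fun ω' => hdf _ _ (fun i hi => by simp [hi])
      fun i hi => ?_)
    by_cases hiK : i ∈ K
    · simp [hiK]
    · simp [hiK, h1 i hi]
  have step : ∀ (g : (I → E) → ℝ) (Bg : ℝ), Measurable g → (∀ ξ, |g ξ| ≤ Bg) →
      (∀ ξ ζ : I → E, (∀ j, (∀ i ∈ K, R < edist i j) → (∀ i ∈ L, R < edist i j) → ξ j = ζ j) →
      g ξ = g ζ) → |∫ ω, f (fun i => X i ω) * g (fun i => X i ω) ∂P -
        ∫ ω, F (fun i => X i ω) * g (fun i => X i ω) ∂P| ≤ 4 * (Bf * Bg) * β := by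
    intro g Bg hg hBg hdg
    have hs := hM.swap K hK (Φ := fun ξ => f ξ * g ξ) (hf.mul hg) (B := Bf * Bg) (fun ξ => by
      rw [abs_mul]
      exact mul_le_mul (hBf ξ) (hBg ξ) (abs_nonneg _) hBf0) fun ξ ζ h1 h2 => by
        rw [hdf ξ ζ h1 fun i hi => h2 i fun j hj => hKL j hj i hi, hdg ξ ζ fun j hj _ => h2 j hj]
    have e : ∀ ω ω', f (K.piecewise (fun i => X i ω') fun i => X i ω) *
        g (K.piecewise (fun i => X i ω') fun i => X i ω) =
        f (K.piecewise (fun i => X i ω') fun i => X i ω) * g (fun i => X i ω) := by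
      intro ω ω'
      congr 1
      refine hdg _ _ fun j hj _ => ?_
      have hjK : j ∉ K := fun hjK => by
        have := hj j hjK; rw [edist_self] at this; exact absurd this (not_lt.2 zero_le)
      simp [hjK]
    simp only [e] at hs
    simp only [integral_mul_const] at hs
    exact hs
  have h1 := step g Bg hg hBg hdg
  -- Taking `g = 1` compares the expectations of `f` and `F`. The three errors, each with the
  -- constant 4, add up to 12.
  have h2 := step (fun _ => 1) 1 measurable_const (by simp) (by simp)
  have h3 := hM.abs_integral_mul_sub_le L hL hFm hg hFB hBg hFd fun ξ ζ h => hdg ξ ζ fun j _ hj => h j hj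
  simp only [mul_one] at h2
  have hgI : |∫ ω, g (fun i => X i ω) ∂P| ≤ Bg := abs_integral_le_of_abs_le fun ω => hBg _
  have h4 : |(∫ ω, f (fun i => X i ω) ∂P) * (∫ ω, g (fun i => X i ω) ∂P) -
      (∫ ω, F (fun i => X i ω) ∂P) * ∫ ω, g (fun i => X i ω) ∂P| ≤ 4 * (Bf * Bg) * β := by
    rw [← sub_mul, abs_mul]
    calc _ ≤ (4 * Bf * β) * Bg := mul_le_mul h2 hgI (abs_nonneg _) (by positivity)
      _ = _ := by ring
  rw [abs_le] at *
  constructor <;> linarith [h1.1, h1.2, h3.1, h3.2, h4.1, h4.2]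

end Decoupling

/-! ### Contractions of two kernels over a pair of slots -/

section PairIntegrals

variable {Ω I E : Type*} [MeasurableSpace Ω] [MeasurableSpace E] [Fintype I] [EMetricSpace I]
variable {P : Measure Ω} [IsProbabilityMeasure P] {X : I → Ω → E} {R : ℝ≥0∞} {β : ℝ}
  {h : I → I → E → E → ℝ} {b : ℝ}

/-- The expectation `E[h_{uk}(x, X_k) h_{vk'}(y, X_{k'})]`. -/
noncomputable def pairInt (P : Measure Ω) (X : I → Ω → E) (h h' : I → I → E → E → ℝ)
    (u v k k' : I) (x y : E) : ℝ :=
  ∫ ω, h u k x (X k ω) * h' v k' y (X k' ω) ∂P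

open Classical in
/-- The sum of the pair expectations over the pairs of close indices. -/
noncomputable def closeSum (P : Measure Ω) (X : I → Ω → E) (R : ℝ≥0∞) (h : I → I → E → E → ℝ)
    (u v : I) (x y : E) : ℝ :=
  ∑ k, ∑ k', if edist k k' ≤ R then pairInt P X h h u v k k' x y else 0

lemma IsKernel.measurable_pairInt (hK : IsKernel P X R h b) (hM : IsMixing P X R β)
    {h' : I → I → E → E → ℝ} {b' : ℝ} (hK' : IsKernel P X R h' b') (u v k k' : I) :
    Measurable fun z : E × E => pairInt P X h h' u v k k' z.1 z.2 := by
  have : Measurable fun z : (E × E) × Ω => h u k z.1.1 (X k z.2) * h' v k' z.1.2 (X k' z.2) := by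
    refine Measurable.mul ?_ ?_
    · exact (hK.measurable u k).comp (g := fun z : E × E => h u k z.1 z.2)
        (f := fun z : (E × E) × Ω => (z.1.1, X k z.2))
        ((measurable_fst.comp measurable_fst).prodMk ((hM.measurable k).comp measurable_snd))
    · exact (hK'.measurable v k').comp (g := fun z : E × E => h' v k' z.1 z.2)
        (f := fun z : (E × E) × Ω => (z.1.2, X k' z.2))
        ((measurable_snd.comp measurable_fst).prodMk ((hM.measurable k').comp measurable_snd))
  exact (this.stronglyMeasurable.integral_prod_right' (ν := P)).measurable

lemma IsKernel.abs_pairInt_le (hK : IsKernel P X R h b)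
    {h' : I → I → E → E → ℝ} {b' : ℝ} (hK' : IsKernel P X R h' b') (u v k k' : I)
    (x y : E) : |pairInt P X h h' u v k k' x y| ≤ b * b' := by
  refine abs_integral_le_of_abs_le fun ω => ?_
  rw [abs_mul]
  exact mul_le_mul (hK.bound _ _ _ _) (hK'.bound _ _ _ _) (abs_nonneg _) (hK.bound_nonneg u k x x)

lemma IsKernel.measurable_pairInt_eval (hK : IsKernel P X R h b) (hM : IsMixing P X R β)
    (u v k k' : I) : Measurable fun ξ : I → E => pairInt P X h h u v k k' (ξ u) (ξ v) :=
  (hK.measurable_pairInt hM hK u v k k').comp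
    (g := fun z : E × E => pairInt P X h h u v k k' z.1 z.2)
    (f := fun ξ : I → E => (ξ u, ξ v)) ((measurable_pi_apply u).prodMk (measurable_pi_apply v))

lemma ne_of_lt_edist {i j : I} (hij : R < edist i j) : j ≠ i := fun e => by
  rw [e, edist_self] at hij; exact absurd hij (not_lt.2 zero_le)

/-- A close pair of slots, far from everything else, may be integrated out. -/
lemma IsKernel.abs_integral_sub_pairInt_le (hK : IsKernel P X R h b) (hM : IsMixing P X R β)
    {u v k k' : I} (hku : R < edist k u) (hkv : R < edist k v) (hku' : R < edist k' u)
    (hkv' : R < edist k' v) {g : (I → E) → ℝ} (hg : Measurable g) {B : ℝ} (hB : ∀ ξ, |g ξ| ≤ B)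
    (hd : ∀ ξ ζ : I → E, (∀ j, R < edist k j → R < edist k' j → ξ j = ζ j) → g ξ = g ζ) :
    |∫ ω, h u k (X u ω) (X k ω) * h v k' (X v ω) (X k' ω) * g (fun i => X i ω) ∂P -
      ∫ ω, pairInt P X h h u v k k' (X u ω) (X v ω) * g (fun i => X i ω) ∂P| ≤
      4 * (b ^ 2 * B) * β := by
  classical
  have hs := hM.swap {k, k'} Finset.card_le_two
    (Φ := fun ξ => h u k (ξ u) (ξ k) * h v k' (ξ v) (ξ k') * g ξ)
    (((hK.measurable_eval u k).mul (hK.measurable_eval v k')).mul hg) (B := b ^ 2 * B)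
    (fun ξ => by
      rw [abs_mul, abs_mul, sq]
      have hb := hK.bound_nonneg u k (ξ u) (ξ k)
      exact mul_le_mul (mul_le_mul (hK.bound _ _ _ _) (hK.bound _ _ _ _) (abs_nonneg _) hb)
        (hB ξ) (abs_nonneg _) (mul_nonneg hb hb))
    fun ξ ζ h1 h2 => by
      have hj : ∀ j, R < edist k j → R < edist k' j → ξ j = ζ j := fun j hj hj' =>
        h2 j (by simp [hj, hj'])
      simp only [h1 k (by simp), h1 k' (by simp), hj u hku hku', hj v hkv hkv', hd ξ ζ hj]
  have hnot : ∀ j, R < edist k j → R < edist k' j → j ∉ ({k, k'} : Finset I) := fun j h1 h2 => by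
    simp [ne_of_lt_edist h1, ne_of_lt_edist h2]
  have e : ∀ ω ω', g (({k, k'} : Finset I).piecewise (fun i => X i ω') fun i => X i ω) =
      g (fun i => X i ω) := fun ω ω' => hd _ _ fun j h1 h2 => by simp [hnot j h1 h2]
  simp only [e, Finset.piecewise_eq_of_notMem _ _ _ (hnot u hku hku'),
    Finset.piecewise_eq_of_notMem _ _ _ (hnot v hkv hkv')] at hs
  have e2 : ∀ ω ω', ({k, k'} : Finset I).piecewise (fun i => X i ω') (fun i => X i ω) k = X k ω' :=
    fun ω ω' => Finset.piecewise_eq_of_mem _ _ _ (by simp)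
  have e3 : ∀ ω ω', ({k, k'} : Finset I).piecewise (fun i => X i ω') (fun i => X i ω) k' = X k' ω' :=
    fun ω ω' => Finset.piecewise_eq_of_mem _ _ _ (by simp)
  simp only [e2, e3, integral_mul_const] at hs
  exact hs

/-- The fourth moment under the product law differs from the one under the joint law by a single
decoupling error, which `hτ` bounds by 1; for close indices the kernel is zero. -/
lemma IsKernel.integral_integral_pow_four_le (hK : IsKernel P X R h b) (hM : IsMixing P X R β)
    {a4 : ℝ} (ha : ∀ i k, ∫ ω, h i k (X i ω) (X k ω) ^ 4 ∂P ≤ a4) (hτ : 4 * b ^ 4 * β ≤ 1)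
    (ha0 : 0 ≤ a4) (u k : I) : ∫ ω, ∫ ω', h u k (X u ω) (X k ω') ^ 4 ∂P ∂P ≤ a4 + 1 := by
  classical
  by_cases huk : edist u k ≤ 3 * R
  · simp only [hK.zero u k huk]; simp; linarith
  have huk' : R < edist k u := by
    rw [edist_comm]; exact (le_three_mul R).trans_lt (not_le.1 huk)
  have hs := hM.swap {k} (by simp) (Φ := fun ξ => h u k (ξ u) (ξ k) ^ 4)
    ((hK.measurable_eval u k).pow_const 4) (B := b ^ 4)
    (fun ξ => by rw [abs_pow]; exact pow_le_pow_left₀ (abs_nonneg _) (hK.bound _ _ _ _) 4)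
    fun ξ ζ h1 h2 => by
      rw [h1 k (by simp), h2 u (by simpa using huk')]
  simp only [Finset.piecewise_singleton, Function.update_self,
    Function.update_of_ne (ne_of_lt_edist huk')] at hs
  linarith [(abs_le.1 hs).1, ha u k]

lemma sq_integral_le {α : Type*} [MeasurableSpace α] {μ : Measure α} [IsProbabilityMeasure μ]
    {f : α → ℝ} (hf : Integrable f μ) (hf2 : Integrable (fun x => f x ^ 2) μ) :
    (∫ x, f x ∂μ) ^ 2 ≤ ∫ x, f x ^ 2 ∂μ := by
  have h0 : 0 ≤ ∫ x, (f x - ∫ y, f y ∂μ) ^ 2 ∂μ := integral_nonneg fun _ => sq_nonneg _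
  have e : ∀ x, (f x - ∫ y, f y ∂μ) ^ 2 =
      f x ^ 2 - 2 * (∫ y, f y ∂μ) * f x + (∫ y, f y ∂μ) ^ 2 := fun x => by ring
  simp only [e] at h0
  have i1 := integral_sub hf2 (hf.const_mul (2 * ∫ y, f y ∂μ))
  have i2 := integral_add (f := fun x => f x ^ 2 - (2 * ∫ y, f y ∂μ) * f x)
    (hf2.sub (hf.const_mul (2 * ∫ y, f y ∂μ))) (integrable_const ((∫ y, f y ∂μ) ^ 2))
  rw [integral_const_mul] at i1
  rw [i2, i1] at h0
  simp only [integral_const, probReal_univ, one_smul] at h0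
  nlinarith

lemma IsKernel.integrable_section_pow (hK : IsKernel P X R h b) (hM : IsMixing P X R β) (u k : I)
    (x : E) (p : ℕ) : Integrable (fun ω => h u k x (X k ω) ^ p) P := by
  refine integrable_of_abs_le (B := b ^ p) (((hK.measurable u k).comp
    (g := fun z : E × E => h u k z.1 z.2) (f := fun ω => (x, X k ω))
    (measurable_const.prodMk (hM.measurable k))).pow_const p) fun ω => ?_
  rw [abs_pow]; exact pow_le_pow_left₀ (abs_nonneg _) (hK.bound _ _ _ _) p

lemma IsKernel.pairInt_sq_le (hK : IsKernel P X R h b) (hM : IsMixing P X R β)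
    (u v k k' : I) (x y : E) : pairInt P X h h u v k k' x y ^ 2 ≤
      ((∫ ω, h u k x (X k ω) ^ 4 ∂P) + ∫ ω, h v k' y (X k' ω) ^ 4 ∂P) / 2 := by
  have hm : ∀ u k x, Measurable fun ω => h u k x (X k ω) := fun u k x =>
    (hK.measurable u k).comp (g := fun z : E × E => h u k z.1 z.2) (f := fun ω => (x, X k ω))
      (measurable_const.prodMk (hM.measurable k))
  have hb : ∀ ω, |h u k x (X k ω) * h v k' y (X k' ω)| ≤ b * b := fun ω => by
    rw [abs_mul]
    exact mul_le_mul (hK.bound _ _ _ _) (hK.bound _ _ _ _) (abs_nonneg _)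
      (hK.bound_nonneg u k x x)
  refine (sq_integral_le (integrable_of_abs_le ((hm u k x).mul (hm v k' y)) hb)
    (integrable_of_abs_le (((hm u k x).mul (hm v k' y)).pow_const 2) (B := (b * b) ^ 2)
      fun ω => ?_)).trans ?_
  · rw [abs_pow]; exact pow_le_pow_left₀ (abs_nonneg _) (hb ω) 2
  rw [← integral_add (hK.integrable_section_pow hM _ _ _ 4) (hK.integrable_section_pow hM _ _ _ 4),
    ← integral_div]
  refine integral_mono (integrable_of_abs_le (((hm u k x).mul (hm v k' y)).pow_const 2)
    (B := (b * b) ^ 2) fun ω => ?_) (((hK.integrable_section_pow hM _ _ _ 4).add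
    (hK.integrable_section_pow hM _ _ _ 4)).div_const 2) fun ω => ?_
  · rw [abs_pow]; exact pow_le_pow_left₀ (abs_nonneg _) (hb ω) 2
  · simp only [Pi.mul_apply]
    nlinarith [sq_nonneg (h u k x (X k ω) ^ 2 - h v k' y (X k' ω) ^ 2)]

lemma IsKernel.integrable_pairInt_sq (hK : IsKernel P X R h b) (hM : IsMixing P X R β)
    (u v k k' : I) : Integrable (fun ω => pairInt P X h h u v k k' (X u ω) (X v ω) ^ 2) P :=
  hM.integrable_comp (Φ := fun ξ => pairInt P X h h u v k k' (ξ u) (ξ v) ^ 2)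
    ((hK.measurable_pairInt_eval hM u v k k').pow_const 2) (B := (b * b) ^ 2) fun ξ => by
      rw [abs_pow]; exact pow_le_pow_left₀ (abs_nonneg _) (hK.abs_pairInt_le hK _ _ _ _ _ _) 2

lemma IsKernel.integral_pairInt_sq_le (hK : IsKernel P X R h b) (hM : IsMixing P X R β)
    {a4 : ℝ} (ha : ∀ i k, ∫ ω, h i k (X i ω) (X k ω) ^ 4 ∂P ≤ a4) (hτ : 4 * b ^ 4 * β ≤ 1)
    (ha0 : 0 ≤ a4) (u v k k' : I) :
    ∫ ω, pairInt P X h h u v k k' (X u ω) (X v ω) ^ 2 ∂P ≤ a4 + 1 := by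
  have hi : ∀ u k, Integrable (fun ω => ∫ ω', h u k (X u ω) (X k ω') ^ 4 ∂P) P := by
    intro u k
    have hm : Measurable fun z : Ω × Ω => h u k (X u z.1) (X k z.2) ^ 4 :=
      ((hK.measurable u k).comp (g := fun z : E × E => h u k z.1 z.2)
        (f := fun z : Ω × Ω => (X u z.1, X k z.2)) (((hM.measurable u).comp measurable_fst).prodMk
          ((hM.measurable k).comp measurable_snd))).pow_const 4
    refine integrable_of_abs_le (hm.stronglyMeasurable.integral_prod_right' (ν := P)).measurable
      (B := b ^ 4) fun ω => abs_integral_le_of_abs_le fun ω' => ?_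
    rw [abs_pow]; exact pow_le_pow_left₀ (abs_nonneg _) (hK.bound _ _ _ _) 4
  refine (integral_mono (hK.integrable_pairInt_sq hM u v k k') (((hi u k).add (hi v k')).div_const 2)
    fun ω => hK.pairInt_sq_le hM u v k k' _ _).trans ?_
  simp only [Pi.add_apply]
  rw [integral_div, integral_add (hi u k) (hi v k')]
  linarith [hK.integral_integral_pow_four_le hM ha hτ ha0 u k,
    hK.integral_integral_pow_four_le hM ha hτ ha0 v k']

lemma IsKernel.measurable_closeSum_eval (hK : IsKernel P X R h b) (hM : IsMixing P X R β)
    (u v : I) : Measurable fun ξ : I → E => closeSum P X R h u v (ξ u) (ξ v) := by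
  refine Finset.measurable_sum _ fun k _ => Finset.measurable_sum _ fun k' _ => ?_
  split_ifs
  · exact hK.measurable_pairInt_eval hM u v k k'
  · exact measurable_const

lemma IsKernel.abs_closeSum_le (hK : IsKernel P X R h b) (u v : I) (x y : E) :
    |closeSum P X R h u v x y| ≤ Fintype.card I * (Fintype.card I * (b * b)) := by
  refine (Finset.abs_sum_le_sum_abs _ _).trans ((Finset.sum_le_card_nsmul _ _
    (Fintype.card I * (b * b)) fun k _ => (Finset.abs_sum_le_sum_abs _ _).trans
      ((Finset.sum_le_card_nsmul _ _ (b * b) fun k' _ => ?_).trans (by simp))).trans (by simp))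
  split_ifs
  · exact hK.abs_pairInt_le hK _ _ _ _ _ _
  · have := hK.bound_nonneg u v x y
    simpa using mul_nonneg this this

lemma sum_pi_fin_succ {M : Type*} [AddCommMonoid M] {m : ℕ} (F : (Fin (m + 1) → I) → M) :
    ∑ k, F k = ∑ x, ∑ κ : Fin m → I, F (Fin.cons x κ) := by
  rw [← (Fin.consEquiv fun _ : Fin (m + 1) => I).sum_comp, Fintype.sum_prod_type]
  rfl

lemma sum_pi_fin_four {M : Type*} [AddCommMonoid M] (F : (Fin 4 → I) → M) :
    ∑ k, F k = ∑ x, ∑ y, ∑ z, ∑ w, F ![x, y, z, w] := by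
  simp only [sum_pi_fin_succ]
  refine Finset.sum_congr rfl fun x _ => Finset.sum_congr rfl fun y _ => Finset.sum_congr rfl
    fun z _ => Finset.sum_congr rfl fun w _ => ?_
  rw [Fintype.sum_unique]
  congr 1

end PairIntegrals

/-! ### Good kernels; quadruples matched across two far groups -/

section Covariance

variable {Ω I E : Type*} [MeasurableSpace Ω] [MeasurableSpace E] [Fintype I] [EMetricSpace I]
variable {P : Measure Ω} [IsProbabilityMeasure P] {X : I → Ω → E} {R : ℝ≥0∞} {β : ℝ}
  {h : I → I → E → E → ℝ} {b : ℝ}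

/-- The partner of a slot is the only other slot within `R`. Hence a tuple determines its matching,
and the tuples of different matchings form disjoint sets. -/
lemma Matched.eq_of_close {r : ℕ} {u k : Fin r → I} {π : Fin r → Fin r} (hm : Matched R u k π)
    {a c : Fin r} (hca : c ≠ a) (hd : edist (k a) (k c) ≤ R) : π a = c := by
  by_contra hne
  exact absurd hd (not_le.2 ((hm a).2.2.2.2 c hca fun e => hne e.symm))

lemma Matched.eq {r : ℕ} {u k : Fin r → I} {π π' : Fin r → Fin r} (hm : Matched R u k π)
    (hm' : Matched R u k π') : π = π' :=
  funext fun a => hm.eq_of_close (hm' a).2.1 (hm' a).2.2.1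

/-- Trichotomy for tuples of even length. -/
lemma isolated_or_clustered_or_matched (R : ℝ≥0∞) {q : ℕ} {r : ℕ} (hr : r = 2 * (q + 1))
    (u k : Fin r → I) :
    (∃ a, Isolated R u k a) ∨ Clustered R u k q ∨ ∃ π, Matched R u k π := by
  by_cases hno : ∃ a, Isolated R u k a
  · exact Or.inl hno
  push Not at hno
  obtain ⟨T, hT, hcov, hπ⟩ := clustered_or_matched u k hno
  by_cases hTq : T.card ≤ q
  · exact Or.inr (Or.inl ⟨T, hTq, hcov⟩)
  · exact Or.inr (Or.inr (hπ (by omega)))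

open Classical in
lemma card_clustered_le {D : ℕ} (hD : NbhdBound I R D) (hn : 1 ≤ Fintype.card I) {r q : ℕ}
    (u : Fin r → I) (S : Finset (Fin r → I)) (hS : ∀ k ∈ S, Clustered R u k q) :
    (S.card : ℝ) ≤ 2 ^ r * (Fintype.card I ^ q * (2 * r * D) ^ r) := by
  have := card_le_of_clustered (R := R) (D := D) (fun i => hD i _ fun j hj =>
    (Finset.mem_filter.1 hj).2.trans (by
      simpa using ennreal_mul_le_mul R (a := 3) (b := 10) (by norm_num))) u hn S hS
  exact_mod_cast this

/-- The common shape of all tuple sums below: the exceptional tuples in `S` are few and are counted,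
the others are many but contribute only a mixing error `t` each. -/
lemma sum_if_const_le {α : Type*} [Fintype α] {S : Finset α} {f : α → ℝ} {c m t : ℝ}
    (ht : 0 ≤ t) (hS : (S.card : ℝ) ≤ c) (hm : 0 ≤ m) (T : Finset α)
    (h1 : ∀ k ∈ T, k ∉ S → |f k| ≤ t) (h2 : ∀ k ∈ T, k ∈ S → |f k| ≤ m) :
    |∑ k ∈ T, f k| ≤ Fintype.card α * t + c * m := by
  classical
  calc |∑ k ∈ T, f k| ≤ ∑ k ∈ T, |f k| := Finset.abs_sum_le_sum_abs _ _
    _ ≤ ∑ k ∈ T, (t + if k ∈ S then m else 0) := by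
        refine Finset.sum_le_sum fun k hk => ?_
        by_cases hkS : k ∈ S
        · rw [if_pos hkS]; linarith [h2 k hk hkS]
        · rw [if_neg hkS]; linarith [h1 k hk hkS]
    _ ≤ ∑ k, (t + if k ∈ S then m else 0) := by
        refine Finset.sum_le_sum_of_subset_of_nonneg (Finset.subset_univ _) fun k _ _ => ?_
        split_ifs <;> linarith
    _ = Fintype.card α * t + S.card * m := by
        rw [Finset.sum_add_distrib, Finset.sum_ite_mem, Finset.univ_inter]
        simp
    _ ≤ _ := by gcongr

/-- The hypotheses on a bounded kernel under which the moments of the row sums are estimated. -/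
structure IsGood (P : Measure Ω) (X : I → Ω → E) (R : ℝ≥0∞) (h : I → I → E → E → ℝ) (b β : ℝ)
    (D : ℕ) (a4 Λ : ℝ) : Prop where
  mixing : IsMixing P X R β
  kernel : IsKernel P X R h b
  nbhd : NbhdBound I R D
  card_pos : 1 ≤ Fintype.card I
  one_le_b : 1 ≤ b
  negligible : Negligible (Fintype.card I) b β
  one_le_a4 : 1 ≤ a4
  fourth : ∀ i k, ∫ ω, h i k (X i ω) (X k ω) ^ 4 ∂P ≤ a4
  close : ∀ u v, R < edist u v → ∫ ω, closeSum P X R h u v (X u ω) (X v ω) ^ 2 ∂P ≤ Λ ^ 2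

variable {D : ℕ} {a4 Λ : ℝ}

lemma IsGood.tiny (hG : IsGood P X R h b β D a4 Λ) {p q : ℕ} (hq : q ≤ 8) (hp : p ≤ 12) :
    (Fintype.card I : ℝ) ^ q * (4 * b ^ p * β) ≤ 1 :=
  hG.negligible.le_one hG.card_pos hG.one_le_b hG.mixing.nonneg hq hp

lemma IsGood.integrable_closeSum_sq (hG : IsGood P X R h b β D a4 Λ) (u v : I) :
    Integrable (fun ω => closeSum P X R h u v (X u ω) (X v ω) ^ 2) P :=
  hG.mixing.integrable_comp (Φ := fun ξ => closeSum P X R h u v (ξ u) (ξ v) ^ 2)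
    ((hG.kernel.measurable_closeSum_eval hG.mixing u v).pow_const 2)
    (B := (Fintype.card I * (Fintype.card I * (b * b))) ^ 2) fun ξ => by
      rw [abs_pow]
      exact pow_le_pow_left₀ (abs_nonneg _) (hG.kernel.abs_closeSum_le u v _ _) 2

lemma abs_integral_mul_le_half {f g : Ω → ℝ} (hf : Integrable (fun ω => f ω ^ 2) P)
    (hg : Integrable (fun ω => g ω ^ 2) P) (hfg : Integrable (fun ω => f ω * g ω) P) {c d : ℝ}
    (hc : ∫ ω, f ω ^ 2 ∂P ≤ c) (hd : ∫ ω, g ω ^ 2 ∂P ≤ d) :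
    |∫ ω, f ω * g ω ∂P| ≤ (c + d) / 2 := by
  calc |∫ ω, f ω * g ω ∂P| ≤ ∫ ω, |f ω * g ω| ∂P := abs_integral_le_integral_abs
    _ ≤ ∫ ω, (f ω ^ 2 + g ω ^ 2) / 2 ∂P := by
        refine integral_mono hfg.abs ((hf.add hg).div_const 2) fun ω => ?_
        simp only
        rw [abs_le]; constructor <;> nlinarith [sq_nonneg (f ω - g ω), sq_nonneg (f ω + g ω)]
    _ ≤ _ := by rw [integral_div, integral_add hf hg]; linarith

open Classical in
/-- The contribution of the tuples that are matched across two far groups. -/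
lemma IsGood.abs_sum_cross_le (hG : IsGood P X R h b β D a4 Λ) (u : Fin 4 → I)
    (h02 : R < edist (u 0) (u 2)) (h13 : R < edist (u 1) (u 3)) :
    |∑ k with Matched R u k ![2, 3, 0, 1], ∫ ω, kerProd h u k (fun i => X i ω) ∂P| ≤
      2 + Λ ^ 2 + 2 ^ 16 * Fintype.card I * D ^ 4 * (a4 + 1) := by
  have hK := hG.kernel
  have hM := hG.mixing
  have hβ := hM.nonneg
  have hb0 : 0 ≤ b := zero_le_one.trans hG.one_le_b
  set n := Fintype.card I with hn
  set p : I → I → Ω → ℝ := fun x z ω => pairInt P X h h (u 0) (u 2) x z (X (u 0) ω) (X (u 2) ω)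
    with hp
  set q : I → I → Ω → ℝ := fun y w ω => pairInt P X h h (u 1) (u 3) y w (X (u 1) ω) (X (u 3) ω)
    with hq
  have hpq : ∀ x z y w, Integrable (fun ω => p x z ω * q y w ω) P := fun x z y w =>
    hM.integrable_comp (Φ := fun ξ => pairInt P X h h (u 0) (u 2) x z (ξ (u 0)) (ξ (u 2)) *
      pairInt P X h h (u 1) (u 3) y w (ξ (u 1)) (ξ (u 3)))
      ((hK.measurable_pairInt_eval hM _ _ _ _).mul (hK.measurable_pairInt_eval hM _ _ _ _))
      (B := (b * b) * (b * b)) fun ξ => by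
        rw [abs_mul]
        exact mul_le_mul (hK.abs_pairInt_le hK _ _ _ _ _ _) (hK.abs_pairInt_le hK _ _ _ _ _ _)
          (abs_nonneg _) (by positivity)
  -- The expectation after both pairs of slots have been integrated out. It makes sense for all
  -- tuples, so the sum can be extended from separated pairs to all close pairs, where it factorises
  -- into two `closeSum`s.
  set pp : (Fin 4 → I) → ℝ := fun k => ∫ ω, p (k 0) (k 2) ω * q (k 1) (k 3) ω ∂P with hpp
  have hτ4 := hG.tiny (p := 4) (q := 4) (by norm_num) (by norm_num)
  have hτ0 := hG.tiny (p := 4) (q := 0) (by norm_num) (by norm_num)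
  rw [pow_zero, one_mul] at hτ0
  have hppb : ∀ k, |pp k| ≤ a4 + 1 := fun k => by
    have ha0 : 0 ≤ a4 := zero_le_one.trans hG.one_le_a4
    have := abs_integral_mul_le_half (hK.integrable_pairInt_sq hM (u 0) (u 2) (k 0) (k 2))
      (hK.integrable_pairInt_sq hM (u 1) (u 3) (k 1) (k 3)) (hpq _ _ _ _)
      (hK.integral_pairInt_sq_le hM hG.fourth hτ0 ha0 _ _ _ _)
      (hK.integral_pairInt_sq_le hM hG.fourth hτ0 ha0 _ _ _ _)
    linarith
  set A := Finset.univ.filter fun k : Fin 4 → I => Matched R u k ![2, 3, 0, 1] with hA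
  set M := Finset.univ.filter fun k : Fin 4 → I => edist (k 0) (k 2) ≤ R ∧ edist (k 1) (k 3) ≤ R
    with hMdef
  have hAM : A ⊆ M := fun k hk => by
    have hm := (Finset.mem_filter.1 hk).2
    exact Finset.mem_filter.2 ⟨Finset.mem_univ _, (hm 0).2.2.1, (hm 1).2.2.1⟩
  -- the sum over all close pairs
  have hsumM : ∑ k ∈ M, pp k = ∫ ω, closeSum P X R h (u 0) (u 2) (X (u 0) ω) (X (u 2) ω) *
      closeSum P X R h (u 1) (u 3) (X (u 1) ω) (X (u 3) ω) ∂P := by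
    rw [← integral_finsetSum _ fun k _ => hpq _ _ _ _]
    refine integral_congr_ae (ae_of_all _ fun ω => ?_)
    set F : I → I → I → I → ℝ := fun x y z w =>
      (if edist x z ≤ R then p x z ω else 0) * (if edist y w ≤ R then q y w ω else 0) with hF
    have e : ∑ k ∈ M, p (k 0) (k 2) ω * q (k 1) (k 3) ω =
        ∑ k : Fin 4 → I, F (k 0) (k 1) (k 2) (k 3) := by
      rw [hMdef, Finset.sum_filter]
      refine Finset.sum_congr rfl fun k _ => ?_
      by_cases h1 : edist (k 0) (k 2) ≤ R <;> by_cases h2 : edist (k 1) (k 3) ≤ R <;>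
        simp [h1, h2, hF]
    simp only
    rw [e, sum_pi_fin_four]
    change ∑ x, ∑ y, ∑ z, ∑ w, F x y z w = _
    simp only [closeSum]
    rw [Finset.sum_mul_sum]
    simp_rw [Finset.sum_mul_sum]
    rfl
  have hsumM' : |∑ k ∈ M, pp k| ≤ Λ ^ 2 := by
    rw [hsumM]
    have := abs_integral_mul_le_half (hG.integrable_closeSum_sq (u 0) (u 2))
      (hG.integrable_closeSum_sq (u 1) (u 3))
      (hM.integrable_comp (Φ := fun ξ => closeSum P X R h (u 0) (u 2) (ξ (u 0)) (ξ (u 2)) *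
      closeSum P X R h (u 1) (u 3) (ξ (u 1)) (ξ (u 3)))
        ((hK.measurable_closeSum_eval hM _ _).mul (hK.measurable_closeSum_eval hM _ _))
        (B := (n * (n * (b * b))) * (n * (n * (b * b)))) fun ξ => by
          rw [abs_mul]
          exact mul_le_mul (hK.abs_closeSum_le _ _ _ _) (hK.abs_closeSum_le _ _ _ _)
            (abs_nonneg _) (by positivity)) (hG.close _ _ h02) (hG.close _ _ h13)
    linarith
  -- the tuples with close pairs which are not separated
  have hdiff : |∑ k ∈ M \ A, pp k| ≤ 2 ^ 16 * n * D ^ 4 * (a4 + 1) := by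
    have hcl : ∀ k ∈ M \ A, Clustered R u k 1 := by
      intro k hk
      obtain ⟨hkM, hkA⟩ := Finset.mem_sdiff.1 hk
      obtain ⟨h1, h2⟩ := (Finset.mem_filter.1 hkM).2
      have h1' : edist (k 2) (k 0) ≤ R := by rwa [edist_comm]
      have h2' : edist (k 3) (k 1) ≤ R := by rwa [edist_comm]
      -- Every slot has its partner within `R`, so none is isolated, and a matching of the tuple
      -- could only be the given one. What remains is clustered with a single free index.
      rcases isolated_or_clustered_or_matched R (q := 1) rfl u k with ⟨a, ha⟩ | hc | ⟨π, hπ⟩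
      · exfalso
        fin_cases a
        · exact absurd h1 (not_le.2 (ha.2 2 (by decide)))
        · exact absurd h2 (not_le.2 (ha.2 3 (by decide)))
        · exact absurd h1' (not_le.2 (ha.2 0 (by decide)))
        · exact absurd h2' (not_le.2 (ha.2 1 (by decide)))
      · exact hc
      · refine absurd (Finset.mem_filter.2 ⟨Finset.mem_univ _, ?_⟩) hkA
        have : π = ![2, 3, 0, 1] := by
          funext a
          fin_cases a
          · exact hπ.eq_of_close (by decide) h1
          · exact hπ.eq_of_close (by decide) h2
          · exact hπ.eq_of_close (by decide) h1'
          · exact hπ.eq_of_close (by decide) h2'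
        exact this ▸ hπ
    have hc := card_clustered_le hG.nbhd hG.card_pos u (M \ A) hcl
    have := sum_if_const_le (α := Fin 4 → I) (f := pp) (m := a4 + 1) le_rfl hc
      (by linarith [hG.one_le_a4]) (M \ A) (fun k h1 h2 => absurd h1 h2) fun k _ _ => hppb k
    refine this.trans (le_of_eq ?_)
    rw [← hn]; push_cast; ring
  -- integrating out the pairs
  have hstep : ∀ k ∈ A, |∫ ω, kerProd h u k (fun i => X i ω) ∂P - pp k| ≤ 2 * (4 * b ^ 4 * β) := by
    intro k hk
    have hm := (Finset.mem_filter.1 hk).2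
    have s1 := hK.abs_integral_sub_pairInt_le hM (u := u 0) (v := u 2) (k := k 0) (k' := k 2)
      ((hm 0).2.2.2.1 0) ((hm 0).2.2.2.1 2) ((hm 2).2.2.2.1 0) ((hm 2).2.2.2.1 2)
      (g := fun ξ => h (u 1) (k 1) (ξ (u 1)) (ξ (k 1)) * h (u 3) (k 3) (ξ (u 3)) (ξ (k 3)))
      ((hK.measurable_eval _ _).mul (hK.measurable_eval _ _)) (B := b ^ 2) (fun ξ => by
        rw [abs_mul, sq]
        exact mul_le_mul (hK.bound _ _ _ _) (hK.bound _ _ _ _) (abs_nonneg _) hb0)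
      fun ξ ζ hd => by
        simp only [hd (u 1) ((hm 0).2.2.2.1 1) ((hm 2).2.2.2.1 1),
          hd (u 3) ((hm 0).2.2.2.1 3) ((hm 2).2.2.2.1 3),
          hd (k 1) ((hm 0).2.2.2.2 1 (by decide) (by decide))
            ((hm 2).2.2.2.2 1 (by decide) (by decide)),
          hd (k 3) ((hm 0).2.2.2.2 3 (by decide) (by decide))
            ((hm 2).2.2.2.2 3 (by decide) (by decide))]
    have s2 := hK.abs_integral_sub_pairInt_le hM (u := u 1) (v := u 3) (k := k 1) (k' := k 3)
      ((hm 1).2.2.2.1 1) ((hm 1).2.2.2.1 3) ((hm 3).2.2.2.1 1) ((hm 3).2.2.2.1 3)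
      (g := fun ξ => pairInt P X h h (u 0) (u 2) (k 0) (k 2) (ξ (u 0)) (ξ (u 2)))
      (hK.measurable_pairInt_eval hM _ _ _ _) (B := b * b)
      (fun ξ => hK.abs_pairInt_le hK _ _ _ _ _ _)
      fun ξ ζ hd => by
        simp only [hd (u 0) ((hm 1).2.2.2.1 0) ((hm 3).2.2.2.1 0),
          hd (u 2) ((hm 1).2.2.2.1 2) ((hm 3).2.2.2.1 2)]
    have e1 : ∫ ω, kerProd h u k (fun i => X i ω) ∂P = ∫ ω, h (u 0) (k 0) (X (u 0) ω) (X (k 0) ω) *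
        h (u 2) (k 2) (X (u 2) ω) (X (k 2) ω) * (h (u 1) (k 1) (X (u 1) ω) (X (k 1) ω) *
          h (u 3) (k 3) (X (u 3) ω) (X (k 3) ω)) ∂P := by
      refine integral_congr_ae (ae_of_all _ fun ω => ?_)
      simp only [kerProd, Fin.prod_univ_four]; ring
    have e2 : ∫ ω, p (k 0) (k 2) ω * (h (u 1) (k 1) (X (u 1) ω) (X (k 1) ω) *
          h (u 3) (k 3) (X (u 3) ω) (X (k 3) ω)) ∂P = ∫ ω, h (u 1) (k 1) (X (u 1) ω) (X (k 1) ω) *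
          h (u 3) (k 3) (X (u 3) ω) (X (k 3) ω) * p (k 0) (k 2) ω ∂P :=
      integral_congr_ae (ae_of_all _ fun ω => mul_comm _ _)
    have e3 : pp k = ∫ ω, q (k 1) (k 3) ω * p (k 0) (k 2) ω ∂P :=
      integral_congr_ae (ae_of_all _ fun ω => mul_comm _ _)
    rw [e1, e3]
    have := abs_sub_le _ _ _ |>.trans (add_le_add s1 (e2 ▸ s2))
    refine this.trans (le_of_eq ?_)
    ring
  have hA1 : |∑ k ∈ A, (∫ ω, kerProd h u k (fun i => X i ω) ∂P - pp k)| ≤ 2 := by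
    have := sum_if_const_le (α := Fin 4 → I) (S := ∅) (c := 0) (m := 0) (T := A)
      (f := fun k => ∫ ω, kerProd h u k (fun i => X i ω) ∂P - pp k)
      (t := 2 * (4 * b ^ 4 * β)) (by positivity) (by simp) le_rfl (fun k hk _ => hstep k hk)
      (by simp)
    refine this.trans ?_
    rw [Fintype.card_fun, Fintype.card_fin, ← hn]
    push_cast
    linarith
  have hsplit : ∑ k ∈ A, pp k = ∑ k ∈ M, pp k - ∑ k ∈ M \ A, pp k := by
    rw [← Finset.sum_sdiff hAM]; ring
  rw [Finset.sum_sub_distrib, hsplit] at hA1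
  rw [abs_le] at *
  constructor <;> linarith [hA1.1, hA1.2, hsumM'.1, hsumM'.2, hdiff.1, hdiff.2]

end Covariance

/-! ### Covariance of products of two row sums -/

section FarCovariance

variable {Ω I E : Type*} [MeasurableSpace Ω] [MeasurableSpace E] [Fintype I] [EMetricSpace I]
variable {P : Measure Ω} [IsProbabilityMeasure P] {X : I → Ω → E} {R : ℝ≥0∞} {β : ℝ}
  {h : I → I → E → E → ℝ} {b : ℝ} {D : ℕ} {a4 Λ : ℝ}

lemma Matched.comp_perm {r : ℕ} {u k : Fin r → I} {π : Fin r → Fin r} (hm : Matched R u k π)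
    (e : Equiv.Perm (Fin r)) : Matched R (u ∘ e) (k ∘ e) (e.symm ∘ π ∘ e) := by
  intro a
  obtain ⟨h1, h2, h3, h4, h5⟩ := hm (e a)
  refine ⟨by simp [h1], fun he => h2 ?_, by simpa using h3, fun c => h4 (e c), fun c hc hc' =>
    h5 (e c) (fun he => hc (e.injective he)) fun he => hc' ?_⟩
  · have : e.symm (π (e a)) = a := he
    simpa using congrArg e this
  · simp [← he]

lemma kerProd_comp_perm {r : ℕ} (u k : Fin r → I) (e : Equiv.Perm (Fin r)) (ξ : I → E) :
    kerProd h (u ∘ e) (k ∘ e) ξ = kerProd h u k ξ := by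
  simp only [kerProd, Function.comp_apply]
  exact Equiv.prod_comp e fun a => h (u a) (k a) (ξ (u a)) (ξ (k a))

/-- The three perfect matchings of four points: one inside the groups `{0,1}` and `{2,3}`, two
across them. -/
lemma involution_fin_four : ∀ p0 p1 p2 p3 : Fin 4,
    (∀ a, (![p0, p1, p2, p3] : Fin 4 → Fin 4) (![p0, p1, p2, p3] a) = a ∧
      (![p0, p1, p2, p3] : Fin 4 → Fin 4) a ≠ a) →
    (![p0, p1, p2, p3] = ![1, 0, 3, 2] ∨ ![p0, p1, p2, p3] = ![2, 3, 0, 1] ∨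
      ![p0, p1, p2, p3] = (![3, 2, 1, 0] : Fin 4 → Fin 4)) := by
  decide

open Classical in
-- Exchanging the slots 2 and 3 turns this matching into the one of `IsGood.abs_sum_cross_le`.
lemma IsGood.abs_sum_cross_le' (hG : IsGood P X R h b β D a4 Λ) (u : Fin 4 → I)
    (h03 : R < edist (u 0) (u 3)) (h12 : R < edist (u 1) (u 2)) :
    |∑ k with Matched R u k ![3, 2, 1, 0], ∫ ω, kerProd h u k (fun i => X i ω) ∂P| ≤
      2 + Λ ^ 2 + 2 ^ 16 * Fintype.card I * D ^ 4 * (a4 + 1) := by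
  set e : Equiv.Perm (Fin 4) := Equiv.swap 2 3 with he
  have v0 : e 0 = 0 := by rw [he]; decide
  have v1 : e 1 = 1 := by rw [he]; decide
  have v2 : e 2 = 3 := by rw [he]; decide
  have v3 : e 3 = 2 := by rw [he]; decide
  have h1 := hG.abs_sum_cross_le (u ∘ e) (by simpa only [Function.comp_apply, v0, v2] using h03)
    (by simpa only [Function.comp_apply, v1, v3] using h12)
  have c1 : e.symm ∘ (![3, 2, 1, 0] : Fin 4 → Fin 4) ∘ e = ![2, 3, 0, 1] := by rw [he]; decide
  have c2 : e.symm ∘ (![2, 3, 0, 1] : Fin 4 → Fin 4) ∘ e = ![3, 2, 1, 0] := by rw [he]; decide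
  have hee : ∀ f : Fin 4 → I, (f ∘ e) ∘ e = f := fun f => by
    funext a; simp [he]
  have hM : ∀ k : Fin 4 → I, Matched R u k ![3, 2, 1, 0] ↔
      Matched R (u ∘ e) (k ∘ e) ![2, 3, 0, 1] := fun k => by
    constructor
    · intro hm; rw [← c1]; exact hm.comp_perm e
    · intro hm
      have := hm.comp_perm e
      rwa [hee, hee, c2] at this
  have : ∑ k with Matched R u k ![3, 2, 1, 0], ∫ ω, kerProd h u k (fun i => X i ω) ∂P =
      ∑ k with Matched R (u ∘ e) k ![2, 3, 0, 1], ∫ ω, kerProd h (u ∘ e) k (fun i => X i ω) ∂P := by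
    rw [Finset.sum_filter, Finset.sum_filter, ← (e.arrowCongr (Equiv.refl I)).sum_comp]
    refine Finset.sum_congr rfl fun k _ => ?_
    have e1 : (e.arrowCongr (Equiv.refl I)) k = k ∘ e := by
      funext a; simp [Equiv.arrowCongr, he]
    rw [e1]
    have e2 := hM (k ∘ e)
    rw [hee] at e2
    simp only [e2]
    simp only [← kerProd_comp_perm (h := h) u (k ∘ e) e, hee]
  rwa [this]

/-- Jensen and `2x²y² ≤ x⁴ + y⁴`. It bounds the product of expectations in the covariance by the
same `a4` as the joint expectation. -/
lemma IsGood.sq_integral_mul_le (hG : IsGood P X R h b β D a4 Λ) (u k : Fin 2 → I) :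
    (∫ ω, kerProd h u k (fun i => X i ω) ∂P) ^ 2 ≤ a4 := by
  have hK := hG.kernel
  have hM := hG.mixing
  have hint2 : Integrable (fun ω => kerProd h u k (fun i => X i ω) ^ 2) P :=
    hM.integrable_comp (Φ := fun ξ => kerProd h u k ξ ^ 2) ((hK.measurable_kerProd u k).pow_const 2)
      (B := (b ^ 2) ^ 2) fun ξ => by
        rw [abs_pow]; exact pow_le_pow_left₀ (abs_nonneg _) (hK.abs_kerProd_le u k ξ) 2
  refine (sq_integral_le (hM.integrable_comp (hK.measurable_kerProd u k)
    (hK.abs_kerProd_le u k)) hint2).trans ?_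
  have i0 := hK.integrable_pow hM (u 0) (k 0) 4
  have i1 := hK.integrable_pow hM (u 1) (k 1) 4
  calc ∫ ω, kerProd h u k (fun i => X i ω) ^ 2 ∂P
      ≤ ∫ ω, (h (u 0) (k 0) (X (u 0) ω) (X (k 0) ω) ^ 4 +
        h (u 1) (k 1) (X (u 1) ω) (X (k 1) ω) ^ 4) / 2 ∂P := by
        refine integral_mono hint2 ((i0.add i1).div_const 2) fun ω => ?_
        simp only [kerProd, Fin.prod_univ_two]
        nlinarith [sq_nonneg (h (u 0) (k 0) (X (u 0) ω) (X (k 0) ω) ^ 2 -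
          h (u 1) (k 1) (X (u 1) ω) (X (k 1) ω) ^ 2)]
    _ ≤ a4 := by
        rw [integral_div, integral_add i0 i1]
        linarith [hG.fourth (u 0) (k 0), hG.fourth (u 1) (k 1)]

lemma abs_mul_le_of_sq_le {x y c : ℝ} (hx : x ^ 2 ≤ c) (hy : y ^ 2 ≤ c) : |x * y| ≤ c := by
  rw [abs_le]; constructor <;> nlinarith [sq_nonneg (x - y), sq_nonneg (x + y)]

/-- The product of two row sums is almost uncorrelated with the product of two far row sums. -/
theorem IsGood.abs_cov_mul_le (hG : IsGood P X R h b β D a4 Λ) (u : Fin 4 → I)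
    (h02 : R < edist (u 0) (u 2)) (h03 : R < edist (u 0) (u 3)) (h12 : R < edist (u 1) (u 2))
    (h13 : R < edist (u 1) (u 3)) :
    |∫ ω, ∏ a, rowSum h (u a) (fun i => X i ω) ∂P -
      (∫ ω, ∏ a, rowSum h (![u 0, u 1] a) (fun i => X i ω) ∂P) *
        ∫ ω, ∏ a, rowSum h (![u 2, u 3] a) (fun i => X i ω) ∂P| ≤
      2 ^ 19 * Fintype.card I * D ^ 4 * a4 + 2 * Λ ^ 2 := by
  classical
  have hK := hG.kernel
  have hM := hG.mixing
  have hβ := hM.nonneg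
  have hb0 : 0 ≤ b := zero_le_one.trans hG.one_le_b
  have ha0 : 0 ≤ a4 := zero_le_one.trans hG.one_le_a4
  set n := Fintype.card I with hn
  set m : (Fin 4 → I) → ℝ := fun k => ∫ ω, kerProd h u k (fun i => X i ω) ∂P with hm
  set p : (Fin 2 → I) → ℝ := fun k => ∫ ω, kerProd h ![u 0, u 1] k (fun i => X i ω) ∂P with hp
  set q : (Fin 2 → I) → ℝ := fun k => ∫ ω, kerProd h ![u 2, u 3] k (fun i => X i ω) ∂P with hq
  have hexp : ∀ {r : ℕ} (v : Fin r → I), ∫ ω, ∏ a, rowSum h (v a) (fun i => X i ω) ∂P =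
      ∑ k, ∫ ω, kerProd h v k (fun i => X i ω) ∂P := fun v => by
    simp only [prod_rowSum]
    exact integral_finsetSum _ fun k _ => hM.integrable_comp (hK.measurable_kerProd v k)
      (hK.abs_kerProd_le v k)
  have hpq : (∑ k, p k) * ∑ k, q k = ∑ k : Fin 4 → I, p ![k 0, k 1] * q ![k 2, k 3] := by
    have e2 : ∀ f : (Fin 2 → I) → ℝ, ∑ k, f k = ∑ x, ∑ y, f ![x, y] := fun f => by
      simp only [sum_pi_fin_succ]
      refine Finset.sum_congr rfl fun x _ => Finset.sum_congr rfl fun y _ => ?_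
      rw [Fintype.sum_unique]
      congr 1
    rw [sum_pi_fin_four]
    change _ = ∑ x, ∑ y, ∑ z, ∑ w, p ![x, y] * q ![z, w]
    rw [e2 p, e2 q, Finset.sum_mul]
    simp only [Finset.sum_mul, Finset.mul_sum]
    exact Finset.sum_congr rfl fun x _ =>
      (Finset.sum_congr rfl fun z _ => Finset.sum_comm).trans Finset.sum_comm
  rw [hexp, hexp, hexp, hpq]
  set A2 := Finset.univ.filter fun k : Fin 4 → I => Matched R u k ![2, 3, 0, 1] with hA2
  set A3 := Finset.univ.filter fun k : Fin 4 → I => Matched R u k ![3, 2, 1, 0] with hA3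
  have hdisj : ∀ k, k ∈ A2 → k ∉ A3 := fun k h2 h3 => by
    have := congrFun ((Finset.mem_filter.1 h2).2.eq (Finset.mem_filter.1 h3).2) 0
    exact absurd this (by decide)
  set S := Finset.univ.filter fun k : Fin 4 → I => Clustered R u k 1 with hS
  -- The covariance term of a tuple once the two cross matchings, whose sums are estimated as a
  -- whole, are taken away. It is a mixing error unless the tuple is clustered.
  set f : (Fin 4 → I) → ℝ := fun k => m k - p ![k 0, k 1] * q ![k 2, k 3] -
    (if k ∈ A2 then m k else 0) - (if k ∈ A3 then m k else 0) with hf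
  have hmle : ∀ k, |m k| ≤ a4 := fun k =>
    abs_integral_le_integral_abs.trans (hK.integral_abs_mul4_le hM hG.fourth u k)
  have hpqle : ∀ k l, |p k * q l| ≤ a4 := fun k l =>
    abs_mul_le_of_sq_le (hG.sq_integral_mul_le _ k) (hG.sq_integral_mul_le _ l)
  have hpb : ∀ k, |p k| ≤ b ^ 2 := fun k => abs_integral_le_of_abs_le fun ω => hK.abs_kerProd_le _ _ _
  have hqb : ∀ k, |q k| ≤ b ^ 2 := fun k => abs_integral_le_of_abs_le fun ω => hK.abs_kerProd_le _ _ _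
  have hpiso : ∀ {k l : Fin 2 → I} {a}, Isolated R ![u 0, u 1] k a → |p k * q l| ≤ 4 * b ^ 4 * β := by
    intro k l a ha
    rw [abs_mul]
    calc |p k| * |q l| ≤ (4 * b ^ 2 * β) * b ^ 2 :=
          mul_le_mul (hK.abs_integral_kerProd_le_of_isolated hM _ _ ha) (hqb l) (abs_nonneg _)
            (by positivity)
      _ = _ := by ring
  have hqiso : ∀ {k l : Fin 2 → I} {a}, Isolated R ![u 2, u 3] l a → |p k * q l| ≤ 4 * b ^ 4 * β := by
    intro k l a ha
    rw [abs_mul]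
    calc |p k| * |q l| ≤ b ^ 2 * (4 * b ^ 2 * β) :=
          mul_le_mul (hpb k) (hK.abs_integral_kerProd_le_of_isolated hM _ _ ha) (abs_nonneg _)
            (by positivity)
      _ = _ := by ring
  have hfS : ∀ k ∈ Finset.univ, k ∈ S → |f k| ≤ 2 * a4 := by
    intro k _ _
    have h1 := abs_le.1 (hmle k)
    have h2 := abs_le.1 (hpqle ![k 0, k 1] ![k 2, k 3])
    by_cases h2' : k ∈ A2
    · simp only [hf, h2', hdisj k h2', if_true, if_false]
      rw [abs_le]; constructor <;> linarith
    · by_cases h3' : k ∈ A3 <;> simp only [hf, h2', h3', if_true, if_false] <;> rw [abs_le] <;>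
        constructor <;> linarith
  have hfT : ∀ k ∈ Finset.univ, k ∉ S → |f k| ≤ 3 * (4 * b ^ 4 * β) := by
    intro k _ hkS
    have h0 : 0 ≤ 4 * b ^ 4 * β := by positivity
    rcases isolated_or_clustered_or_matched R (q := 1) rfl u k with ⟨a, ha⟩ | hc | ⟨π, hπ⟩
    · have hn2 : k ∉ A2 := fun hk => by
        have := (Finset.mem_filter.1 hk).2 a
        exact absurd this.2.2.1 (not_le.2 (ha.2 _ this.2.1))
      have hn3 : k ∉ A3 := fun hk => by
        have := (Finset.mem_filter.1 hk).2 a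
        exact absurd this.2.2.1 (not_le.2 (ha.2 _ this.2.1))
      have h1 := abs_le.1 (hK.abs_integral_kerProd_le_of_isolated hM u k ha)
      -- A slot isolated in the quadruple is isolated in its own pair, so one of the two factors is
      -- a mixing error.
      have h2 : |p ![k 0, k 1] * q ![k 2, k 3]| ≤ 4 * b ^ 4 * β := by
        fin_cases a
        · exact hpiso (a := 0) ⟨by intro c; fin_cases c; exacts [ha.1 0, ha.1 1],
            by intro c hc; fin_cases c; exacts [absurd rfl hc, ha.2 1 (by decide)]⟩
        · exact hpiso (a := 1) ⟨by intro c; fin_cases c; exacts [ha.1 0, ha.1 1],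
            by intro c hc; fin_cases c; exacts [ha.2 0 (by decide), absurd rfl hc]⟩
        · exact hqiso (a := 0) ⟨by intro c; fin_cases c; exacts [ha.1 2, ha.1 3],
            by intro c hc; fin_cases c; exacts [absurd rfl hc, ha.2 3 (by decide)]⟩
        · exact hqiso (a := 1) ⟨by intro c; fin_cases c; exacts [ha.1 2, ha.1 3],
            by intro c hc; fin_cases c; exacts [ha.2 2 (by decide), absurd rfl hc]⟩
      have h2 := abs_le.1 h2
      have h1' : -(4 * b ^ 4 * β) ≤ m k ∧ m k ≤ 4 * b ^ 4 * β := h1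
      simp only [hf, hn2, hn3, if_false]
      rw [abs_le]; constructor <;> linarith [h1'.1, h1'.2, h2.1, h2.2]
    · exact (hkS (Finset.mem_filter.2 ⟨Finset.mem_univ _, hc⟩)).elim
    · have hπ3 : π = ![1, 0, 3, 2] ∨ π = ![2, 3, 0, 1] ∨ π = ![3, 2, 1, 0] := by
        have e : π = ![π 0, π 1, π 2, π 3] := by
          funext a; fin_cases a <;> rfl
        have := involution_fin_four (π 0) (π 1) (π 2) (π 3)
        rw [← e] at this
        exact this fun a => ⟨(hπ a).1, (hπ a).2.1⟩
      rcases hπ3 with rfl | rfl | rfl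
      · have hn2 : k ∉ A2 := fun hk => by
          have := congrFun (hπ.eq (Finset.mem_filter.1 hk).2) 0
          exact absurd this (by decide)
        have hn3 : k ∉ A3 := fun hk => by
          have := congrFun (hπ.eq (Finset.mem_filter.1 hk).2) 0
          exact absurd this (by decide)
        simp only [hf, hn2, hn3, if_false, sub_zero]
        -- Matching inside the groups: the slots `{k 0, k 1}` and the anchors `{u 0, u 1}` are two
        -- far groups, and the second product lives on observations far from both. The expectation
        -- factorises, so the covariance is a mixing error.
        have s := hM.abs_integral_mul_sub_le₂ {k 0, k 1} {u 0, u 1} Finset.card_le_two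
          Finset.card_le_two (by
            intro i hi j hj
            simp only [Finset.mem_insert, Finset.mem_singleton] at hi hj
            rcases hi with rfl | rfl <;> rcases hj with rfl | rfl
            exacts [(hπ 0).2.2.2.1 0, (hπ 0).2.2.2.1 1, (hπ 1).2.2.2.1 0, (hπ 1).2.2.2.1 1])
          (hK.measurable_kerProd ![u 0, u 1] ![k 0, k 1])
          (hK.measurable_kerProd ![u 2, u 3] ![k 2, k 3])
          (hK.abs_kerProd_le _ _) (hK.abs_kerProd_le _ _)
          (by
            intro ξ ζ h1 h2
            refine kerProd_congr _ _ (fun a => ?_) fun a => ?_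
            · fin_cases a
              exacts [h2 (u 0) (by simp), h2 (u 1) (by simp)]
            · fin_cases a
              exacts [h1 (k 0) (by simp), h1 (k 1) (by simp)])
          (by
            intro ξ ζ h1
            have h1' : ∀ j, R < edist (k 0) j → R < edist (k 1) j → R < edist (u 0) j →
                R < edist (u 1) j → ξ j = ζ j := fun j a1 a2 a3 a4 => h1 j
              (by simp [a1, a2]) (by simp [a3, a4])
            refine kerProd_congr _ _ (fun a => ?_) fun a => ?_
            · fin_cases a
              · exact h1' (u 2) ((hπ 0).2.2.2.1 2) ((hπ 1).2.2.2.1 2) h02 h12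
              · exact h1' (u 3) ((hπ 0).2.2.2.1 3) ((hπ 1).2.2.2.1 3) h03 h13
            · fin_cases a
              · exact h1' (k 2) ((hπ 0).2.2.2.2 2 (by decide) (by decide))
                  ((hπ 1).2.2.2.2 2 (by decide) (by decide))
                  (by rw [edist_comm]; exact (hπ 2).2.2.2.1 0)
                  (by rw [edist_comm]; exact (hπ 2).2.2.2.1 1)
              · exact h1' (k 3) ((hπ 0).2.2.2.2 3 (by decide) (by decide))
                  ((hπ 1).2.2.2.2 3 (by decide) (by decide))
                  (by rw [edist_comm]; exact (hπ 3).2.2.2.1 0)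
                  (by rw [edist_comm]; exact (hπ 3).2.2.2.1 1))
        have em : m k = ∫ ω, kerProd h ![u 0, u 1] ![k 0, k 1] (fun i => X i ω) *
            kerProd h ![u 2, u 3] ![k 2, k 3] (fun i => X i ω) ∂P := by
          refine integral_congr_ae (ae_of_all _ fun ω => ?_)
          simp only [kerProd, Fin.prod_univ_four, Fin.prod_univ_two]
          simp only [Matrix.cons_val_zero, Matrix.cons_val_one, mul_assoc]
        rw [em]
        refine s.trans (le_of_eq ?_)
        ring
      · have hk2 : k ∈ A2 := Finset.mem_filter.2 ⟨Finset.mem_univ _, hπ⟩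
        simp only [hf, hk2, hdisj k hk2, if_true, if_false]
        -- The joint expectation has been subtracted, and in the product of expectations the slot 0
        -- has lost its partner and is isolated.
        have := abs_le.1 (hpiso (k := ![k 0, k 1]) (l := ![k 2, k 3]) (a := 0)
          ⟨by intro c; fin_cases c; exacts [(hπ 0).2.2.2.1 0, (hπ 0).2.2.2.1 1],
            by intro c hc; fin_cases c; exacts [absurd rfl hc,
              (hπ 0).2.2.2.2 1 (by decide) (by decide)]⟩)
        rw [abs_le]; constructor <;> linarith [this.1, this.2]
      · have hk3 : k ∈ A3 := Finset.mem_filter.2 ⟨Finset.mem_univ _, hπ⟩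
        have hk2 : k ∉ A2 := fun h2 => hdisj k h2 hk3
        simp only [hf, hk3, hk2, if_true, if_false]
        have := abs_le.1 (hpiso (k := ![k 0, k 1]) (l := ![k 2, k 3]) (a := 0)
          ⟨by intro c; fin_cases c; exacts [(hπ 0).2.2.2.1 0, (hπ 0).2.2.2.1 1],
            by intro c hc; fin_cases c; exacts [absurd rfl hc,
              (hπ 0).2.2.2.2 1 (by decide) (by decide)]⟩)
        rw [abs_le]; constructor <;> linarith [this.1, this.2]
  have hcard := card_clustered_le hG.nbhd hG.card_pos u S fun k hk => (Finset.mem_filter.1 hk).2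
  have hsf := sum_if_const_le (α := Fin 4 → I) (f := f) (t := 3 * (4 * b ^ 4 * β)) (by positivity)
    hcard (by positivity) Finset.univ hfT hfS
  have hτ := hG.tiny (p := 4) (q := 4) (by norm_num) (by norm_num)
  have hsum : ∑ k, m k - ∑ k : Fin 4 → I, p ![k 0, k 1] * q ![k 2, k 3] =
      ∑ k, f k + ∑ k ∈ A2, m k + ∑ k ∈ A3, m k := by
    simp only [hf, Finset.sum_sub_distrib, Finset.sum_ite_mem, Finset.univ_inter]
    ring
  rw [hsum]
  have h2 := hG.abs_sum_cross_le u h02 h13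
  have h3 := hG.abs_sum_cross_le' u h03 h12
  have hn1 : (1 : ℝ) ≤ n := by exact_mod_cast hG.card_pos
  have hD1 : (1 : ℝ) ≤ D := by exact_mod_cast hG.nbhd.one_le hG.card_pos
  have hD4 : (1 : ℝ) ≤ (D : ℝ) ^ 4 := one_le_pow₀ hD1
  have hnD : (1 : ℝ) ≤ n * D ^ 4 * a4 :=
    one_le_mul_of_one_le_of_one_le (one_le_mul_of_one_le_of_one_le hn1 hD4) hG.one_le_a4
  have hnD' : (n : ℝ) * D ^ 4 ≤ n * D ^ 4 * a4 := le_mul_of_one_le_right (by positivity) hG.one_le_a4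
  have e1 : (Fintype.card (Fin 4 → I) : ℝ) * (3 * (4 * b ^ 4 * β)) ≤ 3 := by
    rw [Fintype.card_fun, Fintype.card_fin, ← hn]; push_cast; linarith
  have e2 : (2 : ℝ) ^ 4 * (n ^ 1 * (2 * (4 : ℕ) * D) ^ 4) * (2 * a4) = 2 ^ 17 * (n * D ^ 4 * a4) := by
    push_cast; ring
  rw [e2] at hsf
  refine (abs_add_three _ _ _).trans ((add_le_add (add_le_add hsf h2) h3).trans ?_)
  rw [← hn]
  nlinarith

end FarCovariance

/-! ### Moments of local sums -/

section LocalSums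

variable {Ω I E : Type*} [MeasurableSpace Ω] [MeasurableSpace E] [Fintype I] [EMetricSpace I]
variable {P : Measure Ω} [IsProbabilityMeasure P] {X : I → Ω → E} {R : ℝ≥0∞} {β : ℝ}
  {h : I → I → E → E → ℝ} {b : ℝ} {D : ℕ} {a4 Λ : ℝ}

open Classical in
/-- The sum of the row sums over the neighbours of an index. -/
noncomputable def localSum (h : I → I → E → E → ℝ) (R : ℝ≥0∞) (i : I) (ξ : I → E) : ℝ :=
  ∑ j with edist i j ≤ R, rowSum h j ξ

lemma IsKernel.measurable_localSum (hK : IsKernel P X R h b) (i : I) :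
    Measurable (localSum h R i) :=
  Finset.measurable_sum _ fun j _ => hK.measurable_rowSum j

lemma IsKernel.abs_localSum_le (hK : IsKernel P X R h b) (i : I) (ξ : I → E) :
    |localSum h R i ξ| ≤ Fintype.card I * (Fintype.card I * b) := by
  refine (Finset.abs_sum_le_sum_abs _ _).trans ((Finset.sum_le_sum_of_subset_of_nonneg
    (Finset.subset_univ _) fun _ _ _ => abs_nonneg _).trans ((Finset.sum_le_sum fun j _ =>
      hK.abs_rowSum_le j ξ).trans (by simp)))

open Classical in
lemma NbhdBound.card_le (hD : NbhdBound I R D) {c : ℕ} (hc : c ≤ 10) (i : I) :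
    ((Finset.univ.filter fun j => edist i j ≤ c * R).card : ℝ) ≤ D := by
  have := hD i (Finset.univ.filter fun j => edist i j ≤ c * R) fun j hj =>
    (Finset.mem_filter.1 hj).2.trans (by exact_mod_cast ennreal_mul_le_mul R hc)
  exact_mod_cast this

open Classical in
lemma NbhdBound.card_le_one (hD : NbhdBound I R D) (i : I) :
    ((Finset.univ.filter fun j => edist i j ≤ R).card : ℝ) ≤ D := by
  simpa using hD.card_le (c := 1) (by norm_num) i

lemma IsGood.integrable_prod_rowSum (hG : IsGood P X R h b β D a4 Λ) {r : ℕ} (u : Fin r → I) :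
    Integrable (fun ω => ∏ a, rowSum h (u a) (fun i => X i ω)) P :=
  hG.mixing.integrable_comp (Φ := fun ξ => ∏ a, rowSum h (u a) ξ)
    (Finset.measurable_prod _ fun a _ => hG.kernel.measurable_rowSum (u a))
    (B := ∏ _a : Fin r, (Fintype.card I * b)) fun ξ => by
      rw [Finset.abs_prod]
      exact Finset.prod_le_prod (fun _ _ => abs_nonneg _) fun a _ => hG.kernel.abs_rowSum_le _ _

/-- Fourth-order moments of the row sums. -/
lemma IsGood.abs_integral_prod_four_le (hG : IsGood P X R h b β D a4 Λ) (u : Fin 4 → I) :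
    |∫ ω, ∏ a, rowSum h (u a) (fun i => X i ω) ∂P| ≤
      2 ^ 17 * Fintype.card I ^ 2 * D ^ 4 * a4 := by
  have h1 := hG.kernel.abs_integral_prod_rowSum_le hG.mixing hG.nbhd hG.card_pos
    (zero_le_one.trans hG.one_le_b) (r := 4) (q := 2) (by norm_num) u
    (hG.kernel.integral_abs_mul4_le hG.mixing hG.fourth u)
  have h2 := hG.tiny (p := 4) (q := 4) (by norm_num) (by norm_num)
  have hn1 : (1 : ℝ) ≤ Fintype.card I := by exact_mod_cast hG.card_pos
  have hD1 : (1 : ℝ) ≤ D := by exact_mod_cast hG.nbhd.one_le hG.card_pos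
  have h3 : (1 : ℝ) ≤ Fintype.card I ^ 2 * D ^ 4 * a4 :=
    one_le_mul_of_one_le_of_one_le (one_le_mul_of_one_le_of_one_le (one_le_pow₀ hn1)
      (one_le_pow₀ hD1)) hG.one_le_a4
  push_cast at h1
  nlinarith

lemma IsGood.sq_integral_prod_two_le (hG : IsGood P X R h b β D a4 Λ) (i j : I) :
    (∫ ω, ∏ a, rowSum h (![i, j] a) (fun l => X l ω) ∂P) ^ 2 ≤
      2 ^ 17 * Fintype.card I ^ 2 * D ^ 4 * a4 := by
  have h4 := (abs_le.1 (hG.abs_integral_prod_four_le ![i, j, i, j])).2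
  have e : ∀ ω, ∏ a, rowSum h (![i, j, i, j] a) (fun l => X l ω) =
      (∏ a, rowSum h (![i, j] a) (fun l => X l ω)) ^ 2 := fun ω => by
    rw [Fin.prod_univ_four, Fin.prod_univ_two]
    change rowSum h i _ * rowSum h j _ * rowSum h i _ * rowSum h j _ =
      (rowSum h i _ * rowSum h j _) ^ 2
    ring
  have hi4 := hG.integrable_prod_rowSum ![i, j, i, j]
  simp only [e] at h4 hi4
  exact (sq_integral_le (hG.integrable_prod_rowSum _) hi4).trans h4

/-- Without separation of the two pairs only the order `n²` is available instead of `n`; this is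
affordable since there are few close pairs of indices. -/
lemma IsGood.abs_cov_mul_le_of_near (hG : IsGood P X R h b β D a4 Λ) (u : Fin 4 → I) :
    |∫ ω, ∏ a, rowSum h (u a) (fun i => X i ω) ∂P -
      (∫ ω, ∏ a, rowSum h (![u 0, u 1] a) (fun i => X i ω) ∂P) *
        ∫ ω, ∏ a, rowSum h (![u 2, u 3] a) (fun i => X i ω) ∂P| ≤
      2 ^ 18 * Fintype.card I ^ 2 * D ^ 4 * a4 := by
  have h1 := hG.abs_integral_prod_four_le u
  have h2 := abs_mul_le_of_sq_le (hG.sq_integral_prod_two_le (u 0) (u 1))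
    (hG.sq_integral_prod_two_le (u 2) (u 3))
  have := (abs_sub _ _).trans (add_le_add h1 h2)
  linarith

lemma IsGood.integral_rowSum_pow_four_le (hG : IsGood P X R h b β D a4 Λ) (i : I) :
    ∫ ω, rowSum h i (fun l => X l ω) ^ 4 ∂P ≤ 2 ^ 17 * Fintype.card I ^ 2 * D ^ 4 * a4 := by
  have h4 := (abs_le.1 (hG.abs_integral_prod_four_le fun _ => i)).2
  simpa using h4

lemma IsGood.integrable_rowSum_pow (hG : IsGood P X R h b β D a4 Λ) (i : I) (p : ℕ) :
    Integrable (fun ω => rowSum h i (fun l => X l ω) ^ p) P := by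
  simpa using hG.integrable_prod_rowSum fun _ : Fin p => i

lemma IsGood.integrable_localSum_pow (hG : IsGood P X R h b β D a4 Λ) (i : I) (p : ℕ) :
    Integrable (fun ω => localSum h R i (fun l => X l ω) ^ p) P :=
  hG.mixing.integrable_comp (Φ := fun ξ => localSum h R i ξ ^ p)
    ((hG.kernel.measurable_localSum i).pow_const p)
    (B := (Fintype.card I * (Fintype.card I * b)) ^ p) fun ξ => by
      rw [abs_pow]
      exact pow_le_pow_left₀ (abs_nonneg _) (hG.kernel.abs_localSum_le i ξ) p

/-- Two applications of Cauchy–Schwarz bound the fourth power of a sum of at most `D` terms by `D³`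
times the sum of the fourth powers. -/
lemma IsGood.integral_localSum_pow_four_le (hG : IsGood P X R h b β D a4 Λ) (i : I) :
    ∫ ω, localSum h R i (fun l => X l ω) ^ 4 ∂P ≤
      D ^ 4 * (2 ^ 17 * Fintype.card I ^ 2 * D ^ 4 * a4) := by
  classical
  set S := Finset.univ.filter fun j => edist i j ≤ R with hS
  have hcard : (S.card : ℝ) ≤ D := hG.nbhd.card_le_one i
  have hle : ∀ ω, localSum h R i (fun l => X l ω) ^ 4 ≤
      (D : ℝ) ^ 3 * ∑ j ∈ S, rowSum h j (fun l => X l ω) ^ 4 := by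
    intro ω
    have h2 : localSum h R i (fun l => X l ω) ^ 4 ≤
        (S.card : ℝ) ^ 3 * ∑ j ∈ S, rowSum h j (fun l => X l ω) ^ 4 := by
      have e1 := sq_sum_le_card_mul_sum_sq (s := S) (f := fun j => rowSum h j (fun l => X l ω))
      have e2 := sq_sum_le_card_mul_sum_sq (s := S) (f := fun j => rowSum h j (fun l => X l ω) ^ 2)
      have h0 : 0 ≤ ∑ j ∈ S, rowSum h j (fun l => X l ω) ^ 2 :=
        Finset.sum_nonneg fun _ _ => sq_nonneg _
      calc localSum h R i (fun l => X l ω) ^ 4 = ((∑ j ∈ S, rowSum h j (fun l => X l ω)) ^ 2) ^ 2 := by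
            rw [localSum, ← pow_mul]
        _ ≤ (S.card * ∑ j ∈ S, rowSum h j (fun l => X l ω) ^ 2) ^ 2 :=
            pow_le_pow_left₀ (sq_nonneg _) e1 2
        _ = (S.card : ℝ) ^ 2 * (∑ j ∈ S, rowSum h j (fun l => X l ω) ^ 2) ^ 2 := by ring
        _ ≤ (S.card : ℝ) ^ 2 * (S.card * ∑ j ∈ S, (rowSum h j (fun l => X l ω) ^ 2) ^ 2) := by gcongr
        _ = _ := by simp only [← pow_mul]; ring
    refine h2.trans ?_
    have : 0 ≤ ∑ j ∈ S, rowSum h j (fun l => X l ω) ^ 4 :=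
      Finset.sum_nonneg fun j _ => by positivity
    gcongr
  refine (integral_mono (hG.integrable_localSum_pow i 4) ((integrable_finsetSum S fun j _ =>
    hG.integrable_rowSum_pow j 4).const_mul _) hle).trans ?_
  rw [integral_const_mul, integral_finsetSum S fun j _ => hG.integrable_rowSum_pow j 4]
  have hn : 0 ≤ 2 ^ 17 * (Fintype.card I : ℝ) ^ 2 * D ^ 4 * a4 := by
    have := hG.one_le_a4; positivity
  calc (D : ℝ) ^ 3 * ∑ j ∈ S, ∫ ω, rowSum h j (fun l => X l ω) ^ 4 ∂P
      ≤ (D : ℝ) ^ 3 * (S.card * (2 ^ 17 * (Fintype.card I : ℝ) ^ 2 * D ^ 4 * a4)) := by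
        gcongr
        rw [← nsmul_eq_mul]
        exact Finset.sum_le_card_nsmul _ _ _ fun j _ => hG.integral_rowSum_pow_four_le j
    _ ≤ (D : ℝ) ^ 3 * (D * (2 ^ 17 * (Fintype.card I : ℝ) ^ 2 * D ^ 4 * a4)) := by gcongr
    _ = _ := by ring

/-- The third-order remainder. -/
lemma IsGood.integral_abs_rowSum_mul_localSum_le (hG : IsGood P X R h b β D a4 Λ) (i : I) :
    ∫ ω, |rowSum h i (fun l => X l ω) * localSum h R i (fun l => X l ω) ^ 3| ∂P ≤
      2 ^ 18 * Fintype.card I ^ 2 * D ^ 8 * a4 := by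
  have hD1 : (1 : ℝ) ≤ D := by exact_mod_cast hG.nbhd.one_le hG.card_pos
  have i1 := hG.integrable_rowSum_pow i 4
  have i2 := hG.integrable_localSum_pow i 4
  have h1 := hG.integral_rowSum_pow_four_le i
  have h2 := hG.integral_localSum_pow_four_le i
  have hle : ∀ x y : ℝ, |x * y ^ 3| ≤ x ^ 4 + y ^ 4 := fun x y => by
    have := sq_nonneg (x * y - y ^ 2)
    have := sq_nonneg (x * y + y ^ 2)
    have := sq_nonneg (x ^ 2 - y ^ 2)
    rw [abs_le]; constructor <;> nlinarith [sq_nonneg (x * y), sq_nonneg (x ^ 2), sq_nonneg (y ^ 2)]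
  refine (integral_mono (hG.mixing.integrable_comp (Φ := fun ξ => |rowSum h i ξ *
      localSum h R i ξ ^ 3|) ((hG.kernel.measurable_rowSum i).mul
      ((hG.kernel.measurable_localSum i).pow_const 3)).abs
      (B := Fintype.card I * b * (Fintype.card I * (Fintype.card I * b)) ^ 3) fun ξ => ?_)
      (i1.add i2) fun ω => hle _ _).trans ?_
  · rw [abs_abs, abs_mul, abs_pow]
    exact mul_le_mul (hG.kernel.abs_rowSum_le i ξ) (pow_le_pow_left₀ (abs_nonneg _)
      (hG.kernel.abs_localSum_le i ξ) 3) (by positivity) ((abs_nonneg _).trans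
        (hG.kernel.abs_rowSum_le i ξ))
  · simp only [Pi.add_apply]
    rw [integral_add i1 i2]
    have hn : 0 ≤ 2 ^ 17 * (Fintype.card I : ℝ) ^ 2 * a4 := by
      have := hG.one_le_a4; positivity
    have h8 : (D : ℝ) ^ 4 ≤ D ^ 8 := pow_le_pow_right₀ hD1 (by norm_num)
    nlinarith

open Classical in
/-- The variance of `∑ᵢ Yᵢ Lᵢ`. -/
theorem IsGood.integral_sq_sum_localSum_sub_le (hG : IsGood P X R h b β D a4 Λ) :
    ∫ ω, (∑ i, rowSum h i (fun l => X l ω) * localSum h R i (fun l => X l ω) -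
      ∑ i, ∫ ω', rowSum h i (fun l => X l ω') * localSum h R i (fun l => X l ω') ∂P) ^ 2 ∂P ≤
      2 ^ 20 * Fintype.card I ^ 3 * D ^ 7 * a4 + 2 * Fintype.card I ^ 2 * D ^ 2 * Λ ^ 2 := by
  set n := Fintype.card I with hn
  set N : I → Finset I := fun i => Finset.univ.filter fun j => edist i j ≤ R with hN
  set N3 : I → Finset I := fun i => Finset.univ.filter fun j => edist i j ≤ (3 : ℕ) * R with hN3
  have hNc : ∀ i, ((N i).card : ℝ) ≤ D := fun i => hG.nbhd.card_le_one i
  have hN3c : ∀ i, ((N3 i).card : ℝ) ≤ D := fun i => hG.nbhd.card_le (by norm_num) i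
  set V : I → I → Ω → ℝ := fun i j ω => rowSum h i (fun l => X l ω) * rowSum h j (fun l => X l ω)
    with hV
  set e : I → I → ℝ := fun i j => ∫ ω, V i j ω ∂P with he
  have hVi : ∀ i j, Integrable (V i j) P := fun i j => hG.kernel.integrable_rowSum_mul hG.mixing i j
  have hVVi : ∀ i j i' j', Integrable (fun ω => V i j ω * V i' j' ω) P := fun i j i' j' => by
    refine (hG.integrable_prod_rowSum ![i, j, i', j']).congr (ae_of_all _ fun ω => ?_)
    simp only
    rw [Fin.prod_univ_four]
    change rowSum h i _ * rowSum h j _ * rowSum h i' _ * rowSum h j' _ = _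
    simp only [hV]; ring
  have hci : ∀ i j i' j', Integrable (fun ω => (V i j ω - e i j) * (V i' j' ω - e i' j')) P := by
    intro i j i' j'
    refine ((((hVVi i j i' j').sub ((hVi i j).mul_const (e i' j'))).sub
      ((hVi i' j').const_mul (e i j))).add (integrable_const (e i j * e i' j'))).congr
        (ae_of_all _ fun ω => ?_)
    simp only [Pi.add_apply, Pi.sub_apply]; ring
  have hcov : ∀ i j i' j', ∫ ω, (V i j ω - e i j) * (V i' j' ω - e i' j') ∂P =
      ∫ ω, ∏ a, rowSum h (![i, j, i', j'] a) (fun l => X l ω) ∂P -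
        (∫ ω, ∏ a, rowSum h (![i, j] a) (fun l => X l ω) ∂P) *
          ∫ ω, ∏ a, rowSum h (![i', j'] a) (fun l => X l ω) ∂P := by
    intro i j i' j'
    have e2 : ∀ i j, ∫ ω, ∏ a, rowSum h (![i, j] a) (fun l => X l ω) ∂P = e i j := fun i j =>
      integral_congr_ae (ae_of_all _ fun ω => by
        simp only [Fin.prod_univ_two]; rfl)
    have e4 : ∫ ω, ∏ a, rowSum h (![i, j, i', j'] a) (fun l => X l ω) ∂P =
        ∫ ω, V i j ω * V i' j' ω ∂P := integral_congr_ae (ae_of_all _ fun ω => by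
        simp only [Fin.prod_univ_four]
        change rowSum h i _ * rowSum h j _ * rowSum h i' _ * rowSum h j' _ = _
        simp only [hV]; ring)
    rw [e2, e2, e4]
    have e3 : ∀ ω, (V i j ω - e i j) * (V i' j' ω - e i' j') =
        V i j ω * V i' j' ω - V i j ω * e i' j' - e i j * (V i' j' ω - e i' j') := fun ω => by ring
    simp only [e3]
    have s1 := integral_sub (hVVi i j i' j') ((hVi i j).mul_const (e i' j'))
    have s2 := integral_sub ((hVVi i j i' j').sub ((hVi i j).mul_const (e i' j')))
      (((hVi i' j').sub (integrable_const (e i' j'))).const_mul (e i j))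
    have s3 := integral_sub (hVi i' j') (integrable_const (e i' j'))
    simp only [Pi.sub_apply] at s1 s2 s3
    rw [s2, s1, integral_const_mul, integral_mul_const, s3]
    simp [he]
  set M : ℝ := 2 ^ 18 * n ^ 2 * D ^ 4 * a4 with hMdef
  set F : ℝ := 2 ^ 19 * n * D ^ 4 * a4 + 2 * Λ ^ 2 with hF
  have ha0 : 0 ≤ a4 := zero_le_one.trans hG.one_le_a4
  have hM0 : 0 ≤ M := by positivity
  have hF0 : 0 ≤ F := by positivity
  have hpair : ∀ i i', ∀ j ∈ N i, ∀ j' ∈ N i',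
      ∫ ω, (V i j ω - e i j) * (V i' j' ω - e i' j') ∂P ≤ F + if i' ∈ N3 i then M else 0 := by
    intro i i' j hj j' hj'
    rw [hcov]
    have hj := (Finset.mem_filter.1 hj).2
    have hj' := (Finset.mem_filter.1 hj').2
    by_cases hii : i' ∈ N3 i
    · rw [if_pos hii]
      have := (abs_le.1 (hG.abs_cov_mul_le_of_near ![i, j, i', j'])).2
      exact this.trans (by linarith)
    · rw [if_neg hii, add_zero]
      -- Passing to neighbours moves each index by at most `R`, so all four distances between the
      -- two pairs still exceed `R`.
      have hii : 3 * R < edist i i' := by simpa [hN3] using hii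
      have h3 : (3 : ℝ≥0∞) * R = R + R + R := by ring
      refine (abs_le.1 (hG.abs_cov_mul_le ![i, j, i', j'] ?_ ?_ ?_ ?_)).2
      · exact (le_three_mul R).trans_lt hii
      · change R < edist i j'
        by_contra! hcon
        refine absurd hii (not_lt.2 ?_)
        calc edist i i' ≤ edist i j' + edist i' j' := edist_triangle_right _ _ _
          _ ≤ R + R := add_le_add hcon hj'
          _ ≤ 3 * R := by rw [h3]; exact le_self_add
      · change R < edist j i'
        by_contra! hcon
        refine absurd hii (not_lt.2 ?_)
        calc edist i i' ≤ edist i j + edist j i' := edist_triangle _ _ _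
          _ ≤ R + R := add_le_add hj hcon
          _ ≤ 3 * R := by rw [h3]; exact le_self_add
      · change R < edist j j'
        by_contra! hcon
        refine absurd hii (not_lt.2 ?_)
        calc edist i i' ≤ edist i j + edist j j' + edist j' i' := edist_triangle4 _ _ _ _
          _ ≤ R + R + R := add_le_add (add_le_add hj hcon) (by rwa [edist_comm])
          _ = 3 * R := h3.symm
  have hexp : ∀ ω, (∑ i, rowSum h i (fun l => X l ω) * localSum h R i (fun l => X l ω) -
      ∑ i, ∫ ω', rowSum h i (fun l => X l ω') * localSum h R i (fun l => X l ω') ∂P) ^ 2 =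
      ∑ i, ∑ i', ∑ j ∈ N i, ∑ j' ∈ N i', (V i j ω - e i j) * (V i' j' ω - e i' j') := by
    intro ω
    have e1 : ∀ i, ∫ ω', rowSum h i (fun l => X l ω') * localSum h R i (fun l => X l ω') ∂P =
        ∑ j ∈ N i, e i j := fun i => by
      simp only [localSum, Finset.mul_sum]
      exact integral_finsetSum _ fun j _ => hVi i j
    have e2 : ∑ i, rowSum h i (fun l => X l ω) * localSum h R i (fun l => X l ω) -
        ∑ i, ∫ ω', rowSum h i (fun l => X l ω') * localSum h R i (fun l => X l ω') ∂P =
        ∑ i, ∑ j ∈ N i, (V i j ω - e i j) := by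
      rw [← Finset.sum_sub_distrib]
      refine Finset.sum_congr rfl fun i _ => ?_
      rw [e1, Finset.sum_sub_distrib, localSum, Finset.mul_sum]
    rw [e2, sq, Finset.sum_mul_sum]
    refine Finset.sum_congr rfl fun i _ => Finset.sum_congr rfl fun i' _ => ?_
    rw [Finset.sum_mul_sum]
  simp only [hexp]
  rw [integral_finsetSum _ fun i _ => integrable_finsetSum _ fun i' _ => integrable_finsetSum _
    fun j _ => integrable_finsetSum _ fun j' _ => hci i j i' j']
  have hrow : ∀ i, ∫ ω, ∑ i', ∑ j ∈ N i, ∑ j' ∈ N i', (V i j ω - e i j) * (V i' j' ω - e i' j') ∂P ≤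
      n * (D * (D * F)) + D * (D * (D * M)) := by
    intro i
    rw [integral_finsetSum _ fun i' _ => integrable_finsetSum _
      fun j _ => integrable_finsetSum _ fun j' _ => hci i j i' j']
    have h1 : ∀ i', ∫ ω, ∑ j ∈ N i, ∑ j' ∈ N i', (V i j ω - e i j) * (V i' j' ω - e i' j') ∂P ≤
        D * (D * F) + if i' ∈ N3 i then D * (D * M) else 0 := by
      intro i'
      rw [integral_finsetSum _ fun j _ => integrable_finsetSum _ fun j' _ => hci i j i' j']
      have hc0 : 0 ≤ F + if i' ∈ N3 i then M else 0 := by split_ifs <;> linarith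
      calc _ ≤ ∑ j ∈ N i, (D : ℝ) * (F + if i' ∈ N3 i then M else 0) := by
            refine Finset.sum_le_sum fun j hj => ?_
            rw [integral_finsetSum _ fun j' _ => hci i j i' j']
            refine (Finset.sum_le_card_nsmul _ _ _ fun j' hj' => hpair i i' j hj j' hj').trans ?_
            rw [nsmul_eq_mul]
            exact mul_le_mul_of_nonneg_right (hNc i') hc0
        _ ≤ (D : ℝ) * (D * (F + if i' ∈ N3 i then M else 0)) := by
            rw [Finset.sum_const, nsmul_eq_mul]
            exact mul_le_mul_of_nonneg_right (hNc i) (by positivity)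
        _ = _ := by split_ifs <;> ring
    refine (Finset.sum_le_sum fun i' _ => h1 i').trans ?_
    rw [Finset.sum_add_distrib, Finset.sum_ite_mem, Finset.univ_inter]
    simp only [Finset.sum_const, nsmul_eq_mul, Finset.card_univ]
    have := mul_le_mul_of_nonneg_right (hN3c i) (show 0 ≤ D * (D * M) by positivity)
    linarith
  refine (Finset.sum_le_card_nsmul _ _ _ fun i _ => hrow i).trans ?_
  rw [nsmul_eq_mul, Finset.card_univ, ← hn, hMdef, hF]
  have hD1 : (1 : ℝ) ≤ D := by exact_mod_cast hG.nbhd.one_le hG.card_pos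
  have hn1 : (1 : ℝ) ≤ n := by exact_mod_cast hG.card_pos
  have h67 : (n : ℝ) ^ 3 * a4 * D ^ 6 ≤ n ^ 3 * a4 * D ^ 7 :=
    mul_le_mul_of_nonneg_left (pow_le_pow_right₀ hD1 (by norm_num)) (by positivity)
  have h7 : 0 ≤ (n : ℝ) ^ 3 * a4 * D ^ 7 := by positivity
  nlinarith

end LocalSums

/-! ### Matched sextuples -/

section SixthOrder

variable {Ω I E : Type*} [MeasurableSpace Ω] [MeasurableSpace E] [Fintype I] [EMetricSpace I]
variable {P : Measure Ω} [IsProbabilityMeasure P] {X : I → Ω → E} {R : ℝ≥0∞} {β : ℝ}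
  {h : I → I → E → E → ℝ} {b : ℝ} {D : ℕ} {a4 Λ : ℝ}

/-- Far factors decouple, which gives `a4²` up to a mixing error of at most `1 ≤ a4²`. An eighth
moment of the kernel is thus avoided. -/
lemma IsGood.integral_pow_four_mul_le (hG : IsGood P X R h b β D a4 Λ) {i k i' k' : I}
    (h1 : R < edist i i') (h2 : R < edist i k') (h3 : R < edist k i') (h4 : R < edist k k') :
    ∫ ω, h i k (X i ω) (X k ω) ^ 4 * h i' k' (X i' ω) (X k' ω) ^ 4 ∂P ≤ 2 * a4 ^ 2 := by
  classical
  have hK := hG.kernel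
  have hb : ∀ i k (ξ : I → E), |h i k (ξ i) (ξ k) ^ 4| ≤ b ^ 4 := fun i k ξ => by
    rw [abs_pow]; exact pow_le_pow_left₀ (abs_nonneg _) (hK.bound _ _ _ _) 4
  have s := hG.mixing.abs_integral_mul_sub_le {i, k} Finset.card_le_two
    ((hK.measurable_eval i k).pow_const 4) ((hK.measurable_eval i' k').pow_const 4)
    (hb i k) (hb i' k')
    (fun ξ ζ hξ => by simp only [hξ i (by simp), hξ k (by simp)])
    fun ξ ζ hξ => by simp only [hξ i' (by simp [h1, h3]), hξ k' (by simp [h2, h4])]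
  have hτ := hG.tiny (p := 8) (q := 0) (by norm_num) (by norm_num)
  rw [pow_zero, one_mul] at hτ
  have hnn : ∀ i k, 0 ≤ ∫ ω, h i k (X i ω) (X k ω) ^ 4 ∂P := fun i k =>
    integral_nonneg fun ω => by positivity
  have ha := hG.one_le_a4
  have hprod := mul_le_mul (hG.fourth i k) (hG.fourth i' k') (hnn i' k') (by linarith)
  have s' := (abs_le.1 s).2
  have e : 4 * (b ^ 4 * b ^ 4) * β = 4 * b ^ 8 * β := by ring
  nlinarith

lemma IsGood.integrable_kerProd_sq (hG : IsGood P X R h b β D a4 Λ) {r : ℕ} (w κ : Fin r → I) :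
    Integrable (fun ω => kerProd h w κ (fun i => X i ω) ^ 2) P :=
  hG.mixing.integrable_comp (Φ := fun ξ => kerProd h w κ ξ ^ 2)
    ((hG.kernel.measurable_kerProd w κ).pow_const 2) (B := (b ^ r) ^ 2) fun ξ => by
      rw [abs_pow]; exact pow_le_pow_left₀ (abs_nonneg _) (hG.kernel.abs_kerProd_le w κ ξ) 2

/-- Second moment of a product of four kernels which splits into two pairs of far factors. -/
lemma IsGood.integral_kerProd_four_sq_le (hG : IsGood P X R h b β D a4 Λ) (w κ : Fin 4 → I)
    {a c a' c' : Fin 4} (hperm : ∀ f : Fin 4 → ℝ, ∏ i, f i = f a * f c * (f a' * f c'))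
    (h1 : R < edist (w a) (w c)) (h2 : R < edist (w a) (κ c)) (h3 : R < edist (κ a) (w c))
    (h4 : R < edist (κ a) (κ c)) (h1' : R < edist (w a') (w c')) (h2' : R < edist (w a') (κ c'))
    (h3' : R < edist (κ a') (w c')) (h4' : R < edist (κ a') (κ c')) :
    ∫ ω, kerProd h w κ (fun i => X i ω) ^ 2 ∂P ≤ 2 * a4 ^ 2 := by
  have hK := hG.kernel
  have hi : ∀ i k i' k', Integrable (fun ω => h i k (X i ω) (X k ω) ^ 4 *
      h i' k' (X i' ω) (X k' ω) ^ 4) P := fun i k i' k' =>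
    hG.mixing.integrable_comp (Φ := fun ξ => h i k (ξ i) (ξ k) ^ 4 * h i' k' (ξ i') (ξ k') ^ 4)
      (((hK.measurable_eval i k).pow_const 4).mul ((hK.measurable_eval i' k').pow_const 4))
      (B := b ^ 4 * b ^ 4) fun ξ => by
        have hb : ∀ i k (ξ : I → E), |h i k (ξ i) (ξ k) ^ 4| ≤ b ^ 4 := fun i k ξ => by
          rw [abs_pow]; exact pow_le_pow_left₀ (abs_nonneg _) (hK.bound _ _ _ _) 4
        rw [abs_mul]
        exact mul_le_mul (hb _ _ _) (hb _ _ _) (abs_nonneg _) ((abs_nonneg _).trans (hb i k ξ))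
  have i1 := hi (w a) (κ a) (w c) (κ c)
  have i2 := hi (w a') (κ a') (w c') (κ c')
  refine (integral_mono (hG.integrable_kerProd_sq w κ) ((i1.add i2).div_const 2)
    fun ω => ?_).trans ?_
  · simp only [kerProd, Pi.add_apply]
    rw [hperm]
    set p := h (w a) (κ a) (X (w a) ω) (X (κ a) ω)
    set q := h (w c) (κ c) (X (w c) ω) (X (κ c) ω)
    set p' := h (w a') (κ a') (X (w a') ω) (X (κ a') ω)
    set q' := h (w c') (κ c') (X (w c') ω) (X (κ c') ω)
    nlinarith [sq_nonneg ((p * q) ^ 2 - (p' * q') ^ 2)]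
  · simp only [Pi.add_apply]
    rw [integral_div, integral_add i1 i2]
    linarith [hG.integral_pow_four_mul_le h1 h2 h3 h4, hG.integral_pow_four_mul_le h1' h2' h3' h4']

lemma kerProd_cons {r : ℕ} (u : Fin (r + 1) → I) (x : I) (κ : Fin r → I) (ξ : I → E) :
    kerProd h u (Fin.cons x κ) ξ = h (u 0) x (ξ (u 0)) (ξ x) * kerProd h (Fin.tail u) κ ξ := by
  simp only [kerProd, Fin.prod_univ_succ, Fin.cons_zero, Fin.cons_succ, Fin.tail]

open Classical in
-- The pair of the slots 0 and 1 has anchors in different groups. Integrating it out and summing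
-- over its positions gives `closeSum`; the other four factors have a bounded second moment, and
-- their two pairs of slots leave only `n²` tuples up to powers of `D`. Counting all matched
-- sextuples would give `n³`.
lemma IsGood.abs_sum_matched_six_le (hG : IsGood P X R h b β D a4 Λ) (u : Fin 6 → I)
    {π : Fin 6 → Fin 6} (hπ0 : π 0 = 1) (h01 : R < edist (u 0) (u 1))
    (h24 : R < edist (u 2) (u 4)) (h25 : R < edist (u 2) (u 5))
    (h34 : R < edist (u 3) (u 4)) (h35 : R < edist (u 3) (u 5)) :
    |∑ k with Matched R u k π, ∫ ω, kerProd h u k (fun i => X i ω) ∂P| ≤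
      2 ^ 30 * Fintype.card I ^ 2 * D ^ 6 * (a4 ^ 2 + Λ ^ 2) := by
  have hK := hG.kernel
  have hM := hG.mixing
  have hβ := hM.nonneg
  have hb0 : 0 ≤ b := zero_le_one.trans hG.one_le_b
  have ha1 := hG.one_le_a4
  set n := Fintype.card I with hn
  set w : Fin 4 → I := Fin.tail (Fin.tail u) with hw
  set kk : I → I → (Fin 4 → I) → Fin 6 → I := fun x y κ => Fin.cons x (Fin.cons y κ) with hkk
  set p : I → I → Ω → ℝ := fun x y ω => pairInt P X h h (u 0) (u 1) x y (X (u 0) ω) (X (u 1) ω)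
    with hp
  set F : (Fin 4 → I) → Ω → ℝ := fun κ ω => kerProd h w κ fun i => X i ω with hF
  set N := Finset.univ.filter fun κ : Fin 4 → I => ∃ x y, Matched R u (kk x y κ) π with hN
  have hpF : ∀ x y κ, Integrable (fun ω => p x y ω * F κ ω) P := fun x y κ =>
    hM.integrable_comp (Φ := fun ξ => pairInt P X h h (u 0) (u 1) x y (ξ (u 0)) (ξ (u 1)) *
      kerProd h w κ ξ) ((hK.measurable_pairInt_eval hM _ _ _ _).mul (hK.measurable_kerProd _ _))
      (B := (b * b) * b ^ 4) fun ξ => by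
        rw [abs_mul]
        exact mul_le_mul (hK.abs_pairInt_le hK _ _ _ _ _ _) (hK.abs_kerProd_le _ _ _)
          (abs_nonneg _) (by positivity)
  set pp : I → I → (Fin 4 → I) → ℝ := fun x y κ => ∫ ω, p x y ω * F κ ω ∂P with hpp
  -- second moments of the remaining factors
  have hF2 : ∀ κ ∈ N, ∫ ω, F κ ω ^ 2 ∂P ≤ 2 * a4 ^ 2 := by
    intro κ hκ
    obtain ⟨x, y, hm⟩ := (Finset.mem_filter.1 hκ).2
    have hinv : ∀ a c, π a = c → π c = a := fun a c hac => hac ▸ (hm a).1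
    have hu : ∀ (a : Fin 4) (c : Fin 6), R < edist (κ a) (u c) := fun a c => (hm a.succ.succ).2.2.2.1 c
    have hu' : ∀ (a : Fin 4) (c : Fin 6), R < edist (u c) (κ a) := fun a c => by
      rw [edist_comm]; exact hu a c
    have hk : ∀ a c : Fin 4, c ≠ a → c.succ.succ ≠ π a.succ.succ → R < edist (κ a) (κ c) :=
      fun a c hca hne => (hm a.succ.succ).2.2.2.2 c.succ.succ
        (fun e => hca (Fin.succ_injective _ (Fin.succ_injective _ e))) hne
    -- The four remaining factors are arranged in two couples, each with one anchor of `{2,3}` and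
    -- one of `{4,5}`, such that no couple is matched by `π`: `(2,5),(3,4)` if `π 2 = 4`, and
    -- `(2,4),(3,5)` otherwise. The factors in each couple are then far from each other.
    by_cases h4 : π 2 = 4
    · refine hG.integral_kerProd_four_sq_le w κ (a := 0) (c := 3) (a' := 1) (c' := 2)
        (fun f => by rw [Fin.prod_univ_four]; ring) h25 (hu' 3 2) (hu 0 5)
        (hk 0 3 (by decide) ?_) h34 (hu' 2 3) (hu 1 4) (hk 1 2 (by decide) ?_)
      · change (5 : Fin 6) ≠ π 2
        rw [h4]; decide
      · change (4 : Fin 6) ≠ π 3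
        intro e
        have := hinv 3 4 e.symm
        rw [hinv 2 4 h4] at this
        exact absurd this (by decide)
    · refine hG.integral_kerProd_four_sq_le w κ (a := 0) (c := 2) (a' := 1) (c' := 3)
        (fun f => by rw [Fin.prod_univ_four]; ring) h24 (hu' 2 2) (hu 0 4)
        (hk 0 2 (by decide) ?_) h35 (hu' 3 3) (hu 1 5) (hk 1 3 (by decide) ?_)
      · exact fun e => h4 e.symm
      · change (5 : Fin 6) ≠ π 3
        intro e
        have h5 := hinv 3 5 e.symm
        have hv : ∀ v : Fin 6, v ≠ 0 → v ≠ 1 → v ≠ 2 → v ≠ 3 → v ≠ 5 → v = 4 := by decide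
        refine h4 (hv _ (fun q => ?_) (fun q => ?_) (hm 2).2.1 (fun q => ?_) fun q => ?_)
        · have := hinv _ _ q; rw [hπ0] at this; exact absurd this (by decide)
        · have := hinv _ _ q; rw [hinv _ _ hπ0] at this; exact absurd this (by decide)
        · have := hinv _ _ q; rw [← e] at this; exact absurd this (by decide)
        · have := hinv _ _ q; rw [h5] at this; exact absurd this (by decide)
  have hτ6 := hG.tiny (p := 6) (q := 6) (by norm_num) (by norm_num)
  have hτ0 := hG.tiny (p := 4) (q := 0) (by norm_num) (by norm_num)
  rw [pow_zero, one_mul] at hτ0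
  have hppb : ∀ x y, ∀ κ ∈ N, |pp x y κ| ≤ 2 * a4 ^ 2 := fun x y κ hκ => by
    have := abs_integral_mul_le_half (hK.integrable_pairInt_sq hM (u 0) (u 1) x y)
      (hG.integrable_kerProd_sq w κ) (hpF _ _ _)
      (hK.integral_pairInt_sq_le hM hG.fourth hτ0 (by linarith) _ _ _ _) (hF2 κ hκ)
    refine this.trans ?_
    nlinarith
  set A := Finset.univ.filter fun k : Fin 6 → I => Matched R u k π with hA
  set B := Finset.univ.filter fun k : Fin 6 → I =>
    edist (k 0) (k 1) ≤ R ∧ Fin.tail (Fin.tail k) ∈ N with hB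
  have hkeq : ∀ k : Fin 6 → I, kk (k 0) (k 1) (Fin.tail (Fin.tail k)) = k := fun k => by
    have : k 1 = Fin.tail k 0 := rfl
    simp only [hkk]
    rw [this, Fin.cons_self_tail, Fin.cons_self_tail]
  set qq : (Fin 6 → I) → ℝ := fun k => pp (k 0) (k 1) (Fin.tail (Fin.tail k)) with hqq
  have hAB : A ⊆ B := fun k hk => by
    have hm := (Finset.mem_filter.1 hk).2
    refine Finset.mem_filter.2 ⟨Finset.mem_univ _, hπ0 ▸ (hm 0).2.2.1,
      Finset.mem_filter.2 ⟨Finset.mem_univ _, k 0, k 1, ?_⟩⟩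
    rw [hkeq]; exact hm
  -- the sum over all close pairs
  have hsumB : |∑ k ∈ B, qq k| ≤ N.card * (Λ ^ 2 / 2 + a4 ^ 2) := by
    have e : ∑ k ∈ B, qq k = ∑ κ ∈ N, ∫ ω, closeSum P X R h (u 0) (u 1) (X (u 0) ω) (X (u 1) ω) *
        F κ ω ∂P := by
      rw [hB, Finset.sum_filter, sum_pi_fin_succ]
      simp only [sum_pi_fin_succ (m := 4)]
      have e1 : ∀ x y (κ : Fin 4 → I), (if edist ((Fin.cons x (Fin.cons y κ) : Fin 6 → I) 0)
          ((Fin.cons x (Fin.cons y κ) : Fin 6 → I) 1) ≤ R ∧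
          Fin.tail (Fin.tail (Fin.cons x (Fin.cons y κ) : Fin 6 → I)) ∈ N then
            qq (Fin.cons x (Fin.cons y κ)) else 0) =
          if κ ∈ N then (if edist x y ≤ R then pp x y κ else 0) else 0 := by
        intro x y κ
        have t : Fin.tail (Fin.tail (Fin.cons x (Fin.cons y κ) : Fin 6 → I)) = κ := by
          rw [Fin.tail_cons, Fin.tail_cons]
        have t1 : (Fin.cons x (Fin.cons y κ) : Fin 6 → I) 1 = y := rfl
        have t0 : (Fin.cons x (Fin.cons y κ) : Fin 6 → I) 0 = x := rfl
        simp only [hqq, t, t1, t0]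
        by_cases h1 : edist x y ≤ R <;> by_cases h2 : κ ∈ N <;> simp [h1, h2]
      simp only [e1]
      have e2 : ∀ x, ∑ y, ∑ κ, (if κ ∈ N then (if edist x y ≤ R then pp x y κ else 0) else 0) =
          ∑ κ ∈ N, ∑ y, if edist x y ≤ R then pp x y κ else 0 := fun x => by
        simp only [Finset.sum_ite_mem, Finset.univ_inter]
        exact Finset.sum_comm
      simp only [e2]
      rw [Finset.sum_comm]
      refine Finset.sum_congr rfl fun κ _ => ?_
      have e3 : ∀ x y, (if edist x y ≤ R then pp x y κ else 0) =
          ∫ ω, (if edist x y ≤ R then p x y ω * F κ ω else 0) ∂P := fun x y => by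
        split_ifs
        · rfl
        · simp
      have i3 : ∀ x y, Integrable (fun ω => if edist x y ≤ R then p x y ω * F κ ω else 0) P :=
        fun x y => by
          split_ifs
          · exact hpF x y κ
          · exact integrable_zero _ _ _
      simp only [e3]
      have e4 : ∀ x, ∑ y, ∫ ω, (if edist x y ≤ R then p x y ω * F κ ω else 0) ∂P =
          ∫ ω, ∑ y, (if edist x y ≤ R then p x y ω * F κ ω else 0) ∂P := fun x =>
        (integral_finsetSum _ fun y _ => i3 x y).symm
      simp only [e4]
      rw [← integral_finsetSum _ fun x _ => integrable_finsetSum _ fun y _ => i3 x y]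
      refine integral_congr_ae (ae_of_all _ fun ω => ?_)
      simp only [closeSum, Finset.sum_mul, ite_mul, zero_mul, hp]
    rw [e]
    refine (Finset.abs_sum_le_sum_abs _ _).trans ((Finset.sum_le_card_nsmul _ _
      (Λ ^ 2 / 2 + a4 ^ 2) fun κ hκ => ?_).trans (by rw [nsmul_eq_mul]))
    have := abs_integral_mul_le_half (hG.integrable_closeSum_sq (u 0) (u 1))
      (hG.integrable_kerProd_sq w κ)
      (hM.integrable_comp (Φ := fun ξ => closeSum P X R h (u 0) (u 1) (ξ (u 0)) (ξ (u 1)) *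
        kerProd h w κ ξ)
        ((hK.measurable_closeSum_eval hM _ _).mul (hK.measurable_kerProd _ _))
        (B := (n * (n * (b * b))) * b ^ 4) fun ξ => by
          rw [abs_mul]
          exact mul_le_mul (hK.abs_closeSum_le _ _ _ _) (hK.abs_kerProd_le _ _ _)
            (abs_nonneg _) (by positivity)) (hG.close _ _ h01) (hF2 κ hκ)
    refine this.trans (le_of_eq ?_)
    ring
  have hNc : (N.card : ℝ) ≤ 2 ^ 4 * (n ^ 2 * (2 * (4 : ℕ) * D) ^ 4) := by
    refine card_clustered_le hG.nbhd hG.card_pos w N fun κ hκ => ?_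
    obtain ⟨x, y, hm⟩ := (Finset.mem_filter.1 hκ).2
    -- Since `π` exchanges 0 and 1, it maps the slots 2 to 5 among themselves, so each of these
    -- keeps its close partner in `κ`.
    have hpart : ∀ a : Fin 4, ¬ Isolated R w κ a := by
      intro a ha
      have hv : ∀ v : Fin 6, v ≠ 0 → v ≠ 1 → ∃ c : Fin 4, v = c.succ.succ := by decide
      have hne : ∀ a : Fin 4, 1 ≠ a.succ.succ ∧ 0 ≠ a.succ.succ := by decide
      have hπ1 : π 1 = 0 := hπ0 ▸ (hm 0).1
      obtain ⟨c, hc⟩ := hv (π a.succ.succ)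
        (fun q => by
          have := (hm a.succ.succ).1; rw [q, hπ0] at this
          exact absurd this (hne a).1)
        (fun q => by
          have := (hm a.succ.succ).1; rw [q, hπ1] at this
          exact absurd this (hne a).2)
      have h2 := (hm a.succ.succ).2.2.1
      have h3 := (hm a.succ.succ).2.1
      rw [hc] at h2 h3
      exact absurd h2 (not_le.2 (ha.2 c fun e => h3 (by rw [e])))
    obtain ⟨T, hT, hcov, -⟩ := clustered_or_matched w κ hpart
    exact ⟨T, by omega, hcov⟩
  -- the tuples which are not separated
  have hdiff : |∑ k ∈ B \ A, qq k| ≤ 2 ^ 6 * (n ^ 2 * (2 * (6 : ℕ) * D) ^ 6) * (2 * a4 ^ 2) := by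
    have hcl : ∀ k ∈ B \ A, Clustered R u k 2 := by
      intro k hk
      obtain ⟨hkB, hkA⟩ := Finset.mem_sdiff.1 hk
      obtain ⟨h1, h2⟩ := (Finset.mem_filter.1 hkB).2
      obtain ⟨x, y, hm⟩ := (Finset.mem_filter.1 h2).2
      have hπ1 : π 1 = 0 := hπ0 ▸ (hm 0).1
      have hv : ∀ v : Fin 6, v ≠ 0 → v ≠ 1 → ∃ c : Fin 4, v = c.succ.succ := by decide
      have hclose : ∀ a, edist (k a) (k (π a)) ≤ R := by
        intro a
        by_cases ha0 : a = 0
        · rw [ha0, hπ0]; exact h1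
        by_cases ha1 : a = 1
        · rw [ha1, hπ1, edist_comm]; exact h1
        obtain ⟨c, rfl⟩ := hv a ha0 ha1
        obtain ⟨d, hd⟩ := hv (π c.succ.succ)
          (fun q => by have := (hm c.succ.succ).1; rw [q, hπ0] at this; exact ha1 this.symm)
          (fun q => by have := (hm c.succ.succ).1; rw [q, hπ1] at this; exact ha0 this.symm)
        have := (hm c.succ.succ).2.2.1
        rw [hd] at this ⊢
        exact this
      rcases isolated_or_clustered_or_matched R (q := 2) rfl u k with ⟨a, ha⟩ | hc | ⟨π', hπ'⟩
      · exact absurd (hclose a) (not_le.2 (ha.2 _ (hm a).2.1))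
      · exact hc
      · refine absurd (Finset.mem_filter.2 ⟨Finset.mem_univ _, ?_⟩) hkA
        -- All slots are close to their `π`-partners, so a matching of this tuple can only be `π`,
        -- which is excluded.
        have : π' = π := funext fun a => hπ'.eq_of_close (hm a).2.1 (hclose a)
        exact this ▸ hπ'
    have hc := card_clustered_le hG.nbhd hG.card_pos u (B \ A) hcl
    have := sum_if_const_le (α := Fin 6 → I) (f := qq) (m := 2 * a4 ^ 2) le_rfl hc
      (by positivity) (B \ A) (fun k h1 h2 => absurd h1 h2) fun k hk _ =>
        hppb _ _ _ (Finset.mem_filter.1 (Finset.mem_sdiff.1 hk).1).2.2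
    refine this.trans (le_of_eq ?_)
    rw [← hn]; ring
  -- integrating out the pair
  have hstep : ∀ k ∈ A, |∫ ω, kerProd h u k (fun i => X i ω) ∂P - qq k| ≤ 4 * b ^ 6 * β := by
    intro k hk
    have hm := (Finset.mem_filter.1 hk).2
    have hπ1 : π 1 = 0 := hπ0 ▸ (hm 0).1
    have s1 := hK.abs_integral_sub_pairInt_le hM (u := u 0) (v := u 1) (k := k 0) (k' := k 1)
      ((hm 0).2.2.2.1 0) ((hm 0).2.2.2.1 1) ((hm 1).2.2.2.1 0) ((hm 1).2.2.2.1 1)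
      (g := kerProd h w (Fin.tail (Fin.tail k))) (hK.measurable_kerProd _ _) (B := b ^ 4)
      (hK.abs_kerProd_le _ _) fun ξ ζ hd => by
        refine kerProd_congr _ _ (fun a => hd _ ((hm 0).2.2.2.1 _) ((hm 1).2.2.2.1 _)) fun a => ?_
        exact hd _ ((hm 0).2.2.2.2 a.succ.succ (by revert a; decide)
          (by rw [hπ0]; revert a; decide)) ((hm 1).2.2.2.2 a.succ.succ (by revert a; decide)
          (by rw [hπ1]; revert a; decide))
    have e1 : ∫ ω, kerProd h u k (fun i => X i ω) ∂P = ∫ ω, h (u 0) (k 0) (X (u 0) ω) (X (k 0) ω) *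
        h (u 1) (k 1) (X (u 1) ω) (X (k 1) ω) *
          kerProd h w (Fin.tail (Fin.tail k)) (fun i => X i ω) ∂P := by
      refine integral_congr_ae (ae_of_all _ fun ω => ?_)
      simp only
      conv_lhs => rw [← hkeq k]
      simp only [hkk]
      rw [kerProd_cons, kerProd_cons, mul_assoc]
      rfl
    rw [e1]
    refine s1.trans (le_of_eq ?_)
    ring
  have hA1 : |∑ k ∈ A, (∫ ω, kerProd h u k (fun i => X i ω) ∂P - qq k)| ≤ 1 := by
    have := sum_if_const_le (α := Fin 6 → I) (S := ∅) (c := 0) (m := 0) (T := A)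
      (f := fun k => ∫ ω, kerProd h u k (fun i => X i ω) ∂P - qq k)
      (t := 4 * b ^ 6 * β) (by positivity) (by simp) le_rfl (fun k hk _ => hstep k hk)
      (by simp)
    refine this.trans ?_
    rw [Fintype.card_fun, Fintype.card_fin, ← hn]
    push_cast
    linarith
  have hsplit : ∑ k ∈ A, qq k = ∑ k ∈ B, qq k - ∑ k ∈ B \ A, qq k := by
    rw [← Finset.sum_sdiff hAB]; ring
  rw [Finset.sum_sub_distrib, hsplit] at hA1
  have hn1 : (1 : ℝ) ≤ n := by exact_mod_cast hG.card_pos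
  have hD1 : (1 : ℝ) ≤ D := by exact_mod_cast hG.nbhd.one_le hG.card_pos
  have hNc' := mul_le_mul_of_nonneg_right hNc (show 0 ≤ Λ ^ 2 / 2 + a4 ^ 2 by positivity)
  have htot : |∑ k ∈ A, ∫ ω, kerProd h u k (fun i => X i ω) ∂P| ≤
      1 + 2 ^ 4 * (n ^ 2 * (2 * (4 : ℕ) * D) ^ 4) * (Λ ^ 2 / 2 + a4 ^ 2) +
        2 ^ 6 * (n ^ 2 * (2 * (6 : ℕ) * D) ^ 6) * (2 * a4 ^ 2) := by
    have key : ∀ s b d c₁ c₂ : ℝ, |s - (b - d)| ≤ 1 → |b| ≤ c₁ → |d| ≤ c₂ → |s| ≤ 1 + c₁ + c₂ := by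
      intro s b d c₁ c₂ h1 h2 h3
      rw [abs_le] at *
      constructor <;> linarith [h1.1, h1.2, h2.1, h2.2, h3.1, h3.2]
    exact key _ _ _ _ _ hA1 (hsumB.trans hNc') hdiff
  refine htot.trans ?_
  push_cast
  have h46 : (n : ℝ) ^ 2 * D ^ 4 ≤ n ^ 2 * D ^ 6 :=
    mul_le_mul_of_nonneg_left (pow_le_pow_right₀ hD1 (by norm_num)) (by positivity)
  have h1 : (1 : ℝ) ≤ n ^ 2 * D ^ 6 := one_le_mul_of_one_le_of_one_le (one_le_pow₀ hn1) (one_le_pow₀ hD1)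
  have h2 : (1 : ℝ) ≤ a4 ^ 2 := one_le_pow₀ ha1
  have h3 : (n : ℝ) ^ 2 * D ^ 4 * (Λ ^ 2 / 2 + a4 ^ 2) ≤ n ^ 2 * D ^ 6 * (Λ ^ 2 / 2 + a4 ^ 2) :=
    mul_le_mul_of_nonneg_right h46 (by positivity)
  have h4 : (1 : ℝ) ≤ n ^ 2 * D ^ 6 * a4 ^ 2 := one_le_mul_of_one_le_of_one_le h1 h2
  have h5 : 0 ≤ (n : ℝ) ^ 2 * D ^ 6 * Λ ^ 2 := by positivity
  nlinarith

end SixthOrder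

/-! ### The second moment of the third-order term -/

section ThirdTerm

variable {Ω I E : Type*} [MeasurableSpace Ω] [MeasurableSpace E] [Fintype I] [EMetricSpace I]
variable {P : Measure Ω} [IsProbabilityMeasure P] {X : I → Ω → E} {R : ℝ≥0∞} {β : ℝ}
  {h : I → I → E → E → ℝ} {b : ℝ} {D : ℕ} {a4 Λ : ℝ}

open Classical in
-- Relabelling the slots is harmless, so a matching may be brought to a normal form in which a
-- chosen pair consists of the slots 0 and 1.
lemma sum_matched_comp_perm {r : ℕ} (u : Fin r → I) (π : Fin r → Fin r)
    (e : Equiv.Perm (Fin r)) :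
    ∑ k with Matched R u k π, ∫ ω, kerProd h u k (fun i => X i ω) ∂P =
      ∑ k with Matched R (u ∘ e) k (e.symm ∘ π ∘ e),
        ∫ ω, kerProd h (u ∘ e) k (fun i => X i ω) ∂P := by
  have hee : ∀ (f : Fin r → I), (f ∘ e) ∘ e.symm = f := fun f => by funext a; simp
  have hM : ∀ k : Fin r → I, Matched R u k π ↔
      Matched R (u ∘ e) (k ∘ e) (e.symm ∘ π ∘ e) := fun k => by
    constructor
    · exact fun hm => hm.comp_perm e
    · intro hm
      have := hm.comp_perm e.symm
      rw [hee, hee] at this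
      convert this using 1
      funext a; simp
  rw [Finset.sum_filter, Finset.sum_filter, ← (e.symm.arrowCongr (Equiv.refl I)).sum_comp fun k =>
    if Matched R (u ∘ e) k (e.symm ∘ π ∘ e) then
      ∫ ω, kerProd h (u ∘ e) k (fun i => X i ω) ∂P else 0]
  refine Finset.sum_congr rfl fun k _ => ?_
  have e1 : (e.symm.arrowCongr (Equiv.refl I)) k = k ∘ e := by
    funext a; simp [Equiv.arrowCongr]
  rw [e1]
  simp only [hM k, kerProd_comp_perm]

/-- A partition of six slots into two groups of three. -/
def group : Fin 6 → Bool := ![true, false, true, true, false, false]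

/-- A set of three elements has no fixed-point-free involution. Only the three values on the group
vary, the others being filled with 0, so that the decision runs over `6³` cases. -/
lemma not_involution_on_group : ∀ p₀ p₂ p₃ : Fin 6, group p₀ = true → group p₂ = true →
    group p₃ = true → ¬ ∀ a : Fin 6, group a = true →
      (![p₀, 0, p₂, p₃, 0, 0] : Fin 6 → Fin 6) ((![p₀, 0, p₂, p₃, 0, 0] : Fin 6 → Fin 6) a) = a ∧
        (![p₀, 0, p₂, p₃, 0, 0] : Fin 6 → Fin 6) a ≠ a := by
  decide

lemma exists_group_ne {π : Fin 6 → Fin 6} (hπ : ∀ a, π (π a) = a ∧ π a ≠ a) :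
    ∃ a, group a = true ∧ group (π a) = false := by
  by_contra! hcon
  have hg : ∀ a, group a = true → group (π a) = true := fun a ha => by
    simpa using hcon a ha
  refine not_involution_on_group (π 0) (π 2) (π 3) (hg _ rfl) (hg _ rfl) (hg _ rfl) fun a ha => ?_
  have e : ∀ c, group c = true → (![π 0, 0, π 2, π 3, 0, 0] : Fin 6 → Fin 6) c = π c := by
    intro c hc
    fin_cases c
    · rfl
    · exact absurd hc (by decide)
    · rfl
    · rfl
    · exact absurd hc (by decide)
    · exact absurd hc (by decide)
  rw [e a ha, e _ (hg a ha)]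
  exact hπ a

/-- The slots 0 and 1 belong to the two different groups, and each transposition stays inside one
group. -/
lemma exists_perm_group : ∀ a c : Fin 6, group a = true → group c = false →
    (Equiv.swap 0 a * Equiv.swap 1 c) 0 = a ∧ (Equiv.swap 0 a * Equiv.swap 1 c) 1 = c ∧
      ∀ d, group ((Equiv.swap 0 a * Equiv.swap 1 c) d) = group d := by
  decide

open Classical in
-- The groups have odd size, so every perfect matching has a pair across them; a permutation that
-- respects the groups moves it to the slots 0 and 1.
lemma IsGood.abs_sum_matched_six_le_of_group (hG : IsGood P X R h b β D a4 Λ) (u : Fin 6 → I)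
    (hu : ∀ a c, group a ≠ group c → R < edist (u a) (u c)) (π : Fin 6 → Fin 6) :
    |∑ k with Matched R u k π, ∫ ω, kerProd h u k (fun i => X i ω) ∂P| ≤
      2 ^ 30 * Fintype.card I ^ 2 * D ^ 6 * (a4 ^ 2 + Λ ^ 2) := by
  by_cases hπ : ∀ a, π (π a) = a ∧ π a ≠ a
  · obtain ⟨a, ha, hc⟩ := exists_group_ne hπ
    obtain ⟨e0, e1, eg⟩ := exists_perm_group a (π a) ha hc
    set e : Equiv.Perm (Fin 6) := Equiv.swap 0 a * Equiv.swap 1 (π a) with he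
    have hu' : ∀ a c, group a ≠ group c → R < edist ((u ∘ e) a) ((u ∘ e) c) := fun a c hac =>
      hu _ _ (by rwa [eg, eg])
    rw [sum_matched_comp_perm u π e]
    refine hG.abs_sum_matched_six_le (u ∘ e) ?_ (hu' _ _ (by decide)) (hu' _ _ (by decide))
      (hu' _ _ (by decide)) (hu' _ _ (by decide)) (hu' _ _ (by decide))
    rw [Function.comp_apply, Function.comp_apply, e0, Equiv.symm_apply_eq, e1]
  · rw [Finset.filter_false_of_mem fun k _ hm => hπ fun a => ⟨(hm a).1, (hm a).2.1⟩,
      Finset.sum_empty, abs_zero]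
    have := hG.one_le_a4
    positivity

/-- The sixth-order moments over two far groups of row sums. -/
theorem IsGood.abs_integral_prod_six_le (hG : IsGood P X R h b β D a4 Λ) (u : Fin 6 → I)
    (hu : ∀ a c, group a ≠ group c → R < edist (u a) (u c)) :
    |∫ ω, ∏ a, rowSum h (u a) (fun i => X i ω) ∂P| ≤
      2 ^ 47 * Fintype.card I ^ 2 * D ^ 6 * (b ^ 2 * a4 + a4 ^ 2 + Λ ^ 2) := by
  classical
  have hK := hG.kernel
  have hM := hG.mixing
  have hβ := hM.nonneg
  have ha1 := hG.one_le_a4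
  have hb1 := hG.one_le_b
  set n := Fintype.card I with hn
  set m : (Fin 6 → I) → ℝ := fun k => ∫ ω, kerProd h u k (fun i => X i ω) ∂P with hm
  have hexp : ∫ ω, ∏ a, rowSum h (u a) (fun i => X i ω) ∂P = ∑ k, m k := by
    simp only [prod_rowSum]
    exact integral_finsetSum _ fun k _ => hM.integrable_comp (hK.measurable_kerProd u k)
      (hK.abs_kerProd_le u k)
  set M := Finset.univ.filter fun k : Fin 6 → I => ∃ π, Matched R u k π with hMdef
  set S := Finset.univ.filter fun k : Fin 6 → I => Clustered R u k 2 with hS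
  have hMsum : ∑ k ∈ M, m k = ∑ π : Fin 6 → Fin 6, ∑ k with Matched R u k π, m k := by
    rw [← Finset.sum_biUnion]
    · refine Finset.sum_congr ?_ fun _ _ => rfl
      ext k; simp [hMdef]
    · intro π _ π' _ hne
      simp only [Function.onFun]
      rw [Finset.disjoint_left]
      exact fun k h1 h2 => hne ((Finset.mem_filter.1 h1).2.eq (Finset.mem_filter.1 h2).2)
  have hMb : |∑ k ∈ M, m k| ≤ 6 ^ 6 * (2 ^ 30 * n ^ 2 * D ^ 6 * (a4 ^ 2 + Λ ^ 2)) := by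
    rw [hMsum]
    refine (Finset.abs_sum_le_sum_abs _ _).trans ((Finset.sum_le_card_nsmul _ _ _ fun π _ =>
      hG.abs_sum_matched_six_le_of_group u hu π).trans (le_of_eq ?_))
    rw [nsmul_eq_mul, Finset.card_univ, Fintype.card_fun, Fintype.card_fin]
    push_cast; ring
  have hcard := card_clustered_le hG.nbhd hG.card_pos u S fun k hk => (Finset.mem_filter.1 hk).2
  have hrest := sum_if_const_le (α := Fin 6 → I) (f := m) (t := 4 * b ^ 6 * β) (m := b ^ 2 * a4)
    (by positivity) hcard (by positivity) (Finset.univ \ M) (fun k hk hkS => by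
      rcases isolated_or_clustered_or_matched R (q := 2) rfl u k with ⟨a, ha⟩ | hc | hπ
      · exact hK.abs_integral_kerProd_le_of_isolated hM u k ha
      · exact (hkS (Finset.mem_filter.2 ⟨Finset.mem_univ _, hc⟩)).elim
      · exact ((Finset.mem_sdiff.1 hk).2 (Finset.mem_filter.2 ⟨Finset.mem_univ _, hπ⟩)).elim)
    fun k _ _ => abs_integral_le_integral_abs.trans
      (hK.integral_abs_kerProd_six_le hM (by linarith) hG.fourth u k)
  have hτ := hG.tiny (p := 6) (q := 6) (by norm_num) (by norm_num)
  have hn1 : (1 : ℝ) ≤ n := by exact_mod_cast hG.card_pos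
  have hD1 : (1 : ℝ) ≤ D := by exact_mod_cast hG.nbhd.one_le hG.card_pos
  have e1 : (Fintype.card (Fin 6 → I) : ℝ) * (4 * b ^ 6 * β) ≤ 1 := by
    rw [Fintype.card_fun, Fintype.card_fin, ← hn]; push_cast; linarith
  rw [hexp, ← Finset.sum_sdiff (Finset.subset_univ M)]
  refine (abs_add_le _ _).trans ((add_le_add hrest hMb).trans ?_)
  rw [← hn]
  have h1 : (1 : ℝ) ≤ n ^ 2 * D ^ 6 :=
    one_le_mul_of_one_le_of_one_le (one_le_pow₀ hn1) (one_le_pow₀ hD1)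
  have h2 : (1 : ℝ) ≤ n ^ 2 * D ^ 6 * (b ^ 2 * a4) :=
    one_le_mul_of_one_le_of_one_le h1 (one_le_mul_of_one_le_of_one_le (one_le_pow₀ hb1) ha1)
  have h3 : 0 ≤ (n : ℝ) ^ 2 * D ^ 6 * a4 ^ 2 := by positivity
  have h4 : 0 ≤ (n : ℝ) ^ 2 * D ^ 6 * Λ ^ 2 := by positivity
  push_cast
  nlinarith

/-- The plain count of tuples without isolated slots, of order `n³`, used for indices `i`, `i'` that
are not separated. -/
lemma IsGood.abs_integral_prod_six_le_of_near (hG : IsGood P X R h b β D a4 Λ) (u : Fin 6 → I) :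
    |∫ ω, ∏ a, rowSum h (u a) (fun i => X i ω) ∂P| ≤
      2 ^ 28 * Fintype.card I ^ 3 * D ^ 6 * (b ^ 2 * a4) := by
  have ha1 := hG.one_le_a4
  have hb1 := hG.one_le_b
  have h1 := hG.kernel.abs_integral_prod_rowSum_le hG.mixing hG.nbhd hG.card_pos
    (zero_le_one.trans hb1) (r := 6) (q := 3) (by norm_num) u
    (hG.kernel.integral_abs_kerProd_six_le hG.mixing (by linarith) hG.fourth u)
  have h2 := hG.tiny (p := 6) (q := 6) (by norm_num) (by norm_num)
  have hn1 : (1 : ℝ) ≤ Fintype.card I := by exact_mod_cast hG.card_pos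
  have hD1 : (1 : ℝ) ≤ D := by exact_mod_cast hG.nbhd.one_le hG.card_pos
  have h3 : (1 : ℝ) ≤ Fintype.card I ^ 3 * D ^ 6 * (b ^ 2 * a4) :=
    one_le_mul_of_one_le_of_one_le (one_le_mul_of_one_le_of_one_le (one_le_pow₀ hn1)
      (one_le_pow₀ hD1)) (one_le_mul_of_one_le_of_one_le (one_le_pow₀ hb1) ha1)
  push_cast at h1
  nlinarith

lemma abs_sum_le_mul {α : Type*} {S : Finset α} {f : α → ℝ} {c d : ℝ} (hS : (S.card : ℝ) ≤ d)
    (hc : 0 ≤ c) (hf : ∀ a ∈ S, |f a| ≤ c) : |∑ a ∈ S, f a| ≤ d * c :=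
  (Finset.abs_sum_le_sum_abs _ _).trans ((Finset.sum_le_card_nsmul _ _ _ hf).trans (by
    rw [nsmul_eq_mul]; exact mul_le_mul_of_nonneg_right hS hc))

open Classical in
lemma IsGood.abs_integral_localSum_sq_mul_le (hG : IsGood P X R h b β D a4 Λ) (i i' : I) :
    |∫ ω, (rowSum h i (fun l => X l ω) * localSum h R i (fun l => X l ω) ^ 2) *
      (rowSum h i' (fun l => X l ω) * localSum h R i' (fun l => X l ω) ^ 2) ∂P| ≤
      2 ^ 47 * Fintype.card I ^ 2 * D ^ 10 * (b ^ 2 * a4 + a4 ^ 2 + Λ ^ 2) +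
        if edist i i' ≤ 3 * R then 2 ^ 28 * Fintype.card I ^ 3 * D ^ 10 * (b ^ 2 * a4) else 0 := by
  have ha1 := hG.one_le_a4
  set n := Fintype.card I with hn
  set N : I → Finset I := fun i => Finset.univ.filter fun j => edist i j ≤ R with hN
  have hNc : ∀ i, ((N i).card : ℝ) ≤ D := fun i => hG.nbhd.card_le_one i
  set F : ℝ := 2 ^ 47 * n ^ 2 * D ^ 6 * (b ^ 2 * a4 + a4 ^ 2 + Λ ^ 2) +
    if edist i i' ≤ 3 * R then 2 ^ 28 * n ^ 3 * D ^ 6 * (b ^ 2 * a4) else 0 with hF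
  have hF0 : 0 ≤ F := by rw [hF]; split_ifs <;> positivity
  have hexp : ∀ ω, (rowSum h i (fun l => X l ω) * localSum h R i (fun l => X l ω) ^ 2) *
      (rowSum h i' (fun l => X l ω) * localSum h R i' (fun l => X l ω) ^ 2) =
      -- The order `i, i', j, l, j', l'` explains the choice of `group`: the slots 0, 2, 3 belong to
      -- `i` and the slots 1, 4, 5 to `i'`.
      ∑ j ∈ N i, ∑ l ∈ N i, ∑ j' ∈ N i', ∑ l' ∈ N i',
        ∏ a, rowSum h ((![i, i', j, l, j', l'] : Fin 6 → I) a) (fun l => X l ω) := by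
    intro ω
    have e : ∀ j l j' l', ∏ a, rowSum h ((![i, i', j, l, j', l'] : Fin 6 → I) a) (fun l => X l ω) =
        rowSum h i (fun l => X l ω) * rowSum h i' (fun l => X l ω) * rowSum h j (fun l => X l ω) *
          rowSum h l (fun l => X l ω) * rowSum h j' (fun l => X l ω) *
          rowSum h l' (fun l => X l ω) := fun j l j' l' => by
      rw [Fin.prod_univ_six]; rfl
    simp only [e, ← Finset.mul_sum, ← Finset.sum_mul, localSum, hN]
    ring
  have hint : ∀ j l j' l', Integrable (fun ω =>
      ∏ a, rowSum h ((![i, i', j, l, j', l'] : Fin 6 → I) a) (fun l => X l ω)) P := fun j l j' l' =>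
    hG.integrable_prod_rowSum _
  have hterm : ∀ j ∈ N i, ∀ l ∈ N i, ∀ j' ∈ N i', ∀ l' ∈ N i', |∫ ω,
      ∏ a, rowSum h ((![i, i', j, l, j', l'] : Fin 6 → I) a) (fun l => X l ω) ∂P| ≤ F := by
    intro j hj l hl j' hj' l' hl'
    by_cases hii : edist i i' ≤ 3 * R
    · rw [hF, if_pos hii]
      refine (hG.abs_integral_prod_six_le_of_near _).trans (le_add_of_nonneg_left (by positivity))
    · rw [hF, if_neg hii, add_zero]
      refine hG.abs_integral_prod_six_le _ ?_
      have h3 : (3 : ℝ≥0∞) * R = R + R + R := by ring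
      have hfar : ∀ x y, edist i x ≤ R → edist i' y ≤ R → R < edist x y := by
        intro x y hx hy
        by_contra! hcon
        refine hii ?_
        calc edist i i' ≤ edist i x + edist x y + edist y i' := edist_triangle4 _ _ _ _
          _ ≤ R + R + R := add_le_add (add_le_add hx hcon) (by rwa [edist_comm])
          _ = 3 * R := h3.symm
      have h1 : ∀ a, group a = true → edist i ((![i, i', j, l, j', l'] : Fin 6 → I) a) ≤ R := by
        intro a ha
        fin_cases a
        · simp
        · exact absurd ha (by decide)
        · exact (Finset.mem_filter.1 hj).2
        · exact (Finset.mem_filter.1 hl).2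
        · exact absurd ha (by decide)
        · exact absurd ha (by decide)
      have h2 : ∀ a, group a = false → edist i' ((![i, i', j, l, j', l'] : Fin 6 → I) a) ≤ R := by
        intro a ha
        fin_cases a
        · exact absurd ha (by decide)
        · simp
        · exact absurd ha (by decide)
        · exact absurd ha (by decide)
        · exact (Finset.mem_filter.1 hj').2
        · exact (Finset.mem_filter.1 hl').2
      intro a c hac
      rcases ha : group a with _ | _
      · rcases hc : group c with _ | _
        · exact absurd (ha.trans hc.symm) hac
        · rw [edist_comm]; exact hfar _ _ (h1 c hc) (h2 a ha)
      · rcases hc : group c with _ | _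
        · exact hfar _ _ (h1 a ha) (h2 c hc)
        · exact absurd (ha.trans hc.symm) hac
  simp only [hexp]
  have hD0 : (0 : ℝ) ≤ D := Nat.cast_nonneg _
  have key : |∫ ω, ∑ j ∈ N i, ∑ l ∈ N i, ∑ j' ∈ N i', ∑ l' ∈ N i',
        ∏ a, rowSum h ((![i, i', j, l, j', l'] : Fin 6 → I) a) (fun l => X l ω) ∂P| ≤
      D * (D * (D * (D * F))) := by
    rw [integral_finsetSum _ fun j _ => integrable_finsetSum _ fun l _ => integrable_finsetSum _
      fun j' _ => integrable_finsetSum _ fun l' _ => hint j l j' l']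
    refine abs_sum_le_mul (hNc i) (by positivity) fun j hj => ?_
    rw [integral_finsetSum _ fun l _ => integrable_finsetSum _
      fun j' _ => integrable_finsetSum _ fun l' _ => hint j l j' l']
    refine abs_sum_le_mul (hNc i) (by positivity) fun l hl => ?_
    rw [integral_finsetSum _ fun j' _ => integrable_finsetSum _ fun l' _ => hint j l j' l']
    refine abs_sum_le_mul (hNc i') (by positivity) fun j' hj' => ?_
    rw [integral_finsetSum _ fun l' _ => hint j l j' l']
    exact abs_sum_le_mul (hNc i') hF0 fun l' hl' => hterm j hj l hl j' hj' l' hl'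
  refine key.trans (le_of_eq ?_)
  rw [hF]
  split_ifs <;> ring

/-- The second moment of `∑ᵢ Yᵢ Lᵢ²`. -/
theorem IsGood.integral_sq_sum_localSum_sq_le (hG : IsGood P X R h b β D a4 Λ) :
    ∫ ω, (∑ i, rowSum h i (fun l => X l ω) * localSum h R i (fun l => X l ω) ^ 2) ^ 2 ∂P ≤
      2 ^ 48 * Fintype.card I ^ 4 * D ^ 11 * (b ^ 2 * a4 + a4 ^ 2 + Λ ^ 2) := by
  classical
  have ha1 := hG.one_le_a4
  have hK := hG.kernel
  set n := Fintype.card I with hn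
  have hint : ∀ i i', Integrable (fun ω =>
      (rowSum h i (fun l => X l ω) * localSum h R i (fun l => X l ω) ^ 2) *
      (rowSum h i' (fun l => X l ω) * localSum h R i' (fun l => X l ω) ^ 2)) P := fun i i' =>
    hG.mixing.integrable_comp (Φ := fun ξ => (rowSum h i ξ * localSum h R i ξ ^ 2) *
      (rowSum h i' ξ * localSum h R i' ξ ^ 2))
      (((hK.measurable_rowSum i).mul ((hK.measurable_localSum i).pow_const 2)).mul
        ((hK.measurable_rowSum i').mul ((hK.measurable_localSum i').pow_const 2)))
      (B := (n * b * (n * (n * b)) ^ 2) * (n * b * (n * (n * b)) ^ 2)) fun ξ => by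
        have hb : ∀ i, |rowSum h i ξ * localSum h R i ξ ^ 2| ≤ n * b * (n * (n * b)) ^ 2 := fun i => by
          rw [abs_mul, abs_pow]
          exact mul_le_mul (hK.abs_rowSum_le i ξ) (pow_le_pow_left₀ (abs_nonneg _)
            (hK.abs_localSum_le i ξ) 2) (by positivity) ((abs_nonneg _).trans
              (hK.abs_rowSum_le i ξ))
        rw [abs_mul]
        exact mul_le_mul (hb i) (hb i') (abs_nonneg _) ((abs_nonneg _).trans (hb i))
  simp only [sq (∑ i, _), Finset.sum_mul_sum]
  rw [integral_finsetSum _ fun i _ => integrable_finsetSum _ fun i' _ => hint i i']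
  set A : ℝ := 2 ^ 47 * n ^ 2 * D ^ 10 * (b ^ 2 * a4 + a4 ^ 2 + Λ ^ 2) with hA
  set B : ℝ := 2 ^ 28 * n ^ 3 * D ^ 10 * (b ^ 2 * a4) with hB
  have hB0 : 0 ≤ B := by positivity
  have hrow : ∀ i, ∫ ω, ∑ i', (rowSum h i (fun l => X l ω) * localSum h R i (fun l => X l ω) ^ 2) *
      (rowSum h i' (fun l => X l ω) * localSum h R i' (fun l => X l ω) ^ 2) ∂P ≤ n * A + D * B := by
    intro i
    rw [integral_finsetSum _ fun i' _ => hint i i']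
    refine (Finset.sum_le_sum fun i' _ => (le_abs_self _).trans
      (hG.abs_integral_localSum_sq_mul_le i i')).trans ?_
    rw [Finset.sum_add_distrib, ← Finset.sum_filter]
    simp only [Finset.sum_const, nsmul_eq_mul, Finset.card_univ]
    have := mul_le_mul_of_nonneg_right (hG.nbhd.card_le (c := 3) (by norm_num) i) hB0
    push_cast at this
    linarith
  refine (Finset.sum_le_card_nsmul _ _ _ fun i _ => hrow i).trans ?_
  rw [nsmul_eq_mul, Finset.card_univ, ← hn, hA, hB]
  have hD1 : (1 : ℝ) ≤ D := by exact_mod_cast hG.nbhd.one_le hG.card_pos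
  have hc : 0 ≤ b ^ 2 * a4 + a4 ^ 2 + Λ ^ 2 := by positivity
  have h10 : (n : ℝ) ^ 3 * (b ^ 2 * a4 + a4 ^ 2 + Λ ^ 2) * D ^ 10 ≤
      n ^ 3 * (b ^ 2 * a4 + a4 ^ 2 + Λ ^ 2) * D ^ 11 :=
    mul_le_mul_of_nonneg_left (pow_le_pow_right₀ hD1 (by norm_num)) (by positivity)
  have h11 : 0 ≤ (n : ℝ) ^ 3 * D ^ 11 * (a4 ^ 2 + Λ ^ 2) := by positivity
  have h12 : 0 ≤ (n : ℝ) ^ 3 * D ^ 11 * (b ^ 2 * a4) := by positivity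
  rw [show (2 : ℝ) ^ 48 * n ^ 4 * D ^ 11 * (b ^ 2 * a4 + a4 ^ 2 + Λ ^ 2) = n * (2 ^ 48 *
    (n ^ 3 * (b ^ 2 * a4 + a4 ^ 2 + Λ ^ 2) * D ^ 11)) by ring]
  refine mul_le_mul_of_nonneg_left ?_ (Nat.cast_nonneg _)
  nlinarith

end ThirdTerm

/-! ### Stein's method for characteristic functions -/

section CharacteristicFunction

/-- The Taylor remainder for `|x| ≤ 1`, and the trivial bound `2 + |x| + |x|²/2` beyond; the cubic
estimate therefore holds for all `x`, and `Δ_i` need not be small. -/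
lemma norm_exp_mul_I_sub_le (x : ℝ) :
    ‖Complex.exp (x * Complex.I) - (1 + x * Complex.I - x ^ 2 / 2)‖ ≤ 4 * |x| ^ 3 := by
  have hI : ‖(x : ℂ) * Complex.I‖ = |x| := by simp
  by_cases hx : |x| ≤ 1
  · have h := Complex.norm_exp_sub_sum_le_norm_mul_exp (x * Complex.I) 3
    have e : ∑ m ∈ Finset.range 3, ((x : ℂ) * Complex.I) ^ m / (m.factorial : ℂ) =
        1 + x * Complex.I - x ^ 2 / 2 := by
      simp [Finset.sum_range_succ, mul_pow]
      ring
    rw [e, hI] at h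
    refine h.trans ?_
    have h1 : Real.exp |x| ≤ 4 := by
      have := Real.exp_le_exp.2 hx
      have := Real.exp_one_lt_d9
      linarith
    rw [mul_comm]
    exact mul_le_mul_of_nonneg_right h1 (by positivity)
  · push Not at hx
    have h2 : ‖(x : ℂ) ^ 2 / 2‖ = |x| ^ 2 / 2 := by simp
    calc ‖Complex.exp (x * Complex.I) - (1 + x * Complex.I - x ^ 2 / 2)‖
        ≤ ‖Complex.exp (x * Complex.I)‖ + ‖1 + x * Complex.I - (x : ℂ) ^ 2 / 2‖ := norm_sub_le _ _
      _ ≤ 1 + (1 + |x| + |x| ^ 2 / 2) := by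
          rw [Complex.norm_exp_ofReal_mul_I]
          gcongr
          refine (norm_sub_le _ _).trans (add_le_add ((norm_add_le _ _).trans ?_) h2.le)
          rw [hI, norm_one]
      _ ≤ 4 * |x| ^ 3 := by nlinarith [mul_pos (zero_lt_one.trans hx) (zero_lt_one.trans hx)]

variable {Ω : Type*} [MeasurableSpace Ω] {P : Measure Ω} [IsProbabilityMeasure P]

lemma hasDerivAt_integral_exp {W : Ω → ℝ} (hW : Measurable W) {B : ℝ} (hB : ∀ ω, |W ω| ≤ B) (t : ℝ) :
    HasDerivAt (fun s : ℝ => ∫ ω, Complex.exp (s * W ω * Complex.I) ∂P)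
      (∫ ω, W ω * Complex.I * Complex.exp (t * W ω * Complex.I) ∂P) t := by
  have hWc : Measurable fun ω => (W ω : ℂ) := Complex.measurable_ofReal.comp hW
  have hm : ∀ s : ℝ, Measurable fun ω => Complex.exp (s * W ω * Complex.I) := fun s =>
    Complex.measurable_exp.comp ((measurable_const.mul hWc).mul measurable_const)
  have hn : ∀ (s : ℝ) ω, ‖Complex.exp (s * W ω * Complex.I)‖ = 1 := fun s ω => by
    rw [← Complex.ofReal_mul]; exact Complex.norm_exp_ofReal_mul_I _
  refine (hasDerivAt_integral_of_dominated_loc_of_deriv_le (s := Set.univ) (bound := fun _ => B)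
    (F := fun (s : ℝ) ω => Complex.exp (s * W ω * Complex.I))
    (F' := fun (s : ℝ) ω => W ω * Complex.I * Complex.exp (s * W ω * Complex.I))
    Filter.univ_mem (Filter.Eventually.of_forall fun s => (hm s).aestronglyMeasurable) ?_
    ((hWc.mul measurable_const).mul (hm t)).aestronglyMeasurable ?_ (integrable_const _) ?_).2
  · exact Integrable.of_bound (hm t).aestronglyMeasurable 1 (ae_of_all _ fun ω => (hn t ω).le)
  · refine ae_of_all _ fun ω s _ => ?_
    rw [norm_mul, hn, mul_one]
    simpa using hB ω
  · refine ae_of_all _ fun ω s _ => ?_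
    have h1 : HasDerivAt (fun s : ℝ => (s : ℂ) * W ω * Complex.I) (W ω * Complex.I) s := by
      simpa using (Complex.ofRealCLM.hasDerivAt (x := s)).mul_const ((W ω : ℂ)) |>.mul_const Complex.I
    simpa [mul_comm] using h1.cexp

/-- A bounded random variable whose characteristic function almost solves the differential equation
of the Gaussian one. -/
lemma norm_integral_exp_sub_le {W : Ω → ℝ} (hW : Measurable W) {B : ℝ} (hB : ∀ ω, |W ω| ≤ B)
    {T e : ℝ} (he : ∀ t, |t| ≤ |T| → ‖∫ ω, W ω * Complex.exp (t * W ω * Complex.I) ∂P -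
      t * Complex.I * ∫ ω, Complex.exp (t * W ω * Complex.I) ∂P‖ ≤ e) :
    ‖∫ ω, Complex.exp (T * W ω * Complex.I) ∂P - Complex.exp (-(T ^ 2 / 2))‖ ≤ |T| * e := by
  set φ : ℝ → ℂ := fun t => ∫ ω, Complex.exp (t * W ω * Complex.I) ∂P with hφ
  set ψ : ℝ → ℂ := fun t => ∫ ω, W ω * Complex.exp (t * W ω * Complex.I) ∂P with hψ
  have he0 : 0 ≤ e := (norm_nonneg _).trans (he T le_rfl)
  have hφ' : ∀ t, HasDerivAt φ (Complex.I * ψ t) t := fun t => by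
    have := hasDerivAt_integral_exp (P := P) hW hB t
    refine this.congr_deriv ?_
    rw [hψ, ← integral_const_mul]
    exact integral_congr_ae (ae_of_all _ fun ω => by simp only; ring)
  -- Integrating factor: the derivative of `e^{t²/2} φ(t)` contains only the defect of the
  -- differential equation, and the mean value inequality applies.
  have hg : ∀ t : ℝ, HasDerivAt (fun s : ℝ => Complex.exp ((s : ℂ) ^ 2 / 2) * φ s)
      (Complex.exp ((t : ℂ) ^ 2 / 2) * (Complex.I * (ψ t - t * Complex.I * φ t))) t := by
    intro t
    have h1 : HasDerivAt (fun s : ℝ => (s : ℂ) ^ 2 / 2) (t : ℂ) t := by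
      have := ((Complex.ofRealCLM.hasDerivAt (x := t)).pow 2).div_const 2
      simpa using this
    have h2 := h1.cexp.mul (hφ' t)
    refine h2.congr_deriv ?_
    have := Complex.I_mul_I
    linear_combination (Complex.exp ((t : ℂ) ^ 2 / 2) * t * φ t) * this
  have hbound : ∀ t ∈ Set.uIcc 0 T, ‖Complex.exp ((t : ℂ) ^ 2 / 2) *
      (Complex.I * (ψ t - t * Complex.I * φ t))‖ ≤ Real.exp (T ^ 2 / 2) * e := by
    intro t ht
    have htT : |t| ≤ |T| := by
      have := Set.abs_sub_left_of_mem_uIcc ht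
      simpa using this
    rw [norm_mul, norm_mul, Complex.norm_I, one_mul]
    refine mul_le_mul ?_ (he t htT) (norm_nonneg _) (Real.exp_nonneg _)
    rw [Complex.norm_exp]
    refine Real.exp_le_exp.2 ?_
    have : ((t : ℂ) ^ 2 / 2).re = t ^ 2 / 2 := by
      rw [← Complex.ofReal_pow]; norm_cast
    rw [this]
    have := sq_le_sq.2 htT
    linarith
  have hmv := (convex_uIcc (0 : ℝ) T).norm_image_sub_le_of_norm_hasDerivWithin_le
    (fun t _ => (hg t).hasDerivWithinAt) hbound Set.left_mem_uIcc Set.right_mem_uIcc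
  have hφ0 : φ 0 = 1 := by simp [hφ]
  simp only [hφ0, sub_zero] at hmv
  have hE : Complex.exp (-((T : ℂ) ^ 2 / 2)) * Complex.exp ((T : ℂ) ^ 2 / 2) = 1 := by
    rw [← Complex.exp_add]; simp
  have hfac : φ T - Complex.exp (-((T : ℂ) ^ 2 / 2)) = Complex.exp (-((T : ℂ) ^ 2 / 2)) *
      (Complex.exp ((T : ℂ) ^ 2 / 2) * φ T - Complex.exp (((0 : ℝ) : ℂ) ^ 2 / 2) * 1) := by
    rw [mul_sub, ← mul_assoc, hE]; simp
  have hnE : ‖Complex.exp (-((T : ℂ) ^ 2 / 2))‖ = Real.exp (-(T ^ 2 / 2)) := by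
    rw [Complex.norm_exp]
    congr 1
    rw [← Complex.ofReal_pow]; norm_cast
  rw [hfac, norm_mul, hnE]
  calc _ ≤ Real.exp (-(T ^ 2 / 2)) * (Real.exp (T ^ 2 / 2) * e * ‖T‖) :=
        mul_le_mul_of_nonneg_left hmv (Real.exp_nonneg _)
    _ = (Real.exp (-(T ^ 2 / 2)) * Real.exp (T ^ 2 / 2)) * (e * ‖T‖) := by ring
    _ = |T| * e := by rw [← Real.exp_add]; simp [mul_comm]

/-- Stein's expansion of the derivative of the characteristic function of a sum of locally
dependent terms. -/
lemma norm_integral_mul_exp_sub_le {ι : Type*} [Fintype ι] {Z Δ : ι → Ω → ℝ}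
    (hZ : ∀ i, Measurable (Z i)) (hΔ : ∀ i, Measurable (Δ i)) {B : ℝ} (hZB : ∀ i ω, |Z i ω| ≤ B)
    (hΔB : ∀ i ω, |Δ i ω| ≤ B) {t ε₀ v₂ v₃ v₄ : ℝ}
    (h₀ : ‖∑ i, ∫ ω, Z i ω * Complex.exp (t * (∑ j, Z j ω - Δ i ω : ℝ) * Complex.I) ∂P‖ ≤ ε₀)
    (h₂ : ∫ ω, |∑ i, Z i ω * Δ i ω - 1| ∂P ≤ v₂) (h₃ : ∫ ω, |∑ i, Z i ω * Δ i ω ^ 2| ∂P ≤ v₃)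
    (h₄ : ∑ i, ∫ ω, |Z i ω * Δ i ω ^ 3| ∂P ≤ v₄) :
    ‖∫ ω, (∑ i, Z i ω : ℝ) * Complex.exp (t * (∑ i, Z i ω : ℝ) * Complex.I) ∂P -
      t * Complex.I * ∫ ω, Complex.exp (t * (∑ i, Z i ω : ℝ) * Complex.I) ∂P‖ ≤
      ε₀ + |t| * v₂ + t ^ 2 / 2 * v₃ + 4 * |t| ^ 3 * v₄ := by
  set W : Ω → ℝ := fun ω => ∑ i, Z i ω with hWdef
  set ex : ℝ → ℂ := fun x => Complex.exp (t * x * Complex.I) with hex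
  have hexn : ∀ x, ‖ex x‖ = 1 := fun x => by
    simp only [hex]; rw [← Complex.ofReal_mul]; exact Complex.norm_exp_ofReal_mul_I _
  have hexm : Measurable ex := Complex.measurable_exp.comp
    ((measurable_const.mul Complex.measurable_ofReal).mul measurable_const)
  have hWm : Measurable W := Finset.measurable_sum _ fun i _ => hZ i
  have hWB : ∀ ω, |W ω| ≤ Fintype.card ι * B := fun ω => by
    refine (Finset.abs_sum_le_sum_abs _ _).trans ((Finset.sum_le_sum fun i _ => hZB i ω).trans ?_)
    simp
  have hbd : ∀ {f : Ω → ℂ} {M : ℝ}, Measurable f → (∀ ω, ‖f ω‖ ≤ M) → Integrable f P :=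
    fun hf hM => Integrable.of_bound hf.aestronglyMeasurable _ (ae_of_all _ hM)
  have i1 : ∀ i, Integrable (fun ω => (Z i ω : ℂ) * ex (W ω - Δ i ω)) P := fun i =>
    hbd ((Complex.measurable_ofReal.comp (hZ i)).mul (hexm.comp (hWm.sub (hΔ i)))) (M := B)
      fun ω => by rw [norm_mul, hexn, mul_one]; simpa using hZB i ω
  have i2 : Integrable (fun ω => (W ω : ℂ) * ex (W ω)) P :=
    hbd ((Complex.measurable_ofReal.comp hWm).mul (hexm.comp hWm)) fun ω => by
      rw [norm_mul, hexn, mul_one]; simpa using hWB ω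
  have i3 : Integrable (fun ω => ex (W ω)) P := hbd (hexm.comp hWm) fun ω => (hexn _).le
  have hB0 : ∀ i : ι, ∀ ω : Ω, 0 ≤ B := fun i ω => (abs_nonneg _).trans (hZB i ω)
  have j2 : Integrable (fun ω => |∑ i, Z i ω * Δ i ω - 1|) P :=
    ((integrable_finsetSum _ fun i _ => integrable_of_abs_le ((hZ i).mul (hΔ i)) (B := B * B)
      fun ω => by
        simp only [Pi.mul_apply]
        rw [abs_mul]; exact mul_le_mul (hZB i ω) (hΔB i ω) (abs_nonneg _) (hB0 i ω)).sub
        (integrable_const 1)).abs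
  have j3 : Integrable (fun ω => |∑ i, Z i ω * Δ i ω ^ 2|) P :=
    (integrable_finsetSum _ fun i _ => integrable_of_abs_le ((hZ i).mul ((hΔ i).pow_const 2))
      (B := B * B ^ 2) fun ω => by
        simp only [Pi.mul_apply]
        rw [abs_mul, abs_pow]
        exact mul_le_mul (hZB i ω) (pow_le_pow_left₀ (abs_nonneg _) (hΔB i ω) 2) (by positivity)
          (hB0 i ω)).abs
  have j4 : ∀ i, Integrable (fun ω => |Z i ω * Δ i ω ^ 3|) P := fun i =>
    (integrable_of_abs_le ((hZ i).mul ((hΔ i).pow_const 3))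
      (B := B * B ^ 3) fun ω => by
        simp only [Pi.mul_apply]
        rw [abs_mul, abs_pow]
        exact mul_le_mul (hZB i ω) (pow_le_pow_left₀ (abs_nonneg _) (hΔB i ω) 3) (by positivity)
          (hB0 i ω)).abs
  have hpt : ∀ ω, ‖(W ω : ℂ) * ex (W ω) - t * Complex.I * ex (W ω) -
      ∑ i, (Z i ω : ℂ) * ex (W ω - Δ i ω)‖ ≤ |t| * |∑ i, Z i ω * Δ i ω - 1| +
        t ^ 2 / 2 * |∑ i, Z i ω * Δ i ω ^ 2| + 4 * |t| ^ 3 * ∑ i, |Z i ω * Δ i ω ^ 3| := by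
    intro ω
    set r : ι → ℂ := fun i => Complex.exp (((-(t * Δ i ω) : ℝ) : ℂ) * Complex.I) -
      (1 + ((-(t * Δ i ω) : ℝ) : ℂ) * Complex.I - ((-(t * Δ i ω) : ℝ) : ℂ) ^ 2 / 2) with hr
    have hrn : ∀ i, ‖r i‖ ≤ 4 * |t| ^ 3 * |Δ i ω| ^ 3 := fun i => by
      refine (norm_exp_mul_I_sub_le _).trans (le_of_eq ?_)
      rw [abs_neg, abs_mul]; ring
    have hexs : ∀ i, ex (W ω - Δ i ω) = ex (W ω) * (1 + ((-(t * Δ i ω) : ℝ) : ℂ) * Complex.I -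
        ((-(t * Δ i ω) : ℝ) : ℂ) ^ 2 / 2 + r i) := fun i => by
      simp only [hr, hex]
      rw [add_sub_cancel, ← Complex.exp_add]
      congr 1
      push_cast; ring
    -- The zeroth-order term `∑ Z_i ex(W)` is `W ex(W)` and cancels. The first-order term is
    -- compared with `it ex(W)`, which leaves `∑ Z_i Δ_i - 1`.
    have e : (W ω : ℂ) * ex (W ω) - t * Complex.I * ex (W ω) -
        ∑ i, (Z i ω : ℂ) * ex (W ω - Δ i ω) = ex (W ω) * (t * Complex.I *
          ((∑ i, Z i ω * Δ i ω - 1 : ℝ) : ℂ) + (t ^ 2 / 2 : ℝ) * ((∑ i, Z i ω * Δ i ω ^ 2 : ℝ) : ℂ) -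
          ∑ i, (Z i ω : ℂ) * r i) := by
      have hW' : (W ω : ℂ) = ∑ i, (Z i ω : ℂ) := by simp [hWdef]
      have : ∑ i, (Z i ω : ℂ) * ex (W ω - Δ i ω) = ex (W ω) * (∑ i, (Z i ω : ℂ) -
          t * Complex.I * ∑ i, (Z i ω : ℂ) * Δ i ω - t ^ 2 / 2 * ∑ i, (Z i ω : ℂ) * Δ i ω ^ 2 +
          ∑ i, (Z i ω : ℂ) * r i) := by
        rw [Finset.mul_sum, Finset.mul_sum, ← Finset.sum_sub_distrib, ← Finset.sum_sub_distrib,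
          ← Finset.sum_add_distrib, Finset.mul_sum]
        refine Finset.sum_congr rfl fun i _ => ?_
        rw [hexs]; push_cast; ring
      rw [this, hW']
      push_cast
      ring
    rw [e, norm_mul, hexn, one_mul]
    refine (norm_sub_le _ _).trans (add_le_add ((norm_add_le _ _).trans (add_le_add ?_ ?_)) ?_)
    · rw [norm_mul, norm_mul, Complex.norm_I, mul_one, Complex.norm_real, Complex.norm_real]; rfl
    · rw [norm_mul, Complex.norm_real, Complex.norm_real, Real.norm_eq_abs, Real.norm_eq_abs,
        abs_of_nonneg (by positivity : 0 ≤ t ^ 2 / 2)]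
    · refine (norm_sum_le _ _).trans ?_
      rw [Finset.mul_sum]
      refine Finset.sum_le_sum fun i _ => ?_
      rw [norm_mul, abs_mul, abs_pow, Complex.norm_real, Real.norm_eq_abs]
      calc |Z i ω| * ‖r i‖ ≤ |Z i ω| * (4 * |t| ^ 3 * |Δ i ω| ^ 3) :=
            mul_le_mul_of_nonneg_left (hrn i) (abs_nonneg _)
        _ = _ := by ring
  have hsum : ∑ i, ∫ ω, (Z i ω : ℂ) * ex (W ω - Δ i ω) ∂P =
      ∫ ω, ∑ i, (Z i ω : ℂ) * ex (W ω - Δ i ω) ∂P := (integral_finsetSum _ fun i _ => i1 i).symm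
  have hdecomp : ∫ ω, (W ω : ℂ) * ex (W ω) ∂P - t * Complex.I * ∫ ω, ex (W ω) ∂P =
      (∫ ω, ((W ω : ℂ) * ex (W ω) - t * Complex.I * ex (W ω) -
        ∑ i, (Z i ω : ℂ) * ex (W ω - Δ i ω)) ∂P) +
        ∑ i, ∫ ω, (Z i ω : ℂ) * ex (W ω - Δ i ω) ∂P := by
    have s1 := integral_sub i2 (i3.const_mul (t * Complex.I))
    have s2 := integral_sub (i2.sub (i3.const_mul (t * Complex.I)))
      (integrable_finsetSum Finset.univ fun i _ => i1 i)
    simp only [Pi.sub_apply] at s1 s2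
    rw [s2, s1, hsum, integral_const_mul]
    ring
  change ‖∫ ω, (W ω : ℂ) * ex (W ω) ∂P - t * Complex.I * ∫ ω, ex (W ω) ∂P‖ ≤ _
  rw [hdecomp]
  have hmain : ‖∫ ω, ((W ω : ℂ) * ex (W ω) - t * Complex.I * ex (W ω) -
        ∑ i, (Z i ω : ℂ) * ex (W ω - Δ i ω)) ∂P‖ ≤ |t| * v₂ + t ^ 2 / 2 * v₃ + 4 * |t| ^ 3 * v₄ := by
    have k2 := j2.const_mul |t|
    have k3 := j3.const_mul (t ^ 2 / 2)
    have k4 := (integrable_finsetSum Finset.univ fun i _ => j4 i).const_mul (4 * |t| ^ 3)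
    refine (norm_integral_le_of_norm_le ((k2.add k3).add k4) (ae_of_all _ hpt)).trans ?_
    have s1 := integral_add (k2.add k3) k4
    have s2 := integral_add k2 k3
    simp only [Pi.add_apply] at s1 s2 ⊢
    rw [s1, s2, integral_const_mul, integral_const_mul, integral_const_mul,
      integral_finsetSum _ fun i _ => j4 i]
    gcongr
  refine (norm_add_le _ _).trans ?_
  have : ‖∑ i, ∫ ω, (Z i ω : ℂ) * ex (W ω - Δ i ω) ∂P‖ ≤ ε₀ := h₀
  linarith

end CharacteristicFunction

/-! ### The Gaussian approximation for good kernels -/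

section GoodKernels

variable {Ω I E : Type*} [MeasurableSpace Ω] [MeasurableSpace E] [Fintype I] [EMetricSpace I]
variable {P : Measure Ω} [IsProbabilityMeasure P] {X : I → Ω → E} {R : ℝ≥0∞} {β : ℝ}
  {h : I → I → E → E → ℝ} {b : ℝ} {D : ℕ} {a4 Λ : ℝ}

lemma integral_abs_le_of_sq {f : Ω → ℝ} (hf : Integrable f P) (hf2 : Integrable (fun ω => f ω ^ 2) P)
    {M : ℝ} (hM : 0 ≤ M) (h : ∫ ω, f ω ^ 2 ∂P ≤ M ^ 2) : ∫ ω, |f ω| ∂P ≤ M := by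
  have h1 := sq_integral_le (μ := P) (f := fun ω => |f ω|) hf.abs (by simpa only [sq_abs] using hf2)
  simp only [sq_abs] at h1
  exact (abs_le_of_sq_le_sq' (h1.trans h) hM).2

/-- The decoupling estimates are for real functions, so the exponential is split into cosine and
sine. -/
lemma norm_integral_mul_exp_le {Z x : Ω → ℝ} (hZ : Measurable Z) (hx : Measurable x) {B c : ℝ}
    (hB : ∀ ω, |Z ω| ≤ B) (hc : |∫ ω, Z ω * Real.cos (x ω) ∂P| ≤ c)
    (hs : |∫ ω, Z ω * Real.sin (x ω) ∂P| ≤ c) :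
    ‖∫ ω, Z ω * Complex.exp (x ω * Complex.I) ∂P‖ ≤ 2 * c := by
  have hi : ∀ {f : Ω → ℝ}, Measurable f → (∀ ω, |f ω| ≤ 1) → Integrable (fun ω => Z ω * f ω) P :=
    fun hf hf1 => integrable_of_abs_le (hZ.mul hf) (B := B) fun ω => by
      rw [abs_mul]
      exact (mul_le_of_le_one_right (abs_nonneg _) (hf1 ω)).trans (hB ω)
  have i1 := hi (Real.measurable_cos.comp hx) fun ω => Real.abs_cos_le_one _
  have i2 := hi (Real.measurable_sin.comp hx) fun ω => Real.abs_sin_le_one _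
  have e : ∀ ω, (Z ω : ℂ) * Complex.exp (x ω * Complex.I) =
      ((Z ω * Real.cos (x ω) : ℝ) : ℂ) + ((Z ω * Real.sin (x ω) : ℝ) : ℂ) * Complex.I := fun ω => by
    rw [Complex.exp_mul_I]; push_cast; ring
  simp only [e]
  have s1 := integral_add (i1.ofReal (𝕜 := ℂ)) ((i2.ofReal (𝕜 := ℂ)).mul_const Complex.I)
  simp only [Function.comp_apply] at s1
  refine (congrArg norm s1).le.trans ((norm_add_le _ _).trans ?_)
  rw [integral_mul_const, norm_mul, Complex.norm_I, mul_one]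
  have o1 : ∫ ω, ((Z ω * Real.cos (x ω) : ℝ) : ℂ) ∂P = ((∫ ω, Z ω * Real.cos (x ω) ∂P : ℝ) : ℂ) :=
    integral_ofReal
  have o2 : ∫ ω, ((Z ω * Real.sin (x ω) : ℝ) : ℂ) ∂P = ((∫ ω, Z ω * Real.sin (x ω) ∂P : ℝ) : ℂ) :=
    integral_ofReal
  refine (add_le_add (?_ : _ ≤ c) (?_ : _ ≤ c)).trans (le_of_eq (two_mul c).symm)
  · refine (congrArg norm o1).le.trans ?_
    rw [Complex.norm_real]; exact hc
  · refine (congrArg norm o2).le.trans ?_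
    rw [Complex.norm_real]; exact hs

/-- Distance to the Gaussian characteristic function for good kernels. -/
theorem IsGood.norm_charFun_sub_le (hG : IsGood P X R h b β D a4 Λ) {s c γ θ : ℝ} (hc : 0 < c)
    (hs : c * Fintype.card I ≤ s)
    (hγ : |∫ ω, (∑ i, rowSum h i fun l => X l ω) ^ 2 ∂P - s ^ 2| ≤ γ * s ^ 2)
    (hθ : D ^ 11 * (b ^ 2 * a4 + a4 ^ 2 + Λ ^ 2) + Fintype.card I * D ^ 8 * a4 ≤
      θ ^ 2 * Fintype.card I ^ 2) (hθ0 : 0 ≤ θ) (T : ℝ) :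
    ‖∫ ω, Complex.exp (T * ((∑ i, rowSum h i fun l => X l ω) / s : ℝ) * Complex.I) ∂P -
      Complex.exp (-(T ^ 2 / 2))‖ ≤
      |T| * (2 / (c * Fintype.card I) + |T| * (1 / (c * Fintype.card I) ^ 2 + γ +
        2 ^ 11 * θ / c ^ 2) + T ^ 2 / 2 * (2 ^ 26 * θ / c ^ 3) +
        4 * |T| ^ 3 * (2 ^ 21 * θ ^ 2 / c ^ 4)) := by
  classical
  have hK := hG.kernel
  have hM := hG.mixing
  have ha1 := hG.one_le_a4
  have hb1 := hG.one_le_b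
  set n := Fintype.card I with hn
  have hn1 : (1 : ℝ) ≤ n := by exact_mod_cast hG.card_pos
  have hD1 : (1 : ℝ) ≤ D := by exact_mod_cast hG.nbhd.one_le hG.card_pos
  have hcn : 0 < c * n := by positivity
  have hs0 : 0 < s := hcn.trans_le hs
  set Y : I → Ω → ℝ := fun i ω => rowSum h i fun l => X l ω with hY
  set L : I → Ω → ℝ := fun i ω => localSum h R i fun l => X l ω with hL
  have hYm : ∀ i, Measurable (Y i) := fun i => (hK.measurable_rowSum i).comp hM.measurable_sample
  have hLm : ∀ i, Measurable (L i) := fun i => (hK.measurable_localSum i).comp hM.measurable_sample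
  have hYB : ∀ i ω, |Y i ω| ≤ n * b := fun i ω => hK.abs_rowSum_le i _
  have hLB : ∀ i ω, |L i ω| ≤ n * (n * b) := fun i ω => hK.abs_localSum_le i _
  set Z : I → Ω → ℝ := fun i ω => Y i ω / s with hZ
  set Δ : I → Ω → ℝ := fun i ω => 2 * L i ω / s with hΔ
  have hZm : ∀ i, Measurable (Z i) := fun i => (hYm i).div_const s
  have hΔm : ∀ i, Measurable (Δ i) := fun i => ((hLm i).const_mul 2).div_const s
  have hZB : ∀ i ω, |Z i ω| ≤ 2 * (n * (n * b)) / s := fun i ω => by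
    rw [hZ, abs_div, abs_of_pos hs0]
    refine div_le_div_of_nonneg_right ((hYB i ω).trans ?_) hs0.le
    have : (n : ℝ) * b ≤ n * (n * b) := le_mul_of_one_le_left (by positivity) hn1
    have : 0 ≤ (n : ℝ) * (n * b) := by positivity
    linarith
  have hΔB : ∀ i ω, |Δ i ω| ≤ 2 * (n * (n * b)) / s := fun i ω => by
    rw [hΔ, abs_div, abs_of_pos hs0, abs_mul, abs_two]
    exact div_le_div_of_nonneg_right (by linarith [hLB i ω]) hs0.le
  have hWB : ∀ ω, |∑ i, Z i ω| ≤ n * (2 * (n * (n * b)) / s) := fun ω => by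
    refine (Finset.abs_sum_le_sum_abs _ _).trans ((Finset.sum_le_sum fun i _ => hZB i ω).trans ?_)
    simp [hn]
  have hWs : ∀ ω, ∑ i, Z i ω = (∑ i, Y i ω) / s := fun ω => (Finset.sum_div _ _ _).symm
  have hθ1 : D ^ 11 * (b ^ 2 * a4 + a4 ^ 2 + Λ ^ 2) ≤ θ ^ 2 * n ^ 2 := by
    have : 0 ≤ (n : ℝ) * D ^ 8 * a4 := by positivity
    linarith
  have hθ2 : n * D ^ 8 * a4 ≤ θ ^ 2 * n ^ 2 := by
    have : 0 ≤ (D : ℝ) ^ 11 * (b ^ 2 * a4 + a4 ^ 2 + Λ ^ 2) := by positivity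
    linarith
  -- the almost uncorrelated part
  have h₀ : ∀ t : ℝ, ‖∑ i, ∫ ω, Z i ω * Complex.exp (t * (∑ j, Z j ω - Δ i ω : ℝ) * Complex.I) ∂P‖ ≤
      2 / (c * n) := by
    intro t
    have h1 : ∀ i, ‖∫ ω, Z i ω * Complex.exp (t * (∑ j, Z j ω - Δ i ω : ℝ) * Complex.I) ∂P‖ ≤
        2 * (n * (4 * (b * 1) * β) / s) := by
      intro i
      -- This identity is the reason for the choice `Δ_i = 2 L_i / s`.
      have hfar : ∀ ω, t * (∑ j, Z j ω - Δ i ω) = t / s * farSum h R i fun l => X l ω := by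
        intro ω
        have e1 := hK.sum_rowSum_sub_farSum (R := R) i fun l => X l ω
        have e2 : farSum h R i (fun l => X l ω) = ∑ j, Y j ω - 2 * L i ω := by
          simp only [hY, hL, localSum]; linarith
        rw [e2, hWs, hΔ]; field_simp
      have hxm : Measurable fun ω => t / s * farSum h R i fun l => X l ω :=
        ((hK.measurable_farSum i).comp hM.measurable_sample).const_mul _
      have e3 : ∀ ω, (t : ℂ) * (∑ j, Z j ω - Δ i ω : ℝ) =
          ((t / s * farSum h R i fun l => X l ω : ℝ) : ℂ) := fun ω => by
        rw [← hfar]; push_cast; ring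
      simp only [e3]
      have hcs : ∀ f : ℝ → ℝ, Measurable f → (∀ x, |f x| ≤ 1) →
          |∫ ω, Z i ω * f (t / s * farSum h R i fun l => X l ω) ∂P| ≤ n * (4 * (b * 1) * β) / s := by
        intro f hf hf1
        have h2 := hK.abs_integral_rowSum_mul_le hM i (Ψ := fun ξ => f (t / s * farSum h R i ξ))
          (hf.comp ((hK.measurable_farSum i).const_mul _)) (B := 1) (fun ξ => hf1 _)
          fun ξ ζ hξ => by simp only [farSum_congr hξ]
        have e4 : ∀ ω, Z i ω * f (t / s * farSum h R i fun l => X l ω) =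
            (Y i ω * f (t / s * farSum h R i fun l => X l ω)) / s := fun ω => by
          simp only [hZ]; ring
        simp only [e4]
        rw [integral_div, abs_div, abs_of_pos hs0]
        exact div_le_div_of_nonneg_right h2 hs0.le
      exact norm_integral_mul_exp_le (hZm i) hxm (hZB i)
        (hcs _ Real.measurable_cos Real.abs_cos_le_one) (hcs _ Real.measurable_sin Real.abs_sin_le_one)
    refine (norm_sum_le _ _).trans ((Finset.sum_le_card_nsmul _ _ _ fun i _ => h1 i).trans ?_)
    rw [nsmul_eq_mul, Finset.card_univ, ← hn]
    have hτ := hG.tiny (p := 1) (q := 2) (by norm_num) (by norm_num)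
    rw [← hn, pow_one] at hτ
    calc (n : ℝ) * (2 * (n * (4 * (b * 1) * β) / s)) = 2 * (n ^ 2 * (4 * b * β)) / s := by ring
      _ ≤ 2 / s := by gcongr; linarith
      _ ≤ 2 / (c * n) := by gcongr
  -- the second-order term
  have hYLm : ∀ p, Measurable fun ω => ∑ i, Y i ω * L i ω ^ p := fun p =>
    Finset.measurable_sum _ fun i _ => (hYm i).mul ((hLm i).pow_const p)
  have hYLi : ∀ i p, Integrable (fun ω => Y i ω * L i ω ^ p) P := fun i p =>
    integrable_of_abs_le ((hYm i).mul ((hLm i).pow_const p)) (B := n * b * (n * (n * b)) ^ p)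
      fun ω => by
        rw [abs_mul, abs_pow]
        exact mul_le_mul (hYB i ω) (pow_le_pow_left₀ (abs_nonneg _) (hLB i ω) p) (by positivity)
          (by positivity)
  have hYLb : ∀ p ω, |∑ i, Y i ω * L i ω ^ p| ≤ n * (n * b * (n * (n * b)) ^ p) := fun p ω => by
    refine (Finset.abs_sum_le_sum_abs _ _).trans ((Finset.sum_le_card_nsmul _ _
      (n * b * (n * (n * b)) ^ p) fun i _ => ?_).trans (by simp [hn]))
    rw [abs_mul, abs_pow]
    exact mul_le_mul (hYB i ω) (pow_le_pow_left₀ (abs_nonneg _) (hLB i ω) p) (by positivity)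
      (by positivity)
  have h₂ : ∫ ω, |∑ i, Z i ω * Δ i ω - 1| ∂P ≤ 1 / (c * n) ^ 2 + γ + 2 ^ 11 * θ / c ^ 2 := by
    set m : ℝ := ∑ i, ∫ ω, Y i ω * L i ω ∂P with hm
    have hV := hG.integral_sq_sum_localSum_sub_le
    have hV' : ∫ ω, (∑ i, Y i ω * L i ω - m) ^ 2 ∂P ≤ (2 ^ 10 * θ * n ^ 2) ^ 2 := by
      refine hV.trans ?_
      rw [← hn]
      have d7 : (n : ℝ) ^ 3 * a4 * D ^ 7 ≤ n ^ 3 * a4 * D ^ 8 :=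
        mul_le_mul_of_nonneg_left (pow_le_pow_right₀ hD1 (by norm_num)) (by positivity)
      have d2 : (n : ℝ) ^ 2 * Λ ^ 2 * D ^ 2 ≤ n ^ 2 * Λ ^ 2 * D ^ 11 :=
        mul_le_mul_of_nonneg_left (pow_le_pow_right₀ hD1 (by norm_num)) (by positivity)
      have d3 : 0 ≤ (n : ℝ) ^ 2 * D ^ 11 * (b ^ 2 * a4 + a4 ^ 2) := by positivity
      have d4 := mul_le_mul_of_nonneg_left hθ (show 0 ≤ (n : ℝ) ^ 2 by positivity)
      have d5 : 0 ≤ (n : ℝ) ^ 2 * Λ ^ 2 * D ^ 11 := by positivity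
      nlinarith
    have hint : Integrable (fun ω => ∑ i, Y i ω * L i ω - m) P := by
      have := (integrable_finsetSum Finset.univ fun i _ => hYLi i 1).sub (integrable_const m)
      simp only [pow_one] at this
      exact this
    have hint2 : Integrable (fun ω => (∑ i, Y i ω * L i ω - m) ^ 2) P :=
      integrable_of_abs_le (by simpa using ((hYLm 1).sub_const m).pow_const 2)
        (B := (n * (n * b * (n * (n * b)) ^ 1) + |m|) ^ 2) fun ω => by
          rw [abs_pow]
          refine pow_le_pow_left₀ (abs_nonneg _) ((abs_sub _ _).trans ?_) 2
          have := hYLb 1 ω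
          simp only [pow_one] at this ⊢
          linarith
    have h1 := integral_abs_le_of_sq hint hint2 (by positivity) hV'
    have h2 := hK.abs_integral_sq_sub_le hM hG.card_pos hb1 hG.negligible
    have hmE : ∑ i, ∫ ω, rowSum h i (fun l => X l ω) *
        (2 * ∑ j with edist i j ≤ R, rowSum h j fun l => X l ω) ∂P = 2 * m := by
      rw [hm, Finset.mul_sum]
      refine Finset.sum_congr rfl fun i _ => ?_
      rw [← integral_const_mul]
      refine integral_congr_ae (ae_of_all _ fun ω => ?_)
      simp only [hY, hL, localSum]; ring
    rw [hmE] at h2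
    -- The mean of `∑ Z_i Δ_i` is `2m / s²`. Up to 1, `2m` is the second moment of the total sum,
    -- which by `hγ` is `s²` up to `γ s²`.
    have hm1 : |2 * m / s ^ 2 - 1| ≤ 1 / (c * n) ^ 2 + γ := by
      have e : 2 * m / s ^ 2 - 1 = (2 * m - s ^ 2) / s ^ 2 := by field_simp
      rw [e, abs_div, abs_of_pos (by positivity : 0 < s ^ 2), div_le_iff₀ (by positivity)]
      have h3 : |2 * m - s ^ 2| ≤ 1 + γ * s ^ 2 := by
        rw [abs_le] at h2 hγ ⊢
        constructor <;> linarith [h2.1, h2.2, hγ.1, hγ.2]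
      have h4 : 1 ≤ 1 / (c * n) ^ 2 * s ^ 2 := by
        rw [one_div, inv_mul_eq_div, one_le_div (by positivity)]
        exact pow_le_pow_left₀ hcn.le hs 2
      nlinarith
    have hpt : ∀ ω, |∑ i, Z i ω * Δ i ω - 1| ≤
        2 / s ^ 2 * |∑ i, Y i ω * L i ω - m| + (1 / (c * n) ^ 2 + γ) := by
      intro ω
      have e : ∑ i, Z i ω * Δ i ω - 1 =
          2 / s ^ 2 * (∑ i, Y i ω * L i ω - m) + (2 * m / s ^ 2 - 1) := by
        have : ∑ i, Z i ω * Δ i ω = 2 / s ^ 2 * ∑ i, Y i ω * L i ω := by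
          rw [Finset.mul_sum]
          refine Finset.sum_congr rfl fun i _ => ?_
          simp only [hZ, hΔ]; field_simp
        rw [this]; ring
      rw [e]
      refine (abs_add_le _ _).trans (add_le_add ?_ hm1)
      rw [abs_mul, abs_of_pos (by positivity : 0 < 2 / s ^ 2)]
    have iZ : Integrable (fun ω => |∑ i, Z i ω * Δ i ω - 1|) P := by
      refine (((hint.add (integrable_const m)).const_mul (2 / s ^ 2)).sub
        (integrable_const (1 : ℝ))).abs.congr (ae_of_all _ fun ω => ?_)
      simp only [Pi.sub_apply, Pi.add_apply, sub_add_cancel]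
      congr 2
      rw [Finset.mul_sum]
      refine Finset.sum_congr rfl fun i _ => ?_
      simp only [hZ, hΔ]; field_simp
    refine (integral_mono iZ ((hint.abs.const_mul _).add (integrable_const _)) hpt).trans ?_
    simp only [Pi.add_apply]
    rw [integral_add (hint.abs.const_mul _) (integrable_const _), integral_const_mul]
    simp only [integral_const, probReal_univ, one_smul]
    have h5 : 2 / s ^ 2 * ∫ ω, |∑ i, Y i ω * L i ω - m| ∂P ≤ 2 / (c * n) ^ 2 * (2 ^ 10 * θ * n ^ 2) := by
      gcongr
    have h6 : 2 / (c * n) ^ 2 * (2 ^ 10 * θ * n ^ 2) = 2 ^ 11 * θ / c ^ 2 := by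
      field_simp
    linarith
  -- the third-order term
  have h₃ : ∫ ω, |∑ i, Z i ω * Δ i ω ^ 2| ∂P ≤ 2 ^ 26 * θ / c ^ 3 := by
    have hV := hG.integral_sq_sum_localSum_sq_le
    have hV' : ∫ ω, (∑ i, Y i ω * L i ω ^ 2) ^ 2 ∂P ≤ (2 ^ 24 * θ * n ^ 3) ^ 2 := by
      refine hV.trans ?_
      rw [← hn]
      have d4 := mul_le_mul_of_nonneg_left hθ1 (show 0 ≤ (n : ℝ) ^ 4 by positivity)
      nlinarith
    have h1 := integral_abs_le_of_sq (integrable_finsetSum Finset.univ fun i _ => hYLi i 2)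
      (integrable_of_abs_le ((hYLm 2).pow_const 2) (B := (n * (n * b * (n * (n * b)) ^ 2)) ^ 2)
        fun ω => by
          rw [abs_pow]
          exact pow_le_pow_left₀ (abs_nonneg _) (hYLb 2 ω) 2) (by positivity) hV'
    have e : ∀ ω, |∑ i, Z i ω * Δ i ω ^ 2| = 4 / s ^ 3 * |∑ i, Y i ω * L i ω ^ 2| := by
      intro ω
      have : ∑ i, Z i ω * Δ i ω ^ 2 = 4 / s ^ 3 * ∑ i, Y i ω * L i ω ^ 2 := by
        rw [Finset.mul_sum]
        refine Finset.sum_congr rfl fun i _ => ?_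
        simp only [hZ, hΔ]; field_simp; ring
      rw [this, abs_mul, abs_of_pos (by positivity : 0 < 4 / s ^ 3)]
    simp only [e]
    rw [integral_const_mul]
    calc 4 / s ^ 3 * ∫ ω, |∑ i, Y i ω * L i ω ^ 2| ∂P
        ≤ 4 / (c * n) ^ 3 * (2 ^ 24 * θ * n ^ 3) := by gcongr
      _ = _ := by field_simp; ring
  have h₄ : ∑ i, ∫ ω, |Z i ω * Δ i ω ^ 3| ∂P ≤ 2 ^ 21 * θ ^ 2 / c ^ 4 := by
    have h1 : ∀ i, ∫ ω, |Z i ω * Δ i ω ^ 3| ∂P ≤ 8 / (c * n) ^ 4 * (2 ^ 18 * n ^ 2 * D ^ 8 * a4) := by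
      intro i
      have e : ∀ ω, |Z i ω * Δ i ω ^ 3| = 8 / s ^ 4 * |Y i ω * L i ω ^ 3| := by
        intro ω
        have : Z i ω * Δ i ω ^ 3 = 8 / s ^ 4 * (Y i ω * L i ω ^ 3) := by
          simp only [hZ, hΔ]; field_simp; ring
        rw [this, abs_mul, abs_of_pos (by positivity : 0 < 8 / s ^ 4)]
      simp only [e]
      rw [integral_const_mul]
      have := hG.integral_abs_rowSum_mul_localSum_le i
      gcongr
    refine (Finset.sum_le_card_nsmul _ _ _ fun i _ => h1 i).trans ?_
    rw [nsmul_eq_mul, Finset.card_univ, ← hn]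
    calc (n : ℝ) * (8 / (c * n) ^ 4 * (2 ^ 18 * n ^ 2 * D ^ 8 * a4))
        = 2 ^ 21 / (c ^ 4 * n ^ 2) * (n * D ^ 8 * a4) := by field_simp; ring
      _ ≤ 2 ^ 21 / (c ^ 4 * n ^ 2) * (θ ^ 2 * n ^ 2) := by gcongr
      _ = _ := by field_simp
  have hγ0 : 0 ≤ γ := by
    have := (abs_nonneg _).trans hγ
    exact nonneg_of_mul_nonneg_left this (by positivity)
  have hfin := norm_integral_exp_sub_le (P := P) (W := fun ω => ∑ i, Z i ω)
    (Finset.measurable_sum _ fun i _ => hZm i) hWB (T := T)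
    (e := 2 / (c * n) + |T| * (1 / (c * n) ^ 2 + γ + 2 ^ 11 * θ / c ^ 2) +
      T ^ 2 / 2 * (2 ^ 26 * θ / c ^ 3) + 4 * |T| ^ 3 * (2 ^ 21 * θ ^ 2 / c ^ 4)) fun t ht => by
    refine (norm_integral_mul_exp_sub_le hZm hΔm hZB hΔB (h₀ t) h₂ h₃ h₄).trans ?_
    have : t ^ 2 ≤ T ^ 2 := sq_le_sq.2 ht
    gcongr
  simp only [hWs] at hfin
  exact hfin

end GoodKernels

/-! ### Double centring under arbitrary couplings -/

section Centring

lemma integrable_of_sq {α : Type*} [MeasurableSpace α] {μ : Measure α} [IsFiniteMeasure μ]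
    {f : α → ℝ} (hf : AEStronglyMeasurable f μ) (hf2 : Integrable (fun x => f x ^ 2) μ) :
    Integrable f μ :=
  ((integrable_const (1 : ℝ)).add hf2).mono' hf (ae_of_all _ fun x => by
    simp only [Pi.add_apply, Real.norm_eq_abs]
    nlinarith [sq_nonneg (|f x| - 1), sq_abs (f x), abs_nonneg (f x)])

/-- Jensen's inequality for partial integrals. -/
lemma integral_sq_integral_le {α α' : Type*} [MeasurableSpace α] [MeasurableSpace α']
    {μ : Measure α} {ν : Measure α'} [IsProbabilityMeasure μ] [IsProbabilityMeasure ν]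
    {F : α × α' → ℝ} (hF : Measurable F) (hF2 : Integrable (fun z => F z ^ 2) (μ.prod ν)) :
    Integrable (fun x => (∫ y, F (x, y) ∂ν) ^ 2) μ ∧
      ∫ x, (∫ y, F (x, y) ∂ν) ^ 2 ∂μ ≤ ∫ z, F z ^ 2 ∂μ.prod ν := by
  have hm : Measurable fun x => (∫ y, F (x, y) ∂ν) ^ 2 :=
    (hF.stronglyMeasurable.integral_prod_right' (ν := ν)).measurable.pow_const 2
  have hle : ∀ᵐ x ∂μ, (∫ y, F (x, y) ∂ν) ^ 2 ≤ ∫ y, F (x, y) ^ 2 ∂ν := by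
    filter_upwards [hF2.prod_right_ae] with x hx
    exact sq_integral_le (integrable_of_sq (hF.comp measurable_prodMk_left).aestronglyMeasurable hx) hx
  have hi := hF2.integral_prod_left
  have hint : Integrable (fun x => (∫ y, F (x, y) ∂ν) ^ 2) μ := by
    refine hi.mono' hm.aestronglyMeasurable ?_
    filter_upwards [hle] with x hx
    rwa [Real.norm_eq_abs, abs_of_nonneg (sq_nonneg _)]
  refine ⟨hint, ?_⟩
  rw [integral_prod _ hF2]
  exact integral_mono_ae hint hi hle

/-- Partial integrals of a kernel depend on one variable only, so their moments are the same under
every coupling with the given marginals. This lets the joint law and the product law be treated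
together. -/
lemma integrable_comp_of_map_eq {α α' E : Type*} [MeasurableSpace α] [MeasurableSpace α']
    [MeasurableSpace E] {μ : Measure α} {ν : Measure α'} {U : α → E} {V : α' → E}
    (hU : Measurable U) (hV : Measurable V) (hUV : μ.map U = ν.map V) {f : E → ℝ}
    (hf : Measurable f) (hi : Integrable (fun x => f (V x)) ν) :
    Integrable (fun x => f (U x)) μ ∧ ∫ x, f (U x) ∂μ = ∫ x, f (V x) ∂ν := by
  constructor
  · have : Integrable f (μ.map U) := by
      rw [hUV]; exact (integrable_map_measure hf.aestronglyMeasurable hV.aemeasurable).2 hi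
    exact (integrable_map_measure hf.aestronglyMeasurable hU.aemeasurable).1 this
  · rw [← integral_map hU.aemeasurable hf.aestronglyMeasurable, hUV,
      integral_map hV.aemeasurable hf.aestronglyMeasurable]

variable {Ω Ω' I E : Type*} [MeasurableSpace Ω] [MeasurableSpace Ω'] [MeasurableSpace E]
variable {P : Measure Ω} [IsProbabilityMeasure P] {Q : Measure Ω'} [IsProbabilityMeasure Q]
  {X : I → Ω → E} {H g : E → E → ℝ} {α b : ℝ} {i k : I} {U V : Ω' → E}

/-- Double centring of a function with respect to the laws of `Xᵢ` and `X_k`. -/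
noncomputable def centred (P : Measure Ω) (X : I → Ω → E) (g : E → E → ℝ) (i k : I) (x y : E) : ℝ :=
  g x y - ∫ ω, g x (X k ω) ∂P - ∫ ω, g (X i ω) y ∂P + ∫ ω, ∫ ω', g (X i ω) (X k ω') ∂P ∂P

lemma measurable_section_left (hX : ∀ i, Measurable (X i)) (hg : Measurable (Function.uncurry g))
    (k : I) : Measurable fun x => ∫ ω, g x (X k ω) ∂P := by
  have : Measurable fun z : E × Ω => g z.1 (X k z.2) :=
    hg.comp (measurable_fst.prodMk ((hX k).comp measurable_snd))
  exact (this.stronglyMeasurable.integral_prod_right' (ν := P)).measurable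

lemma measurable_section_right (hX : ∀ i, Measurable (X i)) (hg : Measurable (Function.uncurry g))
    (i : I) : Measurable fun y => ∫ ω, g (X i ω) y ∂P := by
  have : Measurable fun z : E × Ω => g (X i z.2) z.1 :=
    hg.comp (((hX i).comp measurable_snd).prodMk measurable_fst)
  exact (this.stronglyMeasurable.integral_prod_right' (ν := P)).measurable

lemma measurable_centred (hX : ∀ i, Measurable (X i)) (hg : Measurable (Function.uncurry g))
    (i k : I) : Measurable fun z : E × E => centred P X g i k z.1 z.2 :=
  ((hg.sub ((measurable_section_left hX hg k).comp measurable_fst)).sub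
    ((measurable_section_right hX hg i).comp measurable_snd)).add_const _

/-- `(U, V)` has the marginal laws of `Xᵢ` and `X_k`. -/
structure IsCoupling (P : Measure Ω) (X : I → Ω → E) (i k : I) (Q : Measure Ω') (U V : Ω' → E) :
    Prop where
  measurable_left : Measurable U
  measurable_right : Measurable V
  map_left : Q.map U = P.map (X i)
  map_right : Q.map V = P.map (X k)

lemma isCoupling_self (hX : ∀ i, Measurable (X i)) (i k : I) : IsCoupling P X i k P (X i) (X k) :=
  ⟨hX i, hX k, rfl, rfl⟩

lemma isCoupling_prod (hX : ∀ i, Measurable (X i)) (i k : I) :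
    IsCoupling P X i k (P.prod P) (fun z => X i z.1) (fun z => X k z.2) := by
  refine ⟨(hX i).comp measurable_fst, (hX k).comp measurable_snd, ?_, ?_⟩
  · have := Measure.map_map (μ := P.prod P) (hX i) measurable_fst
    rw [Measure.map_fst_prod, measure_univ, one_smul] at this
    exact this.symm
  · have := Measure.map_map (μ := P.prod P) (hX k) measurable_snd
    rw [Measure.map_snd_prod, measure_univ, one_smul] at this
    exact this.symm

lemma IsCoupling.measurable_eval (hC : IsCoupling P X i k Q U V)
    (hg : Measurable (Function.uncurry g)) : Measurable fun z => g (U z) (V z) :=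
  hg.comp (hC.measurable_left.prodMk hC.measurable_right)

lemma measurable_prod_eval (hX : ∀ i, Measurable (X i)) (hg : Measurable (Function.uncurry g))
    (i k : I) : Measurable fun z : Ω × Ω => g (X i z.1) (X k z.2) :=
  hg.comp (((hX i).comp measurable_fst).prodMk ((hX k).comp measurable_snd))

/-- Double centring is bounded in `L²`, for all couplings. -/
lemma IsCoupling.integral_centred_sq_le (hC : IsCoupling P X i k Q U V)
    (hX : ∀ i, Measurable (X i)) (hg : Measurable (Function.uncurry g)) {v : ℝ}
    (h1 : Integrable (fun z => g (U z) (V z) ^ 2) Q) (h1v : ∫ z, g (U z) (V z) ^ 2 ∂Q ≤ v)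
    (h2 : Integrable (fun z : Ω × Ω => g (X i z.1) (X k z.2) ^ 2) (P.prod P))
    (h2v : ∫ z : Ω × Ω, g (X i z.1) (X k z.2) ^ 2 ∂P.prod P ≤ v) :
    Integrable (fun z => centred P X g i k (U z) (V z) ^ 2) Q ∧
      ∫ z, centred P X g i k (U z) (V z) ^ 2 ∂Q ≤ 16 * v := by
  have hm := measurable_prod_eval hX hg i k
  obtain ⟨b1, b2⟩ := integral_sq_integral_le hm h2
  have hm' : Measurable fun z : Ω × Ω => g (X i z.2) (X k z.1) := hm.comp measurable_swap
  obtain ⟨c1, c2⟩ := integral_sq_integral_le hm' (h2.swap)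
  have c3 : ∫ z : Ω × Ω, g (X i z.2) (X k z.1) ^ 2 ∂P.prod P =
      ∫ z : Ω × Ω, g (X i z.1) (X k z.2) ^ 2 ∂P.prod P :=
    integral_prod_swap (μ := P) (ν := P) fun z : Ω × Ω => g (X i z.1) (X k z.2) ^ 2
  obtain ⟨b3, b4⟩ := integrable_comp_of_map_eq hC.measurable_left (hX i) hC.map_left
    ((measurable_section_left (P := P) hX hg k).pow_const 2) b1
  obtain ⟨c4, c5⟩ := integrable_comp_of_map_eq hC.measurable_right (hX k) hC.map_right
    ((measurable_section_right (P := P) hX hg i).pow_const 2) c1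
  set d : ℝ := ∫ ω, ∫ ω', g (X i ω) (X k ω') ∂P ∂P with hd
  have hd2 : d ^ 2 ≤ v := by
    refine (sq_integral_le (integrable_of_sq ?_ b1) b1).trans (b2.trans h2v)
    exact ((measurable_section_left (P := P) hX hg k).comp (hX i)).aestronglyMeasurable
  have hsum := ((h1.add b3).add (c4.add (integrable_const (d ^ 2)))).const_mul 4
  have hpt : ∀ z, centred P X g i k (U z) (V z) ^ 2 ≤ 4 * (g (U z) (V z) ^ 2 +
      (∫ ω, g (U z) (X k ω) ∂P) ^ 2 + ((∫ ω, g (X i ω) (V z) ∂P) ^ 2 + d ^ 2)) := fun z => by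
    simp only [centred, ← hd]
    generalize g (U z) (V z) = p
    generalize ∫ ω, g (U z) (X k ω) ∂P = q
    generalize ∫ ω, g (X i ω) (V z) ∂P = r
    nlinarith [sq_nonneg (p + q), sq_nonneg (p + r), sq_nonneg (p - d), sq_nonneg (q - r),
      sq_nonneg (q + d), sq_nonneg (r + d)]
  have hmc : Measurable fun z => centred P X g i k (U z) (V z) ^ 2 :=
    ((measurable_centred hX hg i k).comp (hC.measurable_left.prodMk hC.measurable_right)).pow_const 2
  have hint : Integrable (fun z => centred P X g i k (U z) (V z) ^ 2) Q :=
    hsum.mono' hmc.aestronglyMeasurable (ae_of_all _ fun z => by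
      rw [Real.norm_eq_abs, abs_of_nonneg (sq_nonneg _)]; exact hpt z)
  refine ⟨hint, (integral_mono hint hsum hpt).trans ?_⟩
  simp only [Pi.add_apply]
  rw [integral_const_mul]
  have s1 := integral_add (h1.add b3) (c4.add (integrable_const (d ^ 2)))
  have s2 := integral_add h1 b3
  have s3 := integral_add c4 (integrable_const (d ^ 2))
  simp only [Pi.add_apply] at s1 s2 s3
  rw [s1, s2, s3]
  simp only [integral_const, probReal_univ, one_smul]
  rw [b4, c5]
  linarith

lemma pow_four_integral_le {α : Type*} [MeasurableSpace α] {μ : Measure α} [IsProbabilityMeasure μ]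
    {f : α → ℝ} (hf : Measurable f) {B : ℝ} (hB : ∀ x, |f x| ≤ B) :
    (∫ x, f x ∂μ) ^ 4 ≤ ∫ x, f x ^ 4 ∂μ := by
  have hp : ∀ p, Integrable (fun x => f x ^ p) μ := fun p =>
    integrable_of_abs_le (hf.pow_const p) (B := B ^ p) fun x => by
      rw [abs_pow]; exact pow_le_pow_left₀ (abs_nonneg _) (hB x) p
  have h1 := sq_integral_le (integrable_of_abs_le hf hB) (hp 2)
  have h2 := sq_integral_le (hp 2) (by simpa only [← pow_mul] using hp 4)
  simp only [← pow_mul] at h2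
  calc (∫ x, f x ∂μ) ^ 4 = ((∫ x, f x ∂μ) ^ 2) ^ 2 := by ring
    _ ≤ (∫ x, f x ^ 2 ∂μ) ^ 2 := pow_le_pow_left₀ (sq_nonneg _) h1 2
    _ ≤ _ := h2

lemma abs_centred_le (hB : ∀ x y, |g x y| ≤ b) (x y : E) : |centred P X g i k x y| ≤ 4 * b := by
  have h1 := abs_le.1 (hB x y)
  have h2 := abs_le.1 (abs_integral_le_of_abs_le (μ := P) fun ω => hB x (X k ω))
  have h3 := abs_le.1 (abs_integral_le_of_abs_le (μ := P) fun ω => hB (X i ω) y)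
  have h4 := abs_le.1 (abs_integral_le_of_abs_le (μ := P)
    fun ω => abs_integral_le_of_abs_le (μ := P) fun ω' => hB (X i ω) (X k ω'))
  rw [centred, abs_le]
  constructor <;> linarith [h1.1, h1.2, h2.1, h2.2, h3.1, h3.2, h4.1, h4.2]

/-- Double centring of a bounded function is bounded in `L⁴`, for all couplings. -/
lemma IsCoupling.integral_centred_pow_four_le (hC : IsCoupling P X i k Q U V)
    (hX : ∀ i, Measurable (X i)) (hg : Measurable (Function.uncurry g)) (hB : ∀ x y, |g x y| ≤ b)
    {v : ℝ} (h1v : ∫ z, g (U z) (V z) ^ 4 ∂Q ≤ v)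
    (h2v : ∫ z : Ω × Ω, g (X i z.1) (X k z.2) ^ 4 ∂P.prod P ≤ v) :
    ∫ z, centred P X g i k (U z) (V z) ^ 4 ∂Q ≤ 256 * v := by
  have hpow : ∀ {x c : ℝ}, |x| ≤ c → |x ^ 4| ≤ c ^ 4 := fun hx => by
    rw [abs_pow]; exact pow_le_pow_left₀ (abs_nonneg _) hx 4
  have hm := measurable_prod_eval hX hg i k
  have h2 : Integrable (fun z : Ω × Ω => g (X i z.1) (X k z.2) ^ 4) (P.prod P) :=
    integrable_of_abs_le (hm.pow_const 4) fun z => hpow (hB _ _)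
  have h1 : Integrable (fun z => g (U z) (V z) ^ 4) Q :=
    integrable_of_abs_le ((hC.measurable_eval hg).pow_const 4) fun z => hpow (hB _ _)
  have hsl : ∀ x, |∫ ω, g x (X k ω) ∂P| ≤ b := fun x => abs_integral_le_of_abs_le fun _ => hB _ _
  have hsr : ∀ y, |∫ ω, g (X i ω) y ∂P| ≤ b := fun y => abs_integral_le_of_abs_le fun _ => hB _ _
  have hml := measurable_section_left (P := P) hX hg k
  have hmr := measurable_section_right (P := P) hX hg i
  have hgl : ∀ x, Measurable fun ω => g x (X k ω) := fun x =>
    hg.comp (measurable_const.prodMk (hX k))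
  have hgr : ∀ y, Measurable fun ω => g (X i ω) y := fun y =>
    hg.comp ((hX i).prodMk measurable_const)
  have jb : ∫ ω, (∫ ω', g (X i ω) (X k ω') ∂P) ^ 4 ∂P ≤ v := by
    refine (integral_mono (integrable_of_abs_le ((hml.comp (hX i)).pow_const 4)
      fun ω => hpow (hsl _)) h2.integral_prod_left fun ω => ?_).trans ?_
    · exact pow_four_integral_le (hgl _) fun ω' => hB _ _
    · rwa [← integral_prod _ h2]
  have jc : ∫ ω', (∫ ω, g (X i ω) (X k ω') ∂P) ^ 4 ∂P ≤ v := by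
    refine (integral_mono (integrable_of_abs_le ((hmr.comp (hX k)).pow_const 4)
      fun ω => hpow (hsr _)) h2.integral_prod_right fun ω => ?_).trans ?_
    · exact pow_four_integral_le (hgr _) fun ω' => hB _ _
    · rwa [← integral_prod_symm _ h2]
  obtain ⟨b3, b4⟩ := integrable_comp_of_map_eq hC.measurable_left (hX i) hC.map_left
    (hml.pow_const 4) (integrable_of_abs_le ((hml.comp (hX i)).pow_const 4) fun ω => hpow (hsl _))
  obtain ⟨c4, c5⟩ := integrable_comp_of_map_eq hC.measurable_right (hX k) hC.map_right
    (hmr.pow_const 4) (integrable_of_abs_le ((hmr.comp (hX k)).pow_const 4) fun ω => hpow (hsr _))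
  set d : ℝ := ∫ ω, ∫ ω', g (X i ω) (X k ω') ∂P ∂P with hd
  have hd4 : d ^ 4 ≤ v :=
    (pow_four_integral_le (hml.comp (hX i)) (fun ω => hsl (X i ω))).trans jb
  have hsum := ((h1.add b3).add (c4.add (integrable_const (d ^ 4)))).const_mul 64
  have hpt : ∀ z, centred P X g i k (U z) (V z) ^ 4 ≤ 64 * (g (U z) (V z) ^ 4 +
      (∫ ω, g (U z) (X k ω) ∂P) ^ 4 + ((∫ ω, g (X i ω) (V z) ∂P) ^ 4 + d ^ 4)) := fun z => by
    simp only [centred, ← hd]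
    generalize g (U z) (V z) = p
    generalize ∫ ω, g (U z) (X k ω) ∂P = q
    generalize ∫ ω, g (X i ω) (V z) ∂P = r
    have e2 : ∀ x y : ℝ, (x - y) ^ 4 ≤ 8 * (x ^ 4 + y ^ 4) := fun x y => by
      nlinarith [sq_nonneg (x + y), sq_nonneg (x ^ 2 - y ^ 2), sq_nonneg ((x + y) ^ 2),
        sq_nonneg (x * y + y ^ 2), sq_nonneg (x ^ 2 + x * y), sq_nonneg (x ^ 2 + y ^ 2),
        sq_nonneg ((x - y) ^ 2 - (x + y) ^ 2)]
    have e3 := e2 (p - q) (r - d)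
    have e4 := e2 p q
    have e5 := e2 r d
    have : (p - q - r + d) ^ 4 = (p - q - (r - d)) ^ 4 := by ring
    rw [this]; linarith
  have hmc : Measurable fun z => centred P X g i k (U z) (V z) ^ 4 :=
    ((measurable_centred hX hg i k).comp (hC.measurable_left.prodMk hC.measurable_right)).pow_const 4
  refine (integral_mono (integrable_of_abs_le hmc fun z => hpow (abs_centred_le hB _ _)) hsum
    hpt).trans ?_
  rw [integral_const_mul]
  simp only [Pi.add_apply]
  have s1 := integral_add (h1.add b3) (c4.add (integrable_const (d ^ 4)))
  have s2 := integral_add h1 b3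
  have s3 := integral_add c4 (integrable_const (d ^ 4))
  simp only [Pi.add_apply] at s1 s2 s3
  rw [s1, s2, s3]
  simp only [integral_const, probReal_univ, one_smul]
  rw [b4, c5]
  linarith

end Centring

/-! ### Truncated kernels and their L² error -/

section Truncation

variable {Ω Ω' I E : Type*} [MeasurableSpace Ω] [MeasurableSpace Ω'] [MeasurableSpace E]
variable {P : Measure Ω} [IsProbabilityMeasure P] {Q : Measure Ω'} [IsProbabilityMeasure Q]
  {X : I → Ω → E} {H : E → E → ℝ} {α b b' : ℝ} {i k : I} {U V : Ω' → E}

/-- A symmetric degenerate kernel with fourth moments at most `α`. -/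
structure IsDegenerate (P : Measure Ω) (X : I → Ω → E) (H : E → E → ℝ) (α : ℝ) : Prop where
  measurable : ∀ i, Measurable (X i)
  measurable_kernel : Measurable (Function.uncurry H)
  symm : ∀ x y, H x y = H y x
  degenerate : ∀ i k, i ≠ k → ∀ᵐ x ∂P.map (X i), ∫ ω, H x (X k ω) ∂P = 0
  joint_integrable : ∀ i k, i ≠ k → Integrable (fun ω => H (X i ω) (X k ω) ^ 4) P
  joint_le : ∀ i k, i ≠ k → ∫ ω, H (X i ω) (X k ω) ^ 4 ∂P ≤ α
  prod_integrable : ∀ i k, i ≠ k →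
    Integrable (fun z : Ω × Ω => H (X i z.1) (X k z.2) ^ 4) (P.prod P)
  prod_le : ∀ i k, i ≠ k → ∫ z : Ω × Ω, H (X i z.1) (X k z.2) ^ 4 ∂P.prod P ≤ α

/-- A coupling under which the kernel has a fourth moment at most `α`. -/
structure IsMomentCoupling (P : Measure Ω) (X : I → Ω → E) (H : E → E → ℝ) (α : ℝ) (i k : I)
    (Q : Measure Ω') (U V : Ω' → E) : Prop extends IsCoupling P X i k Q U V where
  integrable : Integrable (fun z => H (U z) (V z) ^ 4) Q
  le : ∫ z, H (U z) (V z) ^ 4 ∂Q ≤ α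

lemma IsDegenerate.coupling_self (hH : IsDegenerate P X H α) (hik : i ≠ k) :
    IsMomentCoupling P X H α i k P (X i) (X k) :=
  ⟨isCoupling_self hH.measurable i k, hH.joint_integrable i k hik, hH.joint_le i k hik⟩

lemma IsDegenerate.coupling_prod (hH : IsDegenerate P X H α) (hik : i ≠ k) :
    IsMomentCoupling P X H α i k (P.prod P) (fun z => X i z.1) (fun z => X k z.2) :=
  ⟨isCoupling_prod hH.measurable i k, hH.prod_integrable i k hik, hH.prod_le i k hik⟩

open Classical in
/-- The kernel cut off at level `b`. -/
noncomputable def cutoff (b : ℝ) (H : E → E → ℝ) (x y : E) : ℝ := if |H x y| ≤ b then H x y else 0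

lemma measurable_cutoff (hH : Measurable (Function.uncurry H)) (b : ℝ) :
    Measurable (Function.uncurry (cutoff b H)) :=
  Measurable.ite (measurableSet_le hH.abs measurable_const) hH measurable_const

lemma abs_cutoff_le (hb : 0 ≤ b) (x y : E) : |cutoff b H x y| ≤ b := by
  unfold cutoff; split_ifs with h
  · exact h
  · simpa using hb

lemma abs_cutoff_le_abs (x y : E) : |cutoff b H x y| ≤ |H x y| := by
  unfold cutoff; split_ifs with h
  · exact le_rfl
  · simp

lemma sq_sub_cutoff_le (hb : 0 < b) (x y : E) : (H x y - cutoff b H x y) ^ 2 ≤ H x y ^ 4 / b ^ 2 := by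
  unfold cutoff; split_ifs with h
  · rw [sub_self, zero_pow two_ne_zero]; positivity
  · rw [sub_zero, le_div_iff₀ (by positivity)]
    push Not at h
    have h2 : b ^ 2 ≤ H x y ^ 2 := by rw [← sq_abs (H x y)]; exact pow_le_pow_left₀ hb.le h.le 2
    nlinarith [mul_le_mul_of_nonneg_left h2 (sq_nonneg (H x y))]

lemma IsMomentCoupling.integrable_pow (hC : IsMomentCoupling P X H α i k Q U V)
    (hH : Measurable (Function.uncurry H)) : Integrable (fun z => H (U z) (V z) ^ 2) Q :=
  integrable_of_sq ((hC.measurable_eval hH).pow_const 2).aestronglyMeasurable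
    (by simpa only [← pow_mul] using hC.integrable)

lemma IsMomentCoupling.integral_sq_le (hC : IsMomentCoupling P X H α i k Q U V)
    (hH : Measurable (Function.uncurry H)) : ∫ z, H (U z) (V z) ^ 2 ∂Q ≤ √α := by
  refine Real.le_sqrt_of_sq_le ((sq_integral_le (hC.integrable_pow hH) ?_).trans ?_)
  · simpa only [← pow_mul] using hC.integrable
  · simpa only [← pow_mul] using hC.le

lemma IsMomentCoupling.integrable_tail (hC : IsMomentCoupling P X H α i k Q U V)
    (hH : Measurable (Function.uncurry H)) (hb : 0 < b) :
    Integrable (fun z => (H (U z) (V z) - cutoff b H (U z) (V z)) ^ 2) Q ∧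
      ∫ z, (H (U z) (V z) - cutoff b H (U z) (V z)) ^ 2 ∂Q ≤ α / b ^ 2 := by
  have hi := hC.integrable.div_const (b ^ 2)
  have hint : Integrable (fun z => (H (U z) (V z) - cutoff b H (U z) (V z)) ^ 2) Q :=
    hi.mono' (((hC.measurable_eval hH).sub
      (hC.measurable_eval (measurable_cutoff hH b))).pow_const 2).aestronglyMeasurable
      (ae_of_all _ fun z => by
        rw [Real.norm_eq_abs, abs_of_nonneg (sq_nonneg _)]; exact sq_sub_cutoff_le hb _ _)
  refine ⟨hint, (integral_mono hint hi fun z => sq_sub_cutoff_le hb _ _).trans ?_⟩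
  rw [integral_div]
  have := hC.le
  gcongr

/-- The truncated kernel: cut off at level `b`, then made exactly degenerate. -/
noncomputable def truncated (P : Measure Ω) (X : I → Ω → E) (H : E → E → ℝ) (b : ℝ) (i k : I)
    (x y : E) : ℝ :=
  centred P X (cutoff b H) i k x y

lemma IsDegenerate.measurable_truncated (hH : IsDegenerate P X H α) (b : ℝ) (i k : I) :
    Measurable fun z : E × E => truncated P X H b i k z.1 z.2 :=
  measurable_centred hH.measurable (measurable_cutoff hH.measurable_kernel b) i k

lemma abs_truncated_le (hb : 0 ≤ b) (x y : E) : |truncated P X H b i k x y| ≤ 4 * b :=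
  abs_centred_le (fun _ _ => abs_cutoff_le hb _ _) _ _

lemma IsDegenerate.truncated_symm (hH : IsDegenerate P X H α) (hb : 0 ≤ b) (x y : E) :
    truncated P X H b i k x y = truncated P X H b k i y x := by
  have hs : ∀ x y, cutoff b H x y = cutoff b H y x := fun x y => by
    simp only [cutoff, hH.symm x y]
  have hswap := integral_integral_swap (μ := P) (ν := P)
    (f := fun ω ω' => cutoff b H (X i ω) (X k ω')) (integrable_of_abs_le (B := b)
      (measurable_prod_eval hH.measurable (measurable_cutoff hH.measurable_kernel b) i k)
      fun z => abs_cutoff_le hb _ _)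
  have e : ∫ ω, ∫ ω', cutoff b H (X i ω) (X k ω') ∂P ∂P =
      ∫ ω, ∫ ω', cutoff b H (X k ω) (X i ω') ∂P ∂P := by
    rw [hswap]; simp only [hs (X i _)]
  have e1 : ∀ x k, ∫ ω, cutoff b H x (X k ω) ∂P = ∫ ω, cutoff b H (X k ω) x ∂P := fun x k =>
    integral_congr_ae (ae_of_all _ fun ω => hs _ _)
  simp only [truncated, centred]
  rw [e, hs x y, e1 x k, ← e1 y i]
  ring

lemma IsDegenerate.integral_truncated (hH : IsDegenerate P X H α) (hb : 0 ≤ b) (x : E) :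
    ∫ ω, truncated P X H b i k x (X k ω) ∂P = 0 := by
  have hm := measurable_cutoff hH.measurable_kernel b
  have i1 : Integrable (fun ω => cutoff b H x (X k ω)) P :=
    integrable_of_abs_le (hm.comp (measurable_const.prodMk (hH.measurable k)))
      fun ω => abs_cutoff_le hb _ _
  have i2 : Integrable (fun ω' => ∫ ω, cutoff b H (X i ω) (X k ω') ∂P) P :=
    integrable_of_abs_le ((measurable_section_right hH.measurable hm i).comp (hH.measurable k))
      fun ω => abs_integral_le_of_abs_le fun ω' => abs_cutoff_le hb _ _
  have hswap := integral_integral_swap (μ := P) (ν := P)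
    (f := fun ω ω' => cutoff b H (X i ω) (X k ω')) (integrable_of_abs_le (B := b)
      (measurable_prod_eval hH.measurable hm i k) fun z => abs_cutoff_le hb _ _)
  simp only [truncated, centred]
  have s1 := integral_sub i1 (integrable_const (∫ ω, cutoff b H x (X k ω) ∂P))
  have s2 := integral_sub (i1.sub (integrable_const (∫ ω, cutoff b H x (X k ω) ∂P))) i2
  have s3 := integral_add ((i1.sub (integrable_const (∫ ω, cutoff b H x (X k ω) ∂P))).sub i2)
    (integrable_const (∫ ω, ∫ ω', cutoff b H (X i ω) (X k ω') ∂P ∂P))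
  simp only [Pi.sub_apply] at s1 s2 s3
  rw [s3, s2, s1, hswap]
  simp

/-- Almost surely, the error of the truncation is the centred tail. -/
lemma IsDegenerate.sub_truncated_ae (hH : IsDegenerate P X H α) (hik : i ≠ k)
    (hC : IsCoupling P X i k Q U V) (hb : 0 ≤ b) :
    ∀ᵐ z ∂Q, H (U z) (V z) - truncated P X H b i k (U z) (V z) =
      centred P X (fun x y => H x y - cutoff b H x y) i k (U z) (V z) := by
  have hm := measurable_cutoff hH.measurable_kernel b
  -- The kernel `H` has vanishing partial integrals, and by Fubini integrable sections, only for
  -- almost every `x`. Centring `H` therefore changes nothing almost surely, and the truncation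
  -- error is the centred tail.
  have hgood : ∀ i k, i ≠ k → ∀ᵐ x ∂P.map (X i), ∫ ω, (H x (X k ω) - cutoff b H x (X k ω)) ∂P =
      - ∫ ω, cutoff b H x (X k ω) ∂P := by
    intro i k hik
    have hi := hH.prod_integrable i k hik
    have hmap : (P.map (X i)).prod (P.map (X k)) = (P.prod P).map (Prod.map (X i) (X k)) :=
      Measure.map_prod_map P P (hH.measurable i) (hH.measurable k)
    have hi' : Integrable (fun z : E × E => Function.uncurry H z ^ 4)
        ((P.map (X i)).prod (P.map (X k))) := by
      rw [hmap]
      exact (integrable_map_measure (hH.measurable_kernel.pow_const 4).aestronglyMeasurable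
        ((hH.measurable i).prodMap (hH.measurable k)).aemeasurable).2 hi
    have : IsProbabilityMeasure (P.map (X k)) :=
      Measure.isProbabilityMeasure_map (hH.measurable k).aemeasurable
    filter_upwards [hi'.prod_right_ae, hH.degenerate i k hik] with x hx hx0
    have hxm : Measurable fun y => H x y := hH.measurable_kernel.comp measurable_prodMk_left
    have h4 : Integrable (fun ω => H x (X k ω) ^ 4) P :=
      (integrable_map_measure (hxm.pow_const 4).aestronglyMeasurable
        (hH.measurable k).aemeasurable).1 hx
    have h2 : Integrable (fun ω => H x (X k ω) ^ 2) P :=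
      integrable_of_sq ((hxm.comp (hH.measurable k)).pow_const 2).aestronglyMeasurable
        (by simpa only [← pow_mul] using h4)
    have h1 : Integrable (fun ω => H x (X k ω)) P :=
      integrable_of_sq (hxm.comp (hH.measurable k)).aestronglyMeasurable h2
    have hc : Integrable (fun ω => cutoff b H x (X k ω)) P :=
      integrable_of_abs_le (hm.comp (measurable_const.prodMk (hH.measurable k)))
        fun ω => abs_cutoff_le hb _ _
    have := integral_sub h1 hc
    rw [this, hx0, zero_sub]
  have hU : ∀ᵐ z ∂Q, ∫ ω, (H (U z) (X k ω) - cutoff b H (U z) (X k ω)) ∂P =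
      - ∫ ω, cutoff b H (U z) (X k ω) ∂P := by
    have := hgood i k hik
    rw [← hC.map_left] at this
    exact ae_of_ae_map hC.measurable_left.aemeasurable this
  have hs : ∀ x y, cutoff b H x y = cutoff b H y x := fun x y => by
    simp only [cutoff, hH.symm x y]
  have hV : ∀ᵐ z ∂Q, ∫ ω, (H (X i ω) (V z) - cutoff b H (X i ω) (V z)) ∂P =
      - ∫ ω, cutoff b H (X i ω) (V z) ∂P := by
    have := hgood k i hik.symm
    rw [← hC.map_right] at this
    filter_upwards [ae_of_ae_map hC.measurable_right.aemeasurable this] with z hz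
    simpa only [hH.symm (V z), hs (V z)] using hz
  have hd : ∫ ω, ∫ ω', (H (X i ω) (X k ω') - cutoff b H (X i ω) (X k ω')) ∂P ∂P =
      - ∫ ω, ∫ ω', cutoff b H (X i ω) (X k ω') ∂P ∂P := by
    rw [← integral_neg]
    exact integral_congr_ae (ae_of_ae_map (hH.measurable i).aemeasurable (hgood i k hik))
  filter_upwards [hU, hV] with z h1 h2
  simp only [truncated, centred]
  rw [h1, h2, hd]
  ring

/-- The `L²` error of the truncation. -/
lemma IsDegenerate.integral_sq_sub_truncated_le (hH : IsDegenerate P X H α) (hik : i ≠ k)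
    (hC : IsMomentCoupling P X H α i k Q U V) (hb : 0 < b) :
    Integrable (fun z => (H (U z) (V z) - truncated P X H b i k (U z) (V z)) ^ 2) Q ∧
      ∫ z, (H (U z) (V z) - truncated P X H b i k (U z) (V z)) ^ 2 ∂Q ≤ 16 * (α / b ^ 2) := by
  have hae := hH.sub_truncated_ae hik hC.toIsCoupling hb.le
  obtain ⟨h1, h2⟩ := hC.integrable_tail hH.measurable_kernel hb
  obtain ⟨h3, h4⟩ := (hH.coupling_prod hik).integrable_tail hH.measurable_kernel hb
  obtain ⟨h5, h6⟩ := hC.integral_centred_sq_le hH.measurable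
    (g := fun x y => H x y - cutoff b H x y)
    (hH.measurable_kernel.sub (measurable_cutoff hH.measurable_kernel b)) h1 h2 h3 h4
  have hae2 : ∀ᵐ z ∂Q, (H (U z) (V z) - truncated P X H b i k (U z) (V z)) ^ 2 =
      centred P X (fun x y => H x y - cutoff b H x y) i k (U z) (V z) ^ 2 := by
    filter_upwards [hae] with z hz
    rw [hz]
  exact ⟨h5.congr (hae2.mono fun z hz => hz.symm), (integral_congr_ae hae2).trans_le h6⟩

/-- Both truncations are compared with `H`; the error of the lower level dominates. -/
lemma IsDegenerate.integral_sq_truncated_sub_le (hH : IsDegenerate P X H α) (hik : i ≠ k)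
    (hC : IsMomentCoupling P X H α i k Q U V) (hb : 0 < b) (hbb : b ≤ b') :
    ∫ z, (truncated P X H b' i k (U z) (V z) - truncated P X H b i k (U z) (V z)) ^ 2 ∂Q ≤
      64 * (α / b ^ 2) := by
  have hb' := hb.trans_le hbb
  obtain ⟨h1, h2⟩ := hH.integral_sq_sub_truncated_le hik hC hb
  obtain ⟨h3, h4⟩ := hH.integral_sq_sub_truncated_le hik hC hb'
  have hα : 0 ≤ α := (integral_nonneg fun z => by positivity).trans hC.le
  have h5 : α / b' ^ 2 ≤ α / b ^ 2 := by gcongr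
  have hm : ∀ b, Measurable fun z => truncated P X H b i k (U z) (V z) := fun b =>
    (hH.measurable_truncated b i k).comp (hC.measurable_left.prodMk hC.measurable_right)
  refine (integral_mono (integrable_of_abs_le (((hm b').sub (hm b)).pow_const 2)
    (B := (4 * b' + 4 * b) ^ 2) fun z => ?_) ((h1.add h3).const_mul 2) fun z => ?_).trans ?_
  · rw [abs_pow]
    exact pow_le_pow_left₀ (abs_nonneg _) ((abs_sub _ _).trans
      (add_le_add (abs_truncated_le hb'.le _ _) (abs_truncated_le hb.le _ _))) 2
  · simp only [Pi.add_apply, Pi.sub_apply]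
    nlinarith [sq_nonneg (H (U z) (V z) - truncated P X H b i k (U z) (V z) +
      (H (U z) (V z) - truncated P X H b' i k (U z) (V z)))]
  · rw [integral_const_mul]
    simp only [Pi.add_apply]
    rw [integral_add h1 h3]
    linarith

lemma IsDegenerate.integral_truncated_pow_four_le (hH : IsDegenerate P X H α) (hik : i ≠ k)
    (hC : IsMomentCoupling P X H α i k Q U V) (hb : 0 ≤ b) :
    ∫ z, truncated P X H b i k (U z) (V z) ^ 4 ∂Q ≤ 256 * α := by
  have hle : ∀ x y, cutoff b H x y ^ 4 ≤ H x y ^ 4 := fun x y => by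
    have := pow_le_pow_left₀ (abs_nonneg _) (abs_cutoff_le_abs (b := b) (H := H) x y) 4
    simpa only [even_two.mul_left 2 |>.pow_abs, show (4 : ℕ) = 2 * 2 by norm_num] using this
  have hm := measurable_cutoff hH.measurable_kernel b
  have hpow : ∀ x y, |cutoff b H x y ^ 4| ≤ b ^ 4 := fun x y => by
    rw [abs_pow]; exact pow_le_pow_left₀ (abs_nonneg _) (abs_cutoff_le hb _ _) 4
  have hC' := hH.coupling_prod hik
  refine hC.integral_centred_pow_four_le hH.measurable hm (fun _ _ => abs_cutoff_le hb _ _)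
    ((integral_mono (integrable_of_abs_le ((hC.measurable_eval hm).pow_const 4) fun z => hpow _ _)
      hC.integrable fun z => hle _ _).trans hC.le)
    ((integral_mono (integrable_of_abs_le ((hC'.measurable_eval hm).pow_const 4) fun z => hpow _ _)
      hC'.integrable fun z => hle _ _).trans hC'.le)

lemma IsDegenerate.integral_truncated_sq_le (hH : IsDegenerate P X H α) (hik : i ≠ k)
    (hC : IsMomentCoupling P X H α i k Q U V) (hb : 0 ≤ b) :
    ∫ z, truncated P X H b i k (U z) (V z) ^ 2 ∂Q ≤ 16 * √α := by
  have hm : Measurable fun z => truncated P X H b i k (U z) (V z) :=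
    (hH.measurable_truncated b i k).comp (hC.measurable_left.prodMk hC.measurable_right)
  have hB : ∀ p, ∀ z, |truncated P X H b i k (U z) (V z) ^ p| ≤ (4 * b) ^ p := fun p z => by
    rw [abs_pow]; exact pow_le_pow_left₀ (abs_nonneg _) (abs_truncated_le hb _ _) p
  have hα : 0 ≤ α := (integral_nonneg fun z => by positivity).trans hC.le
  have h := sq_integral_le (integrable_of_abs_le (μ := Q) (hm.pow_const 2) (hB 2))
    (by simpa only [← pow_mul] using integrable_of_abs_le (μ := Q) (hm.pow_const 4) (hB 4))
  simp only [← pow_mul] at h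
  refine abs_le_of_sq_le_sq' ?_ (by positivity) |>.2
  rw [mul_pow, Real.sq_sqrt hα]
  have := hH.integral_truncated_pow_four_le hik hC hb
  simp only [show 2 * 2 = 4 by norm_num] at h
  linarith

end Truncation

/-! ### Contractions in L² and interchange of the contracted variable -/

section Gram

variable {Ω : Type*} [MeasurableSpace Ω] {P : Measure Ω} [IsProbabilityMeasure P]

lemma sq_integral_mul_le {f g : Ω → ℝ} (hf : AEStronglyMeasurable f P)
    (hg : AEStronglyMeasurable g P) (hf2 : Integrable (fun x => f x ^ 2) P)
    (hg2 : Integrable (fun x => g x ^ 2) P) :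
    Integrable (fun x => f x * g x) P ∧
      (∫ x, f x * g x ∂P) ^ 2 ≤ (∫ x, f x ^ 2 ∂P) * ∫ x, g x ^ 2 ∂P := by
  have hi : Integrable (fun x => f x * g x) P :=
    ((memLp_two_iff_integrable_sq hf).2 hf2).integrable_mul ((memLp_two_iff_integrable_sq hg).2 hg2)
  refine ⟨hi, ?_⟩
  have key : ∀ t : ℝ, 0 ≤ (∫ x, g x ^ 2 ∂P) * (t * t) + (2 * ∫ x, f x * g x ∂P) * t +
      ∫ x, f x ^ 2 ∂P := fun t => by
    have h0 : 0 ≤ ∫ x, (f x + t * g x) ^ 2 ∂P := integral_nonneg fun _ => sq_nonneg _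
    have e : ∀ x, (f x + t * g x) ^ 2 = f x ^ 2 + ((2 * t) * (f x * g x) + t ^ 2 * g x ^ 2) :=
      fun x => by ring
    simp only [e] at h0
    have s1 := integral_add (hi.const_mul (2 * t)) (hg2.const_mul (t ^ 2))
    have s2 := integral_add hf2 ((hi.const_mul (2 * t)).add (hg2.const_mul (t ^ 2)))
    simp only [Pi.add_apply] at s2
    rw [s2, s1, integral_const_mul, integral_const_mul] at h0
    linarith
  have := discrim_le_zero key
  unfold discrim at this
  linarith

/-- The contraction of two kernels along their second variable. -/
noncomputable def gram (P : Measure Ω) (a c : Ω × Ω → ℝ) (w : Ω × Ω) : ℝ :=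
  ∫ s, a (w.1, s) * c (w.2, s) ∂P

variable {a c a' c' : Ω × Ω → ℝ}

lemma measurable_gram (ha : Measurable a) (hc : Measurable c) : Measurable (gram P a c) := by
  have : Measurable fun z : (Ω × Ω) × Ω => a (z.1.1, z.2) * c (z.1.2, z.2) :=
    (ha.comp (measurable_fst.fst.prodMk measurable_snd)).mul
      (hc.comp (measurable_fst.snd.prodMk measurable_snd))
  exact (this.stronglyMeasurable.integral_prod_right' (ν := P)).measurable

/-- Cauchy–Schwarz in the contracted variable, for almost all values of the free ones. This
pointwise bound has product form, hence the L² norm of a contraction is at most the product of the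
L² norms. -/
lemma integrable_section_ae (ha : Measurable a) (ha2 : Integrable (fun z => a z ^ 2) (P.prod P))
    (hc : Measurable c) (hc2 : Integrable (fun z => c z ^ 2) (P.prod P)) :
    ∀ᵐ w ∂P.prod P, Integrable (fun s => a (w.1, s) * c (w.2, s)) P ∧
      gram P a c w ^ 2 ≤ (∫ s, a (w.1, s) ^ 2 ∂P) * ∫ s, c (w.2, s) ^ 2 ∂P := by
  filter_upwards [Measure.quasiMeasurePreserving_fst.ae ha2.prod_right_ae,
    Measure.quasiMeasurePreserving_snd.ae hc2.prod_right_ae] with w h1 h2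
  exact sq_integral_mul_le (ha.comp measurable_prodMk_left).aestronglyMeasurable
    (hc.comp measurable_prodMk_left).aestronglyMeasurable h1 h2

lemma integral_gram_sq_le (ha : Measurable a) (ha2 : Integrable (fun z => a z ^ 2) (P.prod P))
    (hc : Measurable c) (hc2 : Integrable (fun z => c z ^ 2) (P.prod P)) :
    Integrable (fun w => gram P a c w ^ 2) (P.prod P) ∧
      ∫ w, gram P a c w ^ 2 ∂P.prod P ≤ (∫ z, a z ^ 2 ∂P.prod P) * ∫ z, c z ^ 2 ∂P.prod P := by
  have hg : Integrable (fun w : Ω × Ω => (∫ s, a (w.1, s) ^ 2 ∂P) * ∫ s, c (w.2, s) ^ 2 ∂P)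
      (P.prod P) := ha2.integral_prod_left.mul_prod hc2.integral_prod_left
  have hae := (integrable_section_ae ha ha2 hc hc2).mono fun w hw => hw.2
  have hi : Integrable (fun w => gram P a c w ^ 2) (P.prod P) :=
    hg.mono' ((measurable_gram ha hc).pow_const 2).aestronglyMeasurable <| by
      filter_upwards [hae] with w hw
      rwa [Real.norm_eq_abs, abs_of_nonneg (sq_nonneg _)]
  refine ⟨hi, (integral_mono_ae hi hg hae).trans ?_⟩
  rw [integral_prod_mul (μ := P) (ν := P) (fun x => ∫ s, a (x, s) ^ 2 ∂P)
    (fun x => ∫ s, c (x, s) ^ 2 ∂P), integral_prod _ ha2, integral_prod _ hc2]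

/-- The `L²` error of replacing the kernels in a contraction. -/
lemma integral_gram_sub_sq_le (ha : Measurable a) (ha2 : Integrable (fun z => a z ^ 2) (P.prod P))
    (hc : Measurable c) (hc2 : Integrable (fun z => c z ^ 2) (P.prod P))
    (ha' : Measurable a') (ha2' : Integrable (fun z => a' z ^ 2) (P.prod P))
    (hc' : Measurable c') (hc2' : Integrable (fun z => c' z ^ 2) (P.prod P))
    (hd : Integrable (fun z => (a z - a' z) ^ 2) (P.prod P))
    (he : Integrable (fun z => (c z - c' z) ^ 2) (P.prod P)) :
    ∫ w, gram P a' c' w ^ 2 ∂P.prod P ≤ 2 * ∫ w, gram P a c w ^ 2 ∂P.prod P +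
      4 * ((∫ z, (a z - a' z) ^ 2 ∂P.prod P) * (∫ z, c z ^ 2 ∂P.prod P) +
        (∫ z, a' z ^ 2 ∂P.prod P) * ∫ z, (c z - c' z) ^ 2 ∂P.prod P) := by
  obtain ⟨i1, b1⟩ := integral_gram_sq_le (P := P) (ha.sub ha') hd hc hc2
  obtain ⟨i2, b2⟩ := integral_gram_sq_le (P := P) ha' ha2' (hc.sub hc') he
  obtain ⟨i0, -⟩ := integral_gram_sq_le (P := P) ha ha2 hc hc2
  obtain ⟨i', -⟩ := integral_gram_sq_le (P := P) ha' ha2' hc' hc2'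
  have hae : ∀ᵐ w ∂P.prod P, gram P a' c' w ^ 2 ≤ 2 * gram P a c w ^ 2 +
      (4 * gram P (a - a') c w ^ 2 + 4 * gram P a' (c - c') w ^ 2) := by
    filter_upwards [integrable_section_ae ha ha2 hc hc2,
      integrable_section_ae ha' ha2' hc hc2, integrable_section_ae ha' ha2' hc' hc2']
      with w h1 h2 h3
    have e1 : gram P (a - a') c w = gram P a c w - gram P a' c w := by
      unfold gram
      rw [← integral_sub h1.1 h2.1]
      exact integral_congr_ae (ae_of_all _ fun s => by simp only [Pi.sub_apply]; ring)
    have e2 : gram P a' (c - c') w = gram P a' c w - gram P a' c' w := by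
      unfold gram
      rw [← integral_sub h2.1 h3.1]
      exact integral_congr_ae (ae_of_all _ fun s => by simp only [Pi.sub_apply]; ring)
    rw [e1, e2]
    nlinarith [sq_nonneg (gram P a c w + (gram P a c w - gram P a' c' w)),
      sq_nonneg ((gram P a c w - gram P a' c w) - (gram P a' c w - gram P a' c' w))]
  have s1 := integral_add (i1.const_mul 4) (i2.const_mul 4)
  have s2 := integral_add (i0.const_mul 2) ((i1.const_mul 4).add (i2.const_mul 4))
  have hle := integral_mono_ae i' ((i0.const_mul 2).add ((i1.const_mul 4).add (i2.const_mul 4))) hae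
  simp only [Pi.add_apply] at s2 hle
  rw [s2, s1, integral_const_mul, integral_const_mul, integral_const_mul] at hle
  simp only [Pi.sub_apply] at b1 b2
  linarith

/-- The scalar product of two contractions along the second variable is the scalar product of the
contractions along the first variable. -/
lemma integral_gram_mul_gram (ha : Measurable a) (hc : Measurable c) (ha' : Measurable a')
    (hc' : Measurable c') {A B A' B' : ℝ} (hA : ∀ z, |a z| ≤ A) (hB : ∀ z, |c z| ≤ B)
    (hA' : ∀ z, |a' z| ≤ A') (hB' : ∀ z, |c' z| ≤ B') :
    ∫ z, gram P a c z * gram P a' c' z ∂P.prod P =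
      ∫ w, gram P (a ∘ Prod.swap) (a' ∘ Prod.swap) w *
        gram P (c ∘ Prod.swap) (c' ∘ Prod.swap) w ∂P.prod P := by
  -- Both sides are integrals of `a(x,s) c(y,s) a'(x,s') c'(y,s')` over all four variables.
  have e1 : ∀ z : Ω × Ω, gram P a c z * gram P a' c' z = ∫ w : Ω × Ω,
      (a (z.1, w.1) * c (z.2, w.1)) * (a' (z.1, w.2) * c' (z.2, w.2)) ∂P.prod P := fun z =>
    (integral_prod_mul (μ := P) (ν := P) (fun s => a (z.1, s) * c (z.2, s))
      fun s => a' (z.1, s) * c' (z.2, s)).symm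
  have e2 : ∀ w : Ω × Ω, gram P (a ∘ Prod.swap) (a' ∘ Prod.swap) w *
      gram P (c ∘ Prod.swap) (c' ∘ Prod.swap) w = ∫ z : Ω × Ω,
      (a (z.1, w.1) * c (z.2, w.1)) * (a' (z.1, w.2) * c' (z.2, w.2)) ∂P.prod P := fun w => by
    refine (integral_prod_mul (μ := P) (ν := P) (fun s => a (s, w.1) * a' (s, w.2))
      fun s => c (s, w.1) * c' (s, w.2)).symm.trans ?_
    exact integral_congr_ae (ae_of_all _ fun z => by ring)
  simp only [e1, e2]
  refine integral_integral_swap (f := fun z w : Ω × Ω =>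
    (a (z.1, w.1) * c (z.2, w.1)) * (a' (z.1, w.2) * c' (z.2, w.2))) ?_
  refine integrable_of_abs_le (B := (A * B) * (A' * B')) ?_ fun x => ?_
  · simp only [Function.uncurry_def]
    fun_prop
  · simp only [Function.uncurry_def, abs_mul]
    have hA0 := (abs_nonneg _).trans (hA (x.1.1, x.2.1))
    have hA0' := (abs_nonneg _).trans (hA' (x.1.1, x.2.1))
    exact mul_le_mul (mul_le_mul (hA _) (hB _) (abs_nonneg _) hA0)
      (mul_le_mul (hA' _) (hB' _) (abs_nonneg _) hA0') (by positivity)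
      (mul_nonneg hA0 ((abs_nonneg _).trans (hB (x.1.1, x.2.1))))

lemma abs_gram_le {A B : ℝ} (hA : ∀ z, |a z| ≤ A) (hB : ∀ z, |c z| ≤ B) (w : Ω × Ω) :
    |gram P a c w| ≤ A * B :=
  abs_integral_le_of_abs_le fun s => by
    rw [abs_mul]
    exact mul_le_mul (hA _) (hB _) (abs_nonneg _) ((abs_nonneg _).trans (hA (w.1, s)))

/-- The square is expanded, each scalar product is rewritten by `integral_gram_mul_gram`, and
Cauchy–Schwarz separates the `f`s from the `g`s. Only contractions of `f`s with `f`s and of `g`s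
with `g`s are needed. -/
lemma integral_sq_sum_gram_le {ι : Type*} (S : Finset ι) {f g : ι → Ω × Ω → ℝ}
    (hf : ∀ p, Measurable (f p)) (hg : ∀ p, Measurable (g p)) {A B : ℝ}
    (hA : ∀ p z, |f p z| ≤ A) (hB : ∀ p z, |g p z| ≤ B) {F G : ι → ι → ℝ}
    (hF0 : ∀ p q, 0 ≤ F p q) (hG0 : ∀ p q, 0 ≤ G p q)
    (hF : ∀ p q, ∫ w, gram P (f p ∘ Prod.swap) (f q ∘ Prod.swap) w ^ 2 ∂P.prod P ≤ F p q ^ 2)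
    (hG : ∀ p q, ∫ w, gram P (g p ∘ Prod.swap) (g q ∘ Prod.swap) w ^ 2 ∂P.prod P ≤ G p q ^ 2) :
    ∫ z, (∑ p ∈ S, gram P (f p) (g p) z) ^ 2 ∂P.prod P ≤
      ∑ p ∈ S, ∑ q ∈ S, F p q * G p q := by
  have hAg : ∀ {f : ι → Ω × Ω → ℝ} {A : ℝ}, (∀ p, Measurable (f p)) → (∀ p z, |f p z| ≤ A) →
      ∀ p q, Integrable
        (fun w => gram P (f p ∘ Prod.swap) (f q ∘ Prod.swap) w ^ 2) (P.prod P) :=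
    fun {f A} hf hA p q => integrable_of_abs_le (B := (A * A) ^ 2)
      ((measurable_gram ((hf p).comp measurable_swap) ((hf q).comp measurable_swap)).pow_const 2)
      fun w => by
        rw [abs_pow]
        exact pow_le_pow_left₀ (abs_nonneg _) (abs_gram_le (fun z => hA p _) (fun z => hA q _) w) 2
  have hint : ∀ p q, Integrable (fun z => gram P (f p) (g p) z * gram P (f q) (g q) z) (P.prod P) :=
    fun p q => integrable_of_abs_le (B := (A * B) * (A * B))
      ((measurable_gram (hf p) (hg p)).mul (measurable_gram (hf q) (hg q))) fun z => by
        have h1 := abs_gram_le (P := P) (hA p) (hB p) z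
        rw [abs_mul]
        exact mul_le_mul h1 (abs_gram_le (hA q) (hB q) z) (abs_nonneg _) ((abs_nonneg _).trans h1)
  simp only [sq, Finset.sum_mul_sum]
  rw [integral_finsetSum _ fun p _ => integrable_finsetSum _ fun q _ => hint p q]
  refine Finset.sum_le_sum fun p _ => ?_
  rw [integral_finsetSum _ fun q _ => hint p q]
  refine Finset.sum_le_sum fun q _ => ?_
  rw [integral_gram_mul_gram (hf p) (hg p) (hf q) (hg q) (hA p) (hB p) (hA q) (hB q)]
  refine abs_le_of_sq_le_sq' ?_ (mul_nonneg (hF0 p q) (hG0 p q)) |>.2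
  refine (sq_integral_mul_le ?_ ?_ (hAg hf hA p q) (hAg hg hB p q)).2.trans ?_
  · exact (measurable_gram ((hf p).comp measurable_swap)
      ((hf q).comp measurable_swap)).aestronglyMeasurable
  · exact (measurable_gram ((hg p).comp measurable_swap)
      ((hg q).comp measurable_swap)).aestronglyMeasurable
  · rw [mul_pow]
    exact mul_le_mul (hF p q) (hG p q) (integral_nonneg fun _ => sq_nonneg _) (sq_nonneg _)

end Gram

/-! ### The L² norm of the sum of pair expectations -/

section CloseSum

variable {Ω I E : Type*} [MeasurableSpace Ω] [MeasurableSpace E] [Fintype I] [EMetricSpace I]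
variable {P : Measure Ω} [IsProbabilityMeasure P] {X : I → Ω → E} {R m : ℝ≥0∞} {β βm : ℝ}
  {f g h : I → I → E → E → ℝ} {b b' : ℝ} {D : ℕ}

open Classical in
lemma NbhdBound.card_filter_le (hD : NbhdBound I R D) (hm : m ≤ 10 * R) (i : I) :
    ((Finset.univ.filter fun j => edist i j ≤ m).card : ℝ) ≤ D :=
  Nat.cast_le.2 (hD i _ fun _ hj => (Finset.mem_filter.1 hj).2.trans hm)

open Classical in
lemma NbhdBound.card_pairs_le (hD : NbhdBound I R D) (hm : m ≤ 10 * R) :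
    ((Finset.univ.filter fun p : I × I => edist p.1 p.2 ≤ m).card : ℝ) ≤ Fintype.card I * D := by
  rw [Finset.card_filter, Fintype.sum_prod_type]
  push_cast
  calc ∑ k : I, ∑ k' : I, (if edist k k' ≤ m then 1 else 0 : ℝ)
      = ∑ k : I, ((Finset.univ.filter fun j => edist k j ≤ m).card : ℝ) := by
        simp only [Finset.sum_boole]
    _ ≤ ∑ _k : I, (D : ℝ) := Finset.sum_le_sum fun k _ => hD.card_filter_le hm k
    _ = _ := by simp

open Classical in
lemma NbhdBound.card_pairs_near_le (hD : NbhdBound I R D) (hm : m ≤ 10 * R) {r : ℝ≥0∞}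
    (hr : r ≤ 10 * R) (i : I) :
    (((Finset.univ.filter fun p : I × I => edist p.1 p.2 ≤ m).filter
      fun p => edist i p.1 ≤ r).card : ℝ) ≤ D * D := by
  rw [Finset.filter_filter, Finset.card_filter, Fintype.sum_prod_type]
  push_cast
  calc ∑ k : I, ∑ k' : I, (if edist k k' ≤ m ∧ edist i k ≤ r then 1 else 0 : ℝ)
      = ∑ k with edist i k ≤ r, ((Finset.univ.filter fun j => edist k j ≤ m).card : ℝ) := by
        rw [Finset.sum_filter]
        refine Finset.sum_congr rfl fun k _ => ?_
        by_cases hk : edist i k ≤ r <;> simp [hk]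
    _ ≤ ∑ k with edist i k ≤ r, (D : ℝ) := Finset.sum_le_sum fun k _ => hD.card_filter_le hm k
    _ ≤ _ := by
        rw [Finset.sum_const, nsmul_eq_mul]
        have := hD.card_filter_le hr i
        gcongr

lemma le_ten_mul (R : ℝ≥0∞) {c : ℕ} (hc : c ≤ 10) : (c : ℝ≥0∞) * R ≤ 10 * R := by
  exact_mod_cast ennreal_mul_le_mul R hc

lemma le_ten_mul_self (R : ℝ≥0∞) : R ≤ 10 * R := by
  simpa using le_ten_mul R (c := 1) (by norm_num)

open Classical in
-- If `p` and `q` are close in either coordinate, their first indices are within `3R`, since both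
-- pairs have diameter at most `m ≤ R`. Such `(p, q)` number at most `|I| D³`; all others carry the
-- small bounds `φ` and `γ`.
lemma NbhdBound.sum_pairs_le (hD : NbhdBound I R D) (hm : m ≤ R) {φ φ' γ γ' : ℝ} (hφ : 0 ≤ φ)
    (hγ : 0 ≤ γ) (hφ' : φ ≤ φ') (hγ' : γ ≤ γ') :
    ∑ p : I × I with edist p.1 p.2 ≤ m, ∑ q : I × I with edist q.1 q.2 ≤ m,
      (if edist p.1 q.1 ≤ m then φ' else φ) * (if edist p.2 q.2 ≤ m then γ' else γ) ≤
      (Fintype.card I * D) ^ 2 * (φ * γ) + Fintype.card I * D ^ 3 * (φ' * γ') := by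
  set S := Finset.univ.filter fun p : I × I => edist p.1 p.2 ≤ m with hS
  have hSc : (S.card : ℝ) ≤ Fintype.card I * D :=
    hD.card_pairs_le (hm.trans (le_ten_mul_self R))
  have hφ0 := hφ.trans hφ'
  have hγ0 := hγ.trans hγ'
  have hpt : ∀ p ∈ S, ∀ q ∈ S, (if edist p.1 q.1 ≤ m then φ' else φ) *
      (if edist p.2 q.2 ≤ m then γ' else γ) ≤
      φ * γ + if edist p.1 q.1 ≤ 3 * R then φ' * γ' else 0 := by
    intro p hp q hq
    have hp' : edist p.1 p.2 ≤ R := (Finset.mem_filter.1 hp).2.trans hm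
    have hq' : edist q.1 q.2 ≤ R := (Finset.mem_filter.1 hq).2.trans hm
    by_cases h3 : edist p.1 q.1 ≤ 3 * R
    · rw [if_pos h3]
      have h1 : (if edist p.1 q.1 ≤ m then φ' else φ) ≤ φ' := by split_ifs <;> linarith
      have h2 : (if edist p.2 q.2 ≤ m then γ' else γ) ≤ γ' := by split_ifs <;> linarith
      have h3 : 0 ≤ if edist p.2 q.2 ≤ m then γ' else γ := by split_ifs <;> linarith
      nlinarith [mul_le_mul h1 h2 h3 hφ0, mul_nonneg hφ hγ]
    · have h1 : ¬ edist p.1 q.1 ≤ m := fun h => h3 ((h.trans hm).trans (le_three_mul R))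
      have h2 : ¬ edist p.2 q.2 ≤ m := fun h => by
        refine h3 ?_
        have h4 : edist p.1 q.1 ≤ edist p.1 p.2 + edist p.2 q.2 + edist q.2 q.1 :=
          edist_triangle4 _ _ _ _
        rw [edist_comm q.2] at h4
        refine h4.trans ((add_le_add (add_le_add hp' (h.trans hm)) hq').trans_eq ?_)
        ring
      rw [if_neg h1, if_neg h2, if_neg h3, add_zero]
  calc _ ≤ ∑ p ∈ S, ∑ q ∈ S, (φ * γ + if edist p.1 q.1 ≤ 3 * R then φ' * γ' else 0) :=
        Finset.sum_le_sum fun p hp => Finset.sum_le_sum fun q hq => hpt p hp q hq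
    _ = S.card * (S.card * (φ * γ)) + ∑ p ∈ S,
        ((S.filter fun q => edist p.1 q.1 ≤ 3 * R).card : ℝ) * (φ' * γ') := by
        simp [Finset.sum_add_distrib, ← Finset.sum_filter]
    _ ≤ Fintype.card I * D * (Fintype.card I * D * (φ * γ)) +
        ∑ _p ∈ S, (D * D : ℝ) * (φ' * γ') := by
        gcongr with p
        exact hD.card_pairs_near_le (hm.trans (le_ten_mul_self R))
          (by exact_mod_cast le_ten_mul R (c := 3) (by norm_num)) p.1
    _ ≤ Fintype.card I * D * (Fintype.card I * D * (φ * γ)) +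
        Fintype.card I * D * ((D * D : ℝ) * (φ' * γ')) := by
        rw [Finset.sum_const, nsmul_eq_mul]
        gcongr
    _ = _ := by ring

/-- The kernel of two indices, evaluated at independent observations. -/
def kerEval (X : I → Ω → E) (h : I → I → E → E → ℝ) (i k : I) (z : Ω × Ω) : ℝ :=
  h i k (X i z.1) (X k z.2)

lemma IsKernel.measurable_kerEval (hK : IsKernel P X R h b) (hX : ∀ i, Measurable (X i))
    (i k : I) : Measurable (kerEval X h i k) :=
  (hK.measurable i k).comp (((hX i).comp measurable_fst).prodMk ((hX k).comp measurable_snd))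

lemma IsKernel.kerEval_comp_swap (hK : IsKernel P X R h b) (i k : I) :
    kerEval X h i k ∘ Prod.swap = kerEval X h k i :=
  funext fun _ => hK.symm _ _ _ _

open Classical in
-- A pair expectation is a contraction over the common sample point at which `X_k` and `X_{k'}` are
-- evaluated, so it carries their true joint law. After the interchange the contracted variable is
-- the anchor `X_u` or `X_v`.
lemma IsKernel.integral_sq_sum_pairInt_le (hf : IsKernel P X R f b) (hg : IsKernel P X R g b')
    (hX : ∀ i, Measurable (X i)) (hD : NbhdBound I R D) (hm : m ≤ R) {φ φ' γ γ' : ℝ} (hφ : 0 ≤ φ)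
    (hγ : 0 ≤ γ) (hφ' : φ ≤ φ') (hγ' : γ ≤ γ') (u v : I)
    (h1 : ∀ k k', ∫ w, gram P (kerEval X f k u) (kerEval X f k' u) w ^ 2 ∂P.prod P ≤ φ' ^ 2)
    (h1' : ∀ k k', m < edist k k' →
      ∫ w, gram P (kerEval X f k u) (kerEval X f k' u) w ^ 2 ∂P.prod P ≤ φ ^ 2)
    (h2 : ∀ k k', ∫ w, gram P (kerEval X g k v) (kerEval X g k' v) w ^ 2 ∂P.prod P ≤ γ' ^ 2)
    (h2' : ∀ k k', m < edist k k' →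
      ∫ w, gram P (kerEval X g k v) (kerEval X g k' v) w ^ 2 ∂P.prod P ≤ γ ^ 2) :
    ∫ z : Ω × Ω, (∑ p : I × I with edist p.1 p.2 ≤ m,
      pairInt P X f g u v p.1 p.2 (X u z.1) (X v z.2)) ^ 2 ∂P.prod P ≤
      (Fintype.card I * D) ^ 2 * (φ * γ) + Fintype.card I * D ^ 3 * (φ' * γ') := by
  refine (integral_sq_sum_gram_le (P := P) (Finset.univ.filter fun p : I × I => edist p.1 p.2 ≤ m)
    (f := fun p => kerEval X f u p.1) (g := fun p => kerEval X g v p.2)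
    (fun p => hf.measurable_kerEval hX _ _) (fun p => hg.measurable_kerEval hX _ _)
    (A := b) (B := b') (fun p z => hf.bound _ _ _ _) (fun p z => hg.bound _ _ _ _)
    (F := fun p q => if edist p.1 q.1 ≤ m then φ' else φ)
    (G := fun p q => if edist p.2 q.2 ≤ m then γ' else γ) (fun p q => ?_) (fun p q => ?_)
    (fun p q => ?_) fun p q => ?_).trans (hD.sum_pairs_le hm hφ hγ hφ' hγ')
  · split_ifs <;> linarith
  · split_ifs <;> linarith
  · rw [hf.kerEval_comp_swap, hf.kerEval_comp_swap]
    split_ifs with hpq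
    · exact h1 _ _
    · exact h1' _ _ (not_le.1 hpq)
  · rw [hg.kerEval_comp_swap, hg.kerEval_comp_swap]
    split_ifs with hpq
    · exact h2 _ _
    · exact h2' _ _ (not_le.1 hpq)

lemma IsKernel.sub (hg : IsKernel P X R g b') (hh : IsKernel P X R h b)
    (hX : ∀ i, Measurable (X i)) :
    IsKernel P X R (fun i k x y => g i k x y - h i k x y) (b' + b) where
  measurable i k := (hg.measurable i k).sub (hh.measurable i k)
  bound i k x y := (abs_sub _ _).trans (add_le_add (hg.bound i k x y) (hh.bound i k x y))
  symm i k x y := by rw [hg.symm, hh.symm]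
  zero i k hik x y := by rw [hg.zero i k hik, hh.zero i k hik, sub_zero]
  degenerate i k x := by
    have hi : ∀ {h b}, IsKernel P X R h b → Integrable (fun ω => h i k x (X k ω)) P :=
      fun hh => integrable_of_abs_le ((hh.measurable i k).comp (measurable_const.prodMk (hX k)))
        fun ω => hh.bound _ _ _ _
    rw [integral_sub (hi hg) (hi hh), hg.degenerate, hh.degenerate, sub_zero]

/-- Bilinearity, with `h = g - (g - h)`. It is used with `g` cut off so high that its contractions
are close to those of `H`, and `h` the working kernel. -/
lemma IsKernel.pairInt_eq (hg : IsKernel P X R g b') (hh : IsKernel P X R h b)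
    (hX : ∀ i, Measurable (X i)) (u v k k' : I) (x y : E) :
    pairInt P X h h u v k k' x y = pairInt P X g g u v k k' x y -
      pairInt P X g (fun i k x y => g i k x y - h i k x y) u v k k' x y -
      pairInt P X (fun i k x y => g i k x y - h i k x y) g u v k k' x y +
      pairInt P X (fun i k x y => g i k x y - h i k x y) (fun i k x y => g i k x y - h i k x y)
        u v k k' x y := by
  have hi : ∀ {h h' b b'}, IsKernel P X R h b → IsKernel P X R h' b' →
      Integrable (fun ω => h u k x (X k ω) * h' v k' y (X k' ω)) P :=
    fun {h h' b b'} hh hh' => integrable_of_abs_le (B := b * b')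
      (((hh.measurable u k).comp (measurable_const.prodMk (hX k))).mul
        ((hh'.measurable v k').comp (measurable_const.prodMk (hX k')))) fun ω => by
      rw [abs_mul]
      exact mul_le_mul (hh.bound _ _ _ _) (hh'.bound _ _ _ _) (abs_nonneg _)
        (hh.bound_nonneg u k x y)
  have hr := hg.sub hh hX
  unfold pairInt
  have s1 := integral_sub (hi hg hg) (hi hg hr)
  have s2 := integral_sub ((hi hg hg).sub (hi hg hr)) (hi hr hg)
  have s3 := integral_add (((hi hg hg).sub (hi hg hr)).sub (hi hr hg)) (hi hr hr)
  simp only [Pi.sub_apply] at s1 s2 s3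
  rw [← s1, ← s2, ← s3]
  exact integral_congr_ae (ae_of_all _ fun ω => by ring)

/-- The pair expectations of far indices are negligible. -/
lemma IsKernel.abs_pairInt_le_of_far (hh : IsKernel P X R h b) (hMm : IsMixing P X m βm)
    {u v k k' : I} (hk : m < edist k k') (x y : E) :
    |pairInt P X h h u v k k' x y| ≤ 4 * b ^ 2 * βm := by
  classical
  refine hMm.abs_integral_le_of_centred k (Φ := fun ξ => h u k x (ξ k) * h v k' y (ξ k'))
    (B := b ^ 2) ?_ (fun ξ => ?_) (fun ξ ζ h1 h2 => ?_) fun ξ => ?_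
  · exact ((hh.measurable u k).comp (measurable_const.prodMk (measurable_pi_apply k))).mul
      ((hh.measurable v k').comp (measurable_const.prodMk (measurable_pi_apply k')))
  · rw [abs_mul, sq]
    exact mul_le_mul (hh.bound _ _ _ _) (hh.bound _ _ _ _) (abs_nonneg _) (hh.bound_nonneg u k x y)
  · rw [h1, h2 k' hk]
  · simp only [Function.update_self, Function.update_of_ne (ne_of_lt_edist hk)]
    rw [integral_mul_const, hh.degenerate, zero_mul]

open Classical in
-- Pairs at a distance between `m` and `R` are handled by degeneracy and mixing at the smaller scale
-- `m`, which leaves the scale at which the contractions of `H` are controlled.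
lemma IsKernel.abs_closeSum_sub_le (hh : IsKernel P X R h b) (hMm : IsMixing P X m βm) (hm : m ≤ R)
    (hD : NbhdBound I R D) (u v : I) (x y : E) :
    |closeSum P X R h u v x y - ∑ p : I × I with edist p.1 p.2 ≤ m,
      pairInt P X h h u v p.1 p.2 x y| ≤ Fintype.card I * D * (4 * b ^ 2 * βm) := by
  have e : closeSum P X R h u v x y = ∑ p : I × I with edist p.1 p.2 ≤ R,
      pairInt P X h h u v p.1 p.2 x y := by
    rw [closeSum, Finset.sum_filter, Fintype.sum_prod_type]
  have hβ := hMm.nonneg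
  rw [e, ← Finset.sum_filter_add_sum_filter_not _ (fun p : I × I => edist p.1 p.2 ≤ m),
    Finset.filter_filter, Finset.filter_congr (q := fun p : I × I => edist p.1 p.2 ≤ m)
      fun p _ => ⟨fun hp => hp.2, fun hp => ⟨hp.trans hm, hp⟩⟩, add_sub_cancel_left]
  refine (Finset.abs_sum_le_sum_abs _ _).trans ((Finset.sum_le_sum (g := fun _ => 4 * b ^ 2 * βm)
    fun p hp => hh.abs_pairInt_le_of_far hMm (not_le.1 (Finset.mem_filter.1 hp).2) x y).trans ?_)
  rw [Finset.sum_const, nsmul_eq_mul]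
  refine mul_le_mul_of_nonneg_right ?_ (by positivity)
  exact (Nat.cast_le.2 (Finset.card_le_card (Finset.filter_subset _ _))).trans
    (hD.card_pairs_le (le_ten_mul_self R))

/-- The second moment of the sum of the pair expectations over the pairs of close indices. -/
lemma IsKernel.integral_closeSum_sq_le (hg : IsKernel P X R g b') (hh : IsKernel P X R h b)
    (hM : IsMixing P X R β) (hMm : IsMixing P X m βm) (hm : m ≤ R) (hD : NbhdBound I R D)
    (hn : 1 ≤ Fintype.card I) (hb : 1 ≤ b) (hτ : Negligible (Fintype.card I) b β)
    {φ φ' ψ : ℝ} (hφ : 0 ≤ φ) (hψ : 0 ≤ ψ) (hφ' : φ ≤ φ')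
    (h1 : ∀ u k k', ∫ w, gram P (kerEval X g k u) (kerEval X g k' u) w ^ 2 ∂P.prod P ≤ φ' ^ 2)
    (h2 : ∀ u k k', m < edist k k' →
      ∫ w, gram P (kerEval X g k u) (kerEval X g k' u) w ^ 2 ∂P.prod P ≤ φ ^ 2)
    (h3 : ∀ u k k', ∫ w, gram P (kerEval X (fun i k x y => g i k x y - h i k x y) k u)
      (kerEval X (fun i k x y => g i k x y - h i k x y) k' u) w ^ 2 ∂P.prod P ≤ ψ ^ 2)
    {u v : I} (huv : R < edist u v) :
    ∫ ω, closeSum P X R h u v (X u ω) (X v ω) ^ 2 ∂P ≤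
      1 + 5 * ((Fintype.card I * D * (4 * b ^ 2 * βm)) ^ 2 +
        (Fintype.card I * D) ^ 2 * (φ + ψ) ^ 2 + Fintype.card I * D ^ 3 * (φ' + ψ) ^ 2) := by
  classical
  have hX := hM.measurable
  have hr := hg.sub hh hX
  set r : I → I → E → E → ℝ := fun i k x y => g i k x y - h i k x y with hrdef
  -- The anchors are far from each other, so their joint law may be replaced by the product law; the
  -- summand 1 absorbs the error.
  have hjoint : ∫ ω, closeSum P X R h u v (X u ω) (X v ω) ^ 2 ∂P ≤
      1 + ∫ z : Ω × Ω, closeSum P X R h u v (X u z.1) (X v z.2) ^ 2 ∂P.prod P := by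
    have hmeas : Measurable fun z : E × E => closeSum P X R h u v z.1 z.2 := by
      unfold closeSum
      refine Finset.measurable_sum _ fun k _ => Finset.measurable_sum _ fun k' _ => ?_
      split_ifs
      · exact hh.measurable_pairInt hM hh u v k k'
      · exact measurable_const
    have hbd : ∀ x y, |closeSum P X R h u v x y ^ 2| ≤
        (Fintype.card I * (Fintype.card I * (b * b))) ^ 2 := fun x y => by
      rw [abs_pow]; exact pow_le_pow_left₀ (abs_nonneg _) (hh.abs_closeSum_le _ _ _ _) 2
    have hs := hM.swap {u} (by simp) (Φ := fun ξ => closeSum P X R h u v (ξ u) (ξ v) ^ 2)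
      ((hh.measurable_closeSum_eval hM u v).pow_const 2) (fun ξ => hbd _ _)
      fun ξ ζ e1 e2 => by rw [e1 u (by simp), e2 v (by simpa using huv)]
    simp only [Finset.piecewise_singleton, Function.update_self,
      Function.update_of_ne (ne_of_lt_edist huv)] at hs
    have hi : Integrable (fun z : Ω × Ω => closeSum P X R h u v (X u z.1) (X v z.2) ^ 2)
        (P.prod P) := integrable_of_abs_le (((hmeas.comp (((hX u).comp measurable_fst).prodMk
          ((hX v).comp measurable_snd)))).pow_const 2) fun z => hbd _ _
    rw [integral_prod_symm _ hi]
    have ht := hτ.le_one hn hb hM.nonneg (p := 4) (q := 4) (by norm_num) (by norm_num)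
    have e : 4 * (Fintype.card I * (Fintype.card I * (b * b)) : ℝ) ^ 2 * β =
        (Fintype.card I : ℝ) ^ 4 * (4 * b ^ 4 * β) := by ring
    rw [e] at hs
    linarith [(abs_le.1 hs).2]
  set N : (I → I → E → E → ℝ) → (I → I → E → E → ℝ) → Ω × Ω → ℝ := fun f f' z =>
    ∑ p : I × I with edist p.1 p.2 ≤ m, pairInt P X f f' u v p.1 p.2 (X u z.1) (X v z.2) with hN
  have hNi : ∀ {f f' b b'}, IsKernel P X R f b → IsKernel P X R f' b' →
      Integrable (fun z => N f f' z ^ 2) (P.prod P) := by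
    intro f f' b b' hf hf'
    refine integrable_of_abs_le (B := (∑ p : I × I with edist p.1 p.2 ≤ m, b * b') ^ 2)
      (Measurable.pow_const (Finset.measurable_sum _ fun p _ =>
        (hf.measurable_pairInt hM hf' u v p.1 p.2).comp (((hX u).comp measurable_fst).prodMk
          ((hX v).comp measurable_snd))) 2) fun z => ?_
    rw [abs_pow]
    exact pow_le_pow_left₀ (abs_nonneg _) ((Finset.abs_sum_le_sum_abs _ _).trans
      (Finset.sum_le_sum fun p _ => hf.abs_pairInt_le hf' _ _ _ _ _ _)) 2
  -- Each of the four terms is bounded through contractions of a kernel with itself, also the mixed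
  -- ones, which cost `φ ψ`; no contraction of `g` with `r` occurs. The bounds add up to `(φ + ψ)²`
  -- and `(φ' + ψ)²`.
  have bgg := hg.integral_sq_sum_pairInt_le hg hX hD hm hφ hφ hφ' hφ' u v (h1 u) (h2 u) (h1 v) (h2 v)
  have bgr := hg.integral_sq_sum_pairInt_le hr hX hD hm hφ hψ hφ' le_rfl u v (h1 u) (h2 u) (h3 v)
    fun k k' _ => h3 v k k'
  have brg := hr.integral_sq_sum_pairInt_le hg hX hD hm hψ hφ le_rfl hφ' u v (h3 u)
    (fun k k' _ => h3 u k k') (h1 v) (h2 v)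
  have brr := hr.integral_sq_sum_pairInt_le hr hX hD hm hψ hψ le_rfl le_rfl u v (h3 u)
    (fun k k' _ => h3 u k k') (h3 v) fun k k' _ => h3 v k k'
  set F : ℝ := Fintype.card I * D * (4 * b ^ 2 * βm) with hF
  have hpt : ∀ z : Ω × Ω, closeSum P X R h u v (X u z.1) (X v z.2) ^ 2 ≤
      5 * F ^ 2 + 5 * (N g g z ^ 2 + (N g r z ^ 2 + (N r g z ^ 2 + N r r z ^ 2))) := by
    intro z
    have h0 := hh.abs_closeSum_sub_le hMm hm hD u v (X u z.1) (X v z.2)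
    have e : ∑ p : I × I with edist p.1 p.2 ≤ m, pairInt P X h h u v p.1 p.2 (X u z.1) (X v z.2) =
        N g g z - N g r z - N r g z + N r r z := by
      simp only [hN, ← Finset.sum_sub_distrib, ← Finset.sum_add_distrib]
      exact Finset.sum_congr rfl fun p _ => hg.pairInt_eq hh hX _ _ _ _ _ _
    rw [e] at h0
    set c := closeSum P X R h u v (X u z.1) (X v z.2)
    have h5 := sq_le_sq' (neg_le_of_abs_le h0) (le_of_abs_le h0)
    have key : ∀ a b c d f : ℝ, (f + a - b - c + d) ^ 2 ≤
        5 * f ^ 2 + 5 * (a ^ 2 + (b ^ 2 + (c ^ 2 + d ^ 2))) := fun a b c d f => by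
      nlinarith [sq_nonneg (a + b), sq_nonneg (a + c), sq_nonneg (a - d), sq_nonneg (b - c),
        sq_nonneg (b + d), sq_nonneg (c + d), sq_nonneg (f - a), sq_nonneg (f + b),
        sq_nonneg (f + c), sq_nonneg (f - d)]
    have h6 := key (N g g z) (N g r z) (N r g z) (N r r z)
      (c - (N g g z - N g r z - N r g z + N r r z))
    have h7 : c - (N g g z - N g r z - N r g z + N r r z) + N g g z - N g r z - N r g z + N r r z =
      c := by ring
    rw [h7] at h6
    linarith
  have i1 := hNi hr hg
  have i2 := hNi hr hr
  have i3 := hNi hg hr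
  have i4 := hNi hg hg
  have s1 := integral_add i1 i2
  have s2 := integral_add i3 (i1.add i2)
  have s3 := integral_add i4 (i3.add (i1.add i2))
  have s4 := integral_add (integrable_const (μ := P.prod P) (5 * F ^ 2))
    ((i4.add (i3.add (i1.add i2))).const_mul 5)
  have hle : ∫ z : Ω × Ω, closeSum P X R h u v (X u z.1) (X v z.2) ^ 2 ∂P.prod P ≤ _ :=
    integral_mono_of_nonneg (ae_of_all _ fun z => sq_nonneg _)
    ((integrable_const (μ := P.prod P) (5 * F ^ 2)).add
      ((i4.add (i3.add (i1.add i2))).const_mul 5)) (ae_of_all _ hpt)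
  simp only [Pi.add_apply] at s2 s3 s4 hle
  rw [s4, integral_const, integral_const_mul, s3, s2, s1] at hle
  simp only [probReal_univ, one_smul] at hle
  refine hjoint.trans ?_
  generalize (Fintype.card I : ℝ) = n at *
  nlinarith
end CloseSum

/-! ### The truncated kernels are good -/

section TruncKernel

variable {Ω I E : Type*} [MeasurableSpace Ω] [MeasurableSpace E] [Fintype I] [EMetricSpace I]
variable {P : Measure Ω} [IsProbabilityMeasure P] {X : I → Ω → E} {R m : ℝ≥0∞} {β βm : ℝ}
  {H : E → E → ℝ} {α b b' G : ℝ} {D : ℕ}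

open Classical in
/-- The truncated kernel for far indices. -/
noncomputable def truncKernel (P : Measure Ω) (X : I → Ω → E) (H : E → E → ℝ) (R : ℝ≥0∞) (b : ℝ)
    (i k : I) (x y : E) : ℝ :=
  if edist i k ≤ 3 * R then 0 else truncated P X H b i k x y

lemma truncKernel_of_le {i k : I} (hik : edist i k ≤ 3 * R) (x y : E) :
    truncKernel P X H R b i k x y = 0 :=
  if_pos hik

lemma truncKernel_of_lt {i k : I} (hik : 3 * R < edist i k) (x y : E) :
    truncKernel P X H R b i k x y = truncated P X H b i k x y :=
  if_neg (not_le.2 hik)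

/-- Double centring gives degeneracy at every point, not only almost everywhere, as the pointwise
integration over a single updated coordinate requires. It adds three averages to the cut-off kernel,
hence the bound `4b`. -/
lemma IsDegenerate.isKernel (hH : IsDegenerate P X H α) (R : ℝ≥0∞) (hb : 0 ≤ b) :
    IsKernel P X R (truncKernel P X H R b) (4 * b) where
  measurable i k := by
    unfold truncKernel; split_ifs
    · exact measurable_const
    · exact hH.measurable_truncated b i k
  bound i k x y := by
    unfold truncKernel; split_ifs
    · simpa using hb
    · exact abs_truncated_le hb x y
  symm i k x y := by
    unfold truncKernel
    rw [edist_comm k i, hH.truncated_symm hb]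
  zero i k hik x y := if_pos hik
  degenerate i k x := by
    rcases le_or_gt (edist i k) (3 * R) with h | h
    · simp only [truncKernel_of_le h, integral_zero]
    · simp only [truncKernel_of_lt h, hH.integral_truncated hb]

lemma IsDegenerate.integral_truncKernel_pow_four_le (hH : IsDegenerate P X H α) (hα : 0 ≤ α)
    (R : ℝ≥0∞) (hb : 0 ≤ b) (i k : I) :
    ∫ ω, truncKernel P X H R b i k (X i ω) (X k ω) ^ 4 ∂P ≤ 256 * α := by
  rcases le_or_gt (edist i k) (3 * R) with h | h
  · simp only [truncKernel_of_le h]; simpa using hα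
  · simp only [truncKernel_of_lt h]
    exact hH.integral_truncated_pow_four_le (ne_of_lt_edist h).symm
      (hH.coupling_self (ne_of_lt_edist h).symm) hb

lemma IsDegenerate.integral_truncKernel_sq_le (hH : IsDegenerate P X H α) (R : ℝ≥0∞) (hb : 0 ≤ b)
    (i k : I) : ∫ ω, truncKernel P X H R b i k (X i ω) (X k ω) ^ 2 ∂P ≤ 16 * √α := by
  rcases le_or_gt (edist i k) (3 * R) with h | h
  · simp only [truncKernel_of_le h]; simp
  · simp only [truncKernel_of_lt h]
    exact hH.integral_truncated_sq_le (ne_of_lt_edist h).symm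
      (hH.coupling_self (ne_of_lt_edist h).symm) hb

lemma IsDegenerate.integral_truncKernel_sub_sq_le (hH : IsDegenerate P X H α) (hα : 0 ≤ α)
    (R : ℝ≥0∞) (hb : 0 < b) (hbb : b ≤ b') (i k : I) :
    ∫ ω, (truncKernel P X H R b' i k (X i ω) (X k ω) -
      truncKernel P X H R b i k (X i ω) (X k ω)) ^ 2 ∂P ≤ 64 * (α / b ^ 2) := by
  rcases le_or_gt (edist i k) (3 * R) with h | h
  · simp only [truncKernel_of_le h]; simp; positivity
  · simp only [truncKernel_of_lt h]
    exact hH.integral_sq_truncated_sub_le (ne_of_lt_edist h).symm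
      (hH.coupling_self (ne_of_lt_edist h).symm) hb hbb

lemma IsDegenerate.integral_kerEval_sq_le (hH : IsDegenerate P X H α) (R : ℝ≥0∞) (hb : 0 ≤ b)
    (i k : I) : ∫ z, kerEval X (truncKernel P X H R b) i k z ^ 2 ∂P.prod P ≤ 16 * √α := by
  unfold kerEval
  rcases le_or_gt (edist i k) (3 * R) with h | h
  · simp only [truncKernel_of_le h]; simp
  · simp only [truncKernel_of_lt h]
    exact hH.integral_truncated_sq_le (ne_of_lt_edist h).symm
      (hH.coupling_prod (ne_of_lt_edist h).symm) hb

lemma IsDegenerate.integral_kerEval_sub_sq_le (hH : IsDegenerate P X H α) (hα : 0 ≤ α)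
    (R : ℝ≥0∞) (hb : 0 < b) (hbb : b ≤ b') (i k : I) :
    ∫ z, kerEval X (fun i k x y => truncKernel P X H R b' i k x y - truncKernel P X H R b i k x y)
      i k z ^ 2 ∂P.prod P ≤ 64 * (α / b ^ 2) := by
  unfold kerEval
  rcases le_or_gt (edist i k) (3 * R) with h | h
  · simp only [truncKernel_of_le h]; simp; positivity
  · simp only [truncKernel_of_lt h]
    exact hH.integral_sq_truncated_sub_le (ne_of_lt_edist h).symm
      (hH.coupling_prod (ne_of_lt_edist h).symm) hb hbb

lemma IsKernel.integral_gram_kerEval_sq_le {h : I → I → E → E → ℝ} (hK : IsKernel P X R h b)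
    (hX : ∀ i, Measurable (X i)) {v : ℝ}
    (hv : ∀ i k, ∫ z, kerEval X h i k z ^ 2 ∂P.prod P ≤ v) (u k k' : I) :
    ∫ w, gram P (kerEval X h k u) (kerEval X h k' u) w ^ 2 ∂P.prod P ≤ v ^ 2 := by
  have hi : ∀ k, Integrable (fun z => kerEval X h k u z ^ 2) (P.prod P) := fun k =>
    integrable_of_abs_le ((hK.measurable_kerEval hX k u).pow_const 2) (B := b ^ 2) fun z => by
      rw [abs_pow]; exact pow_le_pow_left₀ (abs_nonneg _) (hK.bound _ _ _ _) 2
  refine (integral_gram_sq_le (hK.measurable_kerEval hX k u) (hi k)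
    (hK.measurable_kerEval hX k' u) (hi k')).2.trans ?_
  rw [sq]
  exact mul_le_mul (hv _ _) (hv _ _) (integral_nonneg fun _ => sq_nonneg _)
    ((integral_nonneg fun _ => sq_nonneg _).trans (hv k u))

/-- The contraction of the truncated kernel is close to the contraction of the kernel. -/
lemma IsDegenerate.integral_gram_truncKernel_sq_le (hH : IsDegenerate P X H α) (hα : 0 ≤ α)
    (R : ℝ≥0∞) (hb : 0 < b)
    (hG : ∀ u k k', m < edist k k' →
      ∫ w : Ω × Ω, Gam P X H u u (X k w.1) (X k' w.2) ^ 2 ∂P.prod P ≤ G ^ 2)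
    {u k k' : I} (hk : m < edist k k') :
    ∫ w, gram P (kerEval X (truncKernel P X H R b) k u) (kerEval X (truncKernel P X H R b) k' u) w
      ^ 2 ∂P.prod P ≤ 2 * G ^ 2 + 1088 * (√α * (α / b ^ 2)) := by
  have hX := hH.measurable
  have hK := hH.isKernel R hb.le
  have hc : 0 ≤ 2 * G ^ 2 + 1088 * (√α * (α / b ^ 2)) := by positivity
  rcases le_or_gt (edist k u) (3 * R) with h1 | h1
  · have e : kerEval X (truncKernel P X H R b) k u = fun _ => 0 := by
      ext z; simp only [kerEval, truncKernel_of_le h1]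
    simp only [gram, e]
    simpa using hc
  rcases le_or_gt (edist k' u) (3 * R) with h2 | h2
  · have e : kerEval X (truncKernel P X H R b) k' u = fun _ => 0 := by
      ext z; simp only [kerEval, truncKernel_of_le h2]
    simp only [gram, e]
    simpa using hc
  have hne := (ne_of_lt_edist h1).symm
  have hne' := (ne_of_lt_edist h2).symm
  have hC := hH.coupling_prod hne
  have hC' := hH.coupling_prod hne'
  obtain ⟨d1, d2⟩ := hH.integral_sq_sub_truncated_le hne hC hb
  obtain ⟨d1', d2'⟩ := hH.integral_sq_sub_truncated_le hne' hC' hb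
  have e : ∀ k, 3 * R < edist k u → kerEval X (truncKernel P X H R b) k u =
      fun z => truncated P X H b k u (X k z.1) (X u z.2) := fun k hk => by
    ext z; simp only [kerEval, truncKernel_of_lt hk]
  have hi : ∀ k, Integrable (fun z => kerEval X (truncKernel P X H R b) k u z ^ 2) (P.prod P) :=
    fun k => integrable_of_abs_le ((hK.measurable_kerEval hX k u).pow_const 2)
      (B := (4 * b) ^ 2) fun z => by
      rw [abs_pow]; exact pow_le_pow_left₀ (abs_nonneg _) (hK.bound _ _ _ _) 2
  have hHm : ∀ k, Measurable fun z : Ω × Ω => H (X k z.1) (X u z.2) := fun k =>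
    measurable_prod_eval hX hH.measurable_kernel k u
  have hI := hi k
  have hI' := hi k'
  have hM := hK.measurable_kerEval hX k u
  have hM' := hK.measurable_kerEval hX k' u
  have hv := hH.integral_kerEval_sq_le R hb.le k u
  rw [e k h1] at hI hM hv ⊢
  rw [e k' h2] at hI' hM' ⊢
  refine (integral_gram_sub_sq_le (hHm k) (hC.integrable_pow hH.measurable_kernel) (hHm k')
    (hC'.integrable_pow hH.measurable_kernel) hM hI hM' hI' d1 d1').trans ?_
  -- Contracting over a single anchor gives the diagonal `Γ^{u,u}`.
  have eG : ∀ w : Ω × Ω, gram P (fun z => H (X k z.1) (X u z.2)) (fun z => H (X k' z.1) (X u z.2)) w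
      = Gam P X H u u (X k w.1) (X k' w.2) := fun w =>
    integral_congr_ae (ae_of_all _ fun s => by simp only [hH.symm (X u s)])
  simp only [eG]
  have h3 := hG u k k' hk
  have h4 := hC'.integral_sq_le hH.measurable_kernel
  -- The two products contribute `4 (16 · 1 + 16 · 16) = 1088`.
  have m1 := mul_le_mul d2 h4 (integral_nonneg fun _ => sq_nonneg _) (by positivity)
  have m2 := mul_le_mul hv d2' (integral_nonneg fun _ => sq_nonneg _) (by positivity)
  linarith

/-- The truncated kernels satisfy the assumptions of the quantitative central limit theorem. -/
theorem IsDegenerate.isGood (hH : IsDegenerate P X H α) (hα : 1 ≤ α) (hM : IsMixing P X R β)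
    (hMm : IsMixing P X m βm) (hm : m ≤ R) (hD : NbhdBound I R D) (hn : 1 ≤ Fintype.card I)
    (hb : 1 ≤ b) (hbb : b ≤ b') (hτ : Negligible (Fintype.card I) (4 * b) β)
    (hG : ∀ u k k', m < edist k k' →
      ∫ w : Ω × Ω, Gam P X H u u (X k w.1) (X k' w.2) ^ 2 ∂P.prod P ≤ G ^ 2) {φ : ℝ} (hφ : 0 ≤ φ)
    (hGφ : 2 * G ^ 2 + 1088 * (√α * (α / b' ^ 2)) ≤ φ ^ 2) :
    IsGood P X R (truncKernel P X H R b) (4 * b) β D (256 * α)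
      √(1 + 5 * ((Fintype.card I * D * (4 * (4 * b) ^ 2 * βm)) ^ 2 +
        (Fintype.card I * D) ^ 2 * (φ + 64 * (α / b ^ 2)) ^ 2 +
        Fintype.card I * D ^ 3 * ((φ + 16 * √α) + 64 * (α / b ^ 2)) ^ 2)) := by
  have hb0 : 0 < b := zero_lt_one.trans_le hb
  have hb0' : 0 < b' := hb0.trans_le hbb
  have hα0 : 0 ≤ α := zero_le_one.trans hα
  have hK := hH.isKernel R hb0.le
  have hK' := hH.isKernel R hb0'.le
  refine ⟨hM, hK, hD, hn, by linarith, hτ, by linarith,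
    hH.integral_truncKernel_pow_four_le hα0 R hb0.le, fun u v huv => ?_⟩
  rw [Real.sq_sqrt (by positivity)]
  refine hK'.integral_closeSum_sq_le hK hM hMm hm hD hn (by linarith) hτ hφ (by positivity)
    (by linarith [Real.sqrt_nonneg α]) (fun u k k' => ?_) (fun u k k' hk => ?_)
    (fun u k k' => ?_) huv
  · refine (hK'.integral_gram_kerEval_sq_le hH.measurable
      (hH.integral_kerEval_sq_le R hb0'.le) u k k').trans ?_
    have := Real.sqrt_nonneg α
    gcongr
    linarith
  · exact (hH.integral_gram_truncKernel_sq_le hα0 R hb0' hG hk).trans hGφ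
  · exact (hK'.sub hK hH.measurable).integral_gram_kerEval_sq_le hH.measurable
      (hH.integral_kerEval_sub_sq_le hα0 R hb0 hbb) u k k'

end TruncKernel

/-! ### L² approximation of the U-statistic -/

section Approximation

variable {Ω I E : Type*} [MeasurableSpace Ω] [MeasurableSpace E] [Fintype I] [EMetricSpace I]
variable {P : Measure Ω} [IsProbabilityMeasure P] {X : I → Ω → E} {R : ℝ≥0∞} {β : ℝ}
  {H : E → E → ℝ} {α b b' : ℝ} {D : ℕ}

lemma memLp_of_abs_le {f : Ω → ℝ} (hf : Measurable f) {B : ℝ} (hB : ∀ ω, |f ω| ≤ B) :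
    MemLp f 2 P :=
  MemLp.of_bound hf.aestronglyMeasurable B (ae_of_all _ hB)

lemma IsDegenerate.memLp_uStat (hH : IsDegenerate P X H α) : MemLp (uStat X H) 2 P := by
  unfold uStat
  refine memLp_finsetSum _ fun i _ => memLp_finsetSum _ fun k _ => ?_
  split_ifs with h
  · exact (memLp_two_iff_integrable_sq (hH.measurable_kernel.comp
      ((hH.measurable i).prodMk (hH.measurable k))).aestronglyMeasurable).2
      ((hH.coupling_self h).integrable_pow hH.measurable_kernel)
  · exact memLp_const 0

lemma IsDegenerate.measurable_eval_truncated (hH : IsDegenerate P X H α) (b : ℝ) (i k : I) :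
    Measurable fun ω => truncated P X H b i k (X i ω) (X k ω) :=
  (hH.measurable_truncated b i k).comp ((hH.measurable i).prodMk (hH.measurable k))

open Classical in
/-- The sum of the truncation errors is small in `L²`. -/
lemma IsDegenerate.variance_sum_error_le (hH : IsDegenerate P X H α) (hα : 0 ≤ α) (hb : 0 < b) :
    MemLp (fun ω => ∑ p : I × I, if p.1 ≠ p.2 then H (X p.1 ω) (X p.2 ω) -
      truncated P X H b p.1 p.2 (X p.1 ω) (X p.2 ω) else 0) 2 P ∧
    Var[fun ω => ∑ p : I × I, if p.1 ≠ p.2 then H (X p.1 ω) (X p.2 ω) -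
      truncated P X H b p.1 p.2 (X p.1 ω) (X p.2 ω) else 0; P] ≤
      Fintype.card I ^ 4 * (16 * (α / b ^ 2)) := by
  set v : I × I → Ω → ℝ := fun p ω => if p.1 ≠ p.2 then H (X p.1 ω) (X p.2 ω) -
      truncated P X H b p.1 p.2 (X p.1 ω) (X p.2 ω) else 0 with hv
  have hm : ∀ p, Measurable (v p) := fun p => by
    simp only [hv]
    split_ifs
    · exact (hH.measurable_kernel.comp ((hH.measurable p.1).prodMk (hH.measurable p.2))).sub
        (hH.measurable_eval_truncated b p.1 p.2)
    · exact measurable_const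
  have h2 : ∀ p, Integrable (fun ω => v p ω ^ 2) P ∧ ∫ ω, v p ω ^ 2 ∂P ≤ 16 * (α / b ^ 2) := by
    intro p
    by_cases hp : p.1 ≠ p.2
    · simp only [hv, if_pos hp]
      exact hH.integral_sq_sub_truncated_le hp (hH.coupling_self hp) hb
    · simp only [hv, if_neg hp, zero_pow two_ne_zero, integral_zero]
      exact ⟨integrable_const 0, by positivity⟩
  have hL : MemLp (fun ω => ∑ p, v p ω) 2 P := memLp_finsetSum _ fun p _ =>
    (memLp_two_iff_integrable_sq (hm p).aestronglyMeasurable).2 (h2 p).1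
  refine ⟨hL, (variance_le_expectation_sq hL.1).trans ?_⟩
  have hi : Integrable (fun ω => (Fintype.card I : ℝ) ^ 2 * ∑ p, v p ω ^ 2) P :=
    (integrable_finsetSum _ fun p _ => (h2 p).1).const_mul _
  refine (integral_mono hL.integrable_sq hi fun ω => ?_).trans ?_
  · have := sq_sum_le_card_mul_sum_sq (s := (Finset.univ : Finset (I × I))) (f := fun p => v p ω)
    simpa [← sq] using this
  · rw [integral_const_mul, integral_finsetSum _ fun p _ => (h2 p).1]
    calc _ ≤ (Fintype.card I : ℝ) ^ 2 * ∑ _p : I × I, 16 * (α / b ^ 2) := by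
          gcongr with p; exact (h2 p).2
      _ = _ := by simp; ring

/-- Decoupling of two pairs of far indices. -/
lemma IsDegenerate.sub_le_of_far (hH : IsDegenerate P X H α) (hM : IsMixing P X R β) (hb : 0 ≤ b)
    {i k j l : I} (h1 : R < edist i j) (h2 : R < edist i l) (h3 : R < edist k j)
    (h4 : R < edist k l) :
    ∫ ω, truncated P X H b i k (X i ω) (X k ω) * truncated P X H b j l (X j ω) (X l ω) ∂P -
      (∫ ω, truncated P X H b i k (X i ω) (X k ω) ∂P) *
        ∫ ω, truncated P X H b j l (X j ω) (X l ω) ∂P ≤ 4 * ((4 * b) * (4 * b)) * β := by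
  classical
  have hm : ∀ i k, Measurable fun ξ : I → E => truncated P X H b i k (ξ i) (ξ k) := fun i k => by
    have h : Measurable fun ξ : I → E => (ξ i, ξ k) :=
      (measurable_pi_apply i).prodMk (measurable_pi_apply k)
    exact (hH.measurable_truncated b i k).comp h
  have key := hM.abs_integral_mul_sub_le {i, k} Finset.card_le_two (hm i k) (hm j l)
    (fun ξ => abs_truncated_le hb _ _) (fun ξ => abs_truncated_le hb _ _)
    (fun ξ ζ h => by rw [h i (by simp), h k (by simp)])
    fun ξ ζ h => by rw [h j (by simpa using ⟨h1, h3⟩), h l (by simpa using ⟨h2, h4⟩)]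
  exact (le_abs_self _).trans key

open Classical in
/-- The variance of the sum over the pairs of close indices. -/
lemma IsDegenerate.variance_sum_near_le (hH : IsDegenerate P X H α) (hM : IsMixing P X R β)
    (hD : NbhdBound I R D) (hn : 1 ≤ Fintype.card I) (hb : 0 ≤ b) :
    MemLp (fun ω => ∑ p : I × I with p.1 ≠ p.2 ∧ edist p.1 p.2 ≤ 3 * R,
      truncated P X H b p.1 p.2 (X p.1 ω) (X p.2 ω)) 2 P ∧
    Var[fun ω => ∑ p : I × I with p.1 ≠ p.2 ∧ edist p.1 p.2 ≤ 3 * R,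
      truncated P X H b p.1 p.2 (X p.1 ω) (X p.2 ω); P] ≤
      Fintype.card I ^ 4 * (4 * ((4 * b) * (4 * b)) * β) +
        Fintype.card I * D ^ 3 * (16 * √α) := by
  set F : I × I → Ω → ℝ := fun p ω => truncated P X H b p.1 p.2 (X p.1 ω) (X p.2 ω) with hF
  set S := Finset.univ.filter fun p : I × I => p.1 ≠ p.2 ∧ edist p.1 p.2 ≤ 3 * R with hS
  have hm : ∀ p, Measurable (F p) := fun p => hH.measurable_eval_truncated b p.1 p.2
  have hL : ∀ p, MemLp (F p) 2 P := fun p => memLp_of_abs_le (hm p) fun ω => abs_truncated_le hb _ _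
  have hsum : (fun ω => ∑ p ∈ S, F p ω) = ∑ p ∈ S, F p := by ext ω; simp
  refine ⟨memLp_finsetSum _ fun p _ => hL p, ?_⟩
  rw [hsum, variance_sum' fun p _ => hL p]
  have hβ := hM.nonneg
  have hvar : ∀ p ∈ S, Var[F p; P] ≤ 16 * √α := fun p hp => by
    have hne := (Finset.mem_filter.1 hp).2.1
    refine (variance_le_expectation_sq (hL p).1).trans ?_
    exact hH.integral_truncated_sq_le hne (hH.coupling_self hne) hb
  have h10 : (3 : ℝ≥0∞) * R ≤ 10 * R := by exact_mod_cast le_ten_mul R (c := 3) (by norm_num)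
  have hsub : S ⊆ Finset.univ.filter fun p : I × I => edist p.1 p.2 ≤ 3 * R :=
    Finset.monotone_filter_right _ fun p _ hp => hp.2
  have hSc : (S.card : ℝ) ≤ Fintype.card I * D :=
    (Nat.cast_le.2 (Finset.card_le_card hsub)).trans (hD.card_pairs_le h10)
  have hSn : (S.card : ℝ) ≤ (Fintype.card I : ℝ) ^ 2 := by
    have := Finset.card_le_univ S
    rw [Fintype.card_prod, ← sq] at this
    exact_mod_cast this
  have hpt : ∀ p ∈ S, ∀ q ∈ S, cov[F p, F q; P] ≤ 4 * ((4 * b) * (4 * b)) * β +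
      if edist p.1 q.1 ≤ 7 * R then 16 * √α else 0 := by
    intro p hp q hq
    have hp' := (Finset.mem_filter.1 hp).2.2
    have hq' := (Finset.mem_filter.1 hq).2.2
    have ht : 0 ≤ 4 * ((4 * b) * (4 * b)) * β := by positivity
    split_ifs with h7
    -- The covariance is at most the mean of the two variances.
    · have h1 := variance_nonneg (F p - F q) P
      rw [variance_sub (hL p) (hL q)] at h1
      linarith [hvar p hp, hvar q hq]
    · rw [add_zero, covariance_eq_sub (hL p) (hL q)]
      -- The radius `7R` allows for the two pair diameters `3R` and still leaves a gap `R`.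
      have h7' : 3 * R + R + 3 * R < edist p.1 q.1 := by
        refine lt_of_eq_of_lt ?_ (not_le.1 h7); ring
      have f1 : R < edist p.1 q.1 := lt_of_le_of_lt (le_add_right (le_add_left le_rfl)) h7'
      have f2 : R < edist p.1 q.2 := not_le.1 fun h => not_le.2 h7' <| by
        refine (edist_triangle _ q.2 _).trans ((add_le_add h ?_).trans
          (add_le_add_left (le_add_left le_rfl) (3 * R)))
        rw [edist_comm]; exact hq'
      have f3 : R < edist p.2 q.1 := not_le.1 fun h => not_le.2 h7' <|
        (edist_triangle _ p.2 _).trans ((add_le_add hp' h).trans (le_add_right le_rfl))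
      have f4 : R < edist p.2 q.2 := not_le.1 fun h => not_le.2 h7' <| by
        refine (edist_triangle4 _ p.2 q.2 _).trans (add_le_add (add_le_add hp' h) ?_)
        rw [edist_comm]; exact hq'
      exact hH.sub_le_of_far hM hb f1 f2 f3 f4
  calc _ ≤ ∑ p ∈ S, ∑ q ∈ S, (4 * ((4 * b) * (4 * b)) * β +
        if edist p.1 q.1 ≤ 7 * R then 16 * √α else 0) :=
        Finset.sum_le_sum fun p hp => Finset.sum_le_sum fun q hq => hpt p hp q hq
    _ = S.card * (S.card * (4 * ((4 * b) * (4 * b)) * β)) + ∑ p ∈ S,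
        ((S.filter fun q => edist p.1 q.1 ≤ 7 * R).card : ℝ) * (16 * √α) := by
        simp [Finset.sum_add_distrib, ← Finset.sum_filter]
    _ ≤ (Fintype.card I : ℝ) ^ 2 * ((Fintype.card I : ℝ) ^ 2 * (4 * ((4 * b) * (4 * b)) * β)) +
        ∑ _p ∈ S, (D * D : ℝ) * (16 * √α) := by
        gcongr with p
        exact (Nat.cast_le.2 (Finset.card_le_card (Finset.filter_subset_filter _ hsub))).trans
          (hD.card_pairs_near_le h10 (by exact_mod_cast le_ten_mul R (c := 7) (by norm_num)) p.1)
    _ ≤ (Fintype.card I : ℝ) ^ 2 * ((Fintype.card I : ℝ) ^ 2 * (4 * ((4 * b) * (4 * b)) * β)) +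
        Fintype.card I * D * ((D * D : ℝ) * (16 * √α)) := by
        rw [Finset.sum_const, nsmul_eq_mul]
        gcongr
    _ = _ := by ring

/-- The rows are compared with the centred U-statistic without being centred themselves, so their
mean has to be negligible. -/
lemma IsKernel.abs_integral_sum_rowSum_le {h : I → I → E → E → ℝ} (hK : IsKernel P X R h b)
    (hM : IsMixing P X R β) (hn : 1 ≤ Fintype.card I) (hb : 1 ≤ b)
    (hτ : Negligible (Fintype.card I) b β) :
    |∫ ω, ∑ i, rowSum h i (fun l => X l ω) ∂P| ≤ 1 := by
  rw [integral_finsetSum _ fun i _ => hM.integrable_comp (hK.measurable_rowSum i)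
    (hK.abs_rowSum_le i)]
  refine (Finset.abs_sum_le_sum_abs _ _).trans ((Finset.sum_le_sum (g := fun _ =>
    (Fintype.card I : ℝ) * (4 * (b * 1) * β)) fun i _ => ?_).trans ?_)
  · simpa using hK.abs_integral_rowSum_mul_le hM i (Ψ := fun _ => 1) measurable_const (B := 1)
      (by simp) fun _ _ _ => rfl
  · have := hτ.le_one hn hb hM.nonneg (q := 2) (p := 1) (by norm_num) (by norm_num)
    simp only [Finset.sum_const, Finset.card_univ, nsmul_eq_mul]
    linarith

/-- The centred U-statistic is close in `L²` to the sum of the row sums of the truncated kernels. -/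
theorem IsDegenerate.integral_sq_uStat_sub_le (hH : IsDegenerate P X H α) (hα : 0 ≤ α)
    (hM : IsMixing P X R β) (hD : NbhdBound I R D) (hn : 1 ≤ Fintype.card I) (hb : 1 ≤ b)
    (hbb : b ≤ b') (hτ : Negligible (Fintype.card I) (4 * b' + 4 * b) β) :
    ∫ ω, (uStat X H ω - ∫ ω', uStat X H ω' ∂P -
      ∑ i, rowSum (truncKernel P X H R b) i fun l => X l ω) ^ 2 ∂P ≤
      4 * (Fintype.card I ^ 4 * (16 * (α / b' ^ 2)) +
        (1 + Fintype.card I * D ^ 3 * (16 * √α)) +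
        (128 * Fintype.card I ^ 2 * D ^ 3 * (64 * (α / b ^ 2)) + 3 * Fintype.card I * D) + 1) := by
  classical
  have hb0 : 0 < b := zero_lt_one.trans_le hb
  have hb0' : 0 < b' := hb0.trans_le hbb
  have hβ := hM.nonneg
  have hX := hH.measurable
  have hK := hH.isKernel R hb0.le
  have hK' := hH.isKernel R hb0'.le
  have hr := hK'.sub hK hX
  obtain ⟨L1, V1⟩ := hH.variance_sum_error_le hα hb0'
  obtain ⟨L2, V2⟩ := hH.variance_sum_near_le hM hD hn hb0'.le
  have hτ1 : Negligible (Fintype.card I) (4 * b) β := by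
    refine le_trans ?_ hτ
    gcongr
    linarith
  have EB := hK.abs_integral_sum_rowSum_le hM hn (by linarith) hτ1
  have E3 := hr.integral_sq_sum_rowSum_le hM hD hn (by linarith) hτ
    (hH.integral_truncKernel_sub_sq_le hα R hb0 hbb)
  set h2 := truncKernel P X H R b' with hh2
  set h := truncKernel P X H R b with hh
  set r : I → I → E → E → ℝ := fun i k x y => h2 i k x y - h i k x y with hrd
  -- Four pieces: `U1` is the tail beyond the high level `b'`, small enough for Cauchy–Schwarz over
  -- all pairs; `U2` collects the close pairs; `U3` passes from `b'` to `b` for far pairs, where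
  -- both kernels are bounded and the mixing estimate of second moments applies; `B` is the sum that
  -- is kept.
  set U1 : Ω → ℝ := fun ω => ∑ p : I × I, if p.1 ≠ p.2 then H (X p.1 ω) (X p.2 ω) -
      truncated P X H b' p.1 p.2 (X p.1 ω) (X p.2 ω) else 0 with hU1
  set U2 : Ω → ℝ := fun ω => ∑ p : I × I with p.1 ≠ p.2 ∧ edist p.1 p.2 ≤ 3 * R,
      truncated P X H b' p.1 p.2 (X p.1 ω) (X p.2 ω) with hU2
  set U3 : Ω → ℝ := fun ω => ∑ i, rowSum r i (fun l => X l ω) with hU3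
  set B : Ω → ℝ := fun ω => ∑ i, rowSum h i (fun l => X l ω) with hB
  have hrow : ∀ {h b}, IsKernel P X R h b →
      MemLp (fun ω => ∑ i, rowSum h i (fun l => X l ω)) 2 P := fun {h b} hK =>
    memLp_finsetSum _ fun i _ => memLp_of_abs_le
      ((hK.measurable_rowSum i).comp hM.measurable_sample) fun ω => hK.abs_rowSum_le i _
  have L3 : MemLp U3 2 P := hrow hr
  have LB : MemLp B 2 P := hrow hK
  have hdec : ∀ ω, uStat X H ω = U1 ω + U2 ω + U3 ω + B ω := by
    intro ω
    simp only [uStat, hU1, hU2, hU3, hB, rowSum, ← Finset.sum_add_distrib, Finset.sum_filter,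
      Fintype.sum_prod_type]
    refine Finset.sum_congr rfl fun i _ => Finset.sum_congr rfl fun k _ => ?_
    simp only [hrd]
    rcases le_or_gt (edist i k) (3 * R) with h3 | h3
    · rw [hh, hh2, truncKernel_of_le h3, truncKernel_of_le h3]
      by_cases hik : i = k
      · simp [hik]
      · simp [hik, h3]
    · have hik : i ≠ k := (ne_of_lt_edist h3).symm
      rw [hh, hh2, truncKernel_of_lt h3, truncKernel_of_lt h3]
      simp [hik, not_le.2 h3]
  have hi : ∀ {f : Ω → ℝ}, MemLp f 2 P → Integrable f P := fun hf => hf.integrable one_le_two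
  have hE : ∫ ω, uStat X H ω ∂P = ∫ ω, U1 ω ∂P + ∫ ω, U2 ω ∂P + ∫ ω, U3 ω ∂P + ∫ ω, B ω ∂P := by
    simp only [hdec]
    have s1 := integral_add (hi L1) (hi L2)
    have s2 := integral_add ((hi L1).add (hi L2)) (hi L3)
    have s3 := integral_add (((hi L1).add (hi L2)).add (hi L3)) (hi LB)
    simp only [Pi.add_apply] at s2 s3
    rw [s3, s2, s1]
  have V3 : Var[U3; P] ≤ 128 * Fintype.card I ^ 2 * D ^ 3 * (64 * (α / b ^ 2)) +
      3 * Fintype.card I * D := (variance_le_expectation_sq L3.1).trans E3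
  have ht : (Fintype.card I : ℝ) ^ 4 * (4 * ((4 * b') * (4 * b')) * β) ≤ 1 := by
    refine le_trans ?_ (hτ.le_one hn (by linarith) hβ (q := 4) (p := 2) (by norm_num)
      (by norm_num))
    have : 4 * b' * (4 * b') ≤ (4 * b' + 4 * b) ^ 2 := by nlinarith
    gcongr
  rw [hE]
  have hc : ∀ {f : Ω → ℝ}, MemLp f 2 P → Integrable (fun ω => (f ω - ∫ ω', f ω' ∂P) ^ 2) P :=
    fun hf => (hf.sub (memLp_const _)).integrable_sq
  rw [variance_eq_integral L1.1.aemeasurable] at V1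
  rw [variance_eq_integral L2.1.aemeasurable] at V2
  rw [variance_eq_integral L3.1.aemeasurable] at V3
  have i0 := integrable_const (μ := P) ((∫ ω, B ω ∂P) ^ 2)
  have s1 := integral_add (hc L3) i0
  have s2 := integral_add (hc L2) ((hc L3).add i0)
  have s3 := integral_add (hc L1) ((hc L2).add ((hc L3).add i0))
  have hle : ∫ ω, (uStat X H ω - (∫ ω, U1 ω ∂P + ∫ ω, U2 ω ∂P + ∫ ω, U3 ω ∂P + ∫ ω, B ω ∂P) -
      B ω) ^ 2 ∂P ≤ _ := integral_mono_of_nonneg (ae_of_all _ fun z => sq_nonneg _)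
    (((hc L1).add ((hc L2).add ((hc L3).add i0))).const_mul 4) (ae_of_all _ fun ω => by
      have key : ∀ a b c d : ℝ, (a + b + c - d) ^ 2 ≤ 4 * (a ^ 2 + (b ^ 2 + (c ^ 2 + d ^ 2))) :=
        fun a b c d => by
          nlinarith [sq_nonneg (a - b), sq_nonneg (a - c), sq_nonneg (a + d), sq_nonneg (b - c),
            sq_nonneg (b + d), sq_nonneg (c + d)]
      refine le_trans (le_of_eq ?_) (key (U1 ω - ∫ ω, U1 ω ∂P) (U2 ω - ∫ ω, U2 ω ∂P)
        (U3 ω - ∫ ω, U3 ω ∂P) (∫ ω, B ω ∂P))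
      simp only [hdec]
      ring)
  simp only [Pi.add_apply] at s2 s3 hle
  rw [integral_const_mul, s3, s2, s1, integral_const] at hle
  simp only [probReal_univ, one_smul] at hle
  have hEB : (∫ ω, B ω ∂P) ^ 2 ≤ 1 := by
    rw [← sq_abs]; exact pow_le_one₀ (abs_nonneg _) EB
  refine hle.trans ?_
  linarith

end Approximation

/-! ### The quantitative central limit theorem for degenerate kernels -/

section CharFun

variable {Ω I E : Type*} [MeasurableSpace Ω] [MeasurableSpace E] [Fintype I] [EMetricSpace I]
variable {P : Measure Ω} [IsProbabilityMeasure P] {X : I → Ω → E} {R m : ℝ≥0∞} {β βm : ℝ}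
  {H : E → E → ℝ} {α b b' G : ℝ} {D : ℕ}

lemma norm_exp_mul_I_sub_exp_mul_I_le (x y : ℝ) :
    ‖Complex.exp (x * Complex.I) - Complex.exp (y * Complex.I)‖ ≤ |x - y| := by
  have e : Complex.exp (x * Complex.I) - Complex.exp (y * Complex.I) =
      Complex.exp (y * Complex.I) * (Complex.exp (Complex.I * (x - y : ℝ)) - 1) := by
    rw [mul_sub, mul_one, ← Complex.exp_add]
    congr 2
    push_cast
    ring
  rw [e, norm_mul, Complex.norm_exp_ofReal_mul_I, one_mul]
  exact Real.norm_exp_I_mul_ofReal_sub_one_le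

lemma norm_integral_exp_sub_le_of_sq {f g : Ω → ℝ} (hf : MemLp f 2 P) (hg : MemLp g 2 P) {c : ℝ}
    (hc : 0 ≤ c) (h : ∫ ω, (f ω - g ω) ^ 2 ∂P ≤ c ^ 2) (t : ℝ) :
    ‖∫ ω, Complex.exp (t * f ω * Complex.I) ∂P - ∫ ω, Complex.exp (t * g ω * Complex.I) ∂P‖ ≤
      |t| * c := by
  have hi : ∀ {f : Ω → ℝ}, MemLp f 2 P →
      Integrable (fun ω => Complex.exp (t * f ω * Complex.I)) P := fun {f} hf => by
    refine Integrable.of_bound (C := 1) ?_ (ae_of_all _ fun ω => ?_)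
    · have hc : Continuous fun x : ℝ => Complex.exp (t * x * Complex.I) := by fun_prop
      exact hc.comp_aestronglyMeasurable hf.1
    · rw [show (t * f ω * Complex.I : ℂ) = ((t * f ω : ℝ) : ℂ) * Complex.I by push_cast; ring,
        Complex.norm_exp_ofReal_mul_I]
  have hd := hf.sub hg
  have h1 := integral_abs_le_of_sq (P := P) (f := fun ω => f ω - g ω) (hd.integrable one_le_two)
    hd.integrable_sq hc h
  rw [← integral_sub (hi hf) (hi hg)]
  refine (norm_integral_le_of_norm_le ((hd.integrable one_le_two).abs.const_mul |t|)
    (ae_of_all _ fun ω => ?_)).trans ?_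
  · have := norm_exp_mul_I_sub_exp_mul_I_le (t * f ω) (t * g ω)
    rw [← mul_sub, abs_mul] at this
    push_cast at this
    exact this
  · rw [integral_const_mul]
    exact mul_le_mul_of_nonneg_left h1 (abs_nonneg t)

/-- Expand `g² = f² - 2f(f - g) + (f - g)²` and apply Cauchy–Schwarz to the middle term. It
transfers the variance of the U-statistic to its approximation. -/
lemma abs_integral_sq_sub_sq_le {f g : Ω → ℝ} (hf : MemLp f 2 P) (hg : MemLp g 2 P) {s e : ℝ}
    (hs : 0 ≤ s) (he : 0 ≤ e) (hfs : ∫ ω, f ω ^ 2 ∂P = s ^ 2)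
    (h : ∫ ω, (f ω - g ω) ^ 2 ∂P ≤ e ^ 2) :
    |∫ ω, g ω ^ 2 ∂P - s ^ 2| ≤ e ^ 2 + 2 * (s * e) := by
  have hd := hf.sub hg
  have hi := hd.integrable_sq
  simp only [Pi.sub_apply] at hi
  obtain ⟨i1, c1⟩ := sq_integral_mul_le (P := P) (f := f) (g := fun ω => f ω - g ω) hf.1 hd.1
    hf.integrable_sq hi
  have h0 : 0 ≤ ∫ ω, (f ω - g ω) ^ 2 ∂P := integral_nonneg fun _ => sq_nonneg _
  have c2 : |∫ ω, f ω * (f ω - g ω) ∂P| ≤ s * e := by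
    refine abs_le_of_sq_le_sq (c1.trans ?_) (by positivity)
    rw [hfs, mul_pow]
    exact mul_le_mul_of_nonneg_left h (sq_nonneg s)
  have e1 : ∫ ω, g ω ^ 2 ∂P = s ^ 2 + (∫ ω, (f ω - g ω) ^ 2 ∂P -
      2 * ∫ ω, f ω * (f ω - g ω) ∂P) := by
    rw [← hfs, ← integral_const_mul, ← integral_sub hi (i1.const_mul 2)]
    have := integral_add hf.integrable_sq (hi.sub (i1.const_mul 2))
    simp only [Pi.sub_apply] at this
    rw [← this]
    exact integral_congr_ae (ae_of_all _ fun ω => by ring)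
  rw [e1, add_sub_cancel_left]
  have := abs_le.1 c2
  exact abs_le.2 ⟨by linarith, by linarith⟩

lemma IsKernel.memLp_sum_rowSum {h : I → I → E → E → ℝ} (hK : IsKernel P X R h b)
    (hM : IsMixing P X R β) : MemLp (fun ω => ∑ i, rowSum h i (fun l => X l ω)) 2 P :=
  memLp_finsetSum _ fun i _ => memLp_of_abs_le
    ((hK.measurable_rowSum i).comp hM.measurable_sample) fun _ => hK.abs_rowSum_le i _

lemma IsDegenerate.integral_sq_uStat (hH : IsDegenerate P X H α) :
    ∫ ω, (uStat X H ω - ∫ ω', uStat X H ω' ∂P) ^ 2 ∂P = uStd P X H ^ 2 := by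
  rw [uStd, Real.sq_sqrt (variance_nonneg _ _),
    variance_eq_integral hH.memLp_uStat.1.aemeasurable]

/-- The variance of the U-statistic is bounded by the second moments of the kernel. -/
lemma IsDegenerate.sq_uStd_le (hH : IsDegenerate P X H α) (hα : 0 ≤ α)
    (hM : IsMixing P X R β) (hD : NbhdBound I R D) (hn : 1 ≤ Fintype.card I) (hb : 1 ≤ b)
    (hτ : Negligible (Fintype.card I) (8 * b) β) :
    uStd P X H ^ 2 ≤ 2 * (4 * (Fintype.card I ^ 4 * (16 * (α / b ^ 2)) +
        (1 + Fintype.card I * D ^ 3 * (16 * √α)) +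
        (128 * Fintype.card I ^ 2 * D ^ 3 * (64 * (α / b ^ 2)) + 3 * Fintype.card I * D) + 1)) +
      2 * (128 * Fintype.card I ^ 2 * D ^ 3 * (16 * √α) + 3 * Fintype.card I * D) := by
  have hb0 : 0 ≤ b := zero_le_one.trans hb
  have hβ := hM.nonneg
  have hK := hH.isKernel R hb0
  -- No fine truncation is needed here, so both levels are equal and `4b + 4b = 8b`.
  have h1 := hH.integral_sq_uStat_sub_le hα hM hD hn hb le_rfl (by
    rwa [← add_mul, show (4 : ℝ) + 4 = 8 by norm_num])
  have hτ1 : Negligible (Fintype.card I) (4 * b) β := by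
    refine le_trans ?_ hτ
    gcongr
    norm_num
  have h2 := hK.integral_sq_sum_rowSum_le hM hD hn (by linarith) hτ1
    (hH.integral_truncKernel_sq_le R hb0)
  have hA : MemLp (fun ω => uStat X H ω - ∫ ω', uStat X H ω' ∂P) 2 P :=
    hH.memLp_uStat.sub (memLp_const _)
  have hB := hK.memLp_sum_rowSum hM
  have hd := (hA.sub hB).integrable_sq
  have s1 := integral_add (hd.const_mul 2) (hB.integrable_sq.const_mul 2)
  rw [← hH.integral_sq_uStat]
  have hle := integral_mono hA.integrable_sq
    ((hd.const_mul 2).add (hB.integrable_sq.const_mul 2)) fun ω => by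
      simp only [Pi.add_apply, Pi.sub_apply]
      have key : ∀ x y : ℝ, x ^ 2 ≤ 2 * (x - y) ^ 2 + 2 * y ^ 2 := fun x y => by
        nlinarith [sq_nonneg (x - 2 * y)]
      exact key _ (∑ i, rowSum (truncKernel P X H R b) i fun l => X l ω)
  simp only [Pi.add_apply, Pi.sub_apply] at s1 hle
  rw [s1, integral_const_mul, integral_const_mul] at hle
  linarith

/-- Quantitative central limit theorem for U-statistics of degenerate kernels. -/
theorem IsDegenerate.norm_charFun_uNorm_sub_le (hH : IsDegenerate P X H α) (hα : 1 ≤ α)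
    (hM : IsMixing P X R β) (hMm : IsMixing P X m βm) (hm : m ≤ R) (hD : NbhdBound I R D)
    (hn : 1 ≤ Fintype.card I) (hb : 1 ≤ b) (hbb : b ≤ b')
    (hτ : Negligible (Fintype.card I) (4 * b' + 4 * b) β)
    (hG : ∀ u k k', m < edist k k' →
      ∫ w : Ω × Ω, Gam P X H u u (X k w.1) (X k' w.2) ^ 2 ∂P.prod P ≤ G ^ 2) {φ : ℝ} (hφ : 0 ≤ φ)
    (hGφ : 2 * G ^ 2 + 1088 * (√α * (α / b' ^ 2)) ≤ φ ^ 2) {c η θ : ℝ} (hc : 0 < c)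
    (hs : c * Fintype.card I ≤ uStd P X H) (hη0 : 0 ≤ η) (hθ0 : 0 ≤ θ)
    (hη : 4 * (Fintype.card I ^ 4 * (16 * (α / b' ^ 2)) +
        (1 + Fintype.card I * D ^ 3 * (16 * √α)) +
        (128 * Fintype.card I ^ 2 * D ^ 3 * (64 * (α / b ^ 2)) + 3 * Fintype.card I * D) + 1) ≤
        (η * Fintype.card I) ^ 2)
    (hθ : D ^ 11 * ((4 * b) ^ 2 * (256 * α) + (256 * α) ^ 2 +
        (1 + 5 * ((Fintype.card I * D * (4 * (4 * b) ^ 2 * βm)) ^ 2 +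
        (Fintype.card I * D) ^ 2 * (φ + 64 * (α / b ^ 2)) ^ 2 +
        Fintype.card I * D ^ 3 * ((φ + 16 * √α) + 64 * (α / b ^ 2)) ^ 2))) +
        Fintype.card I * D ^ 8 * (256 * α) ≤ θ ^ 2 * Fintype.card I ^ 2) (t : ℝ) :
    ‖charFun (P.map (uNorm P X H)) t - Complex.exp (-(t ^ 2 / 2))‖ ≤
      |t| * (η / c) + |t| * (2 / (c * Fintype.card I) + |t| * (1 / (c * Fintype.card I) ^ 2 +
        ((η / c) ^ 2 + 2 * (η / c)) + 2 ^ 11 * θ / c ^ 2) + t ^ 2 / 2 * (2 ^ 26 * θ / c ^ 3) +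
        4 * |t| ^ 3 * (2 ^ 21 * θ ^ 2 / c ^ 4)) := by
  have hb0 : 0 ≤ b := zero_le_one.trans hb
  have hβ := hM.nonneg
  have hα0 : 0 ≤ α := zero_le_one.trans hα
  have hn0 : (0 : ℝ) < Fintype.card I := by exact_mod_cast hn
  have hK := hH.isKernel R hb0
  have hτ1 : Negligible (Fintype.card I) (4 * b) β := by
    refine le_trans ?_ hτ
    gcongr
    linarith
  have hgood := hH.isGood hα hM hMm hm hD hn hb hbb hτ1 hG hφ hGφ
  have h1 := (hH.integral_sq_uStat_sub_le hα0 hM hD hn hb hbb hτ).trans hη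
  set s := uStd P X H with hsd
  have hs0 : 0 < s := (by positivity : 0 < c * Fintype.card I).trans_le hs
  have hηs : η * Fintype.card I ≤ η / c * s := by
    rw [div_mul_eq_mul_div, le_div_iff₀ hc]
    nlinarith
  have hA : MemLp (fun ω => uStat X H ω - ∫ ω', uStat X H ω' ∂P) 2 P :=
    hH.memLp_uStat.sub (memLp_const _)
  have hB := hK.memLp_sum_rowSum hM
  set B : Ω → ℝ := fun ω => ∑ i, rowSum (truncKernel P X H R b) i (fun l => X l ω) with hBd
  have hγ : |∫ ω, B ω ^ 2 ∂P - s ^ 2| ≤ ((η / c) ^ 2 + 2 * (η / c)) * s ^ 2 := by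
    refine (abs_integral_sq_sub_sq_le hA hB hs0.le (e := η / c * s) (by positivity)
      hH.integral_sq_uStat (h1.trans ?_)).trans_eq (by ring)
    gcongr
  have h2 := hgood.norm_charFun_sub_le hc hs hγ (by
    rw [Real.sq_sqrt (by positivity)]
    exact hθ) hθ0 t
  have hAs : MemLp (uNorm P X H) 2 P := by
    have := hA.const_mul s⁻¹
    refine this.congr_norm ?_ (ae_of_all _ fun ω => ?_)
    · unfold uNorm
      simp only [div_eq_inv_mul]
      exact this.1
    · simp only [uNorm, div_eq_inv_mul, hsd]
  have hBs : MemLp (fun ω => B ω / s) 2 P := by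
    simpa only [div_eq_inv_mul] using hB.const_mul s⁻¹
  have h3 := norm_integral_exp_sub_le_of_sq hAs hBs (c := η / c) (by positivity) (by
    have e : ∀ ω, (uNorm P X H ω - B ω / s) ^ 2 =
        (uStat X H ω - ∫ ω', uStat X H ω' ∂P - B ω) ^ 2 * (1 / s ^ 2) := fun ω => by
      rw [uNorm, ← hsd]; field_simp
    simp only [e]
    rw [integral_mul_const, mul_one_div, div_le_iff₀ (by positivity), ← mul_pow]
    exact h1.trans (pow_le_pow_left₀ (by positivity) hηs 2)) t
  have e : charFun (P.map (uNorm P X H)) t =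
      ∫ ω, Complex.exp (t * uNorm P X H ω * Complex.I) ∂P := by
    rw [charFun_apply_real, integral_map hAs.1.aemeasurable]
    exact (by fun_prop : Continuous fun x : ℝ => Complex.exp (t * x * Complex.I)).aestronglyMeasurable
  rw [e]
  exact (norm_sub_le_norm_sub_add_norm_sub _ _ _).trans (add_le_add h3 h2)

end CharFun

/-! ### Choice of the parameters and the rate -/

section Rate

variable {Ω I E : Type*} [MeasurableSpace Ω] [MeasurableSpace E] [Fintype I] [EMetricSpace I]
variable {P : Measure Ω} [IsProbabilityMeasure P] {X : I → Ω → E} {R m : ℝ≥0∞} {β βm : ℝ}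
  {H : E → E → ℝ} {α α' G q B c : ℝ} {D : ℕ}

lemma Negligible.mono {n : ℕ} {b b' β : ℝ} (hτ : Negligible n b' β) (hb : 0 ≤ b) (hbb : b ≤ b')
    (hβ : 0 ≤ β) : Negligible n b β := by
  refine le_trans ?_ hτ
  gcongr

lemma IsDegenerate.mono (hH : IsDegenerate P X H α) (hα : α ≤ α') : IsDegenerate P X H α' :=
  { hH with
    joint_le := fun i k hik => (hH.joint_le i k hik).trans hα
    prod_le := fun i k hik => (hH.prod_le i k hik).trans hα }

/-- A growing variance forces the second moments of the kernel to be bounded from below. -/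
lemma IsDegenerate.rate_le_of_le_uStd (hH : IsDegenerate P X H α) (hα : 0 ≤ α)
    (hM : IsMixing P X R β) (hD : NbhdBound I R D) (hn : 1 ≤ Fintype.card I)
    (hτ : Negligible (Fintype.card I) (8 * (Fintype.card I : ℝ) ^ 3) β) (hq : 1 ≤ q) (hDq : D ≤ q)
    (hqn : q ^ 28 ≤ Fintype.card I) (hαq : α * q ^ 28 ≤ 1) (hc : 0 ≤ c)
    (hs : c * Fintype.card I ≤ uStd P X H) : c ^ 2 * q ^ 11 ≤ 70000 := by
  set n : ℝ := (Fintype.card I : ℝ) with hnd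
  have hn1 : 1 ≤ n := by rw [hnd]; exact_mod_cast hn
  have hD1 : (1 : ℝ) ≤ D := by exact_mod_cast hD.one_le hn
  have h := hH.sq_uStd_le hα hM hD hn (b := n ^ 3) (one_le_pow₀ hn1) hτ
  have h1 := (pow_le_pow_left₀ (by positivity) hs 2).trans h
  rw [← hnd] at h1
  have hq0 : 0 < q := by linarith
  have hα1 : α ≤ 1 / q ^ 28 := by rwa [le_div_iff₀ (by positivity)]
  have hsα : √α ≤ 1 / q ^ 14 := by
    refine Real.sqrt_le_iff.2 ⟨by positivity, hα1.trans_eq ?_⟩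
    rw [div_pow, one_pow, ← pow_mul]
  have hD3 : (D : ℝ) ^ 3 ≤ q ^ 3 := pow_le_pow_left₀ (by positivity) hDq 3
  -- The common bound for all terms: `√α ≤ q⁻¹⁴` outweighs `D³ ≤ q³` and leaves the factor `q⁻¹¹`.
  set Y := n ^ 2 / q ^ 11 with hY
  have hY1 : n * q ^ 3 ≤ Y := by
    rw [hY, le_div_iff₀ (by positivity)]
    calc n * q ^ 3 * q ^ 11 = n * q ^ 14 := by ring
      _ ≤ n * q ^ 28 := by gcongr; norm_num
      _ ≤ n * n := by gcongr
      _ = n ^ 2 := by ring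
  have f0 : n ≤ Y := (le_mul_of_one_le_right (by positivity) (one_le_pow₀ hq)).trans hY1
  have f1 : n ^ 2 * D ^ 3 * √α ≤ Y := by
    calc n ^ 2 * D ^ 3 * √α ≤ n ^ 2 * q ^ 3 * (1 / q ^ 14) := by gcongr
      _ = Y := by rw [hY]; field_simp
  have f2 : n * D ^ 3 * √α ≤ Y := by
    refine le_trans ?_ f1
    gcongr
    nlinarith
  have hαs : α ≤ √α := by
    refine Real.le_sqrt_of_sq_le ?_
    have : α ≤ 1 := hα1.trans (by rw [div_le_one (by positivity)]; exact one_le_pow₀ hq)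
    nlinarith
  have f3 : n ^ 2 * D ^ 3 * (α / (n ^ 3) ^ 2) ≤ Y := by
    refine le_trans ?_ f1
    gcongr
    exact (div_le_self hα (one_le_pow₀ (one_le_pow₀ hn1))).trans hαs
  have f4 : n ^ 4 * (α / (n ^ 3) ^ 2) ≤ Y := by
    refine le_trans ?_ f0
    rw [mul_div_assoc', div_le_iff₀ (by positivity)]
    have : α ≤ 1 := hα1.trans (by rw [div_le_one (by positivity)]; exact one_le_pow₀ hq)
    calc n ^ 4 * α ≤ n ^ 4 * 1 := by gcongr
      _ ≤ n ^ 4 * n ^ 3 := by gcongr; exact one_le_pow₀ hn1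
      _ = n * (n ^ 3) ^ 2 := by ring
  have f5 : n * D ≤ Y := by
    refine le_trans ?_ hY1
    gcongr
    exact hDq.trans (le_self_pow₀ hq (by norm_num))
  have h2 : (c * n) ^ 2 ≤ 70000 * Y := by
    generalize √α = sα at *
    generalize α / (n ^ 3) ^ 2 = a at *
    linarith
  rw [hY, mul_div_assoc', le_div_iff₀ (by positivity)] at h2
  have hn2 : 0 < n ^ 2 := by positivity
  refine le_of_mul_le_mul_right ?_ hn2
  linarith

/-- The rate in the central limit theorem. -/
noncomputable def cltRate (c K t x y : ℝ) : ℝ :=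
  |t| * (200 * x / c) + |t| * (2 * y / c + |t| * ((y / c) ^ 2 +
    ((200 * x / c) ^ 2 + 2 * (200 * x / c)) + 2 ^ 11 * (√K * x) / c ^ 2) +
    t ^ 2 / 2 * (2 ^ 26 * (√K * x) / c ^ 3) + 4 * |t| ^ 3 * (2 ^ 21 * (√K * x) ^ 2 / c ^ 4))

theorem IsDegenerate.norm_charFun_uNorm_sub_le_cltRate (hH : IsDegenerate P X H α) (hα : 1 ≤ α)
    (hM : IsMixing P X R β) (hMm : IsMixing P X m βm) (hm : m ≤ R) (hD : NbhdBound I R D)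
    (hn : 1 ≤ Fintype.card I)
    (hτ : Negligible (Fintype.card I) (8 * (Fintype.card I : ℝ) ^ 3) β)
    (hG : ∀ u k k', m < edist k k' →
      ∫ w : Ω × Ω, Gam P X H u u (X k w.1) (X k' w.2) ^ 2 ∂P.prod P ≤ G ^ 2)
    (hq : 1 ≤ q) (hDq : D ≤ q) (hαq : α * q ^ 28 ≤ Fintype.card I) (hGq : G ^ 2 * q ^ 28 ≤ 1)
    (hβm : βm * (Fintype.card I : ℝ) ^ 2 ≤ B) (hc : 0 < c)
    (hs : c * Fintype.card I ≤ uStd P X H) (t : ℝ) :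
    ‖charFun (P.map (uNorm P X H)) t - Complex.exp (-(t ^ 2 / 2))‖ ≤
      cltRate c (20480 * B ^ 2 + 200000) t (1 / q ^ 7) (1 / Fintype.card I) := by
  set n : ℝ := (Fintype.card I : ℝ) with hnd
  have hn1 : 1 ≤ n := by rw [hnd]; exact_mod_cast hn
  have hD1 : (1 : ℝ) ≤ D := by exact_mod_cast hD.one_le hn
  have hβ := hM.nonneg
  have hβ' := hMm.nonneg
  have hq0 : 0 < q := by linarith
  have hB0 : 0 ≤ B := le_trans (by positivity) hβm
  set K := 20480 * B ^ 2 + 200000 with hK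
  have hsn : √n ^ 2 = n := Real.sq_sqrt (by linarith)
  have hsn1 : 1 ≤ √n := Real.one_le_sqrt.2 hn1
  have hsn3 : √n ≤ n ^ 3 := by
    refine Real.sqrt_le_iff.2 ⟨by positivity, ?_⟩
    rw [← pow_mul]
    exact le_self_pow₀ hn1 (by norm_num)
  have hqn : q ^ 28 ≤ n := (le_mul_of_one_le_left (by positivity) hα).trans hαq
  have hαn : α ≤ n := (le_mul_of_one_le_right (by linarith) (one_le_pow₀ hq)).trans hαq
  have hs1 : 1 ≤ √α := Real.one_le_sqrt.2 hα
  have hsα : √α ≤ α := Real.sqrt_le_iff.2 ⟨by linarith, by nlinarith⟩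
  have hss : √α ^ 2 = α := Real.sq_sqrt (by linarith)
  -- All error terms will be at most a constant times `Y`, so the rate is `√Y / n = q⁻⁷`. The
  -- largest power of `D` next to `n α` is `D¹⁴ = D¹¹ · D³`, and `α q²⁸ ≤ n` pays for it with
  -- another `q¹⁴` to spare.
  set Y := n ^ 2 / q ^ 14 with hY
  have f0 : n * D ^ 14 * α ≤ Y := by
    rw [hY, le_div_iff₀ (by positivity)]
    calc n * D ^ 14 * α * q ^ 14 ≤ n * q ^ 14 * α * q ^ 14 := by gcongr
      _ = n * (α * q ^ 28) := by ring
      _ ≤ n * n := by gcongr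
      _ = n ^ 2 := by ring
  have fD : ∀ k ≤ 14, (D : ℝ) ^ k ≤ D ^ 14 := fun k hk => pow_le_pow_right₀ hD1 hk
  have f1 : ∀ k ≤ 14, n * D ^ k * α ≤ Y := fun k hk => le_trans (by gcongr) f0
  have f2 : ∀ k ≤ 14, n * D ^ k ≤ Y := fun k hk =>
    (le_mul_of_one_le_right (by positivity) hα).trans (f1 k hk)
  have f3 : ∀ k ≤ 14, (D : ℝ) ^ k ≤ Y := fun k hk =>
    (le_mul_of_one_le_left (by positivity) hn1).trans (f2 k hk)
  have f4 : 1 ≤ Y := by simpa using f3 0 (by norm_num)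
  have f5 : n * D ^ 3 * √α ≤ Y := le_trans (by gcongr) (f1 3 (by norm_num))
  have f6 : n ^ 4 * (α / (n ^ 3) ^ 2) ≤ Y := by
    refine le_trans ?_ f4
    rw [mul_div_assoc', div_le_one (by positivity)]
    calc n ^ 4 * α ≤ n ^ 4 * n := by gcongr
      _ = n ^ 5 := by ring
      _ ≤ n ^ 6 := pow_le_pow_right₀ hn1 (by norm_num)
      _ = (n ^ 3) ^ 2 := by ring
  have hαn1 : α / n ≤ 1 / q ^ 28 := by
    rw [div_le_div_iff₀ (by positivity) (by positivity), one_mul]; exact hαq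
  have hq14 : 1 / q ^ 28 ≤ 1 / q ^ 14 :=
    one_div_le_one_div_of_le (by positivity) (pow_le_pow_right₀ hq (by norm_num))
  have hq1 : 1 / q ^ 14 ≤ 1 := by rw [div_le_one (by positivity)]; exact one_le_pow₀ hq
  have hG' : G ^ 2 ≤ 1 / q ^ 28 := by rwa [le_div_iff₀ (by positivity)]
  -- The levels are `b = √n` and `b' = n³`. The choice `φ = 34 / q¹⁴` works because `2 + 1088 ≤ 34²
  -- = 1156`.
  have h := hH.norm_charFun_uNorm_sub_le hα hM hMm hm hD hn hsn1 hsn3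
    (hτ.mono (by positivity) (by linarith) hβ) hG (φ := 34 / q ^ 14) (by positivity) (by
      have : √α * (α / (n ^ 3) ^ 2) ≤ 1 / q ^ 28 := by
        calc √α * (α / (n ^ 3) ^ 2) ≤ n * (n / (n ^ 3) ^ 2) := by
              gcongr; exact hsα.trans hαn
          _ = 1 / n ^ 4 := by field_simp
          _ ≤ 1 / q ^ 28 := one_div_le_one_div_of_le (by positivity)
            (hqn.trans (le_self_pow₀ hn1 (by norm_num)))
      have e : (34 / q ^ 14) ^ 2 = 1156 * (1 / q ^ 28) := by rw [div_pow]; ring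
      rw [e]
      have : 0 ≤ 1 / q ^ 28 := by positivity
      linarith) hc hs (η := 200 * (1 / q ^ 7)) (θ := √K * (1 / q ^ 7)) (by positivity)
      (by positivity) (by
      have e : (200 * (1 / q ^ 7) * n) ^ 2 = 40000 * Y := by rw [hY]; field_simp; ring
      rw [← hnd, e, hsn]
      have e2 : n ^ 2 * D ^ 3 * (α / n) = n * D ^ 3 * α := by field_simp
      have g1 := f1 3 (by norm_num)
      have g2 := f2 1 (by norm_num)
      rw [← e2] at g1
      rw [pow_one] at g2
      generalize √α = sα at *
      generalize α / (n ^ 3) ^ 2 = a at *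
      generalize α / n = a' at *
      linarith) (by
      have e : (√K * (1 / q ^ 7)) ^ 2 * n ^ 2 = K * Y := by
        rw [mul_pow, Real.sq_sqrt (by positivity), hY]; field_simp
      rw [← hnd, e, mul_pow 4 (√n) 2, hsn]
      have g1 := f1 11 (by norm_num)
      have g2 : D ^ 11 * α ^ 2 ≤ Y := le_trans (by
        rw [sq, ← mul_assoc]
        calc D ^ 11 * α * α ≤ D ^ 11 * n * α := by gcongr
          _ = n * D ^ 11 * α := by ring) g1
      have g3 := f3 11 (by norm_num)
      -- Here mixing at the scale `m` must be of order `n⁻²`: one `n` comes from the number of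
      -- pairs, the other from the squared cutoff level.
      have g4 : (D : ℝ) ^ 11 * (n * D * (4 * (4 ^ 2 * n) * βm)) ^ 2 ≤ 4096 * B ^ 2 * Y := by
        have e1 : (D : ℝ) ^ 11 * (n * D * (4 * (4 ^ 2 * n) * βm)) ^ 2 =
            4096 * (βm * n ^ 2) ^ 2 * D ^ 13 := by ring
        rw [e1]
        have := f3 13 (by norm_num)
        gcongr
      have g5 : (D : ℝ) ^ 11 * ((n * D) ^ 2 * (34 / q ^ 14 + 64 * (α / n)) ^ 2) ≤ 9604 * Y := by
        have e1 : 34 / q ^ 14 + 64 * (α / n) ≤ 98 * (1 / q ^ 14) := by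
          have : 34 / q ^ 14 = 34 * (1 / q ^ 14) := by ring
          linarith
        calc (D : ℝ) ^ 11 * ((n * D) ^ 2 * (34 / q ^ 14 + 64 * (α / n)) ^ 2)
            ≤ D ^ 11 * ((n * D) ^ 2 * (98 * (1 / q ^ 14)) ^ 2) := by gcongr
          _ = 9604 * (n ^ 2 / q ^ 28) * D ^ 13 := by field_simp; ring
          _ ≤ 9604 * (n ^ 2 / q ^ 28) * q ^ 14 := by
              gcongr
              exact (fD 13 (by norm_num)).trans (pow_le_pow_left₀ (by positivity) hDq 14)
          _ = 9604 * Y := by rw [hY]; field_simp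
      have g6 : (D : ℝ) ^ 11 * (n * D ^ 3 * (34 / q ^ 14 + 16 * √α + 64 * (α / n)) ^ 2) ≤
          12996 * Y := by
        have e1 : 34 / q ^ 14 + 16 * √α + 64 * (α / n) ≤ 114 * √α := by
          have : 34 / q ^ 14 = 34 * (1 / q ^ 14) := by ring
          linarith
        calc (D : ℝ) ^ 11 * (n * D ^ 3 * (34 / q ^ 14 + 16 * √α + 64 * (α / n)) ^ 2)
            ≤ D ^ 11 * (n * D ^ 3 * (114 * √α) ^ 2) := by gcongr
          _ = 12996 * (n * D ^ 14 * √α ^ 2) := by ring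
          _ ≤ 12996 * Y := by rw [hss]; gcongr
      have g7 := f1 8 (by norm_num)
      have e3 : K * Y = 20480 * B ^ 2 * Y + 200000 * Y := by rw [hK]; ring
      rw [e3]
      have e4 : 5 * (4096 * B ^ 2 * Y) = 20480 * B ^ 2 * Y := by ring
      rw [← e4]
      generalize 4096 * B ^ 2 * Y = Z at *
      generalize (n * D * (4 * (4 ^ 2 * n) * βm)) ^ 2 = a1 at *
      generalize (n * D) ^ 2 * (34 / q ^ 14 + 64 * (α / n)) ^ 2 = a2 at *
      generalize n * D ^ 3 * (34 / q ^ 14 + 16 * √α + 64 * (α / n)) ^ 2 = a3 at *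
      have e5 : (D : ℝ) ^ 11 * (4 ^ 2 * n * (256 * α) + (256 * α) ^ 2 + (1 + 5 * (a1 + a2 + a3))) +
          n * D ^ 8 * (256 * α) = 4096 * (n * D ^ 11 * α) + 65536 * (D ^ 11 * α ^ 2) + D ^ 11 +
          5 * (D ^ 11 * a1) + 5 * (D ^ 11 * a2) + 5 * (D ^ 11 * a3) + 256 * (n * D ^ 8 * α) := by
        ring
      rw [e5]
      linarith) t
  refine h.trans_eq ?_
  unfold cltRate
  rw [← hnd]
  have e1 : 2 / (c * n) = 2 * (1 / n) / c := by field_simp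
  have e2 : 1 / (c * n) ^ 2 = (1 / n / c) ^ 2 := by field_simp
  rw [e1, e2]

/-- The rate is a continuous function of `(x, y)` that vanishes at the origin. -/
lemma tendsto_cltRate (c K t : ℝ) {x y : ℕ → ℝ} (hx : Tendsto x atTop (𝓝 0))
    (hy : Tendsto y atTop (𝓝 0)) : Tendsto (fun n => cltRate c K t (x n) (y n)) atTop (𝓝 0) := by
  have hc : Continuous fun z : ℝ × ℝ => cltRate c K t z.1 z.2 := by
    unfold cltRate; fun_prop
  have h := (hc.tendsto (0, 0)).comp (hx.prodMk_nhds hy)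
  have e : cltRate c K t 0 0 = 0 := by simp [cltRate]
  rw [e] at h
  exact h

end Rate

/-! ### From extended norms and coefficients to the real-valued assumptions -/

section Conversion

lemma integral_pow_le_of_eLpNorm_le {α : Type*} [MeasurableSpace α] {μ : Measure α} {f : α → ℝ}
    (hf : AEStronglyMeasurable f μ) {p : ℕ} (hp : Even p) (hp0 : p ≠ 0) {M : ℝ≥0∞} (hM : M ≠ ∞)
    (h : eLpNorm f p μ ≤ M) :
    Integrable (fun x => f x ^ p) μ ∧ ∫ x, f x ^ p ∂μ ≤ (M ^ p).toReal := by
  have hl : ∫⁻ x, ‖f x ^ p‖ₑ ∂μ ≤ M ^ p := by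
    have e := eLpNorm_nnreal_pow_eq_lintegral (μ := μ) (f := f) (p := (p : NNReal))
      (by exact_mod_cast hp0)
    simp only [NNReal.coe_natCast, ENNReal.rpow_natCast, ENNReal.coe_natCast] at e
    simp only [enorm_pow]
    rw [← e]
    gcongr
  have hi : Integrable (fun x => f x ^ p) μ :=
    ⟨hf.pow p, hl.trans_lt (ENNReal.pow_lt_top hM.lt_top)⟩
  refine ⟨hi, ?_⟩
  rw [integral_eq_lintegral_of_nonneg_ae (ae_of_all _ fun x => hp.pow_nonneg _) hi.1]
  refine ENNReal.toReal_mono (ENNReal.pow_ne_top hM) (le_trans (le_of_eq ?_) hl)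
  refine lintegral_congr fun x => ?_
  rw [Real.enorm_eq_ofReal (hp.pow_nonneg _)]

variable {Ω I E : Type*} [MeasurableSpace Ω] [MeasurableSpace E]
variable {P : Measure Ω} [IsProbabilityMeasure P] {X : I → Ω → E} {H : E → E → ℝ}

lemma eLpNorm_prod_eq (hX : ∀ i, Measurable (X i)) {f : E × E → ℝ} (hf : Measurable f) (i k : I)
    (p : ℝ≥0∞) : eLpNorm (fun z : Ω × Ω => f (X i z.1, X k z.2)) p (P.prod P) =
      eLpNorm f p ((P.map (X i)).prod (P.map (X k))) := by
  rw [Measure.map_prod_map P P (hX i) (hX k), eLpNorm_map_measure hf.aestronglyMeasurable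
    ((hX i).prodMap (hX k)).aemeasurable]
  rfl

lemma isDegenerate_of_kernelNorm (hX : ∀ i, Measurable (X i))
    (hH : Measurable (Function.uncurry H)) (hsymm : ∀ x y, H x y = H y x)
    (hdeg : ∀ i k : I, i ≠ k → ∀ᵐ x ∂(P.map (X i)), ∫ ω, H (X k ω) x ∂P = 0)
    (hfin : kernelNorm P X H 4 ≠ ∞) :
    IsDegenerate P X H (kernelNorm P X H 4 ^ 4).toReal := by
  have h1 : ∀ i k, i ≠ k → eLpNorm (fun ω => H (X i ω) (X k ω)) (4 : ℕ) P ≤ kernelNorm P X H 4 :=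
    fun i k hik => (le_max_left _ _).trans (le_iSup_of_le i (le_iSup₂_of_le k hik le_rfl))
  have h2 : ∀ i k, i ≠ k → eLpNorm (fun z : Ω × Ω => H (X i z.1) (X k z.2)) (4 : ℕ) (P.prod P) ≤
      kernelNorm P X H 4 := fun i k hik =>
    (eLpNorm_prod_eq hX hH i k _).trans_le
      ((le_max_right _ _).trans (le_iSup_of_le i (le_iSup₂_of_le k hik le_rfl)))
  have h4 : Even 4 := by decide
  have m1 : ∀ i k, Measurable fun ω => H (X i ω) (X k ω) := fun i k =>
    hH.comp ((hX i).prodMk (hX k))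
  have b1 := fun i k (hik : i ≠ k) => integral_pow_le_of_eLpNorm_le
    (m1 i k).aestronglyMeasurable h4 (by norm_num) hfin (h1 i k hik)
  have b2 := fun i k (hik : i ≠ k) => integral_pow_le_of_eLpNorm_le
    (measurable_prod_eval hX hH i k).aestronglyMeasurable h4 (by norm_num) hfin (h2 i k hik)
  exact ⟨hX, hH, hsymm, fun i k hik => by simpa only [hsymm (X k _)] using hdeg i k hik,
    fun i k hik => (b1 i k hik).1, fun i k hik => (b1 i k hik).2, fun i k hik => (b2 i k hik).1,
    fun i k hik => (b2 i k hik).2⟩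

lemma kernelNorm_mono (hX : ∀ i, Measurable (X i)) (hH : Measurable (Function.uncurry H))
    {p q : ℝ≥0∞} (hpq : p ≤ q) : kernelNorm P X H p ≤ kernelNorm P X H q := by
  have := fun i => Measure.isProbabilityMeasure_map (μ := P) (hX i).aemeasurable
  refine iSup_mono fun i => iSup₂_mono fun k hik => max_le_max ?_ ?_
  · exact eLpNorm_le_eLpNorm_of_exponent_le hpq
      (hH.comp ((hX i).prodMk (hX k))).aestronglyMeasurable
  · exact eLpNorm_le_eLpNorm_of_exponent_le hpq
      (show Measurable fun z : E × E => H z.1 z.2 from hH).aestronglyMeasurable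

/-- The diagonal case `i = j = u` of the supremum, admissible because an index belongs to its own
neighbourhood. -/
lemma integral_Gam_sq_le [EDist I] (hX : ∀ i, Measurable (X i))
    (hH : Measurable (Function.uncurry H)) (hd : ∀ i : I, edist i i = 0) {r : ℝ}
    (hfin : gammaNorm P X H r 2 ≠ ∞) (u k k' : I) (hk : ENNReal.ofReal r < edist k k') :
    ∫ w : Ω × Ω, Gam P X H u u (X k w.1) (X k' w.2) ^ 2 ∂P.prod P ≤
      (gammaNorm P X H r 2).toReal ^ 2 := by
  have hm : Measurable fun z : E × E => Gam P X H u u z.1 z.2 := by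
    have : Measurable fun z : (E × E) × Ω => H (X u z.2) z.1.1 * H (X u z.2) z.1.2 :=
      (hH.comp (((hX u).comp measurable_snd).prodMk measurable_fst.fst)).mul
        (hH.comp (((hX u).comp measurable_snd).prodMk measurable_fst.snd))
    exact (this.stronglyMeasurable.integral_prod_right' (ν := P)).measurable
  have hu : u ∈ nbhd r u := by
    change edist u u ≤ _
    rw [hd]; exact zero_le
  have h : eLpNorm (fun z : Ω × Ω => Gam P X H u u (X k z.1) (X k' z.2)) (2 : ℕ) (P.prod P) ≤
      gammaNorm P X H r 2 := (eLpNorm_prod_eq hX hm k k' _).trans_le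
    (le_iSup_of_le u (le_iSup_of_le u (le_iSup_of_le k (le_iSup_of_le k'
      (le_iSup₂_of_le hu hk le_rfl)))))
  rw [← ENNReal.toReal_pow]
  exact (integral_pow_le_of_eLpNorm_le (hm.comp (((hX k).comp measurable_fst).prodMk
    ((hX k').comp measurable_snd))).aestronglyMeasurable even_two two_ne_zero hfin h).2

lemma isMixing_of_sampleBeta_le [Fintype I] [EMetricSpace I] (hX : ∀ i, Measurable (X i)) {r β : ℝ}
    (hβ : 0 ≤ β) (h : sampleBeta P X 2 ⊤ r ≤ ENNReal.ofReal β) :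
    IsMixing P X (ENNReal.ofReal r) β where
  measurable := hX
  nonneg := hβ
  mix K J hK hKJ := by
    refine le_trans ?_ h
    unfold sampleBeta
    refine le_iSup_of_le K (le_iSup_of_le J (le_iSup₂_of_le (by exact_mod_cast hK) le_top
      (le_iSup_of_le ?_ le_rfl)))
    exact le_iInf₂ fun i hi => le_iInf₂ fun j hj => (hKJ i hi j hj).le

/-- The factor 10 is the radius built into `NbhdBound`, which covers every multiple of `R` met in
the counting. -/
lemma nbhdBound_maxNbhd [Fintype I] [EMetricSpace I] (r : ℝ) :
    NbhdBound I (ENNReal.ofReal r) (maxNbhd I (10 * r)) := by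
  intro i S hS
  refine le_trans ?_ (Finset.le_sup (f := fun i : I => (nbhd (10 * r) i).ncard) (Finset.mem_univ i))
  rw [← Set.ncard_coe_finset]
  refine Set.ncard_le_ncard (fun j hj => ?_) (Set.toFinite _)
  change edist i j ≤ _
  rw [ENNReal.ofReal_mul (by norm_num)]
  simpa using hS j hj

end Conversion

/-! ### Asymptotics in the sample size -/

section Asymptotics

/-- This turns the exponential mixing rate at a logarithmic distance into a power of `n`. -/
lemma rpow_mul_log_comm {ρ x : ℝ} (hρ : 0 < ρ) (hx : 0 < x) (C : ℝ) :
    ρ ^ (C * Real.log x) = x ^ (C * Real.log ρ) := by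
  rw [Real.rpow_def_of_pos hρ, Real.rpow_def_of_pos hx]
  ring_nf

lemma toReal_mul_rpow_le {n : ℕ} (hn : 1 ≤ n) {ε : ℝ} {x : ℝ≥0∞}
    (h : (n : ℝ≥0∞) ^ ε * x ≤ 1) : x ≠ ∞ ∧ x.toReal * (n : ℝ) ^ ε ≤ 1 := by
  have hn0 : (n : ℝ≥0∞) ^ ε ≠ 0 :=
    (ENNReal.rpow_pos (by exact_mod_cast hn) (ENNReal.natCast_ne_top n)).ne'
  refine ⟨fun hx => ?_, ?_⟩
  · rw [hx, ENNReal.mul_top hn0] at h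
    exact absurd h (by simp)
  · have := ENNReal.toReal_mono ENNReal.one_ne_top h
    rwa [ENNReal.toReal_mul, ← ENNReal.toReal_rpow, ENNReal.toReal_natCast, ENNReal.toReal_one,
      mul_comm] at this

lemma tendsto_mul_log_atTop {C : ℝ} (hC : 0 < C) :
    Tendsto (fun n : ℕ => C * Real.log n) atTop atTop :=
  (Real.tendsto_log_atTop.comp tendsto_natCast_atTop_atTop).const_mul_atTop hC

lemma tendsto_natCast_rpow_atTop {s : ℝ} (hs : 0 < s) :
    Tendsto (fun n : ℕ => (n : ℝ) ^ s) atTop atTop :=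
  (tendsto_rpow_atTop hs).comp tendsto_natCast_atTop_atTop

variable {I : ℕ → Type*} [∀ n, Fintype (I n)] [∀ n, EMetricSpace (I n)]

/-- At radius `10 C' log n`, polynomial growth gives a power of `log n`, which is below every
positive power of `n`. -/
lemma eventually_maxNbhd_le {C C' K s : ℝ} (hCC : C ≤ C') (hC : 0 < C) (hs : 0 < s)
    (hη : ∃ c : ℝ, ∀ᶠ n : ℕ in atTop, ∀ r : ℝ, C * Real.log n ≤ r →
      (maxNbhd (I n) r : ℝ) ≤ c * r ^ K) :
    ∀ᶠ n : ℕ in atTop, (maxNbhd (I n) (10 * (C' * Real.log n)) : ℝ) ≤ (n : ℝ) ^ s := by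
  obtain ⟨c, hc⟩ := hη
  have hC' : 0 ≤ C' := hC.le.trans hCC
  have hA : 0 < |c| * (10 * C') ^ K + 1 := by positivity
  have ho := ((isLittleO_log_rpow_rpow_atTop K hs).comp_tendsto
    tendsto_natCast_atTop_atTop).bound (inv_pos.2 hA)
  filter_upwards [hc, ho, eventually_ge_atTop 1] with n h1 h2 hn
  have hl : 0 ≤ Real.log n := Real.log_nonneg (by exact_mod_cast hn)
  have h3 := h1 (10 * (C' * Real.log n)) (by nlinarith [mul_le_mul_of_nonneg_right hCC hl])
  refine h3.trans ?_
  simp only [Function.comp_apply, Real.norm_eq_abs, abs_of_nonneg (Real.rpow_nonneg hl K),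
    abs_of_nonneg (Real.rpow_nonneg (Nat.cast_nonneg n) s)] at h2
  rw [← mul_assoc, Real.mul_rpow (by positivity) hl, ← mul_assoc]
  rw [inv_mul_eq_div, le_div_iff₀ hA] at h2
  have h4 := Real.rpow_nonneg hl K
  have h5 : 0 ≤ (10 * C') ^ K := by positivity
  nlinarith [mul_le_mul_of_nonneg_right (le_abs_self c) (mul_nonneg h5 h4)]

variable {Ω : ℕ → Type*} [∀ n, MeasurableSpace (Ω n)] {P : ∀ n, Measure (Ω n)}
  [∀ n, IsProbabilityMeasure (P n)] {E : Type*} [MeasurableSpace E] {X : ∀ n, I n → Ω n → E}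

lemma exists_isMixing (hX : ∀ n i, Measurable (X n i)) {ρ : ℝ} (hρ : 0 < ρ)
    (hβ : ∃ B : ℝ, ∀ᶠ r : ℝ in atTop,
      (⨆ n, sampleBeta (P n) (X n) 2 ⊤ r) ≤ ENNReal.ofReal (B * ρ ^ r)) :
    ∃ B : ℝ, 0 ≤ B ∧ ∀ C : ℝ, 0 < C → ∀ᶠ n : ℕ in atTop,
      IsMixing (P n) (X n) (ENNReal.ofReal (C * Real.log n)) (B * (n : ℝ) ^ (C * Real.log ρ)) := by
  obtain ⟨B, hB⟩ := hβ
  refine ⟨|B|, abs_nonneg B, fun C hC => ?_⟩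
  filter_upwards [(tendsto_mul_log_atTop hC).eventually hB, eventually_ge_atTop 1] with n hn hn1
  have hn0 : (0 : ℝ) < n := by exact_mod_cast hn1
  refine isMixing_of_sampleBeta_le (hX n) (by positivity)
    ((le_iSup (fun n => sampleBeta (P n) (X n) 2 ⊤ _) n).trans (hn.trans ?_))
  rw [rpow_mul_log_comm hρ hn0]
  gcongr
  exact le_abs_self B

/-- With kernels of size `n³` the polynomial factor is `n^(8 + 3·12) = n⁴⁴`, so the exponent `-45`
leaves `1/n` for the constants. -/
lemma eventually_negligible {B κ : ℝ} (hB : 0 ≤ B) (hκ : κ ≤ -45) :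
    ∀ᶠ n : ℕ in atTop, Negligible n (8 * (n : ℝ) ^ 3) (B * (n : ℝ) ^ κ) := by
  filter_upwards [eventually_ge_atTop 1,
    tendsto_natCast_atTop_atTop.eventually_ge_atTop (4 * 8 ^ 12 * B)] with n hn1 hn
  have hn1' : (1 : ℝ) ≤ n := by exact_mod_cast hn1
  have hn0 : (0 : ℝ) < n := by linarith
  have h1 : (n : ℝ) ^ κ ≤ 1 / (n : ℝ) ^ 45 := by
    refine (Real.rpow_le_rpow_of_exponent_le hn1' hκ).trans_eq ?_
    rw [Real.rpow_neg hn0.le, one_div]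
    norm_cast
  unfold Negligible
  calc (n : ℝ) ^ 8 * (4 * (8 * (n : ℝ) ^ 3) ^ 12 * (B * (n : ℝ) ^ κ))
      ≤ (n : ℝ) ^ 8 * (4 * (8 * (n : ℝ) ^ 3) ^ 12 * (B * (1 / (n : ℝ) ^ 45))) := by gcongr
    _ = 4 * 8 ^ 12 * B / n := by field_simp
    _ ≤ 1 := by rwa [div_le_one hn0]

variable {H : ℕ → E → E → ℝ}

lemma measurable_uNorm (hX : ∀ n i, Measurable (X n i))
    (hH : ∀ n, Measurable (Function.uncurry (H n))) (n : ℕ) :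
    Measurable (uNorm (P n) (X n) (H n)) := by
  have : Measurable (uStat (X n) (H n)) := by
    unfold uStat
    refine Finset.measurable_sum _ fun i _ => Finset.measurable_sum _ fun k _ => ?_
    split_ifs
    · exact (hH n).comp ((hX n i).prodMk (hX n k))
    · exact measurable_const
  exact (this.sub_const _).div_const _

/-- The moment condition, for real numbers. -/
lemma eventually_moments {ε ν C : ℝ} {p : ℝ≥0∞} (hX : ∀ n i, Measurable (X n i))
    (hH : ∀ n, Measurable (Function.uncurry (H n))) (hp : 4 ≤ p)
    (hmom : Tendsto (fun n : ℕ => (n : ℝ≥0∞) ^ ε *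
        ((n : ℝ≥0∞)⁻¹ * kernelNorm (P n) (X n) (H n) 4 ^ 4
          + gammaNorm (P n) (X n) (H n) (C * Real.log n) 2 ^ 2
          + (n : ℝ≥0∞) ^ ν * kernelNorm (P n) (X n) (H n) p ^ 4)) atTop (𝓝 0)) :
    ∀ᶠ n : ℕ in atTop, kernelNorm (P n) (X n) (H n) 4 ≠ ∞ ∧
      (kernelNorm (P n) (X n) (H n) 4 ^ 4).toReal * (n : ℝ) ^ ε ≤ n ∧
      gammaNorm (P n) (X n) (H n) (C * Real.log n) 2 ≠ ∞ ∧
      (gammaNorm (P n) (X n) (H n) (C * Real.log n) 2).toReal ^ 2 * (n : ℝ) ^ ε ≤ 1 ∧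
      (0 < ν → (kernelNorm (P n) (X n) (H n) 4 ^ 4).toReal * (n : ℝ) ^ ε ≤ 1) := by
  filter_upwards [hmom.eventually_le_const zero_lt_one, eventually_ge_atTop 1] with n h hn
  have hn0 : (0 : ℝ) < n := by exact_mod_cast hn
  rw [mul_add, mul_add] at h
  obtain ⟨a1, a2⟩ := toReal_mul_rpow_le hn (le_self_add.trans (le_self_add.trans h))
  obtain ⟨b1, b2⟩ := toReal_mul_rpow_le hn (le_add_self.trans (le_self_add.trans h))
  have hk : kernelNorm (P n) (X n) (H n) 4 ^ 4 ≠ ∞ := fun e => a1 <| by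
    rw [e, ENNReal.mul_top (ENNReal.inv_ne_zero.2 (ENNReal.natCast_ne_top n))]
  refine ⟨fun e => hk (by rw [e]; simp), ?_, fun e => b1 (by rw [e]; simp), ?_, fun hν => ?_⟩
  · rw [ENNReal.toReal_mul, ENNReal.toReal_inv, ENNReal.toReal_natCast, mul_assoc,
      inv_mul_le_iff₀ hn0, mul_one] at a2
    exact a2
  · rwa [ENNReal.toReal_pow] at b2
  · refine (toReal_mul_rpow_le hn (le_trans ?_ (le_add_self.trans h))).2
    gcongr
    refine (pow_le_pow_left₀ zero_le (kernelNorm_mono (hX n) (hH n) hp) 4).trans ?_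
    refine le_mul_of_one_le_left zero_le ?_
    -- For a positive exponent the third term dominates the fourth power of `𝐇_4` itself, without
    -- the factor `1/n` of the first term.
    exact ENNReal.one_le_rpow (by exact_mod_cast hn) hν

end Asymptotics

end CrossSection

/-! ### The limit theorem -/

theorem mainTheorem4
    {d : ℕ}
    -- index spaces of size `n`, with distances in `[0, ∞]`
    {I : ℕ → Type*} [∀ n, Fintype (I n)] [∀ n, EMetricSpace (I n)]
    (hcard : ∀ n, Fintype.card (I n) = n)
    (hsep : ∀ n, ∀ i j : I n, i ≠ j → 1 ≤ edist i j)
    -- the samples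
    {Ω : ℕ → Type*} [∀ n, MeasurableSpace (Ω n)]
    (P : ∀ n, Measure (Ω n)) [∀ n, IsProbabilityMeasure (P n)]
    (X : ∀ n, I n → Ω n → EuclideanSpace ℝ (Fin d))
    (hX : ∀ n i, Measurable (X n i))
    -- the symmetric, square-integrable, degenerate kernels
    (H : ℕ → EuclideanSpace ℝ (Fin d) → EuclideanSpace ℝ (Fin d) → ℝ)
    (hHmeas : ∀ n, Measurable (Function.uncurry (H n)))
    (hHsymm : ∀ n x y, H n x y = H n y x)
    (hHsq : ∀ n, ∀ i j : I n, i ≠ j →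
      MemLp (Function.uncurry (H n)) 2 (((P n).map (X n i)).prod ((P n).map (X n j))))
    (hHdeg : ∀ n, ∀ i k : I n, i ≠ k →
      ∀ᵐ x ∂((P n).map (X n i)), ∫ ω, H n (X n k ω) x ∂(P n) = 0)
    -- `s_n = Θ(n)`
    (hs : (fun n => CrossSection.uStd (P n) (X n) (H n)) =Θ[atTop] fun n : ℕ => (n : ℝ))
    -- `β(r) = sup_n β_n(2, ∞, r) = O(ρ^r)`
    (ρ : ℝ) (hρ0 : 0 < ρ) (hρ1 : ρ < 1)
    (hβ : ∃ B : ℝ, ∀ᶠ r : ℝ in atTop,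
      (⨆ n, CrossSection.sampleBeta (P n) (X n) 2 ⊤ r) ≤ ENNReal.ofReal (B * ρ ^ r))
    -- polynomial growth of the neighbourhoods of radius `r ≥ C log n`
    (C : ℝ) (hC : 0 < C) (K : ℝ)
    (hη : ∃ c : ℝ, ∀ᶠ n : ℕ in atTop, ∀ r : ℝ, C * Real.log n ≤ r →
      (CrossSection.maxNbhd (I n) r : ℝ) ≤ c * r ^ K)
    -- the moment condition, with `m = C log n` and `μ = C δ log ρ / (4 + δ)`
    (ε δ : ℝ) (hε : 0 < ε) (hδ : 0 < δ)
    (hmom : Tendsto (fun n : ℕ => (n : ℝ≥0∞) ^ ε *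
        ((n : ℝ≥0∞)⁻¹ * CrossSection.kernelNorm (P n) (X n) (H n) 4 ^ 4
          + CrossSection.gammaNorm (P n) (X n) (H n) (C * Real.log n) 2 ^ 2
          + (n : ℝ≥0∞) ^ (2 + C * δ / (4 + δ) * Real.log ρ)
            * CrossSection.kernelNorm (P n) (X n) (H n) (ENNReal.ofReal (4 + δ)) ^ 4))
      atTop (𝓝 0)) :
    TendstoInDistribution (fun n => CrossSection.uNorm (P n) (X n) (H n)) atTop
      (id : ℝ → ℝ) P (gaussianReal 0 1) := by
  obtain ⟨B, hB0, hmix⟩ := CrossSection.exists_isMixing hX hρ0 hβ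
  have hlog : Real.log ρ < 0 := Real.log_neg hρ0 hρ1
  -- The working distance `R = C' log n` is enlarged until the mixing coefficient is `O(n⁻⁴⁵)`,
  -- whereas the contractions stay at the scale `m = C log n`.
  set C' : ℝ := max C (45 / -Real.log ρ) with hC'
  have hCC : C ≤ C' := le_max_left _ _
  have hC'0 : 0 < C' := hC.trans_le hCC
  have hC'ρ : C' * Real.log ρ ≤ -45 := by
    have h1 : 45 / -Real.log ρ ≤ C' := le_max_right _ _
    rw [div_le_iff₀ (by linarith)] at h1
    linarith
  -- With `q = n ^ s`, the 28 powers of `q` used in the rate are absorbed both by `n ^ ε` and by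
  -- `n`.
  set s : ℝ := min ε 1 / 28 with hsd
  have hs0 : 0 < s := by positivity
  have hmom' := CrossSection.eventually_moments hX hHmeas
    (show (4 : ℝ≥0∞) ≤ ENNReal.ofReal (4 + δ) by
      rw [show (4 : ℝ≥0∞) = ENNReal.ofReal 4 by simp]
      exact ENNReal.ofReal_le_ofReal (by linarith)) hmom
  obtain ⟨c₀, hc₀, hc⟩ := hs.2.exists_pos
  have hev := (((hmix C' hC'0).and (CrossSection.eventually_negligible hB0 hC'ρ)).and
    (CrossSection.eventually_maxNbhd_le hCC hC hs0 hη)).and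
    ((hmom'.and hc.bound).and (eventually_ge_atTop 1))
  have hq : ∀ n : ℕ, ((n : ℝ) ^ s) ^ 28 = (n : ℝ) ^ min ε 1 := fun n => by
    rw [← Real.rpow_natCast, ← Real.rpow_mul (Nat.cast_nonneg n)]
    congr 1
    rw [hsd]
    push_cast
    ring
  have hqε : ∀ n : ℕ, 1 ≤ n → ((n : ℝ) ^ s) ^ 28 ≤ (n : ℝ) ^ ε := fun n hn => by
    rw [hq]
    exact Real.rpow_le_rpow_of_exponent_le (by exact_mod_cast hn) (min_le_left _ _)
  have hqn : ∀ n : ℕ, 1 ≤ n → ((n : ℝ) ^ s) ^ 28 ≤ n := fun n hn => by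
    rw [hq]
    exact (Real.rpow_le_rpow_of_exponent_le (by exact_mod_cast hn) (min_le_right _ _)).trans_eq
      (Real.rpow_one _)
  have hstd : ∀ n : ℕ, ‖(n : ℝ)‖ ≤ c₀ * ‖CrossSection.uStd (P n) (X n) (H n)‖ →
      c₀⁻¹ * Fintype.card (I n) ≤ CrossSection.uStd (P n) (X n) (H n) := fun n h => by
    rw [hcard, inv_mul_le_iff₀ hc₀]
    rwa [Real.norm_of_nonneg (Nat.cast_nonneg n), Real.norm_of_nonneg
      (show 0 ≤ CrossSection.uStd (P n) (X n) (H n) from Real.sqrt_nonneg _)] at h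
  have hdegen := fun n => CrossSection.isDegenerate_of_kernelNorm (hX n) (hHmeas n) (hHsymm n)
    (hHdeg n)
  -- Otherwise `α q²⁸ ≤ 1` eventually, and the lower bound on the standard deviation would keep the
  -- unbounded `c₀⁻² q¹¹` below 70000.
  have hμ : 2 + C * δ / (4 + δ) * Real.log ρ ≤ 0 := by
    by_contra! hpos
    have hbig : ∀ᶠ n : ℕ in atTop, 70000 < c₀⁻¹ ^ 2 * ((n : ℝ) ^ s) ^ 11 :=
      (((tendsto_pow_atTop (by norm_num)).comp
        (CrossSection.tendsto_natCast_rpow_atTop hs0)).const_mul_atTop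
          (by positivity)).eventually_gt_atTop 70000
    obtain ⟨n, ⟨⟨⟨h1, h2⟩, h3⟩, ⟨⟨h4, -, -, -, h5⟩, h6⟩, hn⟩, hbig⟩ := (hev.and hbig).exists
    refine absurd hbig (not_lt.2 ((hdegen n h4).rate_le_of_le_uStd ENNReal.toReal_nonneg h1
      (CrossSection.nbhdBound_maxNbhd _) (by rwa [hcard]) (by rwa [hcard])
      (Real.one_le_rpow (by exact_mod_cast hn) hs0.le) h3 (by rw [hcard]; exact hqn n hn) ?_
      (by positivity) (hstd n h6)))
    exact (mul_le_mul_of_nonneg_left (hqε n hn) ENNReal.toReal_nonneg).trans (h5 hpos)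
  -- `C log ρ` is negative and `δ / (4 + δ) ≤ 1`, so dropping this fraction only lowers the value.
  have hCρ : C * Real.log ρ ≤ -2 := by
    have h1 : C * δ / (4 + δ) * Real.log ρ = C * Real.log ρ * (δ / (4 + δ)) := by ring
    have h2 : δ / (4 + δ) ≤ 1 := by rw [div_le_one (by linarith)]; linarith
    have h3 : C * Real.log ρ ≤ 0 := (mul_neg_of_pos_of_neg hC hlog).le
    nlinarith
  have hmeas := CrossSection.measurable_uNorm (P := P) hX hHmeas
  refine ⟨fun n => (hmeas n).aemeasurable, aemeasurable_id, ?_⟩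
  refine ProbabilityMeasure.tendsto_of_tendsto_charFun fun t => ?_
  have hlim : charFun ((gaussianReal 0 1).map id) t = Complex.exp (-(t ^ 2 / 2)) := by
    rw [Measure.map_id, charFun_gaussianReal]
    congr 1
    simp
  change Tendsto (fun n => charFun ((P n).map (CrossSection.uNorm (P n) (X n) (H n))) t) atTop
    (𝓝 (charFun ((gaussianReal 0 1).map id) t))
  rw [hlim, tendsto_iff_norm_sub_tendsto_zero]
  refine squeeze_zero' (Eventually.of_forall fun n => norm_nonneg _) ?_
    (CrossSection.tendsto_cltRate c₀⁻¹ (20480 * B ^ 2 + 200000) t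
      (x := fun n => 1 / ((n : ℝ) ^ s) ^ 7) (y := fun n => 1 / (n : ℝ)) ?_
      tendsto_one_div_atTop_nhds_zero_nat)
  · filter_upwards [hev, hmix C hC] with n ⟨⟨⟨h1, h2⟩, h3⟩, ⟨⟨h4, h5, h6, h7, _⟩, h8⟩, hn⟩ hm
    have hn1 : (1 : ℝ) ≤ n := by exact_mod_cast hn
    have hl : 0 ≤ Real.log n := Real.log_nonneg hn1
    -- The quantitative theorem wants `α ≥ 1`, so the moment bound is raised to `max 1 α`; `α q²⁸ ≤
    -- n` survives since `q²⁸ ≤ n`.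
    have h := ((hdegen n h4).mono (le_max_right 1 _)).norm_charFun_uNorm_sub_le_cltRate
      (q := (n : ℝ) ^ s) (B := B) (le_max_left 1 _) h1 hm
      (ENNReal.ofReal_le_ofReal (by gcongr)) (CrossSection.nbhdBound_maxNbhd _) (by rwa [hcard])
      (by rwa [hcard]) (CrossSection.integral_Gam_sq_le (hX n) (hHmeas n) edist_self h6)
      (Real.one_le_rpow hn1 hs0.le) h3 ?_
      ((mul_le_mul_of_nonneg_left (hqε n hn) (sq_nonneg _)).trans h7) ?_ (inv_pos.2 hc₀)
      (hstd n h8) t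
    · rwa [hcard] at h
    · rw [hcard, max_mul_of_nonneg _ _ (by positivity), one_mul]
      exact max_le (hqn n hn)
        ((mul_le_mul_of_nonneg_left (hqε n hn) ENNReal.toReal_nonneg).trans h5)
    · rw [hcard, mul_assoc]
      refine mul_le_of_le_one_right hB0 ?_
      calc (n : ℝ) ^ (C * Real.log ρ) * (n : ℝ) ^ 2 ≤ (n : ℝ) ^ (-2 : ℝ) * (n : ℝ) ^ 2 := by
            gcongr
        _ = 1 := by
            rw [← Real.rpow_natCast (n : ℝ) 2, ← Real.rpow_add (by linarith)]
            simp
  · exact tendsto_const_nhds.div_atTop ((tendsto_pow_atTop (by norm_num)).comp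
      (CrossSection.tendsto_natCast_rpow_atTop hs0))
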